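/- Let $u(x,t)$, $x,t\in\mathbb R$, be a real-valued rapidly decreasing solution of the KdV equation $u_t=6uu_x-u_{xxx}$: for every $t$ the function $u(\cdot,t)$ is $C^3$, the equation holds pointwise, and for every $T>0$ there is a function $g$ with $\int_{\mathbb R}(1+|x|)g(x)\,dx<\infty$ and $|\partial_x^ju(x,t)|\le g(x)$ for all $x\in\mathbb R$, $|t|\le T$, $0\le j\le 3$. Let the eigenvalues (bound states) of $-\frac{d^2}{dx^2}+u(x,0)$ be exactly $-\kappa_1^2,\dots,-\kappa_N^2$ with distinct $\kappa_n>0$ ($N\ge 0$). For $\operatorname{Im}k\ge0$ let $\psi_\pm(k,x,t)$ be the Jost solutions, $-\psi_\pm''+u(x,t)\psi_\pm=k^2\psi_\pm$ with $e^{\mp ikx}\psi_\pm\to1$ as $x\to\pm\infty$, and for $\operatorname{Im}k>0$ let $t(k)=2ik/W(\psi_-,\psi_+)$, $W(f,g)=fg'-f'g$, be the transmission coefficient. Let $r(k)$, $k\in\mathbb R$, be the reflection coefficient at time $0$, i.e. the continuous function for which $\tau(k)\psi_-(k,x,0)=\overline{\psi_+(k,x,0)}+r(k)\psi_+(k,x,0)$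 holds for all $k,x\in\mathbb R$ with some continuous $\tau:\mathbb R\to\mathbb C$; and let $c_n=\|\psi_+(i\kappa_n,\cdot,0)\|_{L^2}^{-2}$. Put $$\chi(k,x,t)=\begin{cases}t(k)\psi_-(k,x,t)e^{ikx},&\operatorname{Im}k>0,\\ \psi_+(-k,x,t)e^{ikx},&\operatorname{Im}k<0,\end{cases}\qquad Q_+(x,t)=-\int_x^\infty u(y,t)\,dy.$$ For $I\subset\{1,\dots,N\}$ put $\widetilde\chi(k,x,t)=\chi(k,x,t)\prod_{m\in I}\frac{k-i\kappa_m}{k+i\kappa_m}$ (with the removable singularities at $i\kappa_m$, $m\in I$, removed) and $$\widetilde\kappa_n=\begin{cases}\kappa_n,&n\notin I,\\-\kappa_n,&n\in I,\end{cases}\qquad \widetilde r(k)=r(k)\prod_{m\in I}\Big(\frac{k-i\kappa_m}{k+i\kappa_m}\Big)^2,$$ $$\widetilde c_n=c_n\prod_{m\in I}\Big(\frac{\kappa_n-\kappa_m}{\kappa_n+\kappa_m}\Big)^2\ (n\notin I),\qquad \widetilde c_n=-\frac{4\kappa_n^2}{c_n}\prod_{m\in I\setminus\{n\}}\Big(\frac{\kappa_n+\kappa_m}{\kappa_n-\kappa_m}\Big)^2\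 (n\in I).$$ Given data $(r;\kappa_1,\dots,\kappa_N,c_1,\dots,c_N)$ with $\kappa_n,c_n$ real, say that $\chi$ solves the dressing problem with these data if, for all $x,t$, the following two conditions hold. (i) $\chi$ is holomorphic off the real axis except for at most simple poles at the points $i\kappa_n$, where $\operatorname{Res}_{i\kappa_n}\chi=ic_ne^{-2\kappa_nx+8\kappa_n^3t}\chi(-i\kappa_n,x,t)$; it has boundary values $\chi_\pm$ on the real axis from the upper and lower half-planes with $\chi_+(k,x,t)-\chi_-(k,x,t)=r(k)e^{2ikx+8ik^3t}\chi_-(-k,x,t)$, $k\in\mathbb R$; and $\chi\to1$ as $|k|\to\infty$, $\operatorname{Im}k\ne0$. (ii) $\chi$ is locally integrable, continuous at the points $-i\kappa_n$, and satisfies the $\overline\partial$-problem $\frac{\partial\chi}{\partial\bar k}=T(k)e^{2ikx+8ik^3t}\chi(-k,x,t)$, $\chi\to1$ as $|k|\to\infty$, $\operatorname{Im} k\neq 0$, with $T(k)=\frac i2\delta(k_I)r(k_R)+i\pi\,\delta(k_R)\sum_nc_n\delta(k_I-\kappa_n)$, where on the real axis $\chi(-k)$ means $\chi_-(-k)$;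 that is, for all $\varphi\in C_c^\infty(\mathbb C)$, $$-\int_{\mathbb C}\chi\,\frac{\partial\varphi}{\partial\bar k}\,dk_R\,dk_I=\int_{\mathbb R}\tfrac i2r(k)e^{2ikx+8ik^3t}\chi_-(-k,x,t)\varphi(k)\,dk+i\pi\sum_nc_ne^{-2\kappa_nx+8\kappa_n^3t}\chi(-i\kappa_n,x,t)\varphi(i\kappa_n).$$ Call such data admissible if $r$ is continuous, $r(-k)=\overline{r(k)}$, $|r(k)|<1$ for $k\ne0$, $r(0)=-1$ if $|r(0)|=1$, all $\kappa_n,c_n$ are nonzero, $\kappa_n\ne\pm\kappa_m$ for $n\neq m$, and $\kappa_n/c_n>0$. Then for every $I\subset\{1,\dots,N\}$: 1. $\widetilde\chi$ solves the dressing problem with data $(\widetilde r;\widetilde\kappa_1,\dots,\widetilde\kappa_N,\widetilde c_1,\dots,\widetilde c_N)$. 2. These data are admissible; moreover $\widetilde r(-k)=\overline{\widetilde r(k)}$, $|\widetilde r(k)|=|r(k)|$ for $k\in\mathbb R$, $\widetilde r(0)=r(0)$, and $\operatorname{sign}\widetilde c_n=\operatorname{sign}\widetilde\kappa_n$. 3.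 $\widetilde\chi''-2ik\widetilde\chi'-u\widetilde\chi=0$ (derivatives in $x$) for all $k\notin\mathbb R$ with $k\ne i\widetilde\kappa_n$ for every $n$. 4. $\widetilde\chi=1+\frac{i}{2k}\widetilde Q_+(x,t)+O(1/k^2)$ as $|k|\to\infty$, $\operatorname{Im}k\ne0$, where $\widetilde Q_+=Q_+-4\sum_{m\in I}\kappa_m$, and $u=\partial_x\widetilde Q_+$; that is, $\widetilde\chi$ recovers the same potential $u$. Consequently $u$ arises from the dressing method in $2^N$ different ways: there are $2^N$ admissible data $(r;\kappa'_1,\dots,\kappa'_N,c'_1,\dots,c'_N)$ with $|\kappa'_n|=\kappa_n$, with pairwise different sets $\{\kappa'_1,\dots,\kappa'_N\}$, for each of which the dressing problem has a solution with an expansion $1+\frac{i}{2k}Q(x,t)+O(1/k^2)$ as $|k|\to\infty$, $\operatorname{Im}k\ne0$, such that $u=\partial_xQ$. -/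

import Mathlib

open Filter Topology MeasureTheory

open scoped ContDiff

noncomputable section

/-! ### The Schrödinger operator `-d²/dx² + v` on the line: Jost solutions and scattering data -/

/-- `f` is a (classical) solution of `-f'' + v f = E f` on the real line. -/
def SolvesSchrodinger (v : ℝ → ℝ) (E : ℂ) (f : ℝ → ℂ) : Prop :=
  ContDiff ℝ 2 f ∧ ∀ x : ℝ, -deriv (deriv f) x + (v x : ℂ) * f x = E * f x

/-- The Jost solution at `+∞`: `-f'' + v f = k² f` and `e^{-ikx} f(x) → 1` as `x → +∞`. -/
def IsJostPlus (v : ℝ → ℝ) (k : ℂ) (f : ℝ → ℂ) : Prop :=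
  SolvesSchrodinger v (k ^ 2) f ∧
    Tendsto (fun x : ℝ => Complex.exp (-(Complex.I * k * x)) * f x) atTop (𝓝 1)

/-- The Jost solution at `-∞`: `-f'' + v f = k² f` and `e^{ikx} f(x) → 1` as `x → -∞`. -/
def IsJostMinus (v : ℝ → ℝ) (k : ℂ) (f : ℝ → ℂ) : Prop :=
  SolvesSchrodinger v (k ^ 2) f ∧
    Tendsto (fun x : ℝ => Complex.exp (Complex.I * k * x) * f x) atBot (𝓝 1)

/-- `ψ₊(k, ·)`, for `Im k ≥ 0`; for the potentials considered it exists and is unique. -/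
def jostPlus (v : ℝ → ℝ) (k : ℂ) : ℝ → ℂ := Classical.epsilon (IsJostPlus v k)

/-- `ψ₋(k, ·)`, for `Im k ≥ 0`; for the potentials considered it exists and is unique. -/
def jostMinus (v : ℝ → ℝ) (k : ℂ) : ℝ → ℂ := Classical.epsilon (IsJostMinus v k)

/-- The Wronskian `f g' - f' g` at the point `x`. -/
def wronskian (f g : ℝ → ℂ) (x : ℝ) : ℂ := f x * deriv g x - deriv f x * g x

/-- The transmission coefficient `t(k) = 2ik / W(ψ₋, ψ₊)` in the upper half-plane
(the Wronskian does not depend on the point at which it is taken). -/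
def transmission (v : ℝ → ℝ) (k : ℂ) : ℂ :=
  2 * Complex.I * k / wronskian (jostMinus v k) (jostPlus v k) 0

/-- `r` is the (right) reflection coefficient: `t ψ₋ = conj ψ₊ + r ψ₊` on the real axis.  For
`k ≠ 0` the relation determines `t(k)` and `r(k)`; continuity pins down their values at `k = 0`. -/
def IsReflectionCoefficient (v : ℝ → ℝ) (r : ℝ → ℂ) : Prop :=
  Continuous r ∧ ∃ τ : ℝ → ℂ, Continuous τ ∧ ∀ k x : ℝ,
    τ k * jostMinus v k x = (starRingEnd ℂ) (jostPlus v k x) + r k * jostPlus v k x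

/-- The reflection coefficient of the potential `v`. -/
def reflection (v : ℝ → ℝ) : ℝ → ℂ := Classical.epsilon (IsReflectionCoefficient v)

/-- `γ²`, where `γ⁻¹ = ‖ψ₊(iκ, ·)‖` is the `L²` norm. -/
def normingConstant (v : ℝ → ℝ) (κ : ℝ) : ℝ :=
  (∫ x : ℝ, ‖jostPlus v (Complex.I * κ) x‖ ^ 2)⁻¹

/-- `E` is an eigenvalue (the energy of a bound state) of `-d²/dx² + v`. -/
def IsBoundStateEnergy (v : ℝ → ℝ) (E : ℝ) : Prop :=
  ∃ f : ℝ → ℂ, f ≠ 0 ∧ MemLp f 2 volume ∧ SolvesSchrodinger v E f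

/-- The bound states of `-d²/dx² + v` are exactly `-κ₁², …, -κ_N²`, with distinct `κ_n > 0`. -/
structure BoundStates (v : ℝ → ℝ) {N : ℕ} (κ : Fin N → ℝ) : Prop where
  pos : ∀ n, 0 < κ n
  injective : Function.Injective κ
  spectrum : ∀ E : ℝ, IsBoundStateEnergy v E ↔ ∃ n, E = -(κ n) ^ 2

/-! ### Rapidly decreasing solutions of KdV and the function `χ` of the inverse scattering method -/

/-- `u` (a function of `x` and `t`) is a classical solution of `u_t = 6 u u_x - u_xxx` such that,
locally uniformly in `t`, `u` and its `x`-derivatives up to order three are dominated by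
functions `g` with `∫ (1 + |x|) g(x) dx < ∞`. -/
structure IsRapidlyDecreasingKdVSolution (u : ℝ → ℝ → ℝ) : Prop where
  contDiff : ∀ t : ℝ, ContDiff ℝ 3 (fun x => u x t)
  kdv : ∀ x t : ℝ, HasDerivAt (fun s => u x s)
    (6 * u x t * deriv (fun y => u y t) x - iteratedDeriv 3 (fun y => u y t) x) t
  decay : ∀ T : ℝ, ∃ g : ℝ → ℝ, Integrable (fun x : ℝ => (1 + |x|) * g x) ∧
    ∀ t : ℝ, |t| ≤ T → ∀ x : ℝ, ∀ j : ℕ, j ≤ 3 → |iteratedDeriv j (fun y => u y t) x| ≤ g x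

/-- `χ(k,x,t) = t(k) ψ₋(k,x,t) e^{ikx}` for `Im k > 0` and `ψ₊(-k,x,t) e^{ikx}` for `Im k < 0`,
built from the Jost solutions of `-d²/dx² + u(·,t)`.  (The values for real `k` play no role.) -/
def ismFunction (u : ℝ → ℝ → ℝ) (k : ℂ) (x t : ℝ) : ℂ :=
  if 0 < k.im then
    transmission (fun y => u y t) k * jostMinus (fun y => u y t) k x * Complex.exp (Complex.I * k * x)
  else jostPlus (fun y => u y t) (-k) x * Complex.exp (Complex.I * k * x)

/-- `Q₊(x,t) = -∫_x^∞ u(y,t) dy`. -/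
def qPlus (u : ℝ → ℝ → ℝ) (x t : ℝ) : ℝ := -∫ y in Set.Ioi x, u y t

/-! ### Dressing data, the contour problem and the `∂̄`-problem -/

/-- Data `(r; κ₁, …, κ_N, c₁, …, c_N)`, the `κ_n` being allowed to have either sign. -/
@[ext]
structure DressingData (N : ℕ) where
  r : ℝ → ℂ
  κ : Fin N → ℝ
  c : Fin N → ℝ

/-- The scattering data of the potential `v` with bound states `-κ_n²`, with `c_n = γ_n²`. -/
def scatteringData (v : ℝ → ℝ) {N : ℕ} (κ : Fin N → ℝ) : DressingData N where
  r := reflection v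
  κ := κ
  c := fun n => normingConstant v (κ n)

namespace DressingData

variable {N : ℕ}

/-- The conditions on the data for the dressing method. -/
structure Admissible (D : DressingData N) : Prop where
  continuous : Continuous D.r
  conj_symm : ∀ k : ℝ, D.r (-k) = (starRingEnd ℂ) (D.r k)
  norm_lt_one : ∀ k : ℝ, k ≠ 0 → ‖D.r k‖ < 1
  at_zero : ‖D.r 0‖ = 1 → D.r 0 = -1
  ne_zero : ∀ n, D.κ n ≠ 0 ∧ D.c n ≠ 0
  ne : ∀ n m, n ≠ m → D.κ n ≠ D.κ m ∧ D.κ n ≠ -D.κ m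
  same_sign : ∀ n, 0 < D.κ n / D.c n

/-- The point `iκ_n`. -/
def pole (D : DressingData N) (n : Fin N) : ℂ := Complex.I * (D.κ n : ℂ)

/-- For fixed `x` and `t`, the contour problem for `χ(·,x,t)` with data `D`: `χ` is holomorphic off
the real axis except for at most simple poles at the `iκ_n`, has boundary values `χ_±` on the real
axis with `χ₊(k) - χ₋(k) = r(k) e^{2ikx+8ik³t} χ₋(-k)`, satisfies
`Res_{iκ_n} χ = i c_n e^{-2κ_n x+8κ_n³ t} χ(-iκ_n)`, and `χ(k) → 1` as `k → ∞`. -/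
structure SolvesContourProblem (D : DressingData N) (x t : ℝ) (χ : ℂ → ℂ) : Prop where
  holomorphic : DifferentiableOn ℂ χ {k : ℂ | k.im ≠ 0 ∧ ∀ n, k ≠ D.pole n}
  jump : ∃ χp χm : ℝ → ℂ,
    (∀ k : ℝ, Tendsto χ (𝓝[{z : ℂ | 0 < z.im}] (k : ℂ)) (𝓝 (χp k))) ∧
    (∀ k : ℝ, Tendsto χ (𝓝[{z : ℂ | z.im < 0}] (k : ℂ)) (𝓝 (χm k))) ∧
    ∀ k : ℝ, χp k - χm k =
      D.r k * Complex.exp (2 * Complex.I * k * x + 8 * Complex.I * (k : ℂ) ^ 3 * t) * χm (-k)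
  residue : ∀ n, Tendsto (fun k => (k - D.pole n) * χ k) (𝓝[≠] (D.pole n))
    (𝓝 (Complex.I * (D.c n : ℂ) * (Real.exp (-2 * D.κ n * x + 8 * (D.κ n) ^ 3 * t) : ℂ) *
      χ (-D.pole n)))
  at_infinity : Tendsto χ (Bornology.cobounded ℂ ⊓ 𝓟 {k : ℂ | k.im ≠ 0}) (𝓝 1)

/-- `∂φ/∂k̄ = (∂φ/∂k_R + i ∂φ/∂k_I) / 2`. -/
def _root_.dbar (φ : ℂ → ℂ) (k : ℂ) : ℂ :=
  (fderiv ℝ φ k 1 + Complex.I * fderiv ℝ φ k Complex.I) / 2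

/-- For fixed `x` and `t`, the `∂̄`-problem `∂χ/∂k̄ = T(k) e^{2ikx+8ik³t} χ(-k)`, `χ → 1` at infinity,
in the sense of distributions on the `k`-plane, where the dressing function `T` is the distribution
`(i/2) δ(k_I) r(k_R) + i π δ(k_R) ∑ c_n δ(k_I - κ_n)`; on the real axis `χ(-k)` is understood as the
boundary value `χ₋(-k)` of `χ` from the lower half-plane. -/
structure SolvesDbarProblem (D : DressingData N) (x t : ℝ) (χ : ℂ → ℂ) : Prop where
  locallyIntegrable : LocallyIntegrable χ volume
  continuousAt : ∀ n, ContinuousAt χ (-D.pole n)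
  dbar_eq : ∃ χm : ℝ → ℂ,
    (∀ k : ℝ, Tendsto χ (𝓝[{z : ℂ | z.im < 0}] (k : ℂ)) (𝓝 (χm k))) ∧
    ∀ φ : ℂ → ℂ, ContDiff ℝ ∞ φ → HasCompactSupport φ →
      -∫ k : ℂ, χ k * dbar φ k =
        (∫ k : ℝ, Complex.I / 2 * D.r k *
          Complex.exp (2 * Complex.I * k * x + 8 * Complex.I * (k : ℂ) ^ 3 * t) *
            χm (-k) * φ k) +
        ∑ n, Complex.I * Real.pi * (D.c n : ℂ) *
          Complex.exp (2 * Complex.I * D.pole n * x + 8 * Complex.I * (D.pole n) ^ 3 * t) *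
            χ (-D.pole n) * φ (D.pole n)
  at_infinity : Tendsto χ (Bornology.cobounded ℂ ⊓ 𝓟 {k : ℂ | k.im ≠ 0}) (𝓝 1)

end DressingData

/-- `χ(k) = 1 + (i / 2k) Q + O(1/k²)` as `|k| → ∞`, `Im k ≠ 0`. -/
def HasExpansionAtInfinity (χ : ℂ → ℂ) (Q : ℝ) : Prop :=
  (fun k : ℂ => χ k - (1 + Complex.I / (2 * k) * (Q : ℂ)))
    =O[Bornology.cobounded ℂ ⊓ 𝓟 {k : ℂ | k.im ≠ 0}] fun k : ℂ => 1 / k ^ 2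

/-- `u` is obtained by the dressing method from the data `D`: for all `x` and `t` there is a solution
`χ(·,x,t)` of the dressing problem with data `D`, with `χ = 1 + (i / 2k) Q(x,t) + O(1/k²)` at
infinity, and `u = ∂Q/∂x`. -/
def DressingData.Generates {N : ℕ} (D : DressingData N) (u : ℝ → ℝ → ℝ) : Prop :=
  ∃ (χ : ℂ → ℝ → ℝ → ℂ) (Q : ℝ → ℝ → ℝ), ∀ x t : ℝ,
    D.SolvesContourProblem x t (fun k => χ k x t) ∧
    D.SolvesDbarProblem x t (fun k => χ k x t) ∧
    HasExpansionAtInfinity (fun k => χ k x t) (Q x t) ∧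
    HasDerivAt (fun y => Q y t) (u x t) x

/-! ### Transplanting poles -/

/-- `∏_{m ∈ I} (k - iκ_m) / (k + iκ_m)`. -/
def blaschke {N : ℕ} (κ : Fin N → ℝ) (I : Finset (Fin N)) (k : ℂ) : ℂ :=
  ∏ m ∈ I, (k - Complex.I * (κ m : ℂ)) / (k + Complex.I * (κ m : ℂ))

open Classical in
/-- `χ̃ = χ ∏_{m ∈ I} (k - iκ_m) / (k + iκ_m)`, the removable singularities at the points `iκ_m`,
`m ∈ I`, being removed. -/
def transplantFunction {N : ℕ} (κ : Fin N → ℝ) (I : Finset (Fin N)) (χ : ℂ → ℝ → ℝ → ℂ)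
    (k : ℂ) (x t : ℝ) : ℂ :=
  if ∃ m ∈ I, k = Complex.I * (κ m : ℂ) then
    limUnder (𝓝[≠] k) (fun z => χ z x t * blaschke κ I z)
  else χ k x t * blaschke κ I k

/-- The transplanted data `(r̃; κ̃, c̃)`. -/
def DressingData.transplant {N : ℕ} (D : DressingData N) (I : Finset (Fin N)) :
    DressingData N where
  r := fun k => D.r k *
    ∏ m ∈ I, (((k : ℂ) - Complex.I * (D.κ m : ℂ)) / ((k : ℂ) + Complex.I * (D.κ m : ℂ))) ^ 2
  κ := fun n => if n ∈ I then -D.κ n else D.κ n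
  c := fun n =>
    if n ∈ I then
      -(4 * (D.κ n) ^ 2 / D.c n) * ∏ m ∈ I.erase n, ((D.κ n + D.κ m) / (D.κ n - D.κ m)) ^ 2
    else D.c n * ∏ m ∈ I, ((D.κ n - D.κ m) / (D.κ n + D.κ m)) ^ 2

end

/-! ### Half-line integrals -/

/-! Let B(k) = ∏_{m∈I} (k − iκ_m)/(k + iκ_m). The algebra of transplantation rests on B(−k) = 1/B(k)
(`blaschke_neg`). Multiplying the jump relation by B(k) = B(k)² B(−k) puts the factor B² into r and
turns χ₋(−k) into the boundary value of the new function; the residue relation at iκ_n, n ∉ I,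
acquires B(iκ_n)² in the same way. For n ∈ I the zero of B cancels the pole of χ at iκ_n, while the
pole of B creates one at −iκ_n. The new residue at −iκ_n and the new value at iκ_n are both
multiples of χ(−iκ_n), and their ratio carries c_n and the exponential in the denominator
(`SolvesContourProblem.transplant`). On the real axis |B| = 1, and B(0)² = 1, so admissibility
persists; B = 1 − (i/2k)·4∑κ_m + O(1/k²) shifts Q₊ by a constant; and since B is independent of x,
the equation in x is unchanged.

The bulk of the work is the case I = ∅: the function χ built from the Jost solutions solves the
dressing problem for the scattering data at time 0. This needs direct scattering theory.

Statics. The Faddeev function e^{−ikx}ψ₊ is the Neumann series of a Volterra equation whose operator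
halves a weighted sup norm, uniformly for Im k ≥ 0. Hence existence, analyticity for Im k > 0,
continuity up to the real axis and expansions for large k; ψ₋ follows by reflecting the line. The
Wronskian W = W(ψ₋, ψ₊) does not vanish at real k ≠ 0. Its zeros in the upper half-plane are exactly
the points iκ_n (`isBoundStateEnergy_of_jostWronskian_eq_zero` and its converse), and they are
simple with derivative 2iκμ‖ψ₊‖², where ψ₋ = μψ₊ (`tendsto_jostWronskian_div`). At k = 0 the
quotient 2ik/W still has a limit (`exists_tendsto_div_jostWronskian`), so t and r are continuous on
the whole line.

Dynamics. The difference quotient in t of the Faddeev function satisfies the Volterra equation up to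
a small source, hence converges (`hasDerivAt_faddeev`). This yields ψ_t = (4k² + 2u)ψ_x − (u_x ±
4ik³)ψ for ψ₊ and ψ₋ respectively. After multiplication by e^{±4ik³t} all Jost solutions with the
same k² obey one evolution equation, so the coefficients in linear relations between them are
constant. For real k this gives r(t) = r(0)e^{8ik³t} and the constancy of W. A Phragmén–Lindelöf
argument carries the constancy of W into the upper half-plane, which in turn fixes the evolution of
the norming constants.

From contour to ∂̄. After the prescribed principal parts have been subtracted, χ is holomorphic in
each half-plane and continuous up to the axis. Green's formula turns its jump into the integral over
the axis, and the Cauchy kernel, a fundamental solution of ∂̄, turns each principal part into a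
point mass (`SolvesContourProblem.solvesDbarProblem`). -/

theorem hasDerivAt_integral_Ioi {E : Type*} [NormedAddCommGroup E] [NormedSpace ℝ E]
    [CompleteSpace E] {f : ℝ → E} (hf : Continuous f) (hi : ∀ a, IntegrableOn f (Set.Ioi a))
    (x : ℝ) : HasDerivAt (fun x => ∫ y in Set.Ioi x, f y) (-f x) x := by
  have h1 : (fun x => ∫ y in Set.Ioi x, f y) =
      fun x => (∫ y in Set.Ioi (0 : ℝ), f y) - ∫ y in (0 : ℝ)..x, f y := by
    funext z
    rw [← intervalIntegral.integral_Ioi_sub_Ioi' (hi 0) (hi z)]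
    abel
  rw [h1]
  exact (intervalIntegral.integral_hasDerivAt_right (hf.intervalIntegrable _ _)
    (hf.stronglyMeasurableAtFilter _ _) hf.continuousAt).const_sub _

/-- The functions on the line whose first moment at `+∞` is finite. -/
def HasRightMoment (φ : ℝ → ℂ) : Prop :=
  ∀ a, IntegrableOn (fun y : ℝ => ((1 + |y| : ℝ) : ℂ) * φ y) (Set.Ioi a)

/-- All kernels met below (constants, y, `phase`, `volterraKernel`) grow at most linearly on a right
half-line, so this one estimate supplies their integrability against φ. -/
theorem HasRightMoment.integrableOn_mul {φ : ℝ → ℂ} (h : HasRightMoment φ) {K : ℝ → ℂ}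
    (hK : Continuous K) (C a : ℝ) (hC : ∀ y, a < y → ‖K y‖ ≤ C * (1 + |y|)) :
    IntegrableOn (fun y => K y * φ y) (Set.Ioi a) := by
  have hpos : ∀ y : ℝ, (0 : ℝ) < 1 + |y| := fun y => by positivity
  have hc : Continuous fun y : ℝ => K y * (((1 + |y| : ℝ) : ℂ))⁻¹ := by
    refine hK.mul (Continuous.inv₀ (by fun_prop) fun y => ?_)
    exact_mod_cast (hpos y).ne'
  have h2 := (h a).bdd_mul (c := C) hc.aestronglyMeasurable (by
    refine (ae_restrict_iff' measurableSet_Ioi).2 (Eventually.of_forall fun y hy => ?_)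
    rw [norm_mul, norm_inv, Complex.norm_real, Real.norm_of_nonneg (hpos y).le,
      ← div_eq_mul_inv, div_le_iff₀ (hpos y)]
    exact hC y hy)
  refine h2.congr (Eventually.of_forall fun y => ?_)
  have : (((1 + |y| : ℝ) : ℂ)) ≠ 0 := by exact_mod_cast (hpos y).ne'
  simp only
  field_simp

theorem HasRightMoment.integrableOn {φ : ℝ → ℂ} (h : HasRightMoment φ) (a : ℝ) :
    IntegrableOn φ (Set.Ioi a) := by
  simpa using h.integrableOn_mul (K := fun _ => 1) continuous_const 1 a
    (fun y _ => by simp)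

/-! ### The Volterra kernel -/

noncomputable section

/-- `∫₀ˢ e^{2ikz} dz`. -/
def volterraKernel (k : ℂ) (s : ℝ) : ℂ := s * dslope Complex.exp 0 (2 * Complex.I * k * s)

/-- `e^{2iks}`. -/
def phase (k : ℂ) (s : ℝ) : ℂ := Complex.exp (2 * Complex.I * k * s)

end

theorem phase_add (k : ℂ) (s s' : ℝ) : phase k (s + s') = phase k s * phase k s' := by
  simp only [phase, ← Complex.exp_add]
  congr 1; push_cast; ring

theorem phase_zero (k : ℂ) : phase k 0 = 1 := by simp [phase]

theorem phase_sub (k : ℂ) (s s' : ℝ) : phase k (s - s') = phase k s * phase k (-s') := by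
  rw [sub_eq_add_neg, phase_add]

theorem phase_neg_mul (k : ℂ) (s : ℝ) : phase k (-s) * phase k s = 1 := by
  rw [← phase_add]; simp [phase]

theorem norm_phase (k : ℂ) (s : ℝ) : ‖phase k s‖ = Real.exp (-2 * k.im * s) := by
  rw [phase, Complex.norm_exp]
  congr 1
  simp [Complex.mul_re, Complex.mul_im]

theorem norm_phase_le {k : ℂ} (hk : 0 ≤ k.im) {s : ℝ} (hs : 0 ≤ s) : ‖phase k s‖ ≤ 1 := by
  rw [norm_phase, Real.exp_le_one_iff]
  have := mul_nonneg hk hs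
  nlinarith

theorem continuous_phase : Continuous fun p : ℂ × ℝ => phase p.1 p.2 := by
  unfold phase; fun_prop

theorem hasDerivAt_phase (k : ℂ) (s : ℝ) :
    HasDerivAt (phase k) (2 * Complex.I * k * phase k s) s := by
  have h : HasDerivAt (fun s : ℝ => 2 * Complex.I * k * (s : ℂ)) (2 * Complex.I * k) s := by
    simpa using (Complex.ofRealCLM.hasDerivAt (x := s)).const_mul (2 * Complex.I * k)
  have := h.cexp
  unfold phase
  convert this using 1
  ring

/-- This is the entire function (e^z − 1)/z. Writing the Volterra kernel through it makes the kernel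
entire in k, with no exception at k = 0, where it degenerates to s. -/
theorem differentiable_dslope_exp : Differentiable ℂ (dslope Complex.exp 0) := by
  rw [← differentiableOn_univ, Complex.differentiableOn_dslope Filter.univ_mem]
  exact Complex.differentiable_exp.differentiableOn

/-- The mean value inequality on the convex left half-plane, where the derivative of exp has norm at
most 1. -/
theorem norm_exp_sub_one_le_of_re_nonpos {z : ℂ} (hz : z.re ≤ 0) :
    ‖Complex.exp z - 1‖ ≤ ‖z‖ := by
  have := (convex_halfSpace_re_le 0).norm_image_sub_le_of_norm_deriv_le (𝕜 := ℂ)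
    (f := Complex.exp) (C := 1) (x := 0) (y := z) (fun x _ => Complex.differentiableAt_exp)
    (fun x hx => by
      rw [Complex.deriv_exp, Complex.norm_exp, Real.exp_le_one_iff]; exact hx)
    (by simp) hz
  simpa using this

theorem norm_dslope_exp_le {z : ℂ} (hz : z.re ≤ 0) : ‖dslope Complex.exp 0 z‖ ≤ 1 := by
  rcases eq_or_ne z 0 with rfl | h
  · simp
  · have h1 := sub_smul_dslope Complex.exp 0 z
    have h2 := norm_exp_sub_one_le_of_re_nonpos hz
    rw [Complex.exp_zero] at h1
    rw [← h1, norm_smul, sub_zero] at h2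
    have : 0 < ‖z‖ := norm_pos_iff.2 h
    nlinarith

theorem mul_volterraKernel (k : ℂ) (s : ℝ) :
    2 * Complex.I * k * volterraKernel k s = phase k s - 1 := by
  have h1 := sub_smul_dslope Complex.exp 0 (2 * Complex.I * k * s)
  rw [Complex.exp_zero, smul_eq_mul, sub_zero] at h1
  rw [phase, ← h1, volterraKernel]
  ring

theorem volterraKernel_zero_left (s : ℝ) : volterraKernel 0 s = s := by
  simp [volterraKernel]

theorem norm_volterraKernel_le {k : ℂ} (hk : 0 ≤ k.im) {s : ℝ} (hs : 0 ≤ s) :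
    ‖volterraKernel k s‖ ≤ s := by
  rw [volterraKernel, norm_mul, Complex.norm_real, Real.norm_of_nonneg hs]
  refine mul_le_of_le_one_right hs (norm_dslope_exp_le ?_)
  have := mul_nonneg hk hs
  simp [Complex.mul_re, Complex.mul_im]
  nlinarith

/-- Complements `norm_volterraKernel_le`: that bound is uniform down to k = 0, this one produces the
decay 1/|k| at the price of the factor s. -/
theorem norm_mul_volterraKernel_le {k : ℂ} (hk : 0 ≤ k.im) {s : ℝ} (hs : 0 ≤ s) :
    ‖k‖ * ‖volterraKernel k s‖ ≤ 1 := by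
  have h := congrArg norm (mul_volterraKernel k s)
  have h2 : ‖phase k s - 1‖ ≤ 2 := (norm_sub_le _ _).trans (by
    have := norm_phase_le hk hs
    simp; linarith)
  rw [norm_mul, norm_mul, norm_mul] at h
  simp at h
  linarith [mul_assoc 2 ‖k‖ ‖volterraKernel k s‖]

theorem continuous_volterraKernel : Continuous fun p : ℂ × ℝ => volterraKernel p.1 p.2 := by
  unfold volterraKernel
  have := differentiable_dslope_exp.continuous
  fun_prop

theorem differentiable_volterraKernel (s : ℝ) : Differentiable ℂ fun k => volterraKernel k s := by
  unfold volterraKernel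
  have h : Differentiable ℂ fun k : ℂ => 2 * Complex.I * k * s := by fun_prop
  exact (differentiable_dslope_exp.comp h).const_mul _

/-! ### Integrals against the Volterra kernel as functions of the lower limit -/

section Operator

variable {φ : ℝ → ℂ} {k : ℂ}

theorem HasRightMoment.integrableOn_phase (h : HasRightMoment φ) (hk : 0 ≤ k.im) (c a : ℝ) :
    IntegrableOn (fun y => phase k (y - c) * φ y) (Set.Ioi a) := by
  refine h.integrableOn_mul (K := fun y => phase k (y - c))
    (continuous_phase.comp (by fun_prop : Continuous fun y => (k, y - c)))
    (Real.exp (2 * k.im * (c - a))) a fun y hy => ?_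
  rw [norm_phase]
  have h1 : Real.exp (-2 * k.im * (y - c)) ≤ Real.exp (2 * k.im * (c - a)) := by
    apply Real.exp_le_exp.2
    have := mul_nonneg hk (sub_nonneg.2 hy.le)
    nlinarith
  have h2 : (1 : ℝ) ≤ 1 + |y| := by linarith [abs_nonneg y]
  nlinarith [Real.exp_pos (2 * k.im * (c - a))]

theorem HasRightMoment.integrableOn_volterraKernel (h : HasRightMoment φ) (hk : 0 ≤ k.im)
    (x : ℝ) : IntegrableOn (fun y => volterraKernel k (y - x) * φ y) (Set.Ioi x) := by
  refine h.integrableOn_mul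
    (continuous_volterraKernel.comp (by fun_prop : Continuous fun y => (k, y - x)))
    (1 + |x|) x fun y hy => ?_
  refine (norm_volterraKernel_le hk (sub_nonneg.2 hy.le)).trans ?_
  nlinarith [le_abs_self y, neg_abs_le x, abs_nonneg x, abs_nonneg y,
    mul_nonneg (abs_nonneg x) (abs_nonneg y)]

theorem hasDerivAt_integral_phase (h : HasRightMoment φ) (hc : Continuous φ) (hk : 0 ≤ k.im)
    (x : ℝ) : HasDerivAt (fun x => ∫ y in Set.Ioi x, phase k (y - x) * φ y)
      (-φ x - 2 * Complex.I * k * ∫ y in Set.Ioi x, phase k (y - x) * φ y) x := by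
  -- The phase factorizes, so x enters only through a prefactor and the limit of integration and
  -- nothing has to be differentiated under the integral sign.
  have h0 : ∀ x : ℝ, ∫ y in Set.Ioi x, phase k (y - x) * φ y =
      phase k (-x) * ∫ y in Set.Ioi x, phase k y * φ y := fun x => by
    rw [← integral_const_mul]
    congr 1; ext y
    rw [phase_sub]; ring
  have h1 : HasDerivAt (fun x : ℝ => phase k (-x)) (-(2 * Complex.I * k * phase k (-x))) x := by
    have := (hasDerivAt_phase k (-x)).scomp x (hasDerivAt_neg x)
    rw [neg_one_smul] at this
    exact this
  have hcp : Continuous fun y => phase k y * φ y :=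
    (continuous_phase.comp (by fun_prop : Continuous fun y : ℝ => (k, y))).mul hc
  have h2 := hasDerivAt_integral_Ioi hcp (fun a => by
    simpa using h.integrableOn_phase hk 0 a) x
  simp_rw [h0]
  refine (h1.mul h2).congr_deriv ?_
  have := phase_neg_mul k x
  linear_combination (-φ x) * this

/-- There is no boundary term because the kernel vanishes on the diagonal. For k ≠ 0 the kernel is
(phase − 1)/(2ik); at k = 0 it is y − x, and both are reduced to integrals in which x separates. -/
theorem hasDerivAt_integral_volterraKernel (h : HasRightMoment φ) (hc : Continuous φ)
    (hk : 0 ≤ k.im) (x : ℝ) :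
    HasDerivAt (fun x => ∫ y in Set.Ioi x, volterraKernel k (y - x) * φ y)
      (-∫ y in Set.Ioi x, phase k (y - x) * φ y) x := by
  rcases eq_or_ne k 0 with rfl | hk0
  · have hy : ∀ a, IntegrableOn (fun y : ℝ => (y : ℂ) * φ y) (Set.Ioi a) := fun a =>
      h.integrableOn_mul (by fun_prop) 1 a fun y _ => by simp
    have h0 : ∀ x : ℝ, ∫ y in Set.Ioi x, volterraKernel 0 (y - x) * φ y =
        (∫ y in Set.Ioi x, (y : ℂ) * φ y) - x * ∫ y in Set.Ioi x, φ y := fun x => by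
      rw [← integral_const_mul, ← integral_sub (hy x) ((h.integrableOn x).const_mul _)]
      congr 1; ext y
      rw [volterraKernel_zero_left]; push_cast; ring
    simp_rw [h0]
    have h1 := hasDerivAt_integral_Ioi (by fun_prop : Continuous fun y : ℝ => (y : ℂ) * φ y) hy x
    have h2 := hasDerivAt_integral_Ioi hc h.integrableOn x
    refine (h1.sub ((Complex.ofRealCLM.hasDerivAt (x := x)).mul h2)).congr_deriv ?_
    simp [phase]
  · have h2k : 2 * Complex.I * k ≠ 0 := by simp [hk0, Complex.I_ne_zero]
    have h0 : ∀ x : ℝ, ∫ y in Set.Ioi x, volterraKernel k (y - x) * φ y =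
        (2 * Complex.I * k)⁻¹ * ((∫ y in Set.Ioi x, phase k (y - x) * φ y) -
          ∫ y in Set.Ioi x, φ y) := fun x => by
      rw [← integral_sub (h.integrableOn_phase hk x x) (h.integrableOn x), ← integral_const_mul]
      congr 1; ext y
      have := mul_volterraKernel k (y - x)
      rw [eq_inv_mul_iff_mul_eq₀ h2k]
      linear_combination (φ y) * this
    simp_rw [h0]
    have h1 := hasDerivAt_integral_phase h hc hk x
    have h2 := hasDerivAt_integral_Ioi hc h.integrableOn x
    refine ((h1.sub h2).const_mul (2 * Complex.I * k)⁻¹).congr_deriv ?_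
    field_simp
    ring

end Operator

/-! ### Short range potentials -/

/-- Continuous potentials with finite first moment. -/
structure IsShortRange (v : ℝ → ℝ) : Prop where
  continuous : Continuous v
  integrable : Integrable fun x : ℝ => (1 + |x|) * |v x|

noncomputable section

/-- `1 + max(-x, 0)`. -/
def leftWeight (x : ℝ) : ℝ := 1 + max (-x) 0

/-- `∫_x^∞ (1 + |y|) |v(y)| dy`. -/
def tailMoment (v : ℝ → ℝ) (x : ℝ) : ℝ := ∫ y in Set.Ioi x, (1 + |y|) * |v y|

/-- `∫ (1 + |y|) |v(y)| dy`. -/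
def firstMoment (v : ℝ → ℝ) : ℝ := ∫ y, (1 + |y|) * |v y|

end

theorem one_le_leftWeight (x : ℝ) : 1 ≤ leftWeight x := by simp [leftWeight]

theorem leftWeight_anti : Antitone leftWeight := fun x y h => by
  unfold leftWeight; gcongr

theorem leftWeight_le (x : ℝ) : leftWeight x ≤ 1 + |x| := by
  unfold leftWeight
  have := neg_le_abs x
  have := abs_nonneg x
  gcongr
  simp [*]

theorem leftWeight_of_nonneg {x : ℝ} (hx : 0 ≤ x) : leftWeight x = 1 := by
  simp [leftWeight, hx]

/-- The growth y − x of the kernel is paid for by a factor 1 + |y|, which goes to the potential, and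
by the weight moving from y to x. Hence a first moment of the potential is enough. -/
theorem sub_mul_leftWeight_le {x y : ℝ} (h : x ≤ y) :
    (y - x) * leftWeight y ≤ leftWeight x * (1 + |y|) := by
  rcases le_total 0 y with hy | hy
  · rw [leftWeight_of_nonneg hy, abs_of_nonneg hy]
    unfold leftWeight
    nlinarith [le_max_left (-x) 0, le_max_right (-x) 0,
      mul_nonneg (le_max_right (-x) 0) hy]
  · have hx : x ≤ 0 := h.trans hy
    unfold leftWeight
    rw [abs_of_nonpos hy, max_eq_left (by linarith), max_eq_left (by linarith)]
    nlinarith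

namespace IsShortRange

variable {v : ℝ → ℝ}

theorem hasDerivAt_tailMoment (hv : IsShortRange v) (x : ℝ) :
    HasDerivAt (tailMoment v) (-((1 + |x|) * |v x|)) x :=
  hasDerivAt_integral_Ioi (by have := hv.continuous; fun_prop)
    (fun _ => hv.integrable.integrableOn) x

theorem _root_.tailMoment_nonneg (v : ℝ → ℝ) (x : ℝ) : 0 ≤ tailMoment v x :=
  integral_nonneg fun y => by positivity

theorem tailMoment_le (hv : IsShortRange v) (x : ℝ) : tailMoment v x ≤ firstMoment v :=
  setIntegral_le_integral hv.integrable (Eventually.of_forall fun y => by positivity)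

theorem tailMoment_anti (hv : IsShortRange v) : Antitone (tailMoment v) := fun x y h =>
  setIntegral_mono_set hv.integrable.integrableOn (Eventually.of_forall fun y => by positivity)
    (Eventually.of_forall (Set.Ioi_subset_Ioi h))

theorem tendsto_tailMoment (hv : IsShortRange v) : Tendsto (tailMoment v) atTop (𝓝 0) := by
  have h := intervalIntegral_tendsto_integral_Ioi 0
    (hv.integrable.integrableOn (s := Set.Ioi 0)) tendsto_id
  have h1 : tailMoment v = fun x => tailMoment v 0 - ∫ y in (0 : ℝ)..x, (1 + |y|) * |v y| := by
    funext z
    rw [← intervalIntegral.integral_Ioi_sub_Ioi' hv.integrable.integrableOn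
      hv.integrable.integrableOn]
    simp [tailMoment]
  rw [h1]
  simpa [tailMoment] using h.const_sub (tailMoment v 0)

/-- The contraction estimate for the Volterra operator. -/
theorem integral_weight_le (hv : IsShortRange v) (x : ℝ) :
    IntegrableOn (fun y => (1 + |y|) * |v y| * Real.exp (2 * tailMoment v y)) (Set.Ioi x) ∧
    ∫ y in Set.Ioi x, (1 + |y|) * |v y| * Real.exp (2 * tailMoment v y) ≤
      Real.exp (2 * tailMoment v x) / 2 := by
  -- The integrand is an exact derivative, since the derivative of `tailMoment` is −(1 + |y|)|v|.
  -- The 2 in the exponent is what makes the contraction constant 1/2.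
  have hd : ∀ y, HasDerivAt (fun y => -(Real.exp (2 * tailMoment v y) / 2))
      ((1 + |y|) * |v y| * Real.exp (2 * tailMoment v y)) y := fun y => by
    have := (((hv.hasDerivAt_tailMoment y).const_mul 2).exp.div_const 2).neg
    refine this.congr_deriv ?_
    ring
  have ht : Tendsto (fun y => -(Real.exp (2 * tailMoment v y) / 2)) atTop
      (𝓝 (-(Real.exp (2 * 0) / 2))) :=
    ((((hv.tendsto_tailMoment).const_mul 2).rexp).div_const 2).neg
  have hi := integrableOn_Ioi_deriv_of_nonneg' (fun y (_ : y ∈ Set.Ici x) => hd y)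
    (fun y _ => by positivity) ht
  refine ⟨hi, ?_⟩
  rw [integral_Ioi_of_hasDerivAt_of_tendsto' (fun y _ => hd y) hi ht]
  simp

end IsShortRange


/-- Dominated holomorphic functions may be integrated over a parameter. -/
theorem differentiableOn_integral_of_dominated {α : Type*} [MeasurableSpace α] {μ : Measure α}
    {F : ℂ → α → ℂ} {U : Set ℂ} (hU : IsOpen U) {bound : α → ℝ}
    (hmeas : ∀ k ∈ U, AEStronglyMeasurable (F k) μ)
    (hbound : ∀ᵐ a ∂μ, ∀ k ∈ U, ‖F k a‖ ≤ bound a) (hint : Integrable bound μ)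
    (hdiff : ∀ᵐ a ∂μ, DifferentiableOn ℂ (fun k => F k a) U) :
    DifferentiableOn ℂ (fun k => ∫ a, F k a ∂μ) U := by
  intro k₀ hk₀
  obtain ⟨R, hR, hball⟩ := Metric.isOpen_iff.1 hU k₀ hk₀
  have hsub : ∀ k ∈ Metric.ball k₀ (R / 2), Metric.closedBall k (R / 2) ⊆ Metric.ball k₀ R := by
    intro k hk z hz
    rw [Metric.mem_ball] at *
    rw [Metric.mem_closedBall] at hz
    linarith [dist_triangle z k k₀]
  have hin : ∀ k ∈ Metric.ball k₀ (R / 2), k ∈ U := fun k hk =>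
    hball (hsub k hk (Metric.mem_closedBall_self (by positivity)))
  have hd : ∀ᵐ a ∂μ, ∀ k ∈ Metric.ball k₀ (R / 2),
      HasDerivAt (fun k => F k a) (deriv (fun k => F k a) k) k := by
    filter_upwards [hdiff] with a ha k hk
    exact (ha.differentiableAt (hU.mem_nhds (hin k hk))).hasDerivAt
  -- Cauchy's estimate on discs of radius R/2: the bound for the functions also dominates their
  -- derivatives.
  have hb : ∀ᵐ a ∂μ, ∀ k ∈ Metric.ball k₀ (R / 2),
      ‖deriv (fun k => F k a) k‖ ≤ bound a / (R / 2) := by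
    filter_upwards [hdiff, hbound] with a ha hb k hk
    refine Complex.norm_deriv_le_of_forall_mem_sphere_norm_le (by positivity) ?_ fun z hz =>
      hb z (hball (hsub k hk (Metric.sphere_subset_closedBall hz)))
    refine DifferentiableOn.diffContOnCl ?_
    rw [closure_ball _ (by positivity)]
    exact ha.mono ((hsub k hk).trans hball)
  -- The derivative is measurable as the limit of difference quotients along a sequence tending to
  -- k₀.
  have hm : AEStronglyMeasurable (fun a => deriv (fun k => F k a) k₀) μ := by
    obtain ⟨u, hu⟩ : ∃ u : ℕ → ℂ, (∀ n, u n ∈ Metric.ball k₀ (R / 2) ∧ u n ≠ k₀) ∧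
        Tendsto u atTop (𝓝[≠] k₀) := by
      have h1 : ∀ᶠ z in 𝓝[≠] k₀, z ∈ Metric.ball k₀ (R / 2) ∧ z ≠ k₀ :=
        (eventually_nhdsWithin_of_eventually_nhds
          (Metric.ball_mem_nhds k₀ (by positivity))).and self_mem_nhdsWithin
      exact (Filter.exists_seq_forall_of_frequently h1.frequently).imp fun u hu => ⟨hu.2, hu.1⟩
    refine aestronglyMeasurable_of_tendsto_ae atTop
      (f := fun n a => slope (fun k => F k a) k₀ (u n)) (fun n => ?_) ?_
    · simp only [slope_def_field]
      exact ((hmeas _ (hin _ (hu.1 n).1)).sub (hmeas _ hk₀)).mul aestronglyMeasurable_const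
    · filter_upwards [hd] with a ha
      exact (hasDerivAt_iff_tendsto_slope.1 (ha k₀ (Metric.mem_ball_self (by positivity)))).comp
        hu.2
  refine (hasDerivAt_integral_of_dominated_loc_of_deriv_le
    (Metric.ball_mem_nhds k₀ (by positivity : 0 < R / 2)) ?_ ?_ hm hb (hint.div_const _)
    hd).2.differentiableAt.differentiableWithinAt
  · filter_upwards [Metric.ball_mem_nhds k₀ (by positivity : 0 < R / 2)] with k hk
    exact hmeas k (hin k hk)
  · exact hint.mono' (hmeas k₀ hk₀) (hbound.mono fun a ha => ha k₀ hk₀)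

/-! ### Successive approximations: the Faddeev function -/

noncomputable section

/-- The weight of the sup norm in which the Volterra operator is a contraction. -/
def jostWeight (v : ℝ → ℝ) (x : ℝ) : ℝ := leftWeight x * Real.exp (2 * tailMoment v x)

/-- The Volterra operator `f ↦ ∫_x^∞ D_k(y - x) v(y) f(y) dy`. -/
def volterraOp (v : ℝ → ℝ) (k : ℂ) (f : ℝ → ℂ) (x : ℝ) : ℂ :=
  ∫ y in Set.Ioi x, volterraKernel k (y - x) * (v y * f y)

/-- `f ↦ ∫_x^∞ e^{2ik(y - x)} v(y) f(y) dy`. -/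
def phaseOp (v : ℝ → ℝ) (k : ℂ) (f : ℝ → ℂ) (x : ℝ) : ℂ :=
  ∫ y in Set.Ioi x, phase k (y - x) * (v y * f y)

/-- The successive approximations to `e^{-ikx} ψ₊(k, x)`. -/
def jostIter (v : ℝ → ℝ) (k : ℂ) : ℕ → ℝ → ℂ
  | 0 => fun _ => 1
  | n + 1 => volterraOp v k (jostIter v k n)

/-- The Faddeev function `e^{-ikx} ψ₊(k, x)`. -/
def faddeev (v : ℝ → ℝ) (k : ℂ) (x : ℝ) : ℂ := ∑' n, jostIter v k n x

/-- The derivative of the Faddeev function. -/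
def faddeevDeriv (v : ℝ → ℝ) (k : ℂ) (x : ℝ) : ℂ := -phaseOp v k (faddeev v k) x

end

namespace IsShortRange

variable {v : ℝ → ℝ} {k : ℂ} {f : ℝ → ℂ} {C : ℝ}

theorem _root_.jostWeight_pos (v : ℝ → ℝ) (x : ℝ) : 0 < jostWeight v x :=
  mul_pos (zero_lt_one.trans_le (one_le_leftWeight x)) (Real.exp_pos _)

theorem _root_.leftWeight_le_jostWeight (v : ℝ → ℝ) (x : ℝ) :
    leftWeight x ≤ jostWeight v x :=
  le_mul_of_one_le_right (zero_le_one.trans (one_le_leftWeight x))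
    (Real.one_le_exp (mul_nonneg zero_le_two (tailMoment_nonneg v x)))

theorem jostWeight_le (hv : IsShortRange v) (x : ℝ) :
    jostWeight v x ≤ Real.exp (2 * firstMoment v) * leftWeight x := by
  rw [mul_comm]
  unfold jostWeight
  have := hv.tailMoment_le x
  have := one_le_leftWeight x
  gcongr

theorem jostWeight_anti (hv : IsShortRange v) : Antitone (jostWeight v) := fun x y h => by
  unfold jostWeight
  have h1 := leftWeight_anti h
  have h2 := hv.tailMoment_anti h
  have := one_le_leftWeight y
  have := one_le_leftWeight x
  gcongr

theorem continuous_tailMoment (hv : IsShortRange v) : Continuous (tailMoment v) :=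
  continuous_iff_continuousAt.2 fun x => (hv.hasDerivAt_tailMoment x).continuousAt

theorem sub_mul_norm_le (hf : ∀ y, ‖f y‖ ≤ C * jostWeight v y) {x y : ℝ} (h : x ≤ y) :
    (y - x) * ‖(v y : ℂ) * f y‖ ≤
      C * leftWeight x * ((1 + |y|) * |v y| * Real.exp (2 * tailMoment v y)) := by
  have hC : 0 ≤ C := nonneg_of_mul_nonneg_left ((norm_nonneg _).trans (hf 0)) (jostWeight_pos v 0)
  rw [norm_mul, Complex.norm_real, Real.norm_eq_abs]
  calc (y - x) * (|v y| * ‖f y‖)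
      ≤ (y - x) * (|v y| * (C * (leftWeight y * Real.exp (2 * tailMoment v y)))) := by
        have := hf y
        have := sub_nonneg.2 h
        unfold jostWeight at *
        gcongr
    _ = C * ((y - x) * leftWeight y) * (|v y| * Real.exp (2 * tailMoment v y)) := by ring
    _ ≤ C * (leftWeight x * (1 + |y|)) * (|v y| * Real.exp (2 * tailMoment v y)) := by
        have := sub_mul_leftWeight_le h
        gcongr
    _ = _ := by ring

theorem norm_mul_le (hf : ∀ y, ‖f y‖ ≤ C * jostWeight v y) (y : ℝ) :
    ‖(v y : ℂ) * f y‖ ≤ C * ((1 + |y|) * |v y| * Real.exp (2 * tailMoment v y)) := by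
  have hC : 0 ≤ C := nonneg_of_mul_nonneg_left ((norm_nonneg _).trans (hf 0)) (jostWeight_pos v 0)
  rw [norm_mul, Complex.norm_real, Real.norm_eq_abs]
  calc |v y| * ‖f y‖ ≤ |v y| * (C * (leftWeight y * Real.exp (2 * tailMoment v y))) := by
        have := hf y
        unfold jostWeight at *
        gcongr
    _ ≤ |v y| * (C * ((1 + |y|) * Real.exp (2 * tailMoment v y))) := by
        have := leftWeight_le y
        gcongr
    _ = _ := by ring

theorem integrable_weight (hv : IsShortRange v) :
    Integrable fun y => (1 + |y|) * |v y| * Real.exp (2 * tailMoment v y) := by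
  refine hv.integrable.mul_bdd (c := Real.exp (2 * firstMoment v)) ?_ ?_
  · have := hv.continuous_tailMoment
    exact Continuous.aestronglyMeasurable (by fun_prop)
  · refine Eventually.of_forall fun y => ?_
    have := hv.tailMoment_le y
    rw [Real.norm_of_nonneg (Real.exp_pos _).le]
    gcongr

theorem hasRightMoment_mul (hv : IsShortRange v) (hc : AEStronglyMeasurable f volume)
    (hf : ∀ y, ‖f y‖ ≤ C * jostWeight v y) : HasRightMoment fun y => v y * f y := by
  intro a
  have hC : 0 ≤ C := nonneg_of_mul_nonneg_left ((norm_nonneg _).trans (hf 0)) (jostWeight_pos v 0)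
  refine Integrable.mono' (g := fun y => C * jostWeight v a * ((1 + |y|) * |v y|))
    (hv.integrable.const_mul _).integrableOn ?_ ?_
  · have := hv.continuous
    exact ((by fun_prop : Continuous fun y : ℝ => ((1 + |y| : ℝ) : ℂ)).aestronglyMeasurable.mul
      ((by fun_prop : Continuous fun y : ℝ => (v y : ℂ)).aestronglyMeasurable.mul hc)).restrict
  · refine (ae_restrict_iff' measurableSet_Ioi).2 (Eventually.of_forall fun y hy => ?_)
    have h1 := (hf y).trans (mul_le_mul_of_nonneg_left (hv.jostWeight_anti (le_of_lt hy)) hC)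
    rw [norm_mul, norm_mul, Complex.norm_real, Complex.norm_real,
      Real.norm_of_nonneg (by positivity : 0 ≤ 1 + |y|), Real.norm_eq_abs]
    calc (1 + |y|) * (|v y| * ‖f y‖) ≤ (1 + |y|) * (|v y| * (C * jostWeight v a)) := by gcongr
      _ = _ := by ring

theorem norm_volterraKernel_mul_le (hk : 0 ≤ k.im) (hf : ∀ y, ‖f y‖ ≤ C * jostWeight v y)
    {x y : ℝ} (h : x ≤ y) : ‖volterraKernel k (y - x) * (v y * f y)‖ ≤
      C * leftWeight x * ((1 + |y|) * |v y| * Real.exp (2 * tailMoment v y)) := by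
  rw [norm_mul]
  exact (mul_le_mul_of_nonneg_right (norm_volterraKernel_le hk (sub_nonneg.2 h))
    (norm_nonneg _)).trans (sub_mul_norm_le hf h)

theorem norm_phase_mul_le (hk : 0 ≤ k.im) (hf : ∀ y, ‖f y‖ ≤ C * jostWeight v y)
    {x y : ℝ} (h : x ≤ y) : ‖phase k (y - x) * (v y * f y)‖ ≤
      C * ((1 + |y|) * |v y| * Real.exp (2 * tailMoment v y)) := by
  rw [norm_mul]
  exact (mul_le_of_le_one_left (norm_nonneg _) (norm_phase_le hk (sub_nonneg.2 h))).trans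
    (norm_mul_le hf y)

theorem norm_volterraOp_le (hv : IsShortRange v) (hk : 0 ≤ k.im)
    (hf : ∀ y, ‖f y‖ ≤ C * jostWeight v y) (x : ℝ) :
    ‖volterraOp v k f x‖ ≤ C / 2 * jostWeight v x := by
  have hC : 0 ≤ C := nonneg_of_mul_nonneg_left ((norm_nonneg _).trans (hf 0)) (jostWeight_pos v 0)
  have h0 := one_le_leftWeight x
  obtain ⟨h1, h2⟩ := hv.integral_weight_le x
  refine (norm_integral_le_of_norm_le (h1.const_mul (C * leftWeight x))
    ((ae_restrict_iff' measurableSet_Ioi).2 (Eventually.of_forall fun y hy =>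
      norm_volterraKernel_mul_le hk hf (le_of_lt hy)))).trans ?_
  rw [integral_const_mul]
  refine (mul_le_mul_of_nonneg_left h2 (by positivity)).trans_eq ?_
  unfold jostWeight
  ring

theorem hasDerivAt_volterraOp (hv : IsShortRange v) (hk : 0 ≤ k.im) (hc : Continuous f)
    (hf : ∀ y, ‖f y‖ ≤ C * jostWeight v y) (x : ℝ) :
    HasDerivAt (volterraOp v k f) (-phaseOp v k f x) x := by
  have := hv.continuous
  exact hasDerivAt_integral_volterraKernel (hv.hasRightMoment_mul hc.aestronglyMeasurable hf)
    (by fun_prop) hk x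

theorem hasDerivAt_phaseOp (hv : IsShortRange v) (hk : 0 ≤ k.im) (hc : Continuous f)
    (hf : ∀ y, ‖f y‖ ≤ C * jostWeight v y) (x : ℝ) :
    HasDerivAt (phaseOp v k f) (-(v x * f x) - 2 * Complex.I * k * phaseOp v k f x) x := by
  have := hv.continuous
  exact hasDerivAt_integral_phase (hv.hasRightMoment_mul hc.aestronglyMeasurable hf)
    (by fun_prop) hk x

theorem continuous_volterraOp (hv : IsShortRange v) (hk : 0 ≤ k.im) (hc : Continuous f)
    (hf : ∀ y, ‖f y‖ ≤ C * jostWeight v y) : Continuous (volterraOp v k f) :=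
  continuous_iff_continuousAt.2 fun x => (hv.hasDerivAt_volterraOp hk hc hf x).continuousAt

/-- Each application of the Volterra operator halves the weighted norm, so the Neumann series is
dominated by a geometric series uniformly in the closed upper half-plane. -/
theorem jostIter_spec (hv : IsShortRange v) (hk : 0 ≤ k.im) (n : ℕ) :
    Continuous (jostIter v k n) ∧ ∀ x, ‖jostIter v k n x‖ ≤ (1 / 2) ^ n * jostWeight v x := by
  induction n with
  | zero =>
    refine ⟨continuous_const, fun x => ?_⟩
    simpa [jostIter] using (one_le_leftWeight x).trans (leftWeight_le_jostWeight v x)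
  | succ n ih =>
    refine ⟨hv.continuous_volterraOp hk ih.1 ih.2, fun x => ?_⟩
    refine (hv.norm_volterraOp_le hk ih.2 x).trans_eq ?_
    rw [pow_succ]; ring

theorem norm_jostIter_le (hv : IsShortRange v) (hk : 0 ≤ k.im) (n : ℕ) (x : ℝ) :
    ‖jostIter v k n x‖ ≤ (1 / 2) ^ n * jostWeight v x := (hv.jostIter_spec hk n).2 x

theorem summable_jostIter (hv : IsShortRange v) (hk : 0 ≤ k.im) (x : ℝ) :
    Summable fun n => jostIter v k n x :=
  Summable.of_norm_bounded (summable_geometric_two.mul_right (jostWeight v x))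
    fun n => hv.norm_jostIter_le hk n x

theorem norm_faddeev_le (hv : IsShortRange v) (hk : 0 ≤ k.im) (x : ℝ) :
    ‖faddeev v k x‖ ≤ 2 * jostWeight v x := by
  refine (tsum_of_norm_bounded (hasSum_geometric_two.mul_right (jostWeight v x))
    fun n => hv.norm_jostIter_le hk n x)

theorem continuous_faddeev (hv : IsShortRange v) (hk : 0 ≤ k.im) : Continuous (faddeev v k) := by
  refine continuous_iff_continuousAt.2 fun x => ?_
  -- The weight grows towards −∞, so the series is controlled uniformly only on right half-lines.
  have : ContinuousOn (faddeev v k) (Set.Ici (x - 1)) := by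
    refine continuousOn_tsum (fun n => (hv.jostIter_spec hk n).1.continuousOn)
      (summable_geometric_two.mul_right (jostWeight v (x - 1))) fun n y hy => ?_
    refine (hv.norm_jostIter_le hk n y).trans ?_
    exact mul_le_mul_of_nonneg_left (hv.jostWeight_anti hy) (by positivity)
  exact this.continuousAt (Ici_mem_nhds (by linarith))

/-- The Volterra equation. -/
theorem faddeev_eq (hv : IsShortRange v) (hk : 0 ≤ k.im) (x : ℝ) :
    faddeev v k x = 1 + volterraOp v k (faddeev v k) x := by
  have h := hasSum_integral_of_summable_integral_norm (μ := volume.restrict (Set.Ioi x))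
    (F := fun n y => volterraKernel k (y - x) * (v y * jostIter v k n y)) (fun n =>
      (hv.hasRightMoment_mul (hv.jostIter_spec hk n).1.aestronglyMeasurable
        (hv.jostIter_spec hk n).2).integrableOn_volterraKernel hk x) (by
      obtain ⟨h1, h2⟩ := hv.integral_weight_le x
      refine Summable.of_nonneg_of_le (fun n => integral_nonneg fun y => norm_nonneg _)
        (fun n => ?_) (summable_geometric_two.mul_right (leftWeight x *
          ∫ y in Set.Ioi x, (1 + |y|) * |v y| * Real.exp (2 * tailMoment v y)))
      rw [← mul_assoc, ← integral_const_mul]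
      refine integral_mono_of_nonneg (Eventually.of_forall fun y => norm_nonneg _)
        (h1.const_mul _) ?_
      exact (ae_restrict_iff' measurableSet_Ioi).2 (Eventually.of_forall fun y hy =>
        norm_volterraKernel_mul_le hk (hv.norm_jostIter_le hk n) (le_of_lt hy)))
  have h3 : ∀ y, ∑' n, volterraKernel k (y - x) * (v y * jostIter v k n y) =
      volterraKernel k (y - x) * (v y * faddeev v k y) := fun y => by
    rw [tsum_mul_left, tsum_mul_left, faddeev]
  simp_rw [h3] at h
  rw [faddeev, (hv.summable_jostIter hk x).tsum_eq_zero_add]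
  exact congrArg (1 + ·) h.tsum_eq

theorem hasDerivAt_faddeev (hv : IsShortRange v) (hk : 0 ≤ k.im) (x : ℝ) :
    HasDerivAt (faddeev v k) (faddeevDeriv v k x) x := by
  have := (hv.hasDerivAt_volterraOp hk (hv.continuous_faddeev hk) (hv.norm_faddeev_le hk)
    x).const_add 1
  rwa [show (fun x => 1 + volterraOp v k (faddeev v k) x) = faddeev v k from
    funext fun x => (hv.faddeev_eq hk x).symm] at this

theorem hasDerivAt_faddeevDeriv (hv : IsShortRange v) (hk : 0 ≤ k.im) (x : ℝ) :
    HasDerivAt (faddeevDeriv v k)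
      (v x * faddeev v k x - 2 * Complex.I * k * faddeevDeriv v k x) x := by
  refine (hv.hasDerivAt_phaseOp hk (hv.continuous_faddeev hk) (hv.norm_faddeev_le hk)
    x).neg.congr_deriv ?_
  unfold faddeevDeriv
  ring

theorem continuous_faddeevDeriv (hv : IsShortRange v) (hk : 0 ≤ k.im) :
    Continuous (faddeevDeriv v k) :=
  continuous_iff_continuousAt.2 fun x => (hv.hasDerivAt_faddeevDeriv hk x).continuousAt

/-! Dependence on the spectral parameter. -/

theorem isOpen_upper : IsOpen {k : ℂ | 0 < k.im} := isOpen_lt continuous_const Complex.continuous_im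

/-- Stated for a general kernel so as to serve twice: with `volterraKernel` for the iterates, with
`phase` for the x-derivative. The companion below does the same for holomorphy. -/
theorem continuousOn_op {K : ℂ → ℝ → ℂ} (hK : Continuous fun p : ℂ × ℝ => K p.1 p.2)
    {F : ℂ → ℝ → ℂ} (hv : IsShortRange v) (x : ℝ) (hm : ∀ k, 0 ≤ k.im → Continuous (F k))
    {B : ℝ}
    (hb : ∀ k, 0 ≤ k.im → ∀ y, x ≤ y → ‖K k (y - x) * (v y * F k y)‖ ≤
      B * ((1 + |y|) * |v y| * Real.exp (2 * tailMoment v y)))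
    (hF : ∀ y, ContinuousOn (fun k => F k y) {k : ℂ | 0 ≤ k.im}) :
    ContinuousOn (fun k => ∫ y in Set.Ioi x, K k (y - x) * (v y * F k y)) {k : ℂ | 0 ≤ k.im} := by
  have hvc := hv.continuous
  refine continuousOn_of_dominated (fun k hk => ?_) (fun k hk => ?_)
    ((hv.integrable_weight.const_mul B).integrableOn (s := Set.Ioi x)) ?_
  · have h1 := hm k hk
    have h2 : Continuous fun y => K k (y - x) :=
      hK.comp (by fun_prop : Continuous fun y => (k, y - x))
    exact Continuous.aestronglyMeasurable (by fun_prop)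
  · exact (ae_restrict_iff' measurableSet_Ioi).2 (Eventually.of_forall fun y hy =>
      hb k hk y (le_of_lt hy))
  · refine Eventually.of_forall fun y => ?_
    have h2 : Continuous fun k => K k (y - x) :=
      hK.comp (by fun_prop : Continuous fun k => (k, y - x))
    exact h2.continuousOn.mul (continuousOn_const.mul (hF y))

theorem differentiableOn_op {K : ℂ → ℝ → ℂ} (hK : Continuous fun p : ℂ × ℝ => K p.1 p.2)
    (hKd : ∀ s, Differentiable ℂ fun k => K k s)
    {F : ℂ → ℝ → ℂ} (hv : IsShortRange v) (x : ℝ) (hm : ∀ k, 0 ≤ k.im → Continuous (F k))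
    {B : ℝ}
    (hb : ∀ k, 0 ≤ k.im → ∀ y, x ≤ y → ‖K k (y - x) * (v y * F k y)‖ ≤
      B * ((1 + |y|) * |v y| * Real.exp (2 * tailMoment v y)))
    (hF : ∀ y, DifferentiableOn ℂ (fun k => F k y) {k : ℂ | 0 < k.im}) :
    DifferentiableOn ℂ (fun k => ∫ y in Set.Ioi x, K k (y - x) * (v y * F k y))
      {k : ℂ | 0 < k.im} := by
  have hvc := hv.continuous
  refine differentiableOn_integral_of_dominated isOpen_upper (fun k hk => ?_) ?_
    ((hv.integrable_weight.const_mul B).integrableOn (s := Set.Ioi x)) ?_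
  · have h1 := hm k (le_of_lt hk)
    have h2 : Continuous fun y => K k (y - x) :=
      hK.comp (by fun_prop : Continuous fun y => (k, y - x))
    exact Continuous.aestronglyMeasurable (by fun_prop)
  · exact (ae_restrict_iff' measurableSet_Ioi).2 (Eventually.of_forall fun y hy k hk =>
      hb k (le_of_lt hk) y (le_of_lt hy))
  · exact Eventually.of_forall fun y => (hKd _).differentiableOn.mul ((hF y).const_mul _)

theorem differentiable_phase (s : ℝ) : Differentiable ℂ fun k => phase k s := by
  unfold phase; fun_prop

theorem continuousOn_jostIter (hv : IsShortRange v) (n : ℕ) :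
    ∀ x, ContinuousOn (fun k => jostIter v k n x) {k : ℂ | 0 ≤ k.im} := by
  induction n with
  | zero => exact fun x => continuousOn_const
  | succ n ih =>
    exact fun x => continuousOn_op continuous_volterraKernel hv x
      (fun _ hk => (hv.jostIter_spec hk n).1) (fun _ hk _ hy =>
        norm_volterraKernel_mul_le hk (hv.norm_jostIter_le hk n) hy) ih

theorem differentiableOn_jostIter (hv : IsShortRange v) (n : ℕ) :
    ∀ x, DifferentiableOn ℂ (fun k => jostIter v k n x) {k : ℂ | 0 < k.im} := by
  induction n with
  | zero => exact fun x => differentiableOn_const _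
  | succ n ih =>
    exact fun x => differentiableOn_op continuous_volterraKernel differentiable_volterraKernel hv x
      (fun _ hk => (hv.jostIter_spec hk n).1) (fun _ hk _ hy =>
        norm_volterraKernel_mul_le hk (hv.norm_jostIter_le hk n) hy) ih

theorem continuousOn_faddeev (hv : IsShortRange v) (x : ℝ) :
    ContinuousOn (fun k => faddeev v k x) {k : ℂ | 0 ≤ k.im} :=
  continuousOn_tsum (fun n => hv.continuousOn_jostIter n x)
    (summable_geometric_two.mul_right (jostWeight v x)) fun n _ hk => hv.norm_jostIter_le hk n x

theorem differentiableOn_faddeev (hv : IsShortRange v) (x : ℝ) :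
    DifferentiableOn ℂ (fun k => faddeev v k x) {k : ℂ | 0 < k.im} :=
  Complex.differentiableOn_tsum_of_summable_norm
    (summable_geometric_two.mul_right (jostWeight v x))
    (fun n => hv.differentiableOn_jostIter n x) isOpen_upper
    fun n _ hk => hv.norm_jostIter_le (le_of_lt hk) n x

theorem continuousOn_faddeevDeriv (hv : IsShortRange v) (x : ℝ) :
    ContinuousOn (fun k => faddeevDeriv v k x) {k : ℂ | 0 ≤ k.im} :=
  (continuousOn_op continuous_phase hv x (fun _ hk => hv.continuous_faddeev hk)
    (fun _ hk _ hy => norm_phase_mul_le hk (hv.norm_faddeev_le hk) hy)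
    hv.continuousOn_faddeev).neg

theorem differentiableOn_faddeevDeriv (hv : IsShortRange v) (x : ℝ) :
    DifferentiableOn ℂ (fun k => faddeevDeriv v k x) {k : ℂ | 0 < k.im} :=
  (differentiableOn_op continuous_phase differentiable_phase hv x
    (fun _ hk => hv.continuous_faddeev hk)
    (fun _ hk _ hy => norm_phase_mul_le hk (hv.norm_faddeev_le hk) hy)
    hv.differentiableOn_faddeev).neg

/-! Behaviour at `+∞`. -/

theorem norm_faddeev_sub_one_le (hv : IsShortRange v) (hk : 0 ≤ k.im) (x : ℝ) :
    ‖faddeev v k x - 1‖ ≤ 2 * leftWeight x *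
      ∫ y in Set.Ioi x, (1 + |y|) * |v y| * Real.exp (2 * tailMoment v y) := by
  rw [hv.faddeev_eq hk, add_sub_cancel_left, ← integral_const_mul]
  exact norm_integral_le_of_norm_le ((hv.integral_weight_le x).1.const_mul _)
    ((ae_restrict_iff' measurableSet_Ioi).2 (Eventually.of_forall fun y hy =>
      norm_volterraKernel_mul_le hk (hv.norm_faddeev_le hk) (le_of_lt hy)))

theorem norm_faddeevDeriv_le (hv : IsShortRange v) (hk : 0 ≤ k.im) (x : ℝ) :
    ‖faddeevDeriv v k x‖ ≤
      2 * ∫ y in Set.Ioi x, (1 + |y|) * |v y| * Real.exp (2 * tailMoment v y) := by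
  rw [faddeevDeriv, norm_neg, ← integral_const_mul]
  exact norm_integral_le_of_norm_le ((hv.integral_weight_le x).1.const_mul _)
    ((ae_restrict_iff' measurableSet_Ioi).2 (Eventually.of_forall fun y hy =>
      norm_phase_mul_le hk (hv.norm_faddeev_le hk) (le_of_lt hy)))

theorem _root_.tendsto_integral_Ioi_atTop {f : ℝ → ℝ} (hf : Integrable f) :
    Tendsto (fun x => ∫ y in Set.Ioi x, f y) atTop (𝓝 0) := by
  have h := intervalIntegral_tendsto_integral_Ioi 0 (hf.integrableOn (s := Set.Ioi 0)) tendsto_id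
  have h1 : (fun x => ∫ y in Set.Ioi x, f y) =
      fun x => (∫ y in Set.Ioi (0 : ℝ), f y) - ∫ y in (0 : ℝ)..x, f y := by
    funext z
    rw [← intervalIntegral.integral_Ioi_sub_Ioi' hf.integrableOn hf.integrableOn]
    simp
  rw [h1]
  simpa using h.const_sub (∫ y in Set.Ioi (0 : ℝ), f y)

theorem tendsto_faddeev (hv : IsShortRange v) (hk : 0 ≤ k.im) :
    Tendsto (faddeev v k) atTop (𝓝 1) := by
  rw [tendsto_iff_norm_sub_tendsto_zero]
  refine squeeze_zero' (Eventually.of_forall fun _ => norm_nonneg _) ?_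
    (by simpa using (tendsto_integral_Ioi_atTop hv.integrable_weight).const_mul 2)
  filter_upwards [eventually_ge_atTop 0] with x hx
  simpa [leftWeight_of_nonneg hx] using hv.norm_faddeev_sub_one_le hk x

theorem tendsto_faddeevDeriv (hv : IsShortRange v) (hk : 0 ≤ k.im) :
    Tendsto (faddeevDeriv v k) atTop (𝓝 0) :=
  squeeze_zero_norm (hv.norm_faddeevDeriv_le hk)
    (by simpa using (tendsto_integral_Ioi_atTop hv.integrable_weight).const_mul 2)

/-- The Volterra operator determines small solutions up to small errors. -/
theorem norm_le_of_le_volterra (hv : IsShortRange v) {z : ℝ → ℂ} {ε : ℝ} (hε : 0 ≤ ε)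
    (hz : ∀ x, ‖z x‖ ≤ C * leftWeight x)
    (h : ∀ x, ‖z x‖ ≤ ε * leftWeight x + ‖volterraOp v k z x‖) (hk : 0 ≤ k.im) (x : ℝ) :
    ‖z x‖ ≤ 2 * ε * jostWeight v x := by
  have hC : 0 ≤ C := nonneg_of_mul_nonneg_left ((norm_nonneg _).trans (hz 0))
    (zero_lt_one.trans_le (one_le_leftWeight 0))
  -- Bootstrap: inserting the bound into the hypothesis halves the a priori constant C and
  -- reproduces 2ε, because ε + (2ε)/2 = 2ε.
  have key : ∀ n : ℕ, ∀ x, ‖z x‖ ≤ (2 * ε + C * (1 / 2) ^ n) * jostWeight v x := by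
    intro n
    induction n with
    | zero =>
      intro x
      refine (hz x).trans ?_
      have := leftWeight_le_jostWeight v x
      have := jostWeight_pos v x
      calc C * leftWeight x ≤ C * jostWeight v x := by gcongr
        _ ≤ _ := by
          gcongr
          linarith
    | succ n ih =>
      intro x
      refine (h x).trans ?_
      have h1 := hv.norm_volterraOp_le hk ih x
      have h2 := mul_le_mul_of_nonneg_left (leftWeight_le_jostWeight v x) hε
      refine (add_le_add h2 h1).trans_eq ?_
      rw [pow_succ]; ring
  have ht : Tendsto (fun n : ℕ => (2 * ε + C * (1 / 2) ^ n) * jostWeight v x) atTop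
      (𝓝 ((2 * ε + C * 0) * jostWeight v x)) :=
    (((tendsto_pow_atTop_nhds_zero_of_lt_one (by norm_num) (by norm_num)).const_mul C).const_add
      _).mul_const _
  rw [mul_zero, add_zero] at ht
  exact ge_of_tendsto' ht fun n => key n x

end IsShortRange


/-! ### Solutions of the Schrödinger equation -/

section Solutions

variable {v : ℝ → ℝ} {E E' : ℂ} {f g : ℝ → ℂ}

theorem solvesSchrodinger_of_hasDerivAt (hv : Continuous v) {f' : ℝ → ℂ}
    (h1 : ∀ x, HasDerivAt f (f' x) x) (h2 : ∀ x, HasDerivAt f' ((v x - E) * f x) x) :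
    SolvesSchrodinger v E f := by
  have hd : deriv f = f' := funext fun x => (h1 x).deriv
  have hd2 : deriv f' = fun x => (v x - E) * f x := funext fun x => (h2 x).deriv
  have hfc : Continuous f := continuous_iff_continuousAt.2 fun x => (h1 x).continuousAt
  have hc1 : ContDiff ℝ 1 f' := by
    rw [contDiff_one_iff_deriv, hd2]
    exact ⟨fun x => (h2 x).differentiableAt, by fun_prop⟩
  refine ⟨?_, fun x => ?_⟩
  · rw [show (2 : WithTop ℕ∞) = 1 + 1 by norm_num, contDiff_succ_iff_deriv, hd]
    exact ⟨fun x => (h1 x).differentiableAt, by simp, hc1⟩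
  · rw [hd, hd2]; ring

namespace SolvesSchrodinger

theorem hasDerivAt (hf : SolvesSchrodinger v E f) (x : ℝ) : HasDerivAt f (deriv f x) x :=
  (hf.1.differentiable (by norm_num) x).hasDerivAt

theorem hasDerivAt_deriv (hf : SolvesSchrodinger v E f) (x : ℝ) :
    HasDerivAt (deriv f) ((v x - E) * f x) x := by
  have h := hf.1
  rw [show (2 : WithTop ℕ∞) = 1 + 1 by norm_num, contDiff_succ_iff_deriv] at h
  refine ((h.2.2.differentiable (by norm_num) x).hasDerivAt).congr_deriv ?_
  have := hf.2 x
  linear_combination -this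

theorem continuous (hf : SolvesSchrodinger v E f) : Continuous f := hf.1.continuous

theorem const_mul (hf : SolvesSchrodinger v E f) (hv : Continuous v) (c : ℂ) :
    SolvesSchrodinger v E fun x => c * f x :=
  solvesSchrodinger_of_hasDerivAt hv (fun x => (hf.hasDerivAt x).const_mul c)
    fun x => ((hf.hasDerivAt_deriv x).const_mul c).congr_deriv (by ring)

theorem sub (hf : SolvesSchrodinger v E f) (hg : SolvesSchrodinger v E g) (hv : Continuous v) :
    SolvesSchrodinger v E fun x => f x - g x :=
  solvesSchrodinger_of_hasDerivAt hv (fun x => (hf.hasDerivAt x).sub (hg.hasDerivAt x))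
    fun x => ((hf.hasDerivAt_deriv x).sub (hg.hasDerivAt_deriv x)).congr_deriv (by ring)

theorem conj (hf : SolvesSchrodinger v E f) (hv : Continuous v) :
    SolvesSchrodinger v ((starRingEnd ℂ) E) fun x => (starRingEnd ℂ) (f x) :=
  solvesSchrodinger_of_hasDerivAt hv (fun x => (hf.hasDerivAt x).star)
    fun x => (hf.hasDerivAt_deriv x).star.congr_deriv (by simp)

theorem comp_neg (hf : SolvesSchrodinger v E f) (hv : Continuous v) :
    SolvesSchrodinger (fun x => v (-x)) E fun x => f (-x) :=
  solvesSchrodinger_of_hasDerivAt (hv.comp continuous_neg)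
    (fun x => (hf.hasDerivAt (-x)).scomp x (hasDerivAt_neg x))
    fun x => (((hf.hasDerivAt_deriv (-x)).scomp x (hasDerivAt_neg x)).const_smul
      (-1 : ℝ)).congr_deriv (by simp)

theorem hasDerivAt_wronskian (hf : SolvesSchrodinger v E f) (hg : SolvesSchrodinger v E' g)
    (x : ℝ) : HasDerivAt (wronskian f g) ((E - E') * (f x * g x)) x :=
  (((hf.hasDerivAt x).mul (hg.hasDerivAt_deriv x)).sub
    ((hf.hasDerivAt_deriv x).mul (hg.hasDerivAt x))).congr_deriv (by ring)

theorem wronskian_eq (hf : SolvesSchrodinger v E f) (hg : SolvesSchrodinger v E g) (x y : ℝ) :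
    wronskian f g x = wronskian f g y :=
  is_const_of_deriv_eq_zero (fun x => (hf.hasDerivAt_wronskian hg x).differentiableAt)
    (fun x => by simp [(hf.hasDerivAt_wronskian hg x).deriv]) x y

theorem eq_zero_of_cauchy (hf : SolvesSchrodinger v E f) (hv : Continuous v) {a : ℝ}
    (h0 : f a = 0) (h1 : deriv f a = 0) (x : ℝ) : f x = 0 := by
  set A := min a x - 1
  set B := max a x + 1
  obtain ⟨K, hK⟩ : ∃ K, ∀ t ∈ Set.Icc A B, ‖(v t : ℂ) - E‖ ≤ K :=
    isCompact_Icc.exists_bound_of_continuousOn (by fun_prop)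
  have hlip : ∀ t ∈ Set.Ioo A B, LipschitzOnWith (max 1 (Real.toNNReal K))
      (fun p : ℂ × ℂ => (p.2, ((v t : ℂ) - E) * p.1)) Set.univ := fun t ht => by
    refine (LipschitzWith.prodMk LipschitzWith.prod_snd ?_).lipschitzOnWith
    refine LipschitzWith.of_dist_le_mul fun p q => ?_
    rw [dist_eq_norm, ← mul_sub, norm_mul]
    gcongr
    · exact (hK t (Set.Ioo_subset_Icc_self ht)).trans (Real.le_coe_toNNReal K)
    · rw [← dist_eq_norm]; exact le_max_left _ _
  have h := ODE_solution_unique_of_mem_Ioo (t₀ := a) (f := fun t => (f t, deriv f t))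
    (g := fun _ => (0, 0)) hlip (by grind)
    (fun t _ => ⟨(hf.hasDerivAt t).prodMk (hf.hasDerivAt_deriv t), Set.mem_univ _⟩)
    (fun t _ => ⟨(hasDerivAt_const t ((0, 0) : ℂ × ℂ)).congr_deriv (by simp; rfl), Set.mem_univ _⟩)
    (by simp [h0, h1]) (by grind : x ∈ Set.Ioo A B)
  exact (Prod.mk.inj h).1

/-- A vanishing Wronskian makes the Cauchy data at a proportional, and uniqueness for the initial
value problem spreads this over the line. If g(a) = 0 the factor is read off from the derivatives,
which cannot both vanish with g. -/
theorem exists_eq_mul_of_wronskian_eq_zero (hf : SolvesSchrodinger v E f)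
    (hg : SolvesSchrodinger v E g) (hv : Continuous v) {a : ℝ} (hW : wronskian f g a = 0)
    (hg0 : g ≠ 0) : ∃ c : ℂ, ∀ x, f x = c * g x := by
  unfold wronskian at hW
  obtain ⟨c, h0, h1⟩ : ∃ c : ℂ, f a = c * g a ∧ deriv f a = c * deriv g a := by
    by_cases h : g a = 0
    · have h' : deriv g a ≠ 0 := fun h' =>
        hg0 (funext fun x => hg.eq_zero_of_cauchy hv h h' x)
      refine ⟨deriv f a / deriv g a, ?_, by field_simp⟩
      rw [h] at hW ⊢
      simpa [h'] using hW
    · refine ⟨f a / g a, by field_simp, ?_⟩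
      field_simp
      linear_combination -hW
  refine ⟨c, fun x => sub_eq_zero.1 ?_⟩
  have h2 := hf.sub (hg.const_mul hv c) hv
  refine h2.eq_zero_of_cauchy hv (a := a) (by simp [h0]) ?_ x
  refine ((hf.hasDerivAt a).sub ((hg.hasDerivAt a).const_mul c)).deriv.trans ?_
  rw [h1, sub_self]

end SolvesSchrodinger

theorem wronskian_neg_swap (f g : ℝ → ℂ) (x : ℝ) : wronskian f g x = -wronskian g f x := by
  unfold wronskian; ring

theorem wronskian_comp_neg (f g : ℝ → ℂ) (x : ℝ) :
    wronskian (fun y => f (-y)) (fun y => g (-y)) x = -wronskian f g (-x) := by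
  unfold wronskian
  rw [deriv_comp_neg, deriv_comp_neg]
  ring

theorem wronskian_mul_left (c : ℂ) (f g : ℝ → ℂ) (x : ℝ) :
    wronskian (fun y => c * f y) g x = c * wronskian f g x := by
  unfold wronskian
  rw [deriv_const_mul_field]
  ring

/-- The Plücker relation. -/
theorem mul_wronskian (h f g : ℝ → ℂ) (x : ℝ) :
    h x * wronskian f g x = f x * wronskian h g x - g x * wronskian h f x := by
  unfold wronskian; ring

end Solutions

/-! ### Jost solutions -/

noncomputable section

/-- `e^{ikx}` times the Faddeev function. -/
def psiPlus (v : ℝ → ℝ) (k : ℂ) (x : ℝ) : ℂ := Complex.exp (Complex.I * k * x) * faddeev v k x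

end

theorem hasDerivAt_planeWave (k : ℂ) (x : ℝ) :
    HasDerivAt (fun x : ℝ => Complex.exp (Complex.I * k * x))
      (Complex.I * k * Complex.exp (Complex.I * k * x)) x := by
  have h : HasDerivAt (fun s : ℝ => Complex.I * k * (s : ℂ)) (Complex.I * k) x := by
    simpa using (Complex.ofRealCLM.hasDerivAt (x := x)).const_mul (Complex.I * k)
  exact h.cexp.congr_deriv (by ring)

theorem norm_planeWave (k : ℂ) (x : ℝ) :
    ‖Complex.exp (Complex.I * k * x)‖ = Real.exp (-(k.im * x)) := by
  rw [Complex.norm_exp]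
  simp [Complex.mul_re, Complex.mul_im]

theorem norm_planeWave_le {k : ℂ} (hk : 0 ≤ k.im) {x : ℝ} (hx : 0 ≤ x) :
    ‖Complex.exp (Complex.I * k * x)‖ ≤ 1 := by
  rw [norm_planeWave, Real.exp_le_one_iff]
  have := mul_nonneg hk hx
  linarith

theorem phase_eq_sq (k : ℂ) (x : ℝ) : phase k x = Complex.exp (Complex.I * k * x) ^ 2 := by
  rw [phase, ← Complex.exp_nat_mul]
  congr 1; push_cast; ring

namespace IsShortRange

variable {v : ℝ → ℝ} {k : ℂ} {f : ℝ → ℂ}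

theorem hasDerivAt_psiPlus (hv : IsShortRange v) (hk : 0 ≤ k.im) (x : ℝ) :
    HasDerivAt (psiPlus v k) (Complex.exp (Complex.I * k * x) *
      (faddeevDeriv v k x + Complex.I * k * faddeev v k x)) x :=
  ((hasDerivAt_planeWave k x).mul (hv.hasDerivAt_faddeev hk x)).congr_deriv (by ring)

theorem deriv_psiPlus (hv : IsShortRange v) (hk : 0 ≤ k.im) (x : ℝ) :
    deriv (psiPlus v k) x = Complex.exp (Complex.I * k * x) *
      (faddeevDeriv v k x + Complex.I * k * faddeev v k x) := (hv.hasDerivAt_psiPlus hk x).deriv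

theorem solves_psiPlus (hv : IsShortRange v) (hk : 0 ≤ k.im) :
    SolvesSchrodinger v (k ^ 2) (psiPlus v k) :=
  solvesSchrodinger_of_hasDerivAt hv.continuous (hv.hasDerivAt_psiPlus hk) fun x =>
    ((hasDerivAt_planeWave k x).mul ((hv.hasDerivAt_faddeevDeriv hk x).add
      ((hv.hasDerivAt_faddeev hk x).const_mul (Complex.I * k)))).congr_deriv (by
        simp only [psiPlus, Pi.add_apply]
        linear_combination (k ^ 2 * Complex.exp (Complex.I * k * x) * faddeev v k x) *
          Complex.I_sq)

theorem isJostPlus_psiPlus (hv : IsShortRange v) (hk : 0 ≤ k.im) :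
    IsJostPlus v k (psiPlus v k) := by
  refine ⟨hv.solves_psiPlus hk, (hv.tendsto_faddeev hk).congr fun x => ?_⟩
  rw [psiPlus, ← mul_assoc, ← Complex.exp_add]
  simp

theorem exists_psiPlus_ne_zero (hv : IsShortRange v) (hk : 0 ≤ k.im) (a : ℝ) :
    ∃ x, a ≤ x ∧ psiPlus v k x ≠ 0 := by
  have h := (hv.tendsto_faddeev hk).eventually_ne one_ne_zero
  obtain ⟨x, hx, ha⟩ := (h.and (eventually_ge_atTop a)).exists
  exact ⟨x, ha, mul_ne_zero (Complex.exp_ne_zero _) hx⟩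

theorem psiPlus_ne_zero (hv : IsShortRange v) (hk : 0 ≤ k.im) : psiPlus v k ≠ 0 := fun h => by
  obtain ⟨x, -, hx⟩ := hv.exists_psiPlus_ne_zero hk 0
  exact hx (congrFun h x)

/-- A solution independent of `ψ₊` is not small compared with `e^{-ikx}` at `+∞`. -/
theorem exists_norm_wronskian_le (hv : IsShortRange v) (hk : 0 ≤ k.im)
    (hf : SolvesSchrodinger v (k ^ 2) f) : ∃ δ X : ℝ, 0 < δ ∧ ∀ x, X ≤ x →
      ‖wronskian (psiPlus v k) f 0‖ * δ ≤ 8 * (‖Complex.exp (Complex.I * k * x) * f x‖ +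
        ‖Complex.exp (Complex.I * k * (x + δ : ℝ)) * f (x + δ)‖) := by
  set C := wronskian (psiPlus v k) f 0 with hC
  have hcont : ContinuousAt (fun p : ℝ × ℂ => phase k (-p.1) / p.2 ^ 2) (0, 1) := by
    refine ContinuousAt.div ?_ (by fun_prop) (by simp)
    exact (continuous_phase.comp (by fun_prop : Continuous fun p : ℝ × ℂ => (k, -p.1))).continuousAt
  -- Here p.1 is a displacement s and p.2 stands for the Faddeev function m, which tends to 1. The
  -- quantity e^{−2iks}/m² is to stay within 1/2 of 1 for all small s and all large x.
  have hnear : ∀ᶠ p : ℝ × ℂ in 𝓝 (0, 1), ‖phase k (-p.1) / p.2 ^ 2 - 1‖ ≤ 1 / 2 ∧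
      ‖phase k (-p.1)‖ ≤ 2 ∧ 1 / 2 ≤ ‖p.2‖ := by
    refine Eventually.and ?_ (Eventually.and ?_ ?_)
    · have := (hcont.sub_const 1).norm
      refine this.eventually (eventually_le_nhds ?_)
      simp [phase_zero]
    · have : ContinuousAt (fun p : ℝ × ℂ => ‖phase k (-p.1)‖) (0, 1) :=
        (continuous_phase.comp
          (by fun_prop : Continuous fun p : ℝ × ℂ => (k, -p.1))).continuousAt.norm
      refine this.eventually (eventually_le_nhds ?_)
      simp [phase_zero]
    · have : ContinuousAt (fun p : ℝ × ℂ => ‖p.2‖) (0, 1) := by fun_prop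
      refine this.eventually (eventually_ge_nhds ?_)
      norm_num
  rw [nhds_prod_eq, eventually_prod_iff] at hnear
  obtain ⟨P, hP, Q, hQ, hPQ⟩ := hnear
  obtain ⟨δ, hδ, hPδ⟩ := Metric.eventually_nhds_iff_ball.1 hP
  obtain ⟨X, hX⟩ := eventually_atTop.1 ((hv.tendsto_faddeev hk).eventually hQ)
  have hP' : ∀ s ∈ Set.Icc (0 : ℝ) (δ / 2), P s := fun s hs => hPδ s (by
    rw [mem_ball_zero_iff, Real.norm_of_nonneg hs.1]; linarith [hs.2])
  refine ⟨δ / 2, X, by positivity, fun x hx => ?_⟩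
  set ψ := psiPlus v k
  have hm : ∀ y, X ≤ y → 1 / 2 ≤ ‖faddeev v k y‖ := fun y hy =>
    (hPQ (hP' 0 (by constructor <;> linarith)) (hX y hy)).2.2
  have hm0 : ∀ y, X ≤ y → faddeev v k y ≠ 0 := fun y hy h => by
    have := hm y hy
    rw [h, norm_zero] at this
    linarith
  have hψ0 : ∀ y, X ≤ y → ψ y ≠ 0 := fun y hy => mul_ne_zero (Complex.exp_ne_zero _) (hm0 y hy)
  have hsol := hv.solves_psiPlus hk
  -- Reduction of order. Since ψ² ≈ e^{2iky}, the function e^{2ikx} f/ψ has derivative close to the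
  -- constant C near x; over a short interval it changes by about C times the length, so f cannot be
  -- small at both ends. This works for real k as well as for Im k > 0.
  have hq : ∀ y, X ≤ y → HasDerivAt (fun y => f y / ψ y) (C / ψ y ^ 2) y := fun y hy => by
    refine ((hf.hasDerivAt y).div (hsol.hasDerivAt y) (hψ0 y hy)).congr_deriv ?_
    rw [hC, hsol.wronskian_eq hf 0 y]
    unfold wronskian
    congr 1
    ring
  have hd : ∀ s ∈ Set.Icc (0 : ℝ) (δ / 2), HasDerivAt
      (fun s : ℝ => phase k x * (f (x + s) / ψ (x + s)) - s * C)
      (phase k x * (C / ψ (x + s) ^ 2) - 1 * C) s := fun s hs => by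
    have h1 := (hq (x + s) (by linarith [hs.1])).comp_const_add x s
    exact (h1.const_mul _).sub ((Complex.ofRealCLM.hasDerivAt (x := s)).mul_const C)
  have hb : ∀ s ∈ Set.Icc (0 : ℝ) (δ / 2),
      ‖phase k x * (C / ψ (x + s) ^ 2) - 1 * C‖ ≤ ‖C‖ / 2 := fun s hs => by
    have h1 := (hPQ (hP' s hs) (hX (x + s) (by linarith [hs.1]))).1
    have h2 : phase k x * (C / ψ (x + s) ^ 2) - 1 * C =
        C * (phase k (-s) / faddeev v k (x + s) ^ 2 - 1) := by
      have h3 : ψ (x + s) ^ 2 = phase k x * phase k s * faddeev v k (x + s) ^ 2 := by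
        rw [← phase_add, phase_eq_sq, ← mul_pow]; rfl
      have h4 := phase_neg_mul k s
      have h5 : phase k x ≠ 0 := Complex.exp_ne_zero _
      have h6 : phase k s ≠ 0 := Complex.exp_ne_zero _
      have h7 := hm0 (x + s) (by linarith [hs.1])
      rw [h3]
      field_simp
      linear_combination (-C) * h4
    rw [h2, norm_mul]
    calc _ ≤ ‖C‖ * (1 / 2) := by gcongr
      _ = _ := by ring
  have hmv := norm_image_sub_le_of_norm_deriv_le_segment'
    (fun s hs => (hd s hs).hasDerivWithinAt)
    (fun s hs => hb s (Set.Ico_subset_Icc_self hs)) (δ / 2) ⟨by positivity, le_rfl⟩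
  have hend : ∀ s ∈ Set.Icc (0 : ℝ) (δ / 2), ‖phase k x * (f (x + s) / ψ (x + s))‖ ≤
      4 * ‖Complex.exp (Complex.I * k * (x + s : ℝ)) * f (x + s)‖ := fun s hs => by
    have h1 := (hPQ (hP' s hs) (hX (x + s) (by linarith [hs.1])))
    have h2 : phase k x * (f (x + s) / ψ (x + s)) = phase k (-s) / faddeev v k (x + s) *
        (Complex.exp (Complex.I * k * (x + s : ℝ)) * f (x + s)) := by
      have h3 : phase k x = phase k (-s) * Complex.exp (Complex.I * k * (x + s : ℝ)) ^ 2 := by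
        rw [← phase_eq_sq, ← phase_add]; congr 1; ring
      have h4 : ψ (x + s) = Complex.exp (Complex.I * k * (x + s : ℝ)) * faddeev v k (x + s) := rfl
      have h5 := Complex.exp_ne_zero (Complex.I * k * (x + s : ℝ))
      have h7 := hm0 (x + s) (by linarith [hs.1])
      rw [h3, h4]
      field_simp
    rw [h2, norm_mul]
    refine mul_le_mul_of_nonneg_right ?_ (norm_nonneg _)
    rw [norm_div, div_le_iff₀ (by linarith [h1.2.2])]
    linarith [h1.2.1, h1.2.2]
  -- The mean value estimate loses at most half of the main term (δ/2)‖C‖, which turns the constant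
  -- 4 of `hend` into 8.
  have e0 := hend 0 ⟨le_rfl, by positivity⟩
  have e1 := hend (δ / 2) ⟨by positivity, le_rfl⟩
  simp only [add_zero] at e0 hmv
  have h3 := norm_le_norm_add_norm_sub' (((δ / 2 : ℝ) : ℂ) * C)
    (phase k x * (f (x + δ / 2) / ψ (x + δ / 2)) - phase k x * (f x / ψ x))
  have h4 : ‖((δ / 2 : ℝ) : ℂ) * C‖ = δ / 2 * ‖C‖ := by
    rw [norm_mul, Complex.norm_real, Real.norm_of_nonneg (by positivity)]
  have h5 := norm_sub_le (phase k x * (f (x + δ / 2) / ψ (x + δ / 2))) (phase k x * (f x / ψ x))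
  rw [norm_sub_rev (((δ / 2 : ℝ) : ℂ) * C)] at h3
  have h6 : phase k x * (f (x + δ / 2) / ψ (x + δ / 2)) - ((δ / 2 : ℝ) : ℂ) * C -
      (phase k x * (f x / ψ x) - ((0 : ℝ) : ℂ) * C) =
      phase k x * (f (x + δ / 2) / ψ (x + δ / 2)) - phase k x * (f x / ψ x) -
        ((δ / 2 : ℝ) : ℂ) * C := by push_cast; ring
  rw [h6] at hmv
  linarith

theorem wronskian_eq_zero_of_tendsto (hv : IsShortRange v) (hk : 0 ≤ k.im)
    (hf : SolvesSchrodinger v (k ^ 2) f)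
    (h : Tendsto (fun x : ℝ => Complex.exp (Complex.I * k * x) * f x) atTop (𝓝 0)) :
    wronskian (psiPlus v k) f 0 = 0 := by
  obtain ⟨δ, X, hδ, hX⟩ := hv.exists_norm_wronskian_le hk hf
  have h1 : Tendsto (fun x : ℝ => Complex.exp (Complex.I * k * (x + δ : ℝ)) * f (x + δ)) atTop
      (𝓝 0) := h.comp (tendsto_atTop_add_const_right _ δ tendsto_id)
  have h2 := (h.norm.add h1.norm).const_mul 8
  rw [norm_zero, add_zero, mul_zero] at h2
  have h3 := ge_of_tendsto h2 (eventually_atTop.2 ⟨X, hX⟩)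
  have h4 : ‖wronskian (psiPlus v k) f 0‖ ≤ 0 := by
    by_contra hcon
    nlinarith [not_le.1 hcon]
  exact norm_le_zero_iff.1 h4

/-- For the difference d of two Jost solutions e^{−ikx}d → 0, hence also e^{ikx}d → 0 because Im k ≥
0. So d is a multiple of ψ₊, and the normalization forces the factor to be 0. This makes the choice
in `jostPlus` harmless, on the real axis too. -/
theorem eq_psiPlus (hv : IsShortRange v) (hk : 0 ≤ k.im) (hf : IsJostPlus v k f) :
    f = psiPlus v k := by
  have hψ := hv.isJostPlus_psiPlus hk
  have h0 : Tendsto (fun x : ℝ => Complex.exp (-(Complex.I * k * x)) * (f x - psiPlus v k x))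
      atTop (𝓝 0) := by
    simpa [mul_sub] using hf.2.sub hψ.2
  have hs := hf.1.sub hψ.1 hv.continuous
  have hW := hv.wronskian_eq_zero_of_tendsto hk hs (by
    refine squeeze_zero_norm' ?_ (tendsto_zero_iff_norm_tendsto_zero.1 h0)
    filter_upwards [eventually_ge_atTop 0] with x hx
    rw [norm_mul, norm_mul, norm_planeWave, Complex.norm_exp]
    refine mul_le_mul_of_nonneg_right (Real.exp_le_exp.2 ?_) (norm_nonneg _)
    have := mul_nonneg hk hx
    simp [Complex.mul_re, Complex.mul_im]
    linarith)
  obtain ⟨c, hc⟩ := hs.exists_eq_mul_of_wronskian_eq_zero hψ.1 hv.continuous (a := 0)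
    (by rw [wronskian_neg_swap, hW, neg_zero]) (hv.psiPlus_ne_zero hk)
  have h1 := hψ.2.const_mul c
  have h2 : c = 0 := by
    refine tendsto_nhds_unique (h1.congr fun x => ?_) h0 |>.symm ▸ (mul_one c).symm
    rw [hc x]; ring
  funext x
  have := hc x
  rw [h2, zero_mul] at this
  exact sub_eq_zero.1 this

theorem jostPlus_eq (hv : IsShortRange v) (hk : 0 ≤ k.im) : jostPlus v k = psiPlus v k :=
  hv.eq_psiPlus hk (Classical.epsilon_spec ⟨_, hv.isJostPlus_psiPlus hk⟩)

/-! Reflection of the line. -/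

theorem comp_neg (hv : IsShortRange v) : IsShortRange fun x => v (-x) :=
  ⟨hv.continuous.comp continuous_neg, by simpa using hv.integrable.comp_neg⟩

theorem _root_.isJostMinus_iff (hv : Continuous v) :
    IsJostMinus v k f ↔ IsJostPlus (fun x => v (-x)) k fun x => f (-x) := by
  refine and_congr ⟨fun h => h.comp_neg hv, fun h => ?_⟩ ?_
  · simpa using h.comp_neg (hv.comp continuous_neg)
  · have hneg : Tendsto (fun x : ℝ => -x) atTop atBot := tendsto_neg_atTop_atBot
    refine ⟨fun h => (h.comp hneg).congr fun x => by simp, fun h => ?_⟩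
    exact (h.comp tendsto_neg_atBot_atTop).congr fun x => by simp

theorem jostMinus_eq (hv : IsShortRange v) (hk : 0 ≤ k.im) :
    jostMinus v k = fun x => psiPlus (fun y => v (-y)) k (-x) := by
  have h : IsJostMinus v k fun x => psiPlus (fun y => v (-y)) k (-x) := by
    rw [isJostMinus_iff hv.continuous]
    simpa using hv.comp_neg.isJostPlus_psiPlus hk
  have h2 := (isJostMinus_iff hv.continuous).1
    (Classical.epsilon_spec (p := IsJostMinus v k) ⟨_, h⟩)
  funext x
  have := congrFun (hv.comp_neg.eq_psiPlus hk h2) (-x)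
  rw [neg_neg] at this
  exact this

theorem solves_jostPlus (hv : IsShortRange v) (hk : 0 ≤ k.im) :
    SolvesSchrodinger v (k ^ 2) (jostPlus v k) := hv.jostPlus_eq hk ▸ hv.solves_psiPlus hk

theorem isJostMinus (hv : IsShortRange v) (hk : 0 ≤ k.im) : IsJostMinus v k (jostMinus v k) := by
  rw [isJostMinus_iff hv.continuous, hv.jostMinus_eq hk]
  simpa using hv.comp_neg.isJostPlus_psiPlus hk

theorem solves_jostMinus (hv : IsShortRange v) (hk : 0 ≤ k.im) :
    SolvesSchrodinger v (k ^ 2) (jostMinus v k) := (hv.isJostMinus hk).1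

theorem jostMinus_comp_neg (hv : IsShortRange v) (hk : 0 ≤ k.im) (x : ℝ) :
    jostMinus v k x = jostPlus (fun y => v (-y)) k (-x) := by
  rw [hv.jostMinus_eq hk, hv.comp_neg.jostPlus_eq hk]

theorem jostPlus_ne_zero (hv : IsShortRange v) (hk : 0 ≤ k.im) : jostPlus v k ≠ 0 :=
  hv.jostPlus_eq hk ▸ hv.psiPlus_ne_zero hk

theorem jostMinus_ne_zero (hv : IsShortRange v) (hk : 0 ≤ k.im) : jostMinus v k ≠ 0 := fun h => by
  refine hv.comp_neg.psiPlus_ne_zero hk (funext fun x => ?_)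
  have := congrFun h (-x)
  rw [hv.jostMinus_eq hk] at this
  simpa using this

/-- Complex conjugation. -/
theorem jostPlus_conj (hv : IsShortRange v) (hk : 0 ≤ k.im) (x : ℝ) :
    jostPlus v (-(starRingEnd ℂ) k) x = (starRingEnd ℂ) (jostPlus v k x) := by
  have hk' : 0 ≤ (-(starRingEnd ℂ) k).im := by simpa using hk
  have h := hv.isJostPlus_psiPlus hk
  rw [hv.jostPlus_eq hk', hv.jostPlus_eq hk]
  refine (congrFun (hv.eq_psiPlus hk' (f := fun x => (starRingEnd ℂ) (psiPlus v k x))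
    ⟨?_, ?_⟩) x).symm
  · have := h.1.conj hv.continuous
    simpa using this
  · have := (Complex.continuous_conj.tendsto 1).comp h.2
    rw [map_one] at this
    refine this.congr fun x => ?_
    simp [← Complex.exp_conj]

theorem jostMinus_conj (hv : IsShortRange v) (hk : 0 ≤ k.im) (x : ℝ) :
    jostMinus v (-(starRingEnd ℂ) k) x = (starRingEnd ℂ) (jostMinus v k x) := by
  have hk' : 0 ≤ (-(starRingEnd ℂ) k).im := by simpa using hk
  rw [hv.jostMinus_comp_neg hk', hv.jostMinus_comp_neg hk, hv.comp_neg.jostPlus_conj hk]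

end IsShortRange


/-! ### The Wronskian of the Jost solutions and its zeros -/

noncomputable section

/-- The Wronskian `W(ψ₋(k), ψ₊(k))`. -/
def jostWronskian (v : ℝ → ℝ) (k : ℂ) : ℂ := wronskian (jostMinus v k) (jostPlus v k) 0

end

namespace IsShortRange

variable {v : ℝ → ℝ} {k : ℂ} {f : ℝ → ℂ}

theorem deriv_jostPlus (hv : IsShortRange v) (hk : 0 ≤ k.im) (x : ℝ) :
    deriv (jostPlus v k) x = Complex.exp (Complex.I * k * x) *
      (faddeevDeriv v k x + Complex.I * k * faddeev v k x) := by
  rw [hv.jostPlus_eq hk, hv.deriv_psiPlus hk]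

theorem deriv_jostMinus (hv : IsShortRange v) (hk : 0 ≤ k.im) (x : ℝ) :
    deriv (jostMinus v k) x = -deriv (jostPlus (fun y => v (-y)) k) (-x) := by
  rw [hv.jostMinus_eq hk, deriv_comp_neg, hv.comp_neg.jostPlus_eq hk]

theorem continuousOn_jostPlus (hv : IsShortRange v) (x : ℝ) :
    ContinuousOn (fun k => jostPlus v k x) {k : ℂ | 0 ≤ k.im} := by
  have h := hv.continuousOn_faddeev x
  refine ContinuousOn.congr (f := fun k => psiPlus v k x) ?_ fun k hk => by
    rw [hv.jostPlus_eq hk]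
  unfold psiPlus
  fun_prop

theorem differentiableOn_jostPlus (hv : IsShortRange v) (x : ℝ) :
    DifferentiableOn ℂ (fun k => jostPlus v k x) {k : ℂ | 0 < k.im} := by
  have h := hv.differentiableOn_faddeev x
  refine DifferentiableOn.congr (f := fun k => psiPlus v k x) ?_ fun k hk => by
    rw [hv.jostPlus_eq (le_of_lt hk)]
  unfold psiPlus
  fun_prop

theorem continuousOn_deriv_jostPlus (hv : IsShortRange v) (x : ℝ) :
    ContinuousOn (fun k => deriv (jostPlus v k) x) {k : ℂ | 0 ≤ k.im} := by
  have h := hv.continuousOn_faddeev x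
  have h' := hv.continuousOn_faddeevDeriv x
  refine ContinuousOn.congr (f := fun k => Complex.exp (Complex.I * k * x) *
      (faddeevDeriv v k x + Complex.I * k * faddeev v k x)) ?_ fun k hk => hv.deriv_jostPlus hk x
  fun_prop

theorem differentiableOn_deriv_jostPlus (hv : IsShortRange v) (x : ℝ) :
    DifferentiableOn ℂ (fun k => deriv (jostPlus v k) x) {k : ℂ | 0 < k.im} := by
  have h := hv.differentiableOn_faddeev x
  have h' := hv.differentiableOn_faddeevDeriv x
  refine DifferentiableOn.congr (f := fun k => Complex.exp (Complex.I * k * x) *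
      (faddeevDeriv v k x + Complex.I * k * faddeev v k x)) ?_
      fun k hk => hv.deriv_jostPlus (le_of_lt hk) x
  fun_prop

theorem continuousOn_jostMinus (hv : IsShortRange v) (x : ℝ) :
    ContinuousOn (fun k => jostMinus v k x) {k : ℂ | 0 ≤ k.im} :=
  (hv.comp_neg.continuousOn_jostPlus (-x)).congr fun _ hk => hv.jostMinus_comp_neg hk x

theorem differentiableOn_jostMinus (hv : IsShortRange v) (x : ℝ) :
    DifferentiableOn ℂ (fun k => jostMinus v k x) {k : ℂ | 0 < k.im} :=
  (hv.comp_neg.differentiableOn_jostPlus (-x)).congr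
    fun _ hk => hv.jostMinus_comp_neg (le_of_lt hk) x

theorem continuousOn_deriv_jostMinus (hv : IsShortRange v) (x : ℝ) :
    ContinuousOn (fun k => deriv (jostMinus v k) x) {k : ℂ | 0 ≤ k.im} :=
  (hv.comp_neg.continuousOn_deriv_jostPlus (-x)).neg.congr fun _ hk => hv.deriv_jostMinus hk x

theorem differentiableOn_deriv_jostMinus (hv : IsShortRange v) (x : ℝ) :
    DifferentiableOn ℂ (fun k => deriv (jostMinus v k) x) {k : ℂ | 0 < k.im} :=
  (hv.comp_neg.differentiableOn_deriv_jostPlus (-x)).neg.congr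
    fun _ hk => hv.deriv_jostMinus (le_of_lt hk) x

theorem continuousOn_jostWronskian (hv : IsShortRange v) :
    ContinuousOn (jostWronskian v) {k : ℂ | 0 ≤ k.im} :=
  ((hv.continuousOn_jostMinus 0).mul (hv.continuousOn_deriv_jostPlus 0)).sub
    ((hv.continuousOn_deriv_jostMinus 0).mul (hv.continuousOn_jostPlus 0))

theorem differentiableOn_jostWronskian (hv : IsShortRange v) :
    DifferentiableOn ℂ (jostWronskian v) {k : ℂ | 0 < k.im} :=
  ((hv.differentiableOn_jostMinus 0).mul (hv.differentiableOn_deriv_jostPlus 0)).sub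
    ((hv.differentiableOn_deriv_jostMinus 0).mul (hv.differentiableOn_jostPlus 0))

theorem jostWronskian_eq (hv : IsShortRange v) (hk : 0 ≤ k.im) (x : ℝ) :
    wronskian (jostMinus v k) (jostPlus v k) x = jostWronskian v k :=
  (hv.solves_jostMinus hk).wronskian_eq (hv.solves_jostPlus hk) x 0

/-- The plane waves of ψ₋ and ψ₊ cancel, leaving only quantities with good bounds for large k. -/
theorem jostWronskian_eq_faddeev (hv : IsShortRange v) (hk : 0 ≤ k.im) (x : ℝ) :
    jostWronskian v k =
      faddeev (fun y => v (-y)) k (-x) * faddeevDeriv v k x +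
      faddeevDeriv (fun y => v (-y)) k (-x) * faddeev v k x +
      2 * Complex.I * k * (faddeev (fun y => v (-y)) k (-x) * faddeev v k x) := by
  rw [← hv.jostWronskian_eq hk x, wronskian, hv.deriv_jostMinus hk, hv.deriv_jostPlus hk,
    hv.comp_neg.deriv_jostPlus hk, hv.jostMinus_eq hk, hv.jostPlus_eq hk]
  simp only [psiPlus]
  have h : Complex.exp (Complex.I * k * (-x : ℝ)) * Complex.exp (Complex.I * k * x) = 1 := by
    rw [← Complex.exp_add]; simp
  linear_combination (faddeev (fun y => v (-y)) k (-x) * faddeevDeriv v k x +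
      faddeevDeriv (fun y => v (-y)) k (-x) * faddeev v k x +
      2 * Complex.I * k * (faddeev (fun y => v (-y)) k (-x) * faddeev v k x)) * h

theorem jostMinus_eq_mul_of_jostWronskian_eq_zero (hv : IsShortRange v) (hk : 0 ≤ k.im)
    (hW : jostWronskian v k = 0) : ∃ c : ℂ, c ≠ 0 ∧ ∀ x, jostMinus v k x = c * jostPlus v k x := by
  obtain ⟨c, hc⟩ := (hv.solves_jostMinus hk).exists_eq_mul_of_wronskian_eq_zero
    (hv.solves_jostPlus hk) hv.continuous hW (hv.jostPlus_ne_zero hk)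
  refine ⟨c, fun h => hv.jostMinus_ne_zero hk (funext fun x => ?_), hc⟩
  rw [hc x, h, zero_mul]; rfl

/-! The real line. -/

/-- The Wronskian is constant in x, so its value can be read off at +∞, where the Faddeev function
tends to 1 and its derivative to 0. -/
theorem wronskian_conj_jostPlus (hv : IsShortRange v) (k x : ℝ) :
    wronskian (fun y => (starRingEnd ℂ) (jostPlus v k y)) (jostPlus v k) x =
      2 * Complex.I * k := by
  have hk : (0 : ℝ) ≤ (k : ℂ).im := by simp
  have hs := hv.solves_jostPlus hk
  have hc : SolvesSchrodinger v ((k : ℂ) ^ 2) fun y => (starRingEnd ℂ) (jostPlus v k y) := by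
    have := hs.conj hv.continuous
    simpa using this
  have hd : ∀ y, deriv (fun y => (starRingEnd ℂ) (jostPlus v k y)) y =
      (starRingEnd ℂ) (deriv (jostPlus v k) y) := fun y => (hs.hasDerivAt y).star.deriv
  have hlim : Tendsto (wronskian (fun y => (starRingEnd ℂ) (jostPlus v k y)) (jostPlus v k))
      atTop (𝓝 (2 * Complex.I * k)) := by
    have hm := hv.tendsto_faddeev hk
    have hm' := hv.tendsto_faddeevDeriv hk
    have hcm := (Complex.continuous_conj.tendsto 1).comp hm
    have hcm' := (Complex.continuous_conj.tendsto 0).comp hm'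
    rw [map_one] at hcm
    rw [map_zero] at hcm'
    have := ((hcm.mul hm').sub (hcm'.mul hm)).add ((hcm.mul hm).const_mul (2 * Complex.I * k))
    simp only [mul_zero, sub_zero, mul_one, zero_add] at this
    refine this.congr fun y => ?_
    have he : (starRingEnd ℂ) (Complex.exp (Complex.I * k * y)) *
        Complex.exp (Complex.I * k * y) = 1 := by
      rw [← Complex.exp_conj, ← Complex.exp_add]; simp
    rw [wronskian, hd, hv.deriv_jostPlus hk, hv.jostPlus_eq hk, psiPlus]
    simp only [map_mul, map_add, Complex.conj_I, Complex.conj_ofReal, Function.comp]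
    linear_combination (-(starRingEnd ℂ) (faddeev v k y) * faddeevDeriv v k y +
      (starRingEnd ℂ) (faddeevDeriv v k y) * faddeev v k y -
      2 * Complex.I * k * ((starRingEnd ℂ) (faddeev v k y) * faddeev v k y)) * he
  refine tendsto_nhds_unique (tendsto_const_nhds.congr fun y => ?_) hlim
  exact hc.wronskian_eq hs x y

theorem wronskian_conj_jostMinus (hv : IsShortRange v) (k x : ℝ) :
    wronskian (fun y => (starRingEnd ℂ) (jostMinus v k y)) (jostMinus v k) x =
      -(2 * Complex.I * k) := by
  have hk : (0 : ℝ) ≤ (k : ℂ).im := by simp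
  have h := hv.comp_neg.wronskian_conj_jostPlus k (-x)
  rw [← h, ← wronskian_comp_neg]
  congr 1 <;> funext y <;> rw [hv.jostMinus_comp_neg hk]

/-- If ψ₋ = cψ₊, comparing the two conjugate Wronskians gives −2ik = |c|²·2ik, which is impossible
for k ≠ 0. -/
theorem jostWronskian_ne_zero_of_real (hv : IsShortRange v) {k : ℝ} (hk0 : k ≠ 0) :
    jostWronskian v k ≠ 0 := fun hW => by
  have hk : (0 : ℝ) ≤ (k : ℂ).im := by simp
  obtain ⟨c, -, hc⟩ := hv.jostMinus_eq_mul_of_jostWronskian_eq_zero hk hW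
  have h1 := hv.wronskian_conj_jostMinus k 0
  have h2 := hv.wronskian_conj_jostPlus k 0
  rw [show jostMinus v k = fun x => c * jostPlus v k x from funext hc] at h1
  simp only [map_mul] at h1
  rw [wronskian_mul_left, wronskian_neg_swap, wronskian_mul_left, wronskian_neg_swap, h2] at h1
  have h3 : ((‖c‖ ^ 2 + 1 : ℝ) : ℂ) * (2 * Complex.I * k) = 0 := by
    push_cast
    rw [← Complex.conj_mul']
    linear_combination h1
  have h4 : ((‖c‖ ^ 2 + 1 : ℝ) : ℂ) ≠ 0 := by
    exact_mod_cast (by positivity : ‖c‖ ^ 2 + 1 ≠ 0)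
  exact mul_ne_zero h4 (by simp [hk0]) h3

/-! The upper half-plane. -/

theorem norm_jostPlus_le (hv : IsShortRange v) (hk : 0 ≤ k.im) {a x : ℝ} (hx : a ≤ x) :
    ‖jostPlus v k x‖ ≤ 2 * jostWeight v a * Real.exp (-(k.im * x)) := by
  rw [hv.jostPlus_eq hk, psiPlus, norm_mul, norm_planeWave, mul_comm]
  have h := (hv.norm_faddeev_le hk x).trans
    (mul_le_mul_of_nonneg_left (hv.jostWeight_anti hx) zero_le_two)
  gcongr

theorem continuous_jostPlus (hv : IsShortRange v) (hk : 0 ≤ k.im) : Continuous (jostPlus v k) :=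
  (hv.solves_jostPlus hk).continuous

theorem integrableOn_sq_norm_jostPlus (hv : IsShortRange v) (hk : 0 < k.im) (a : ℝ) :
    IntegrableOn (fun x => ‖jostPlus v k x‖ ^ 2) (Set.Ioi a) := by
  have hc := hv.continuous_jostPlus hk.le
  refine Integrable.mono' ((exp_neg_integrableOn_Ioi a (by positivity : 0 < 2 * k.im)).const_mul
    ((2 * jostWeight v a) ^ 2)) (Continuous.aestronglyMeasurable (by fun_prop)) ?_
  refine (ae_restrict_iff' measurableSet_Ioi).2 (Eventually.of_forall fun x hx => ?_)
  have h := hv.norm_jostPlus_le hk.le (le_of_lt hx)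
  rw [norm_pow, norm_norm]
  calc ‖jostPlus v k x‖ ^ 2 ≤ (2 * jostWeight v a * Real.exp (-(k.im * x))) ^ 2 := by gcongr
    _ = _ := by
      rw [mul_pow, ← Real.exp_nat_mul]; congr 2; push_cast; ring

theorem tendsto_planeWave (hk : 0 < k.im) :
    Tendsto (fun x : ℝ => Complex.exp (Complex.I * k * x)) atTop (𝓝 0) := by
  rw [tendsto_zero_iff_norm_tendsto_zero]
  simp_rw [norm_planeWave]
  exact Real.tendsto_exp_neg_atTop_nhds_zero.comp (tendsto_id.const_mul_atTop hk)

theorem tendsto_jostPlus (hv : IsShortRange v) (hk : 0 < k.im) :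
    Tendsto (jostPlus v k) atTop (𝓝 0) := by
  rw [hv.jostPlus_eq hk.le]
  have := (tendsto_planeWave hk).mul (hv.tendsto_faddeev hk.le)
  rwa [zero_mul] at this

theorem tendsto_deriv_jostPlus (hv : IsShortRange v) (hk : 0 < k.im) :
    Tendsto (deriv (jostPlus v k)) atTop (𝓝 0) := by
  have := (tendsto_planeWave hk).mul ((hv.tendsto_faddeevDeriv hk.le).add
    ((hv.tendsto_faddeev hk.le).const_mul (Complex.I * k)))
  rw [zero_mul] at this
  exact this.congr fun x => (hv.deriv_jostPlus hk.le x).symm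

theorem tendsto_jostMinus (hv : IsShortRange v) (hk : 0 < k.im) :
    Tendsto (jostMinus v k) atBot (𝓝 0) :=
  ((hv.comp_neg.tendsto_jostPlus hk).comp tendsto_neg_atBot_atTop).congr
    fun x => (hv.jostMinus_comp_neg hk.le x).symm

theorem tendsto_deriv_jostMinus (hv : IsShortRange v) (hk : 0 < k.im) :
    Tendsto (deriv (jostMinus v k)) atBot (𝓝 0) := by
  have := ((hv.comp_neg.tendsto_deriv_jostPlus hk).comp tendsto_neg_atBot_atTop).neg
  rw [neg_zero] at this
  exact this.congr fun x => (hv.deriv_jostMinus hk.le x).symm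

/-- ψ₊ decays exponentially to the right by construction, and to the left because it is a multiple
of ψ₋. -/
theorem integrable_sq_norm_of_jostWronskian_eq_zero (hv : IsShortRange v) (hk : 0 < k.im)
    (hW : jostWronskian v k = 0) : Integrable fun x => ‖jostPlus v k x‖ ^ 2 := by
  obtain ⟨c, hc0, hc⟩ := hv.jostMinus_eq_mul_of_jostWronskian_eq_zero hk.le hW
  have h1 := hv.integrableOn_sq_norm_jostPlus hk 0
  have h2 := hv.comp_neg.integrableOn_sq_norm_jostPlus hk 0
  have h3 : IntegrableOn (fun x => ‖jostPlus v k x‖ ^ 2) (Set.Iio 0) := by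
    have h4 : IntegrableOn (fun x => ‖jostMinus v k x‖ ^ 2) (Set.Iio 0) := by
      have h5 := h2.comp_neg
      rw [Set.neg_Ioi, neg_zero] at h5
      refine h5.congr_fun (fun x _ => ?_) measurableSet_Iio
      simp only
      rw [hv.jostMinus_comp_neg hk.le]
    refine (h4.const_mul (‖c‖ ^ 2)⁻¹).congr (Eventually.of_forall fun x => ?_)
    have : ‖c‖ ≠ 0 := norm_ne_zero_iff.2 hc0
    simp only
    rw [hc, norm_mul, mul_pow]
    field_simp
  rw [← integrableOn_univ, ← Set.Iic_union_Ioi (a := (0 : ℝ))]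
  exact ((integrableOn_Iic_iff_integrableOn_Iio (by finiteness)).2 h3).union h1

/-- Self-adjointness by hand: W(f, f̄) has derivative 4i Re k Im k |f|² and vanishes at both ends.
If Re k ≠ 0, its suitably scaled imaginary part is monotone with limits 0, hence zero, and f would
vanish. -/
theorem re_eq_zero_of_jostWronskian_eq_zero (hv : IsShortRange v) (hk : 0 < k.im)
    (hW : jostWronskian v k = 0) : k.re = 0 := by
  by_contra hre
  obtain ⟨c, hc0, hc⟩ := hv.jostMinus_eq_mul_of_jostWronskian_eq_zero hk.le hW
  set f := jostPlus v k with hf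
  have hs : SolvesSchrodinger v (k ^ 2) f := hv.solves_jostPlus hk.le
  have hcs := hs.conj hv.continuous
  have hd : ∀ y, deriv (fun y => (starRingEnd ℂ) (f y)) y = (starRingEnd ℂ) (deriv f y) :=
    fun y => (hs.hasDerivAt y).star.deriv
  set w : ℝ → ℂ := wronskian f fun y => (starRingEnd ℂ) (f y)
  have hw : ∀ x, HasDerivAt w (((4 * k.re * k.im * ‖f x‖ ^ 2 : ℝ) : ℂ) * Complex.I) x := fun x => by
    refine (hs.hasDerivAt_wronskian hcs x).congr_deriv ?_
    rw [Complex.mul_conj']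
    have h1 : k ^ 2 - (starRingEnd ℂ) (k ^ 2) = ((4 * k.re * k.im : ℝ) : ℂ) * Complex.I := by
      apply Complex.ext
      · simp [pow_two]
      · simp [pow_two]; ring
    rw [h1]
    push_cast
    ring
  have hwi : ∀ x, HasDerivAt (fun x => (w x).im / (4 * k.re * k.im)) (‖f x‖ ^ 2) x := fun x => by
    have h1 := ((Complex.imCLM.hasFDerivAt.comp_hasDerivAt x (hw x)).div_const
      (4 * k.re * k.im))
    refine h1.congr_deriv ?_
    have := hk.ne'
    rw [Complex.imCLM_apply, Complex.im_ofReal_mul, Complex.I_im]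
    field_simp
  have hmono : Monotone fun x => (w x).im / (4 * k.re * k.im) :=
    monotone_of_hasDerivAt_nonneg hwi fun x => by positivity
  have hlim : ∀ l : Filter ℝ, Tendsto f l (𝓝 0) → Tendsto (deriv f) l (𝓝 0) →
      Tendsto (fun x => (w x).im / (4 * k.re * k.im)) l (𝓝 0) := fun l h0 h1 => by
    have hc0 := (Complex.continuous_conj.tendsto 0).comp h0
    have hc1 := (Complex.continuous_conj.tendsto 0).comp h1
    have h2 := (h0.mul hc1).sub (h1.mul hc0)
    simp only [map_zero, mul_zero, sub_zero] at h2
    have h3 : Tendsto w l (𝓝 0) := h2.congr fun x => by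
      simp only [w, wronskian, hd]; rfl
    have h4 := ((Complex.continuous_im.tendsto 0).comp h3).div_const (4 * k.re * k.im)
    simpa using h4
  have hfm : f = fun x => c⁻¹ * jostMinus v k x := funext fun x => by
    rw [hc x]; field_simp
  have hbot := hlim atBot (by
    have := (hv.tendsto_jostMinus hk).const_mul c⁻¹
    rw [mul_zero] at this
    rwa [hfm]) (by
    have := (hv.tendsto_deriv_jostMinus hk).const_mul c⁻¹
    rw [mul_zero] at this
    refine this.congr fun x => ?_
    rw [hfm, deriv_const_mul_field])
  have htop := hlim atTop (hv.tendsto_jostPlus hk) (hv.tendsto_deriv_jostPlus hk)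
  have hz : (fun x => (w x).im / (4 * k.re * k.im)) = fun _ => 0 := funext fun x =>
    le_antisymm (hmono.ge_of_tendsto htop x) (hmono.le_of_tendsto hbot x)
  obtain ⟨x, -, hx⟩ := hv.exists_psiPlus_ne_zero hk.le 0
  have h := hwi x
  rw [hz] at h
  have h5 := h.unique (hasDerivAt_const x 0)
  rw [hf, hv.jostPlus_eq hk.le] at h5
  exact hx (norm_eq_zero.1 (by simpa using h5))

theorem isBoundStateEnergy_of_jostWronskian_eq_zero (hv : IsShortRange v) (hk : 0 < k.im)
    (hW : jostWronskian v k = 0) : k = Complex.I * k.im ∧ IsBoundStateEnergy v (-k.im ^ 2) := by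
  have hre := hv.re_eq_zero_of_jostWronskian_eq_zero hk hW
  have hkI : k = Complex.I * k.im := by apply Complex.ext <;> simp [hre]
  refine ⟨hkI, jostPlus v k, hv.jostPlus_ne_zero hk.le, ?_, ?_⟩
  · exact (memLp_two_iff_integrable_sq_norm
      (hv.continuous_jostPlus hk.le).aestronglyMeasurable).2
      (hv.integrable_sq_norm_of_jostWronskian_eq_zero hk hW)
  · convert hv.solves_jostPlus hk.le using 1
    rw [hkI]
    push_cast
    simp [mul_pow]

/-- A square integrable solution is dependent on ψ₊: otherwise `exists_norm_wronskian_le` bounds a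
positive constant by an integrable function on a half-line of infinite measure. -/
theorem wronskian_eq_zero_of_memLp (hv : IsShortRange v) (hk : 0 ≤ k.im)
    (hs : SolvesSchrodinger v (k ^ 2) f) (hf : MemLp f 2 volume) :
    wronskian (jostPlus v k) f 0 = 0 := by
  rw [hv.jostPlus_eq hk]
  obtain ⟨δ, X, hδ, hX⟩ := hv.exists_norm_wronskian_le hk hs
  set C := wronskian (psiPlus v k) f 0
  by_contra hC
  have hsq := (memLp_two_iff_integrable_sq_norm hs.continuous.aestronglyMeasurable).1 hf
  -- 128 = 8²·2, from (a + b)² ≤ 2(a² + b²).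
  have hsum := ((hsq.add (hsq.comp_add_right δ)).const_mul 128).integrableOn
    (s := Set.Ioi (max X 0))
  have hconst : IntegrableOn (fun _ : ℝ => (‖C‖ * δ) ^ 2) (Set.Ioi (max X 0)) := by
    refine hsum.mono' aestronglyMeasurable_const ?_
    refine (ae_restrict_iff' measurableSet_Ioi).2 (Eventually.of_forall fun x hx => ?_)
    have hx1 : X ≤ x := (le_max_left _ _).trans (le_of_lt hx)
    have hx0 : 0 ≤ x := (le_max_right _ _).trans (le_of_lt hx)
    have h := hX x hx1
    rw [norm_mul, norm_mul] at h
    have h1 := norm_planeWave_le hk hx0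
    have h2 := norm_planeWave_le hk (by linarith : 0 ≤ x + δ)
    have h3 := mul_le_of_le_one_left (norm_nonneg (f x)) h1
    have h4 := mul_le_of_le_one_left (norm_nonneg (f (x + δ))) h2
    have h5 : ‖C‖ * δ ≤ 8 * (‖f x‖ + ‖f (x + δ)‖) := by linarith
    rw [Real.norm_of_nonneg (by positivity)]
    calc (‖C‖ * δ) ^ 2 ≤ (8 * (‖f x‖ + ‖f (x + δ)‖)) ^ 2 := by gcongr
      _ ≤ 128 * (‖f x‖ ^ 2 + ‖f (x + δ)‖ ^ 2) := by nlinarith [sq_nonneg (‖f x‖ - ‖f (x + δ)‖)]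
  rw [integrableOn_const_iff] at hconst
  have : 0 < ‖C‖ := norm_pos_iff.2 hC
  have h7 : (‖C‖ * δ) ^ 2 ≠ 0 := by positivity
  simp [hC, hδ.ne'] at hconst

/-- The eigenfunction is dependent on ψ₊ by its behaviour at +∞ and, after reflecting the line, on
ψ₋ by its behaviour at −∞. -/
theorem jostWronskian_eq_zero_of_isBoundStateEnergy (hv : IsShortRange v) {κ : ℝ} (hκ : 0 < κ)
    (h : IsBoundStateEnergy v (-κ ^ 2)) : jostWronskian v (Complex.I * κ) = 0 := by
  obtain ⟨f, hf0, hf, hs⟩ := h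
  have hk : 0 ≤ (Complex.I * (κ : ℂ)).im := by simpa using hκ.le
  have hE : ((-κ ^ 2 : ℝ) : ℂ) = (Complex.I * κ) ^ 2 := by
    push_cast; simp [mul_pow]
  rw [hE] at hs
  have h1 := hv.wronskian_eq_zero_of_memLp hk hs hf
  have h2 := hv.comp_neg.wronskian_eq_zero_of_memLp hk (hs.comp_neg hv.continuous)
    (hf.comp_measurePreserving (Measure.measurePreserving_neg volume))
  have h3 : wronskian (jostMinus v (Complex.I * κ)) f 0 = 0 := by
    have h4 := wronskian_comp_neg (jostMinus v (Complex.I * κ)) f 0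
    rw [neg_zero, show (fun y => jostMinus v (Complex.I * κ) (-y)) =
      jostPlus (fun y => v (-y)) (Complex.I * κ) from funext fun y => by
        rw [hv.jostMinus_comp_neg hk, neg_neg], h2] at h4
    exact neg_eq_zero.1 h4.symm
  obtain ⟨c, hc⟩ := (hv.solves_jostMinus hk).exists_eq_mul_of_wronskian_eq_zero hs hv.continuous
    h3 hf0
  rw [jostWronskian, show jostMinus v (Complex.I * κ) = fun x => c * f x from funext hc,
    wronskian_mul_left, wronskian_neg_swap, h1, neg_zero, mul_zero]

end IsShortRange


namespace IsShortRange

variable {v : ℝ → ℝ} {k : ℂ}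

/-! ### Large spectral parameters -/

/-- The bound ‖k‖‖D_k‖ ≤ 1 removes the kernel from the Volterra integral; the remaining integrable
majorant depends neither on k nor on x. -/
theorem integral_mul_faddeev_sub_one (hv : IsShortRange v) :
    ∃ C : ℝ, ∀ k : ℂ, 0 ≤ k.im → ∀ x, ‖k‖ * ‖faddeev v k x - 1‖ ≤ C := by
  refine ⟨∫ y, 2 * ((1 + |y|) * |v y| * Real.exp (2 * tailMoment v y)), fun k hk x => ?_⟩
  rw [hv.faddeev_eq hk, add_sub_cancel_left, ← norm_mul, volterraOp, ← integral_const_mul]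
  refine (norm_integral_le_of_norm_le ((hv.integrable_weight.const_mul 2).integrableOn)
    ((ae_restrict_iff' measurableSet_Ioi).2 (Eventually.of_forall fun y hy => ?_))).trans
    (setIntegral_le_integral (hv.integrable_weight.const_mul 2)
      (Eventually.of_forall fun y => by positivity))
  rw [norm_mul, norm_mul, ← mul_assoc]
  exact (mul_le_of_le_one_left (norm_nonneg _)
    (norm_mul_volterraKernel_le hk (sub_nonneg.2 (le_of_lt hy)))).trans
    (norm_mul_le (hv.norm_faddeev_le hk) y)

/-- W − 2ik is bounded on the closed half-plane. This keeps W away from zero for large k and is the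
growth bound needed for the Phragmén–Lindelöf principle. -/
theorem norm_jostWronskian_sub_le (hv : IsShortRange v) :
    ∃ C : ℝ, ∀ k : ℂ, 0 ≤ k.im → ‖jostWronskian v k - 2 * Complex.I * k‖ ≤ C := by
  obtain ⟨C₁, h₁⟩ := hv.integral_mul_faddeev_sub_one
  obtain ⟨C₂, h₂⟩ := hv.comp_neg.integral_mul_faddeev_sub_one
  refine ⟨2 * jostWeight (fun y => v (-y)) 0 * (2 * ∫ y in Set.Ioi 0, (1 + |y|) * |v y| *
      Real.exp (2 * tailMoment v y)) + (2 * ∫ y in Set.Ioi 0, (1 + |y|) * |v (-y)| *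
      Real.exp (2 * tailMoment (fun y => v (-y)) y)) * (2 * jostWeight v 0) +
      2 * (C₂ * (2 * jostWeight v 0) + C₁), fun k hk => ?_⟩
  rw [hv.jostWronskian_eq_faddeev hk 0, neg_zero]
  set n := faddeev (fun y => v (-y)) k 0
  set m := faddeev v k 0
  set n' := faddeevDeriv (fun y => v (-y)) k 0
  set m' := faddeevDeriv v k 0
  have e : n * m' + n' * m + 2 * Complex.I * k * (n * m) - 2 * Complex.I * k =
      n * m' + n' * m + 2 * Complex.I * (k * (n - 1) * m + k * (m - 1)) := by ring
  have hn := hv.comp_neg.norm_faddeev_le hk 0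
  have hm := hv.norm_faddeev_le hk 0
  have hn' := hv.comp_neg.norm_faddeevDeriv_le hk 0
  have hm' := hv.norm_faddeevDeriv_le hk 0
  have hC₁ := h₁ k hk 0
  have hC₂ := h₂ k hk 0
  have p1 := jostWeight_pos (fun y => v (-y)) 0
  have p2 := jostWeight_pos v 0
  have hC₂0 : 0 ≤ C₂ := le_trans (by positivity) hC₂
  rw [e]
  refine (norm_add_le _ _).trans (add_le_add ((norm_add_le _ _).trans (add_le_add ?_ ?_)) ?_)
  · rw [norm_mul]; gcongr
  · rw [norm_mul]; gcongr
  · rw [norm_mul, norm_mul, Complex.norm_I, mul_one, Complex.norm_two]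
    gcongr
    refine (norm_add_le _ _).trans ?_
    rw [norm_mul, norm_mul, norm_mul]
    gcongr

theorem integrable_self (hv : IsShortRange v) : Integrable v := by
  refine hv.integrable.mono' hv.continuous.aestronglyMeasurable (Eventually.of_forall fun x => ?_)
  rw [Real.norm_eq_abs]
  exact le_mul_of_one_le_left (abs_nonneg _) (by linarith [abs_nonneg x])

theorem integrable_ofReal (hv : IsShortRange v) : Integrable fun y => (v y : ℂ) :=
  hv.integrable_self.ofReal

theorem mul_integral_phase {v' : ℝ → ℝ} (hv : IsShortRange v) (hd : ∀ x, HasDerivAt v (v' x) x)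
    (hi : Integrable v') (hk : 0 ≤ k.im) (x : ℝ) :
    2 * Complex.I * k * ∫ y in Set.Ioi x, phase k (y - x) * (v y : ℂ) =
      -(v x : ℂ) - ∫ y in Set.Ioi x, phase k (y - x) * (v' y : ℂ) := by
  have hb : ∀ f : ℝ → ℂ, Integrable f →
      IntegrableOn (fun y => phase k (y - x) * f y) (Set.Ioi x) := fun f hf => by
    refine hf.integrableOn.bdd_mul (c := 1) ?_ ?_
    · exact (continuous_phase.comp
        (by fun_prop : Continuous fun y : ℝ => (k, y - x))).aestronglyMeasurable
    · exact (ae_restrict_iff' measurableSet_Ioi).2 (Eventually.of_forall fun y hy =>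
        norm_phase_le hk (sub_nonneg.2 (le_of_lt hy)))
  have h1 := hb (fun y => (v y : ℂ)) hv.integrable_ofReal
  have h2 := hb (fun y => (v' y : ℂ)) hi.ofReal
  have hder : ∀ y, HasDerivAt (fun y => phase k (y - x) * (v y : ℂ))
      (2 * Complex.I * k * (phase k (y - x) * (v y : ℂ)) + phase k (y - x) * (v' y : ℂ)) y :=
    fun y => (((hasDerivAt_phase k (y - x)).comp_sub_const y x).mul
      (hd y).ofReal_comp).congr_deriv (by ring)
  have hint := (h1.const_mul (2 * Complex.I * k)).add h2
  have hlim := tendsto_zero_of_hasDerivAt_of_integrableOn_Ioi (fun y _ => hder y) hint h1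
  have h3 := integral_Ioi_of_hasDerivAt_of_tendsto' (fun y (_ : y ∈ Set.Ici x) => hder y)
    hint hlim
  rw [integral_add (h1.const_mul (2 * Complex.I * k)) h2, integral_const_mul] at h3
  simp only [sub_self, phase_zero, one_mul, zero_sub] at h3
  linear_combination h3

theorem norm_integral_mul_le (hv : IsShortRange v) {g : ℝ → ℂ} {C : ℝ} {x : ℝ}
    (hg : ∀ y, x < y → ‖g y‖ ≤ C) :
    ‖∫ y in Set.Ioi x, g y * (v y : ℂ)‖ ≤ C * ∫ y, |v y| := by
  have hC : 0 ≤ C := (norm_nonneg _).trans (hg (x + 1) (by linarith))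
  rw [← integral_const_mul]
  refine (norm_integral_le_of_norm_le ((hv.integrable_self.abs.const_mul C).integrableOn)
    ((ae_restrict_iff' measurableSet_Ioi).2 (Eventually.of_forall fun y hy => ?_))).trans
    (setIntegral_le_integral (hv.integrable_self.abs.const_mul C)
      (Eventually.of_forall fun y => by positivity))
  rw [norm_mul, Complex.norm_real, Real.norm_eq_abs]
  gcongr
  exact hg y hy

theorem integrableOn_phase_mul_faddeev (hv : IsShortRange v) (hk : 0 ≤ k.im) (x : ℝ) :
    IntegrableOn (fun y => phase k (y - x) * (v y * faddeev v k y)) (Set.Ioi x) :=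
  (hv.hasRightMoment_mul (hv.continuous_faddeev hk).aestronglyMeasurable
    (hv.norm_faddeev_le hk)).integrableOn_phase hk x x

theorem norm_mul_faddeevDeriv_le {v' : ℝ → ℝ} (hv : IsShortRange v)
    (hd : ∀ x, HasDerivAt v (v' x) x) (hi : Integrable v') (x : ℝ) :
    ∃ C : ℝ, ∀ k : ℂ, 0 ≤ k.im → ‖k‖ * ‖faddeevDeriv v k x‖ ≤ C := by
  obtain ⟨C₁, h₁⟩ := hv.integral_mul_faddeev_sub_one
  refine ⟨|v x| + (∫ y, |v' y|) + C₁ * ∫ y, |v y|, fun k hk => ?_⟩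
  have hi1 : IntegrableOn (fun y => phase k (y - x) * (v y : ℂ)) (Set.Ioi x) := by
    refine hv.integrable_ofReal.integrableOn.bdd_mul (c := 1) ?_ ?_
    · exact (continuous_phase.comp
        (by fun_prop : Continuous fun y : ℝ => (k, y - x))).aestronglyMeasurable
    · exact (ae_restrict_iff' measurableSet_Ioi).2 (Eventually.of_forall fun y hy =>
        norm_phase_le hk (sub_nonneg.2 (le_of_lt hy)))
  -- Split the Faddeev function as 1 + (m − 1): integration by parts gains a factor 1/k in the first
  -- term, and m − 1 is itself O(1/k) uniformly.
  have e : k * faddeevDeriv v k x = -(k * ∫ y in Set.Ioi x, phase k (y - x) * (v y : ℂ)) -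
      ∫ y in Set.Ioi x, (k * phase k (y - x) * (faddeev v k y - 1)) * (v y : ℂ) := by
    have h2 := (hv.integrableOn_phase_mul_faddeev hk x).sub hi1
    have : ∫ y in Set.Ioi x, (k * phase k (y - x) * (faddeev v k y - 1)) * (v y : ℂ) =
        k * ((∫ y in Set.Ioi x, phase k (y - x) * (v y * faddeev v k y)) -
          ∫ y in Set.Ioi x, phase k (y - x) * (v y : ℂ)) := by
      rw [← integral_sub (hv.integrableOn_phase_mul_faddeev hk x) hi1, ← integral_const_mul]
      congr 1; ext y; ring
    rw [this, faddeevDeriv, phaseOp]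
    ring
  have hA : ‖k * ∫ y in Set.Ioi x, phase k (y - x) * (v y : ℂ)‖ ≤ |v x| + ∫ y, |v' y| := by
    have h3 := congrArg norm (hv.mul_integral_phase hd hi hk x)
    rw [norm_mul, norm_mul, norm_mul, Complex.norm_two, Complex.norm_I] at h3
    have h4 : ‖∫ y in Set.Ioi x, phase k (y - x) * (v' y : ℂ)‖ ≤ ∫ y, |v' y| := by
      refine (norm_integral_le_of_norm_le (hi.abs.integrableOn)
        ((ae_restrict_iff' measurableSet_Ioi).2 (Eventually.of_forall fun y hy => ?_))).trans
        (setIntegral_le_integral hi.abs (Eventually.of_forall fun y => abs_nonneg _))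
      rw [norm_mul, Complex.norm_real, Real.norm_eq_abs]
      exact mul_le_of_le_one_left (abs_nonneg _) (norm_phase_le hk (sub_nonneg.2 (le_of_lt hy)))
    have h5 := norm_sub_le (-(v x : ℂ)) (∫ y in Set.Ioi x, phase k (y - x) * (v' y : ℂ))
    rw [norm_neg, Complex.norm_real, Real.norm_eq_abs, ← h3] at h5
    rw [norm_mul]
    have h6 : 0 ≤ ‖k‖ * ‖∫ y in Set.Ioi x, phase k (y - x) * (v y : ℂ)‖ := by positivity
    linarith
  have hB := hv.norm_integral_mul_le (x := x) (C := C₁)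
    (g := fun y => k * phase k (y - x) * (faddeev v k y - 1)) fun y hy => by
      rw [norm_mul, norm_mul]
      refine le_trans ?_ (h₁ k hk y)
      have := norm_phase_le hk (sub_nonneg.2 (le_of_lt hy))
      gcongr
      exact mul_le_of_le_one_right (norm_nonneg _) this
  rw [← norm_mul, e]
  refine (norm_sub_le _ _).trans (add_le_add ?_ hB)
  rwa [norm_neg]

theorem two_mul_faddeev_sub_one (hv : IsShortRange v) (hk : 0 ≤ k.im) (x : ℝ) :
    2 * Complex.I * k * (faddeev v k x - 1) =
      -faddeevDeriv v k x - ∫ y in Set.Ioi x, (v y : ℂ) * faddeev v k y := by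
  have hm := hv.hasRightMoment_mul (hv.continuous_faddeev hk).aestronglyMeasurable
    (hv.norm_faddeev_le hk)
  rw [hv.faddeev_eq hk, add_sub_cancel_left, faddeevDeriv, neg_neg, volterraOp, phaseOp,
    ← integral_const_mul, ← integral_sub (hm.integrableOn_phase hk x x) (hm.integrableOn x)]
  congr 1; ext y
  rw [← mul_assoc, mul_volterraKernel]
  ring

/-- In `two_mul_faddeev_sub_one` the derivative term is O(1/k), and replacing m by 1 in the
remaining integral costs another O(1/k). -/
theorem norm_faddeev_expansion {v' : ℝ → ℝ} (hv : IsShortRange v)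
    (hd : ∀ x, HasDerivAt v (v' x) x) (hi : Integrable v') (x : ℝ) :
    ∃ C : ℝ, ∀ k : ℂ, 0 ≤ k.im → ‖k‖ * ‖2 * Complex.I * k * (faddeev v k x - 1) +
      (∫ y in Set.Ioi x, v y : ℝ)‖ ≤ C := by
  obtain ⟨C₁, h₁⟩ := hv.integral_mul_faddeev_sub_one
  obtain ⟨C₂, h₂⟩ := hv.norm_mul_faddeevDeriv_le hd hi x
  refine ⟨C₂ + C₁ * ∫ y, |v y|, fun k hk => ?_⟩
  have hm := hv.hasRightMoment_mul (hv.continuous_faddeev hk).aestronglyMeasurable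
    (hv.norm_faddeev_le hk)
  have e : k * (2 * Complex.I * k * (faddeev v k x - 1) + (∫ y in Set.Ioi x, v y : ℝ)) =
      -(k * faddeevDeriv v k x) -
        ∫ y in Set.Ioi x, (k * (faddeev v k y - 1)) * (v y : ℂ) := by
    have : ∫ y in Set.Ioi x, (k * (faddeev v k y - 1)) * (v y : ℂ) =
        k * ((∫ y in Set.Ioi x, (v y : ℂ) * faddeev v k y) - ∫ y in Set.Ioi x, (v y : ℂ)) := by
      rw [← integral_sub (hm.integrableOn x) hv.integrable_ofReal.integrableOn,
        ← integral_const_mul]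
      congr 1; ext y; ring
    rw [hv.two_mul_faddeev_sub_one hk, this, ← integral_complex_ofReal]
    ring
  rw [← norm_mul, e]
  refine (norm_sub_le _ _).trans (add_le_add ?_ ?_)
  · rw [norm_neg, norm_mul]; exact h₂ k hk
  · refine hv.norm_integral_mul_le fun y _ => ?_
    rw [norm_mul]; exact h₁ k hk y

/-! ### The derivative of the Wronskian at a bound state -/

theorem integrableOn_norm_jostPlus (hv : IsShortRange v) (hk : 0 < k.im) (a : ℝ) :
    IntegrableOn (fun x => ‖jostPlus v k x‖) (Set.Ioi a) := by
  have hc := hv.continuous_jostPlus hk.le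
  refine Integrable.mono' ((exp_neg_integrableOn_Ioi a hk).const_mul
    (2 * jostWeight v a)) (Continuous.aestronglyMeasurable (by fun_prop)) ?_
  refine (ae_restrict_iff' measurableSet_Ioi).2 (Eventually.of_forall fun x hx => ?_)
  have h := hv.norm_jostPlus_le hk.le (le_of_lt hx)
  rw [norm_norm]
  simpa using h

theorem wronskian_jostPlus_jostPlus (hv : IsShortRange v) {k₀ : ℂ} (hk₀ : 0 < k₀.im)
    (hk : 0 < k.im) (a : ℝ) : wronskian (jostPlus v k₀) (jostPlus v k) a =
      (k ^ 2 - k₀ ^ 2) * ∫ x in Set.Ioi a, jostPlus v k₀ x * jostPlus v k x := by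
  have hc := hv.continuous_jostPlus hk.le
  have hc₀ := hv.continuous_jostPlus hk₀.le
  have hint : IntegrableOn (fun x => jostPlus v k₀ x * jostPlus v k x) (Set.Ioi a) := by
    refine Integrable.mono' ((hv.integrableOn_sq_norm_jostPlus hk₀ a).add
      (hv.integrableOn_sq_norm_jostPlus hk a)) (Continuous.aestronglyMeasurable (by fun_prop))
      (Eventually.of_forall fun x => ?_)
    rw [norm_mul]
    simp only [Pi.add_apply]
    nlinarith [sq_nonneg (‖jostPlus v k₀ x‖ - ‖jostPlus v k x‖), sq_nonneg (‖jostPlus v k₀ x‖),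
      sq_nonneg (‖jostPlus v k x‖)]
  have hlim : Tendsto (wronskian (jostPlus v k₀) (jostPlus v k)) atTop (𝓝 0) := by
    have := ((hv.tendsto_jostPlus hk₀).mul (hv.tendsto_deriv_jostPlus hk)).sub
      ((hv.tendsto_deriv_jostPlus hk₀).mul (hv.tendsto_jostPlus hk))
    rw [mul_zero, sub_zero] at this
    exact this
  have h := integral_Ioi_of_hasDerivAt_of_tendsto' (fun x (_ : x ∈ Set.Ici a) =>
    (hv.solves_jostPlus hk₀.le).hasDerivAt_wronskian (hv.solves_jostPlus hk.le) x)
    (hint.const_mul _) hlim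
  rw [integral_const_mul] at h
  linear_combination h

/-- A substitute for differentiating ψ₊ in k: the Wronskian of solutions at two energies is k² − k₀²
times an integral, and division by k − k₀ leaves k + k₀ → 2k₀ with dominated convergence in the
integral. -/
theorem tendsto_wronskian_jostPlus_div (hv : IsShortRange v) {k₀ : ℂ} (hk₀ : 0 < k₀.im) (a : ℝ) :
    Tendsto (fun k => wronskian (jostPlus v k₀) (jostPlus v k) a / (k - k₀)) (𝓝[≠] k₀)
      (𝓝 (2 * k₀ * ∫ x in Set.Ioi a, jostPlus v k₀ x ^ 2)) := by
  have hnear : ∀ᶠ k in 𝓝 k₀, 0 < k.im ∧ k.im < 2 * k₀.im := by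
    refine Complex.continuous_im.continuousAt.eventually (Ioo_mem_nhds hk₀ (by linarith))
  have hc₀ := hv.continuous_jostPlus hk₀.le
  have hJ : Tendsto (fun k => ∫ x in Set.Ioi a, jostPlus v k₀ x * jostPlus v k x) (𝓝 k₀)
      (𝓝 (∫ x in Set.Ioi a, jostPlus v k₀ x * jostPlus v k₀ x)) := by
    refine tendsto_integral_filter_of_dominated_convergence
      (fun x => ‖jostPlus v k₀ x‖ * (2 * jostWeight v a * Real.exp (2 * k₀.im * |a|)))
      (hnear.mono fun k hk => ?_) (hnear.mono fun k hk => ?_)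
      ((hv.integrableOn_norm_jostPlus hk₀ a).mul_const _) (Eventually.of_forall fun x => ?_)
    · have hc := hv.continuous_jostPlus hk.1.le
      exact Continuous.aestronglyMeasurable (by fun_prop)
    · refine (ae_restrict_iff' measurableSet_Ioi).2 (Eventually.of_forall fun x hx => ?_)
      rw [norm_mul]
      refine mul_le_mul_of_nonneg_left ?_ (norm_nonneg _)
      refine (hv.norm_jostPlus_le hk.1.le (le_of_lt hx)).trans ?_
      have := jostWeight_pos v a
      gcongr
      have hx' : a < x := hx
      have h1 : -x ≤ |a| := by linarith [neg_abs_le a]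
      have h2 := mul_le_mul_of_nonneg_left h1 hk.1.le
      have h3 := mul_le_mul_of_nonneg_right hk.2.le (abs_nonneg a)
      linarith
    · refine tendsto_const_nhds.mul ?_
      exact (hv.continuousOn_jostPlus x).continuousAt
        (Filter.mem_of_superset (isOpen_upper.mem_nhds hk₀) fun k (hk : 0 < k.im) => hk.le)
  have h2 : Tendsto (fun k : ℂ => k + k₀) (𝓝 k₀) (𝓝 (k₀ + k₀)) :=
    (continuous_id.add continuous_const).tendsto k₀
  have h3 := (h2.mul hJ).mono_left (nhdsWithin_le_nhds (s := {k₀}ᶜ))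
  have e : (k₀ + k₀) * ∫ x in Set.Ioi a, jostPlus v k₀ x * jostPlus v k₀ x =
      2 * k₀ * ∫ x in Set.Ioi a, jostPlus v k₀ x ^ 2 := by
    simp_rw [pow_two]; ring
  rw [e] at h3
  refine h3.congr' ?_
  filter_upwards [hnear.filter_mono nhdsWithin_le_nhds, self_mem_nhdsWithin] with k hk hne
  rw [hv.wronskian_jostPlus_jostPlus hk₀ hk.1]
  have : k - k₀ ≠ 0 := sub_ne_zero.2 hne
  field_simp
  ring

/-- The Plücker relation with ψ₊(k₀) as auxiliary solution expresses W(k) through its Wronskians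
with ψ₊(k) and ψ₋(k). Since ψ₋(k₀) = μψ₊(k₀), both are of the type just treated; they contribute the
integrals over the two sides of a, which add up to the line. -/
theorem tendsto_jostWronskian_div (hv : IsShortRange v) {k₀ μ : ℂ} (hk₀ : 0 < k₀.im)
    (hμ0 : μ ≠ 0) (hμ : ∀ x, jostMinus v k₀ x = μ * jostPlus v k₀ x)
    (hint : Integrable fun x => jostPlus v k₀ x ^ 2) :
    Tendsto (fun k => jostWronskian v k / (k - k₀)) (𝓝[≠] k₀)
      (𝓝 (2 * k₀ * μ * ∫ x, jostPlus v k₀ x ^ 2)) := by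
  -- The Plücker relation is divided by ψ₊(k₀, a), so a must not be a zero.
  obtain ⟨a, -, ha⟩ := hv.exists_psiPlus_ne_zero hk₀.le 0
  rw [← hv.jostPlus_eq hk₀.le] at ha
  have hU : {k : ℂ | 0 ≤ k.im} ∈ 𝓝 k₀ :=
    Filter.mem_of_superset (isOpen_upper.mem_nhds hk₀) fun k (hk : 0 < k.im) => hk.le
  have hp : Tendsto (fun k => jostPlus v k a) (𝓝[≠] k₀) (𝓝 (jostPlus v k₀ a)) :=
    ((hv.continuousOn_jostPlus a).continuousAt hU).mono_left nhdsWithin_le_nhds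
  have hm : Tendsto (fun k => jostMinus v k a) (𝓝[≠] k₀) (𝓝 (jostMinus v k₀ a)) :=
    ((hv.continuousOn_jostMinus a).continuousAt hU).mono_left nhdsWithin_le_nhds
  have h1 := hv.tendsto_wronskian_jostPlus_div hk₀ a
  have h2 := hv.comp_neg.tendsto_wronskian_jostPlus_div hk₀ (-a)
  have h3 := ((hm.mul h1).sub (hp.mul (h2.const_mul (-μ⁻¹)))).div_const (jostPlus v k₀ a)
  have hI : ∫ x in Set.Ioi (-a), jostPlus (fun y => v (-y)) k₀ x ^ 2 =
      μ ^ 2 * ∫ x in Set.Iic a, jostPlus v k₀ x ^ 2 := by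
    rw [← integral_const_mul, ← integral_comp_neg_Iic]
    congr 1; ext x
    rw [← hv.jostMinus_comp_neg hk₀.le, hμ]; ring
  have hsplit : (∫ x in Set.Iic a, jostPlus v k₀ x ^ 2) + ∫ x in Set.Ioi a, jostPlus v k₀ x ^ 2 =
      ∫ x, jostPlus v k₀ x ^ 2 := intervalIntegral.integral_Iic_add_Ioi hint.integrableOn
        hint.integrableOn
  have e : (jostMinus v k₀ a * (2 * k₀ * ∫ x in Set.Ioi a, jostPlus v k₀ x ^ 2) -
      jostPlus v k₀ a * (-μ⁻¹ * (2 * k₀ * ∫ x in Set.Ioi (-a),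
        jostPlus (fun y => v (-y)) k₀ x ^ 2))) / jostPlus v k₀ a =
      2 * k₀ * μ * ∫ x, jostPlus v k₀ x ^ 2 := by
    rw [hI, hμ, ← hsplit]
    field_simp
    ring
  rw [e] at h3
  refine h3.congr' ?_
  filter_upwards [nhdsWithin_le_nhds hU, self_mem_nhdsWithin] with k hk hne
  have hW : wronskian (jostPlus v k₀) (jostMinus v k) a =
      -μ⁻¹ * wronskian (jostPlus (fun y => v (-y)) k₀) (jostPlus (fun y => v (-y)) k) (-a) := by
    have h4 := wronskian_comp_neg (jostMinus v k₀) (jostMinus v k) (-a)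
    rw [neg_neg, show (fun y => jostMinus v k₀ (-y)) = jostPlus (fun y => v (-y)) k₀ from
      funext fun y => by rw [hv.jostMinus_comp_neg hk₀.le, neg_neg],
      show (fun y => jostMinus v k (-y)) = jostPlus (fun y => v (-y)) k from
      funext fun y => by rw [hv.jostMinus_comp_neg hk, neg_neg],
      show jostMinus v k₀ = fun x => μ * jostPlus v k₀ x from funext hμ,
      wronskian_mul_left] at h4
    rw [h4]
    field_simp
  have hP := mul_wronskian (jostPlus v k₀) (jostMinus v k) (jostPlus v k) a
  rw [hv.jostWronskian_eq hk, hW] at hP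
  have : k - k₀ ≠ 0 := sub_ne_zero.2 hne
  rw [div_eq_div_iff ha this, mul_comm (jostWronskian v k), hP]
  field_simp

end IsShortRange


namespace IsShortRange

variable {v : ℝ → ℝ} {k : ℂ}

/-! ### The Wronskian near the bottom of the continuous spectrum -/

theorem integrableOn_tail (hv : IsShortRange v) (a : ℝ) :
    IntegrableOn (fun x => ∫ y in Set.Ioi x, |v y|) (Set.Ioi a) := by
  have hc := hv.continuous
  have hi : Integrable fun y => |v y| := hv.integrable_self.abs
  have hyi : Integrable fun y => y * |v y| := by
    refine hv.integrable.mono' (Continuous.aestronglyMeasurable (by fun_prop))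
      (Eventually.of_forall fun y => ?_)
    rw [norm_mul, Real.norm_eq_abs, Real.norm_eq_abs, abs_abs]
    have := abs_nonneg (v y)
    nlinarith
  set T : ℝ → ℝ := fun x => ∫ y in Set.Ioi x, |v y| with hT
  have hT0 : ∀ x, 0 ≤ T x := fun x => integral_nonneg fun y => abs_nonneg _
  -- An explicit antiderivative of the tail T. Since x T(x) ≤ ∫_x^∞ y|v| for x ≥ 0, it tends to 0,
  -- and the first moment alone makes T integrable.
  have hd : ∀ x, HasDerivAt (fun x => x * T x - ∫ y in Set.Ioi x, y * |v y|) (T x) x := fun x => by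
    have h1 := hasDerivAt_integral_Ioi (by fun_prop : Continuous fun y => |v y|)
      (fun a => hi.integrableOn) x
    have h2 := hasDerivAt_integral_Ioi (by fun_prop : Continuous fun y => y * |v y|)
      (fun a => hyi.integrableOn) x
    exact (((hasDerivAt_id x).mul h1).sub h2).congr_deriv (by simp [hT])
  have hxT : Tendsto (fun x => x * T x) atTop (𝓝 0) := by
    refine squeeze_zero' ((eventually_ge_atTop 0).mono fun x hx => mul_nonneg hx (hT0 x)) ?_
      (tendsto_integral_Ioi_atTop hyi)
    filter_upwards with x
    rw [hT, ← integral_const_mul]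
    refine setIntegral_mono_on (hi.const_mul x).integrableOn hyi.integrableOn measurableSet_Ioi
      fun y hy => ?_
    exact mul_le_mul_of_nonneg_right (le_of_lt hy) (abs_nonneg _)
  have hlim := hxT.sub (tendsto_integral_Ioi_atTop hyi)
  exact integrableOn_Ioi_deriv_of_nonneg' (fun x _ => hd x) (fun x _ => hT0 x) hlim

theorem norm_faddeevDeriv_le_tail (hv : IsShortRange v) (hk : 0 ≤ k.im) {a x : ℝ} (hx : a ≤ x) :
    ‖faddeevDeriv v k x‖ ≤ 2 * jostWeight v a * ∫ y in Set.Ioi x, |v y| := by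
  rw [faddeevDeriv, norm_neg, ← integral_const_mul]
  refine norm_integral_le_of_norm_le ((hv.integrable_self.abs.const_mul _).integrableOn)
    ((ae_restrict_iff' measurableSet_Ioi).2 (Eventually.of_forall fun y hy => ?_))
  rw [norm_mul, norm_mul, Complex.norm_real, Real.norm_eq_abs]
  have h1 := (hv.norm_faddeev_le hk y).trans
    (mul_le_mul_of_nonneg_left (hv.jostWeight_anti (hx.trans (le_of_lt hy))) zero_le_two)
  refine (mul_le_of_le_one_left (by positivity)
    (norm_phase_le hk (sub_nonneg.2 (le_of_lt hy)))).trans ?_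
  rw [mul_comm]
  gcongr

theorem norm_faddeev_le_of_le (hv : IsShortRange v) (hk : 0 ≤ k.im) {a x : ℝ} (hx : a ≤ x) :
    ‖faddeev v k x‖ ≤ 2 * jostWeight v a :=
  (hv.norm_faddeev_le hk x).trans
    (mul_le_mul_of_nonneg_left (hv.jostWeight_anti hx) zero_le_two)

theorem norm_deriv_mul_faddeev_le (hv : IsShortRange v) (hk : 0 ≤ k.im) {a x : ℝ} (hx : a ≤ x) :
    ‖faddeevDeriv v 0 x * faddeev v k x + faddeev v 0 x * faddeevDeriv v k x‖ ≤
      8 * jostWeight v a ^ 2 * ∫ y in Set.Ioi x, |v y| := by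
  have h0 : (0 : ℝ) ≤ (0 : ℂ).im := le_rfl
  have h1 := hv.norm_faddeev_le_of_le hk hx
  have h2 := hv.norm_faddeev_le_of_le h0 hx
  have h3 := hv.norm_faddeevDeriv_le_tail hk hx
  have h4 := hv.norm_faddeevDeriv_le_tail h0 hx
  have hw := jostWeight_pos v a
  have hT : 0 ≤ ∫ y in Set.Ioi x, |v y| := integral_nonneg fun y => abs_nonneg _
  refine (norm_add_le _ _).trans ?_
  rw [norm_mul, norm_mul]
  calc _ ≤ 2 * jostWeight v a * (∫ y in Set.Ioi x, |v y|) * (2 * jostWeight v a) +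
        2 * jostWeight v a * (2 * jostWeight v a * ∫ y in Set.Ioi x, |v y|) := by gcongr
    _ = _ := by ring

/-- Near k = 0 the formula with the factor k² is useless, as ψ₊(0) is not integrable. Here a single
factor k is extracted and the integrand contains the derivative of the product of two Faddeev
functions, which is dominated by an integrable tail. -/
theorem wronskian_jostPlus_zero (hv : IsShortRange v) (hk : 0 ≤ k.im) (a : ℝ) :
    wronskian (jostPlus v 0) (jostPlus v k) a = Complex.I * k *
      ((∫ x in Set.Ioi a, Complex.exp (Complex.I * k * x) *
        (faddeevDeriv v 0 x * faddeev v k x + faddeev v 0 x * faddeevDeriv v k x)) +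
        Complex.exp (Complex.I * k * a) * (faddeev v 0 a * faddeev v k a)) := by
  have h0 : (0 : ℝ) ≤ (0 : ℂ).im := le_rfl
  have hm := hv.continuous_faddeev hk
  have hm0 := hv.continuous_faddeev h0
  have hm' := hv.continuous_faddeevDeriv hk
  have hm0' := hv.continuous_faddeevDeriv h0
  set Z : ℝ → ℂ := fun x => Complex.exp (Complex.I * k * x) *
    (faddeev v 0 x * faddeevDeriv v k x - faddeevDeriv v 0 x * faddeev v k x) with hZdef
  have hZ : ∀ x : ℝ, HasDerivAt Z (-(Complex.I * k) * (Complex.exp (Complex.I * k * x) *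
      (faddeevDeriv v 0 x * faddeev v k x + faddeev v 0 x * faddeevDeriv v k x))) x := fun x => by
    refine ((hasDerivAt_planeWave k x).mul
      (((hv.hasDerivAt_faddeev h0 x).mul (hv.hasDerivAt_faddeevDeriv hk x)).sub
      ((hv.hasDerivAt_faddeevDeriv h0 x).mul (hv.hasDerivAt_faddeev hk x)))).congr_deriv ?_
    simp only [Pi.sub_apply, Pi.mul_apply]
    ring
  have hint : IntegrableOn (fun x : ℝ => Complex.exp (Complex.I * k * x) *
      (faddeevDeriv v 0 x * faddeev v k x + faddeev v 0 x * faddeevDeriv v k x)) (Set.Ioi a) := by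
    refine Integrable.mono' ((hv.integrableOn_tail a).const_mul
      (Real.exp (k.im * |a|) * (8 * jostWeight v a ^ 2)))
      (Continuous.aestronglyMeasurable (by fun_prop)) ?_
    refine (ae_restrict_iff' measurableSet_Ioi).2 (Eventually.of_forall fun x hx => ?_)
    rw [norm_mul, norm_planeWave, mul_assoc]
    have h1 := hv.norm_deriv_mul_faddeev_le hk (le_of_lt hx)
    have hx' : a < x := hx
    have h2 : -x ≤ |a| := by linarith [neg_abs_le a]
    have h3 := mul_le_mul_of_nonneg_left h2 hk
    gcongr
    linarith
  have hlim : Tendsto Z atTop (𝓝 0) := by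
    have h1 := ((hv.tendsto_faddeev h0).mul (hv.tendsto_faddeevDeriv hk)).sub
      ((hv.tendsto_faddeevDeriv h0).mul (hv.tendsto_faddeev hk))
    rw [mul_zero, zero_mul, sub_zero] at h1
    refine squeeze_zero_norm' ?_ (tendsto_zero_iff_norm_tendsto_zero.1 h1)
    filter_upwards [eventually_ge_atTop 0] with x hx
    rw [hZdef, norm_mul]
    exact mul_le_of_le_one_left (norm_nonneg _) (norm_planeWave_le hk hx)
  have h := integral_Ioi_of_hasDerivAt_of_tendsto' (fun x (_ : x ∈ Set.Ici a) => hZ x)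
    (hint.const_mul _) hlim
  rw [integral_const_mul] at h
  rw [wronskian, hv.deriv_jostPlus h0, hv.deriv_jostPlus hk, hv.jostPlus_eq h0, hv.jostPlus_eq hk]
  simp only [psiPlus, hZdef, mul_zero, zero_mul, Complex.exp_zero, one_mul, add_zero] at h ⊢
  linear_combination h

/-- In the limit the integrand becomes the derivative of m(0, x)², so the integral is 1 − m(0, a)²
and cancels the boundary term up to 1. -/
theorem tendsto_wronskian_jostPlus_zero_div (hv : IsShortRange v) (a : ℝ) :
    Tendsto (fun k => wronskian (jostPlus v 0) (jostPlus v k) a / k) (𝓝[{k | 0 ≤ k.im} \ {0}] 0)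
      (𝓝 Complex.I) := by
  have h0 : (0 : ℝ) ≤ (0 : ℂ).im := le_rfl
  have hm0 := hv.continuous_faddeev h0
  have hm0' := hv.continuous_faddeevDeriv h0
  have hmem : (0 : ℂ) ∈ {k : ℂ | 0 ≤ k.im} := h0
  set l := 𝓝[{k : ℂ | 0 ≤ k.im}] (0 : ℂ) with hl
  have hnear : ∀ᶠ k in l, 0 ≤ k.im ∧ k.im ≤ 1 := by
    refine (eventually_mem_nhdsWithin).and (eventually_nhdsWithin_of_eventually_nhds ?_)
    exact Complex.continuous_im.continuousAt.eventually (eventually_le_nhds (by simp))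
  have hfm : ∀ x, Tendsto (fun k => faddeev v k x) l (𝓝 (faddeev v 0 x)) := fun x =>
    (hv.continuousOn_faddeev x) 0 hmem
  have hfm' : ∀ x, Tendsto (fun k => faddeevDeriv v k x) l (𝓝 (faddeevDeriv v 0 x)) := fun x =>
    (hv.continuousOn_faddeevDeriv x) 0 hmem
  have hexp : ∀ x : ℝ, Tendsto (fun k => Complex.exp (Complex.I * k * x)) l (𝓝 1) := fun x => by
    have : Continuous fun k => Complex.exp (Complex.I * k * x) := by fun_prop
    have := (this.tendsto 0).mono_left (nhdsWithin_le_nhds (s := {k : ℂ | 0 ≤ k.im}))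
    simpa using this
  have hJ : Tendsto (fun k => ∫ x in Set.Ioi a, Complex.exp (Complex.I * k * x) *
        (faddeevDeriv v 0 x * faddeev v k x + faddeev v 0 x * faddeevDeriv v k x)) l
      (𝓝 (∫ x in Set.Ioi a, (faddeevDeriv v 0 x * faddeev v 0 x +
        faddeev v 0 x * faddeevDeriv v 0 x))) := by
    refine tendsto_integral_filter_of_dominated_convergence
      (fun x => Real.exp |a| * (8 * jostWeight v a ^ 2 * ∫ y in Set.Ioi x, |v y|))
      (hnear.mono fun k hk => ?_) (hnear.mono fun k hk => ?_)
      (((hv.integrableOn_tail a).const_mul _).const_mul _) (Eventually.of_forall fun x => ?_)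
    · have := hv.continuous_faddeev hk.1
      have := hv.continuous_faddeevDeriv hk.1
      exact Continuous.aestronglyMeasurable (by fun_prop)
    · refine (ae_restrict_iff' measurableSet_Ioi).2 (Eventually.of_forall fun x hx => ?_)
      rw [norm_mul, norm_planeWave]
      have h1 := hv.norm_deriv_mul_faddeev_le hk.1 (le_of_lt hx)
      have hx' : a < x := hx
      have h2 : -x ≤ |a| := by linarith [neg_abs_le a]
      have h3 := mul_le_mul_of_nonneg_left h2 hk.1
      have h4 := mul_le_mul_of_nonneg_right hk.2 (abs_nonneg a)
      gcongr
      linarith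
    · simpa using (hexp x).mul (((hfm x).const_mul _).add ((hfm' x).const_mul _))
  have hI : ∫ x in Set.Ioi a, (faddeevDeriv v 0 x * faddeev v 0 x +
        faddeev v 0 x * faddeevDeriv v 0 x) = 1 - faddeev v 0 a * faddeev v 0 a := by
    have hint : IntegrableOn (fun x => faddeevDeriv v 0 x * faddeev v 0 x +
        faddeev v 0 x * faddeevDeriv v 0 x) (Set.Ioi a) := by
      refine Integrable.mono' ((hv.integrableOn_tail a).const_mul (8 * jostWeight v a ^ 2))
        (Continuous.aestronglyMeasurable (by fun_prop)) ?_
      exact (ae_restrict_iff' measurableSet_Ioi).2 (Eventually.of_forall fun x hx =>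
        hv.norm_deriv_mul_faddeev_le h0 (le_of_lt hx))
    have hlim := (hv.tendsto_faddeev h0).mul (hv.tendsto_faddeev h0)
    rw [mul_one] at hlim
    exact integral_Ioi_of_hasDerivAt_of_tendsto' (fun x _ =>
      (hv.hasDerivAt_faddeev h0 x).mul (hv.hasDerivAt_faddeev h0 x)) hint hlim
  rw [hI] at hJ
  have h1 := ((hJ.add ((hexp a).mul ((hfm a).const_mul (faddeev v 0 a)))).const_mul
    Complex.I)
  rw [one_mul, sub_add_cancel, mul_one] at h1
  refine (h1.mono_left (nhdsWithin_mono _ Set.sdiff_subset)).congr' ?_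
  filter_upwards [self_mem_nhdsWithin] with k hk
  have hk0 : k ≠ 0 := hk.2
  rw [hv.wronskian_jostPlus_zero hk.1]
  field_simp

theorem jostPlus_zero_conj (hv : IsShortRange v) (x : ℝ) :
    (starRingEnd ℂ) (jostPlus v 0 x) = jostPlus v 0 x := by
  have := hv.jostPlus_conj (k := 0) le_rfl x
  simpa using this.symm

theorem jostMinus_zero_conj (hv : IsShortRange v) (x : ℝ) :
    (starRingEnd ℂ) (jostMinus v 0 x) = jostMinus v 0 x := by
  have := hv.jostMinus_conj (k := 0) le_rfl x
  simpa using this.symm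

/-- If W(0) ≠ 0 the limit is 0. In the exceptional case ψ₋(0) = cψ₊(0) with c real, and the Plücker
relation gives W(k)/k → i(c + 1/c), which is nonzero because c² + 1 ≠ 0. -/
theorem exists_tendsto_div_jostWronskian (hv : IsShortRange v) :
    ∃ L : ℂ, Tendsto (fun k => 2 * Complex.I * k / jostWronskian v k)
      (𝓝[{k | 0 ≤ k.im} \ {0}] 0) (𝓝 L) := by
  have h0 : (0 : ℝ) ≤ (0 : ℂ).im := le_rfl
  have hmem : (0 : ℂ) ∈ {k : ℂ | 0 ≤ k.im} := h0
  have hle : 𝓝[{k | 0 ≤ k.im} \ {0}] (0 : ℂ) ≤ 𝓝[{k : ℂ | 0 ≤ k.im}] (0 : ℂ) :=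
    nhdsWithin_mono _ Set.sdiff_subset
  by_cases hW : jostWronskian v 0 = 0
  · obtain ⟨c, hc0, hc⟩ := hv.jostMinus_eq_mul_of_jostWronskian_eq_zero h0 hW
    obtain ⟨a, -, ha⟩ := hv.exists_psiPlus_ne_zero h0 0
    rw [← hv.jostPlus_eq h0] at ha
    have hcreal : (starRingEnd ℂ) c = c := by
      have h1 := congrArg (starRingEnd ℂ) (hc a)
      rw [map_mul, hv.jostPlus_zero_conj, hv.jostMinus_zero_conj, hc a] at h1
      exact (mul_right_cancel₀ ha h1).symm
    have hcc : c + c⁻¹ ≠ 0 := fun h => by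
      have h1 : c ^ 2 + 1 = 0 := by
        have := congrArg (c * ·) h
        simp only [mul_add, mul_inv_cancel₀ hc0, mul_zero] at this
        rw [pow_two]; exact this
      rw [← Complex.conj_eq_iff_real.1 hcreal |>.choose_spec.symm] at h1
      have h2 : ((Complex.conj_eq_iff_real.1 hcreal).choose : ℝ) ^ 2 + 1 = 0 := by
        exact_mod_cast h1
      nlinarith [sq_nonneg (Complex.conj_eq_iff_real.1 hcreal).choose]
    have h1 := hv.tendsto_wronskian_jostPlus_zero_div a
    have h2 := hv.comp_neg.tendsto_wronskian_jostPlus_zero_div (-a)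
    have hp : Tendsto (fun k => jostPlus v k a) (𝓝[{k | 0 ≤ k.im} \ {0}] 0)
      (𝓝 (jostPlus v 0 a)) := ((hv.continuousOn_jostPlus a) 0 hmem).mono_left hle
    have hm : Tendsto (fun k => jostMinus v k a) (𝓝[{k | 0 ≤ k.im} \ {0}] 0)
      (𝓝 (jostMinus v 0 a)) := ((hv.continuousOn_jostMinus a) 0 hmem).mono_left hle
    have h3 := ((hm.mul h1).sub (hp.mul (h2.const_mul (-c⁻¹)))).div_const (jostPlus v 0 a)
    have e : (jostMinus v 0 a * Complex.I - jostPlus v 0 a * (-c⁻¹ * Complex.I)) /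
        jostPlus v 0 a = (c + c⁻¹) * Complex.I := by
      rw [hc]; field_simp; ring
    rw [e] at h3
    refine ⟨_, ((tendsto_const_nhds (x := 2 * Complex.I)).div h3
      (mul_ne_zero hcc Complex.I_ne_zero)).congr' ?_⟩
    filter_upwards [self_mem_nhdsWithin] with k hk
    have hk0 : k ≠ 0 := hk.2
    have hW : wronskian (jostPlus v 0) (jostMinus v k) a =
        -c⁻¹ * wronskian (jostPlus (fun y => v (-y)) 0) (jostPlus (fun y => v (-y)) k) (-a) := by
      have h4 := wronskian_comp_neg (jostMinus v 0) (jostMinus v k) (-a)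
      rw [neg_neg, show (fun y => jostMinus v 0 (-y)) = jostPlus (fun y => v (-y)) 0 from
        funext fun y => by rw [hv.jostMinus_comp_neg h0, neg_neg],
        show (fun y => jostMinus v k (-y)) = jostPlus (fun y => v (-y)) k from
        funext fun y => by rw [hv.jostMinus_comp_neg hk.1, neg_neg],
        show jostMinus v 0 = fun x => c * jostPlus v 0 x from funext hc,
        wronskian_mul_left] at h4
      rw [h4]
      field_simp
    have hP := mul_wronskian (jostPlus v 0) (jostMinus v k) (jostPlus v k) a
    rw [hv.jostWronskian_eq hk.1, hW] at hP
    have e2 : (jostMinus v k a * (wronskian (jostPlus v 0) (jostPlus v k) a / k) -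
        jostPlus v k a * (-c⁻¹ * (wronskian (jostPlus (fun y => v (-y)) 0)
          (jostPlus (fun y => v (-y)) k) (-a) / k))) / jostPlus v 0 a = jostWronskian v k / k := by
      rw [div_eq_div_iff ha hk0, mul_comm (jostWronskian v k), hP]
      field_simp
    simp only [Pi.div_apply]
    rw [e2, div_div_eq_mul_div]
  · refine ⟨0, ?_⟩
    have h1 : Tendsto (jostWronskian v) (𝓝[{k : ℂ | 0 ≤ k.im} \ {0}] 0)
      (𝓝 (jostWronskian v 0)) := (hv.continuousOn_jostWronskian 0 hmem).mono_left hle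
    have h2 : Tendsto (fun k : ℂ => 2 * Complex.I * k) (𝓝[{k : ℂ | 0 ≤ k.im} \ {0}] 0)
      (𝓝 (2 * Complex.I * 0)) :=
      ((continuous_const.mul continuous_id).tendsto 0).mono_left nhdsWithin_le_nhds
    have h3 := h2.div h1 hW
    rw [mul_zero, zero_div] at h3
    exact h3

end IsShortRange


/-! ### Transmission and reflection coefficients on the real axis -/

noncomputable section

/-- The transmission coefficient `2ik / W(ψ₋, ψ₊)` on the closed upper half-plane, its value at `0`
being the limit there. -/
def transmissionBdry (v : ℝ → ℝ) : ℂ → ℂ :=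
  Function.update (fun k => 2 * Complex.I * k / jostWronskian v k) 0
    (limUnder (𝓝[{k | 0 ≤ k.im} \ {0}] 0) fun k => 2 * Complex.I * k / jostWronskian v k)

end

theorem transmissionBdry_of_ne (v : ℝ → ℝ) {k : ℂ} (hk : k ≠ 0) :
    transmissionBdry v k = 2 * Complex.I * k / jostWronskian v k := Function.update_of_ne hk _ _

theorem transmission_eq_bdry (v : ℝ → ℝ) {k : ℂ} (hk : 0 < k.im) :
    transmission v k = transmissionBdry v k := by
  rw [transmissionBdry_of_ne v (fun h => by simp [h] at hk)]
  rfl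

theorem eq_of_continuous_of_eq_off_zero {X : Type*} [TopologicalSpace X] [T2Space X]
    {f g : ℝ → X} (hf : Continuous f) (hg : Continuous g) (h : ∀ k, k ≠ 0 → f k = g k) (k : ℝ) :
    f k = g k :=
  congrFun (Continuous.ext_on (dense_compl_singleton (0 : ℝ)) hf hg fun k hk => h k hk) k

namespace IsShortRange

variable {v : ℝ → ℝ}

theorem continuousWithinAt_transmissionBdry (hv : IsShortRange v) {k : ℂ} (hk : 0 ≤ k.im)
    (h : k ≠ 0 → jostWronskian v k ≠ 0) :
    ContinuousWithinAt (transmissionBdry v) {k | 0 ≤ k.im} k := by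
  rcases eq_or_ne k 0 with rfl | hk0
  · rw [transmissionBdry, continuousWithinAt_update_same]
    exact tendsto_nhds_limUnder hv.exists_tendsto_div_jostWronskian
  · rw [transmissionBdry, continuousWithinAt_update_of_ne hk0]
    exact (continuousWithinAt_const.mul continuousWithinAt_id).div
      (hv.continuousOn_jostWronskian k hk) (h hk0)

theorem continuous_ofReal_comp {X : Type*} [TopologicalSpace X] {f : ℂ → X}
    (hf : ∀ k : ℝ, ContinuousWithinAt f {k | 0 ≤ k.im} k) : Continuous fun k : ℝ => f k :=
  continuous_iff_continuousAt.2 fun k =>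
    (hf k).tendsto.comp (tendsto_nhdsWithin_iff.2
      ⟨Complex.continuous_ofReal.continuousAt, Eventually.of_forall fun k => by simp⟩)

theorem continuous_transmissionBdry (hv : IsShortRange v) :
    Continuous fun k : ℝ => transmissionBdry v k :=
  continuous_ofReal_comp fun k => hv.continuousWithinAt_transmissionBdry (by simp)
    fun hk => hv.jostWronskian_ne_zero_of_real (by simpa using hk)

theorem continuous_jostPlus_ofReal (hv : IsShortRange v) (x : ℝ) :
    Continuous fun k : ℝ => jostPlus v k x :=
  continuous_ofReal_comp (f := fun k => jostPlus v k x)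
    fun k => hv.continuousOn_jostPlus x k (by simp)

theorem continuous_jostMinus_ofReal (hv : IsShortRange v) (x : ℝ) :
    Continuous fun k : ℝ => jostMinus v k x :=
  continuous_ofReal_comp (f := fun k => jostMinus v k x)
    fun k => hv.continuousOn_jostMinus x k (by simp)

theorem solves_conj_jostPlus (hv : IsShortRange v) (k : ℝ) :
    SolvesSchrodinger v ((k : ℂ) ^ 2) fun y => (starRingEnd ℂ) (jostPlus v k y) := by
  have := (hv.solves_jostPlus (k := k) (by simp)).conj hv.continuous
  simpa using this

theorem two_mul_jostMinus (hv : IsShortRange v) (k x : ℝ) :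
    2 * Complex.I * k * jostMinus v k x =
      jostWronskian v k * (starRingEnd ℂ) (jostPlus v k x) +
      wronskian (fun y => (starRingEnd ℂ) (jostPlus v k y)) (jostMinus v k) 0 *
        jostPlus v k x := by
  have hk : (0 : ℝ) ≤ (k : ℂ).im := by simp
  have h := mul_wronskian (jostMinus v k) (fun y => (starRingEnd ℂ) (jostPlus v k y))
    (jostPlus v k) x
  rw [hv.wronskian_conj_jostPlus, hv.jostWronskian_eq hk, wronskian_neg_swap (jostMinus v k),
    (hv.solves_conj_jostPlus k).wronskian_eq (hv.solves_jostMinus hk) x 0] at h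
  linear_combination h

theorem exists_isReflectionCoefficient (hv : IsShortRange v) :
    ∃ r, IsReflectionCoefficient v r := by
  obtain ⟨a, -, ha⟩ := hv.exists_psiPlus_ne_zero (k := 0) le_rfl 0
  rw [← hv.jostPlus_eq le_rfl] at ha
  -- R solves the scattering relation for r at a point a with ψ₊(0, a) ≠ 0. It is continuous at 0
  -- and agrees near 0 with the Wronskian quotient, so it provides the value r(0).
  set R : ℝ → ℂ := fun k =>
    (transmissionBdry v k * jostMinus v k a - (starRingEnd ℂ) (jostPlus v k a)) /
      jostPlus v k a with hR
  set r : ℝ → ℂ := Function.update (fun k =>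
    wronskian (fun y => (starRingEnd ℂ) (jostPlus v k y)) (jostMinus v k) 0 /
      jostWronskian v k) 0 (R 0) with hr
  have hT := hv.continuous_transmissionBdry
  have hp := hv.continuous_jostPlus_ofReal
  have hm := hv.continuous_jostMinus_ofReal
  have hid : ∀ k : ℝ, k ≠ 0 → ∀ x, transmissionBdry v k * jostMinus v k x =
      (starRingEnd ℂ) (jostPlus v k x) + r k * jostPlus v k x := fun k hk x => by
    have hW := hv.jostWronskian_ne_zero_of_real hk
    rw [transmissionBdry_of_ne v (by exact_mod_cast hk), hr, Function.update_of_ne hk]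
    have := hv.two_mul_jostMinus k x
    field_simp
    linear_combination this
  have hRc : ContinuousAt R 0 := by
    refine ContinuousAt.div ?_ (hp a).continuousAt (by simpa using ha)
    exact ((hT.mul (hm a)).sub (Complex.continuous_conj.comp (hp a))).continuousAt
  have hrc : Continuous r := by
    refine continuous_iff_continuousAt.2 fun k => ?_
    rcases eq_or_ne k 0 with rfl | hk
    · refine hRc.congr ?_
      filter_upwards [(hp a).continuousAt.eventually_ne (by simpa using ha :
        jostPlus v ((0 : ℝ) : ℂ) a ≠ 0)] with k hk
      rcases eq_or_ne k 0 with rfl | hk0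
      · rw [hr, Function.update_self]
      · rw [hR]
        simp only
        rw [hid k hk0 a]
        field_simp
        ring
    · rw [hr, continuousAt_update_of_ne hk]
      have hd : ∀ k : ℝ, deriv (fun y => (starRingEnd ℂ) (jostPlus v k y)) 0 =
        (starRingEnd ℂ) (deriv (jostPlus v k) 0) := fun k =>
          ((hv.solves_jostPlus (k := k) (by simp)).hasDerivAt 0).star.deriv
      have hdp : Continuous fun k : ℝ => deriv (jostPlus v k) 0 :=
        continuous_ofReal_comp (f := fun k => deriv (jostPlus v k) 0)
          fun k => hv.continuousOn_deriv_jostPlus 0 k (by simp)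
      have hdm : Continuous fun k : ℝ => deriv (jostMinus v k) 0 :=
        continuous_ofReal_comp (f := fun k => deriv (jostMinus v k) 0)
          fun k => hv.continuousOn_deriv_jostMinus 0 k (by simp)
      have hWc : Continuous fun k : ℝ => jostWronskian v k :=
        continuous_ofReal_comp fun k => hv.continuousOn_jostWronskian k (by simp)
      refine ContinuousAt.div (Continuous.continuousAt ?_) hWc.continuousAt
        (hv.jostWronskian_ne_zero_of_real hk)
      simp only [wronskian, hd]
      exact ((Complex.continuous_conj.comp (hp 0)).mul hdm).sub
        ((Complex.continuous_conj.comp hdp).mul (hm 0))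
  refine ⟨r, hrc, fun k => transmissionBdry v k, hT, fun k x => ?_⟩
  exact eq_of_continuous_of_eq_off_zero (hT.mul (hm x))
    ((Complex.continuous_conj.comp (hp x)).add (hrc.mul (hp x))) (fun k hk => hid k hk x) k

theorem isReflectionCoefficient_reflection (hv : IsShortRange v) :
    IsReflectionCoefficient v (reflection v) :=
  Classical.epsilon_spec hv.exists_isReflectionCoefficient

theorem continuous_reflection (hv : IsShortRange v) : Continuous (reflection v) :=
  hv.isReflectionCoefficient_reflection.1

/-- The scattering relation. -/
theorem scattering_relation (hv : IsShortRange v) (k x : ℝ) :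
    transmissionBdry v k * jostMinus v k x =
      (starRingEnd ℂ) (jostPlus v k x) + reflection v k * jostPlus v k x := by
  obtain ⟨hr, τ, hτ, h⟩ := hv.isReflectionCoefficient_reflection
  -- Taking the Wronskian of the relation with ψ₊ removes the reflected term and determines τ(k) for
  -- k ≠ 0; continuity does the rest.
  have e : ∀ k : ℝ, τ k = transmissionBdry v k := by
    refine eq_of_continuous_of_eq_off_zero hτ hv.continuous_transmissionBdry fun k hk => ?_
    have hk' : (0 : ℝ) ≤ (k : ℂ).im := by simp
    have hW := hv.jostWronskian_ne_zero_of_real hk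
    have h1 : τ k * jostWronskian v k = 2 * Complex.I * k := by
      rw [← hv.wronskian_conj_jostPlus k 0, jostWronskian, ← wronskian_mul_left]
      have hs := hv.solves_jostPlus hk'
      have hd : deriv (fun y => τ k * jostMinus v k y) 0 =
          deriv (fun y => (starRingEnd ℂ) (jostPlus v k y)) 0 +
            reflection v k * deriv (jostPlus v k) 0 := by
        rw [show (fun y => τ k * jostMinus v k y) = fun y => (starRingEnd ℂ) (jostPlus v k y) +
          reflection v k * jostPlus v k y from funext (h k)]
        exact (((hv.solves_conj_jostPlus k).hasDerivAt 0).add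
          ((hs.hasDerivAt 0).const_mul _)).deriv
      simp only [wronskian]
      rw [hd, h]
      ring
    rw [transmissionBdry_of_ne v (by exact_mod_cast hk), ← h1]
    field_simp
  rw [← e]
  exact h k x

theorem jostPlus_neg_ofReal (hv : IsShortRange v) (k x : ℝ) :
    jostPlus v (-(k : ℂ)) x = (starRingEnd ℂ) (jostPlus v k x) := by
  have := hv.jostPlus_conj (k := k) (by simp) x
  simpa using this

theorem jostMinus_neg_ofReal (hv : IsShortRange v) (k x : ℝ) :
    jostMinus v (-(k : ℂ)) x = (starRingEnd ℂ) (jostMinus v k x) := by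
  have := hv.jostMinus_conj (k := k) (by simp) x
  simpa using this

/-- The relation at −k minus the conjugate of the relation at k is a linear relation between ψ₋(−k)
and ψ₊(−k), which are independent. -/
theorem transmissionBdry_neg_and_reflection_neg (hv : IsShortRange v) {k : ℝ} (hk : k ≠ 0) :
    transmissionBdry v (-(k : ℂ)) = (starRingEnd ℂ) (transmissionBdry v k) ∧
    reflection v (-k) = (starRingEnd ℂ) (reflection v k) := by
  have hk' : (0 : ℝ) ≤ ((-k : ℝ) : ℂ).im := by simp
  have hW := hv.jostWronskian_ne_zero_of_real (neg_ne_zero.2 hk)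
  set A := transmissionBdry v ((-k : ℝ) : ℂ) - (starRingEnd ℂ) (transmissionBdry v k) with hA
  set B := reflection v (-k) - (starRingEnd ℂ) (reflection v k) with hB
  have h1 : ∀ x, A * jostMinus v ((-k : ℝ) : ℂ) x = B * jostPlus v ((-k : ℝ) : ℂ) x := fun x => by
    have e1 := hv.scattering_relation (-k) x
    have e2 := congrArg (starRingEnd ℂ) (hv.scattering_relation k x)
    have e3 := hv.jostPlus_neg_ofReal k x
    have e4 := hv.jostMinus_neg_ofReal k x
    simp only [map_mul, map_add, ← e3, ← e4] at e2
    push_cast at e1 e2 ⊢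
    rw [hA, hB]
    push_cast
    linear_combination e1 - e2
  have hA0 : A = 0 := by
    have h2 : wronskian (fun x => A * jostMinus v ((-k : ℝ) : ℂ) x)
        (jostPlus v ((-k : ℝ) : ℂ)) 0 = A * jostWronskian v ((-k : ℝ) : ℂ) :=
      wronskian_mul_left _ _ _ _
    rw [funext h1, wronskian_mul_left] at h2
    have h3 : wronskian (jostPlus v ((-k : ℝ) : ℂ)) (jostPlus v ((-k : ℝ) : ℂ)) 0 = 0 := by
      unfold wronskian; ring
    rw [h3, mul_zero] at h2
    exact (mul_eq_zero.1 h2.symm).resolve_right hW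
  have hB0 : B = 0 := by
    by_contra hB0
    refine hv.jostPlus_ne_zero hk' (funext fun x => ?_)
    have := h1 x
    rw [hA0, zero_mul] at this
    exact (mul_eq_zero.1 this.symm).resolve_left hB0
  refine ⟨?_, sub_eq_zero.1 hB0⟩
  have := sub_eq_zero.1 hA0
  push_cast at this
  exact this

theorem reflection_neg (hv : IsShortRange v) (k : ℝ) :
    reflection v (-k) = (starRingEnd ℂ) (reflection v k) :=
  eq_of_continuous_of_eq_off_zero (hv.continuous_reflection.comp continuous_neg)
    (Complex.continuous_conj.comp hv.continuous_reflection)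
    (fun _ hk => (hv.transmissionBdry_neg_and_reflection_neg hk).2) k

/-- Unitarity: the scattering relation is inserted into the conjugate Wronskian of tψ₋, and W(ψ̄₊,
ψ₊) = 2ik is compared with W(ψ̄₋, ψ₋) = −2ik. -/
theorem norm_sq_transmission_add (hv : IsShortRange v) (k : ℝ) :
    ‖transmissionBdry v k‖ ^ 2 + ‖reflection v k‖ ^ 2 = 1 := by
  refine eq_of_continuous_of_eq_off_zero
    ((hv.continuous_transmissionBdry.norm.pow 2).add (hv.continuous_reflection.norm.pow 2))
    continuous_const (fun k hk => ?_) k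
  have hk' : (0 : ℝ) ≤ (k : ℂ).im := by simp
  set T := transmissionBdry v k
  set R := reflection v k
  have hs := hv.solves_jostPlus hk'
  have hsm := hv.solves_jostMinus hk'
  have hc : ∀ f : ℝ → ℂ, SolvesSchrodinger v ((k : ℂ) ^ 2) f →
      deriv (fun y => (starRingEnd ℂ) (f y)) 0 = (starRingEnd ℂ) (deriv f 0) := fun f hf =>
    (hf.hasDerivAt 0).star.deriv
  have h1 := hv.wronskian_conj_jostPlus k 0
  have h2 := hv.wronskian_conj_jostMinus k 0
  have e := hv.scattering_relation k
  have ed : T * deriv (jostMinus v k) 0 = (starRingEnd ℂ) (deriv (jostPlus v k) 0) +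
      R * deriv (jostPlus v k) 0 := by
    have h3 := ((hsm.hasDerivAt 0).const_mul T).deriv
    rw [show (fun y => T * jostMinus v k y) = fun y => (starRingEnd ℂ) (jostPlus v k y) +
          R * jostPlus v k y from funext e] at h3
    rw [← h3]
    exact ((hs.hasDerivAt 0).star.add ((hs.hasDerivAt 0).const_mul _)).deriv
  unfold wronskian at h1 h2
  rw [hc _ hs] at h1
  rw [hc _ hsm] at h2
  have e0 := e 0
  have e0c := congrArg (starRingEnd ℂ) e0
  have edc := congrArg (starRingEnd ℂ) ed
  simp only [map_mul, map_add, Complex.conj_conj] at e0c edc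
  have h4 : ((‖T‖ ^ 2 + ‖R‖ ^ 2 - 1 : ℝ) : ℂ) * (2 * Complex.I * k) = 0 := by
    push_cast
    rw [← Complex.conj_mul', ← Complex.conj_mul']
    set p := jostPlus v k 0
    set p' := deriv (jostPlus v k) 0
    set m := jostMinus v k 0
    set m' := deriv (jostMinus v k) 0
    have h5 : (starRingEnd ℂ) T * (starRingEnd ℂ) m * (T * m') -
        (starRingEnd ℂ) T * (starRingEnd ℂ) m' * (T * m) =
        -((starRingEnd ℂ) T * T) * (2 * Complex.I * k) := by
      linear_combination ((starRingEnd ℂ) T * T) * h2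
    rw [e0c, edc, ed, e0] at h5
    linear_combination h5 - ((starRingEnd ℂ) R * R - 1) * h1
  have h6 : (2 * Complex.I * (k : ℂ)) ≠ 0 := by simp [hk]
  have h7 := (mul_eq_zero.1 h4).resolve_right h6
  have h8 : ‖T‖ ^ 2 + ‖R‖ ^ 2 - 1 = 0 := by exact_mod_cast h7
  exact sub_eq_zero.1 h8

theorem norm_reflection_lt_one (hv : IsShortRange v) {k : ℝ} (hk : k ≠ 0) :
    ‖reflection v k‖ < 1 := by
  have h := hv.norm_sq_transmission_add k
  have hT : 0 < ‖transmissionBdry v k‖ := by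
    rw [norm_pos_iff, transmissionBdry_of_ne v (by exact_mod_cast hk)]
    exact div_ne_zero (by simp [hk]) (hv.jostWronskian_ne_zero_of_real hk)
  nlinarith [norm_nonneg (reflection v k)]

/-- If |r(0)| = 1 then t(0) = 0, and since ψ₊(0, ·) is real the scattering relation at k = 0 reads
(1 + r(0))ψ₊ = 0. -/
theorem reflection_zero (hv : IsShortRange v) (h : ‖reflection v 0‖ = 1) :
    reflection v 0 = -1 := by
  have h1 := hv.norm_sq_transmission_add 0
  rw [h] at h1
  have hT : transmissionBdry v ((0 : ℝ) : ℂ) = 0 := by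
    rw [← norm_eq_zero]
    nlinarith [norm_nonneg (transmissionBdry v ((0 : ℝ) : ℂ))]
  obtain ⟨a, -, ha⟩ := hv.exists_psiPlus_ne_zero (k := 0) le_rfl 0
  rw [← hv.jostPlus_eq le_rfl] at ha
  have h2 := hv.scattering_relation 0 a
  rw [hT, zero_mul, Complex.ofReal_zero, hv.jostPlus_zero_conj] at h2
  have h3 : (1 + reflection v 0) * jostPlus v 0 a = 0 := by linear_combination -h2
  linear_combination (mul_eq_zero.1 h3).resolve_right ha

end IsShortRange


/-! ### Inhomogeneous Volterra equations -/

section Source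

variable {φ : ℝ → ℂ} {k : ℂ} {G : ℝ → ℝ}

theorem hasRightMoment_of_norm_le (hc : Continuous φ)
    (hG : Integrable fun y : ℝ => (1 + |y|) * G y)
    (h : ∀ y, ‖φ y‖ ≤ G y * leftWeight y) : HasRightMoment φ := by
  intro a
  refine Integrable.mono' ((hG.mul_const (leftWeight a)).integrableOn)
    (Continuous.aestronglyMeasurable (by fun_prop)) ?_
  refine (ae_restrict_iff' measurableSet_Ioi).2 (Eventually.of_forall fun y hy => ?_)
  have h1 := leftWeight_anti (le_of_lt hy : a ≤ y)
  have h0 := one_le_leftWeight y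
  have hG0 : 0 ≤ G y := nonneg_of_mul_nonneg_left ((norm_nonneg _).trans (h y)) (by linarith)
  rw [norm_mul, Complex.norm_real, Real.norm_of_nonneg (by positivity), mul_assoc]
  gcongr
  exact (h y).trans (by gcongr)

theorem norm_integral_volterraKernel_le (hk : 0 ≤ k.im)
    (hG : Integrable fun y : ℝ => (1 + |y|) * G y)
    (h : ∀ y, ‖φ y‖ ≤ G y * leftWeight y) (x : ℝ) :
    ‖∫ y in Set.Ioi x, volterraKernel k (y - x) * φ y‖ ≤
      (∫ y, (1 + |y|) * G y) * leftWeight x := by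
  have hG0 : ∀ y, 0 ≤ G y := fun y =>
    nonneg_of_mul_nonneg_left ((norm_nonneg _).trans (h y))
      (zero_lt_one.trans_le (one_le_leftWeight y))
  have hx := one_le_leftWeight x
  rw [← integral_mul_const]
  refine (norm_integral_le_of_norm_le ((hG.mul_const (leftWeight x)).integrableOn)
    ((ae_restrict_iff' measurableSet_Ioi).2 (Eventually.of_forall fun y hy => ?_))).trans
    (setIntegral_le_integral (hG.mul_const _) (Eventually.of_forall fun y =>
      mul_nonneg (mul_nonneg (by positivity) (hG0 y)) (by linarith)))
  have h1 := sub_nonneg.2 (le_of_lt hy : x ≤ y)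
  rw [norm_mul]
  calc _ ≤ (y - x) * (G y * leftWeight y) := by
        gcongr
        · exact norm_volterraKernel_le hk h1
        · exact h y
    _ = G y * ((y - x) * leftWeight y) := by ring
    _ ≤ G y * (leftWeight x * (1 + |y|)) := by
        have := sub_mul_leftWeight_le (le_of_lt hy : x ≤ y)
        have := hG0 y
        gcongr
    _ = _ := by ring

/-- A decaying solution of `n'' + 2ikn' = φ` is given by the Volterra kernel. -/
theorem eq_integral_volterraKernel (hφ : HasRightMoment φ) (hc : Continuous φ) (hk : 0 ≤ k.im)
    {n p : ℝ → ℂ} (hn : ∀ x, HasDerivAt n (p x) x)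
    (hp : ∀ x, HasDerivAt p (φ x - 2 * Complex.I * k * p x) x)
    (hn0 : Tendsto n atTop (𝓝 0)) (hp0 : Tendsto p atTop (𝓝 0)) (x : ℝ) :
    n x = ∫ y in Set.Ioi x, volterraKernel k (y - x) * φ y := by
  set V : ℝ → ℂ := fun x => ∫ y in Set.Ioi x, volterraKernel k (y - x) * φ y
  set P : ℝ → ℂ := fun x => ∫ y in Set.Ioi x, phase k (y - x) * φ y
  have hV : ∀ x, HasDerivAt V (-P x) x := hasDerivAt_integral_volterraKernel hφ hc hk
  have hP : ∀ x, HasDerivAt P (-φ x - 2 * Complex.I * k * P x) x := hasDerivAt_integral_phase hφ hc hk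
  have hint : IntegrableOn (fun y : ℝ => (1 + |y|) * ‖φ y‖) (Set.Ioi 0) := by
    refine (hφ 0).norm.congr (Eventually.of_forall fun y => ?_)
    simp only
    rw [norm_mul, Complex.norm_real, Real.norm_of_nonneg (by positivity)]
  have htail : Tendsto (fun x => ∫ y in Set.Ioi x, (1 + |y|) * ‖φ y‖) atTop (𝓝 0) := by
    have h1 := tendsto_integral_Ioi_atTop ((integrable_indicator_iff measurableSet_Ioi).2 hint)
    refine h1.congr' ?_
    filter_upwards [eventually_ge_atTop 0] with x hx
    refine setIntegral_congr_fun measurableSet_Ioi fun y hy => ?_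
    exact Set.indicator_of_mem (hx.trans_lt hy) _
  have hbound : ∀ K : ℝ → ℝ → ℂ, (∀ x y, 0 ≤ x → x < y → ‖K x y‖ ≤ 1 + |y|) →
      Tendsto (fun x => ∫ y in Set.Ioi x, K x y * φ y) atTop (𝓝 0) := fun K hK => by
    refine squeeze_zero_norm' ?_ htail
    filter_upwards [eventually_ge_atTop 0] with x hx
    refine norm_integral_le_of_norm_le (hint.mono_set (Set.Ioi_subset_Ioi hx))
      ((ae_restrict_iff' measurableSet_Ioi).2 (Eventually.of_forall fun y hy => ?_))
    rw [norm_mul]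
    exact mul_le_mul_of_nonneg_right (hK x y hx hy) (norm_nonneg _)
  have hV0 : Tendsto V atTop (𝓝 0) := hbound _ fun x y hx hy => by
    refine (norm_volterraKernel_le hk (sub_nonneg.2 hy.le)).trans ?_
    linarith [le_abs_self y]
  have hP0 : Tendsto P atTop (𝓝 0) := hbound _ fun x y hx hy => by
    refine (norm_phase_le hk (sub_nonneg.2 hy.le)).trans ?_
    linarith [abs_nonneg y]
  have hd0 : Tendsto (fun x => n x - V x) atTop (𝓝 0) := by simpa using hn0.sub hV0
  -- The combination p + P + 2ik(n − V) is constant and tends to 0. Thus w = n − V satisfies w' =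
  -- −2ikw, and e^{2ikx}w is again a constant tending to 0.
  have he : ∀ x, p x + P x = -(2 * Complex.I * k) * (n x - V x) := fun x => by
    have h1 : ∀ x, HasDerivAt (fun x => p x + P x + 2 * Complex.I * k * (n x - V x)) 0 x :=
      fun x => (((hp x).add (hP x)).add (((hn x).sub (hV x)).const_mul _)).congr_deriv (by ring)
    have h2 : Tendsto (fun x => p x + P x + 2 * Complex.I * k * (n x - V x)) atTop (𝓝 0) := by
      simpa using (hp0.add hP0).add (hd0.const_mul (2 * Complex.I * k))
    have h3 := tendsto_nhds_unique (tendsto_const_nhds.congr fun y =>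
      is_const_of_deriv_eq_zero (fun x => (h1 x).differentiableAt) (fun x => (h1 x).deriv) x y) h2
    linear_combination h3
  have h4 : ∀ x, HasDerivAt (fun x => phase k x * (n x - V x)) 0 x := fun x => by
    refine ((hasDerivAt_phase k x).mul ((hn x).sub (hV x))).congr_deriv ?_
    have := he x
    simp only [Pi.sub_apply]
    linear_combination (phase k x) * this
  have h5 : Tendsto (fun x => phase k x * (n x - V x)) atTop (𝓝 0) := by
    refine squeeze_zero_norm' ?_ (tendsto_zero_iff_norm_tendsto_zero.1 hd0)
    filter_upwards [eventually_ge_atTop 0] with x hx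
    rw [norm_mul]
    exact mul_le_of_le_one_left (norm_nonneg _) (norm_phase_le hk hx)
  have h6 := tendsto_nhds_unique (tendsto_const_nhds.congr fun y =>
      is_const_of_deriv_eq_zero (fun x => (h4 x).differentiableAt) (fun x => (h4 x).deriv) x y) h5
  exact sub_eq_zero.1 ((mul_eq_zero.1 h6).resolve_left (Complex.exp_ne_zero _))

/-- Stability of the Volterra equation. -/
theorem IsShortRange.norm_le_of_volterra {v : ℝ → ℝ} (hv : IsShortRange v) (hk : 0 ≤ k.im)
    (hG : Integrable fun y : ℝ => (1 + |y|) * G y)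
    (h : ∀ y, ‖φ y‖ ≤ G y * leftWeight y) {z : ℝ → ℂ} {C : ℝ}
    (hz : ∀ x, ‖z x‖ ≤ C * leftWeight x)
    (heq : ∀ x, z x = (∫ y in Set.Ioi x, volterraKernel k (y - x) * φ y) + volterraOp v k z x)
    (x : ℝ) : ‖z x‖ ≤ 2 * (∫ y, (1 + |y|) * G y) * jostWeight v x := by
  refine hv.norm_le_of_le_volterra (integral_nonneg fun y => ?_) hz (fun x => ?_) hk x
  · exact mul_nonneg (by positivity) (nonneg_of_mul_nonneg_left ((norm_nonneg _).trans (h y))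
      (zero_lt_one.trans_le (one_le_leftWeight y)))
  · rw [heq x]
    exact (norm_add_le _ _).trans (add_le_add
      (norm_integral_volterraKernel_le hk hG h x) le_rfl)

end Source

/-! ### Potentials dominated together with their derivatives -/

/-- `v` and its derivatives up to order three are bounded by `g`, which has a first moment. -/
structure IsDominated (v g : ℝ → ℝ) : Prop where
  contDiff : ContDiff ℝ 3 v
  integrable : Integrable fun x : ℝ => (1 + |x|) * g x
  bound : ∀ x : ℝ, ∀ j : ℕ, j ≤ 3 → |iteratedDeriv j v x| ≤ g x

noncomputable section

/-- The right-hand side of the KdV equation. -/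
def kdvField (v : ℝ → ℝ) (x : ℝ) : ℝ := 6 * v x * iteratedDeriv 1 v x - iteratedDeriv 3 v x

/-- The time derivative of the Faddeev function along the KdV flow. -/
def faddeevFlow (v : ℝ → ℝ) (k : ℂ) (x : ℝ) : ℂ :=
  (-(2 * Complex.I * k) ^ 2 + 2 * v x) * faddeevDeriv v k x +
    (2 * Complex.I * k * v x - (iteratedDeriv 1 v x : ℝ)) * faddeev v k x

end

namespace IsDominated

variable {v g : ℝ → ℝ} {k : ℂ}

theorem nonneg (h : IsDominated v g) (x : ℝ) : 0 ≤ g x :=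
  (abs_nonneg _).trans (h.bound x 0 (by norm_num))

theorem integrable_self (h : IsDominated v g) : Integrable g := by
  have hc : Continuous fun x : ℝ => (1 + |x|)⁻¹ :=
    Continuous.inv₀ (by fun_prop) fun x => by positivity
  refine (h.integrable.bdd_mul (c := 1) hc.aestronglyMeasurable
    (Eventually.of_forall fun x => ?_)).congr (Eventually.of_forall fun x => ?_)
  · rw [Real.norm_of_nonneg (by positivity)]
    exact inv_le_one_of_one_le₀ (by linarith [abs_nonneg x])
  · have : 1 + |x| ≠ 0 := by positivity
    simp only
    field_simp

theorem continuous_iteratedDeriv (h : IsDominated v g) {j : ℕ} (hj : j ≤ 3) :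
    Continuous (iteratedDeriv j v) :=
  h.contDiff.continuous_iteratedDeriv j (by exact_mod_cast hj)

theorem hasDerivAt_iteratedDeriv (h : IsDominated v g) {j : ℕ} (hj : j < 3) (x : ℝ) :
    HasDerivAt (iteratedDeriv j v) (iteratedDeriv (j + 1) v x) x := by
  rw [iteratedDeriv_succ]
  exact (h.contDiff.differentiable_iteratedDeriv j (by exact_mod_cast hj) x).hasDerivAt

theorem integrable_iteratedDeriv (h : IsDominated v g) {j : ℕ} (hj : j ≤ 3) :
    Integrable (iteratedDeriv j v) :=
  h.integrable_self.mono' (h.continuous_iteratedDeriv hj).aestronglyMeasurable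
    (Eventually.of_forall fun x => h.bound x j hj)

theorem isShortRange (h : IsDominated v g) : IsShortRange v := by
  have hc := h.contDiff.continuous
  refine ⟨hc, h.integrable.mono' (Continuous.aestronglyMeasurable (by fun_prop))
    (Eventually.of_forall fun x => ?_)⟩
  rw [Real.norm_of_nonneg (by positivity)]
  have := h.bound x 0 (by norm_num)
  rw [iteratedDeriv_zero] at this
  gcongr

theorem hasDerivAt (h : IsDominated v g) (x : ℝ) : HasDerivAt v (iteratedDeriv 1 v x) x := by
  have := h.hasDerivAt_iteratedDeriv (j := 0) (by norm_num) x
  rwa [iteratedDeriv_zero] at this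

theorem tendsto_iteratedDeriv (h : IsDominated v g) {j : ℕ} (hj : j < 3) :
    Tendsto (iteratedDeriv j v) atTop (𝓝 0) :=
  tendsto_zero_of_hasDerivAt_of_integrableOn_Ioi (a := 0)
    (fun x _ => h.hasDerivAt_iteratedDeriv hj x) (h.integrable_iteratedDeriv hj).integrableOn
    (h.integrable_iteratedDeriv hj.le).integrableOn

theorem tendsto (h : IsDominated v g) : Tendsto v atTop (𝓝 0) := by
  simpa using h.tendsto_iteratedDeriv (j := 0) (by norm_num)

/-- The majorant g need not be bounded, so sup bounds for v and its lower derivatives come from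
integrating the next derivative from +∞. -/
theorem abs_iteratedDeriv_le (h : IsDominated v g) {j : ℕ} (hj : j < 3) (x : ℝ) :
    |iteratedDeriv j v x| ≤ ∫ y, g y := by
  have h1 := integral_Ioi_of_hasDerivAt_of_tendsto' (fun y (_ : y ∈ Set.Ici x) =>
    h.hasDerivAt_iteratedDeriv hj y) (h.integrable_iteratedDeriv hj).integrableOn
    (h.tendsto_iteratedDeriv hj)
  rw [zero_sub] at h1
  rw [← abs_neg, ← h1, ← Real.norm_eq_abs]
  exact (norm_integral_le_of_norm_le h.integrable_self.integrableOn
    (Eventually.of_forall fun y => h.bound y (j + 1) hj)).trans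
    (setIntegral_le_integral h.integrable_self (Eventually.of_forall h.nonneg))

theorem abs_le (h : IsDominated v g) (x : ℝ) : |v x| ≤ ∫ y, g y := by
  simpa using h.abs_iteratedDeriv_le (j := 0) (by norm_num) x

theorem abs_kdvField_le (h : IsDominated v g) (x : ℝ) :
    |kdvField v x| ≤ (6 * (∫ y, g y) + 1) * g x := by
  have h1 := h.abs_le x
  have h2 := h.bound x 1 (by norm_num)
  have h3 := h.bound x 3 le_rfl
  have h4 := h.nonneg x
  have hB : 0 ≤ ∫ y, g y := integral_nonneg h.nonneg
  unfold kdvField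
  refine (abs_sub _ _).trans ?_
  rw [abs_mul, abs_mul, abs_of_nonneg (by norm_num : (0 : ℝ) ≤ 6)]
  calc _ ≤ 6 * (∫ y, g y) * g x + g x := by gcongr
    _ = _ := by ring

theorem continuous_kdvField (h : IsDominated v g) : Continuous (kdvField v) := by
  have := h.contDiff.continuous
  have := h.continuous_iteratedDeriv (j := 1) (by norm_num)
  have := h.continuous_iteratedDeriv (j := 3) le_rfl
  unfold kdvField
  fun_prop

theorem firstMoment_le (h : IsDominated v g) : firstMoment v ≤ ∫ x, (1 + |x|) * g x := by
  refine integral_mono h.isShortRange.integrable h.integrable fun x => ?_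
  have := h.bound x 0 (by norm_num)
  rw [iteratedDeriv_zero] at this
  simp only
  gcongr

/-- The constant depends on g alone, hence is the same for all times in a bounded interval. -/
theorem norm_faddeev_le (h : IsDominated v g) (hk : 0 ≤ k.im) (x : ℝ) :
    ‖faddeev v k x‖ ≤ 2 * Real.exp (2 * ∫ y, (1 + |y|) * g y) * leftWeight x := by
  refine (h.isShortRange.norm_faddeev_le hk x).trans ?_
  rw [mul_assoc]
  have := one_le_leftWeight x
  have := h.firstMoment_le
  refine mul_le_mul_of_nonneg_left ((h.isShortRange.jostWeight_le x).trans ?_) zero_le_two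
  gcongr

theorem exists_norm_faddeevFlow_le (h : IsDominated v g) (hk : 0 ≤ k.im) :
    ∃ C : ℝ, ∀ x, ‖faddeevFlow v k x‖ ≤ C * leftWeight x := by
  set B := ∫ y, g y
  set D := 2 * ∫ y, (1 + |y|) * |v y| * Real.exp (2 * tailMoment v y)
  set A := 2 * Real.exp (2 * ∫ y, (1 + |y|) * g y)
  have hB : 0 ≤ B := integral_nonneg h.nonneg
  have hD : 0 ≤ D := mul_nonneg zero_le_two (integral_nonneg fun y => by positivity)
  refine ⟨(‖(2 * Complex.I * k) ^ 2‖ + 2 * B) * D + (‖2 * Complex.I * k‖ * B + B) * A,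
    fun x => ?_⟩
  have h1 := h.norm_faddeev_le hk x
  have h2 : ‖faddeevDeriv v k x‖ ≤ D := by
    refine (h.isShortRange.norm_faddeevDeriv_le hk x).trans ?_
    exact mul_le_mul_of_nonneg_left (setIntegral_le_integral h.isShortRange.integrable_weight
      (Eventually.of_forall fun y => by positivity)) zero_le_two
  have h3 := h.abs_le x
  have h4 := h.abs_iteratedDeriv_le (j := 1) (by norm_num) x
  have h5 := one_le_leftWeight x
  have h6 : ‖-(2 * Complex.I * k) ^ 2 + 2 * (v x : ℂ)‖ ≤ ‖(2 * Complex.I * k) ^ 2‖ + 2 * B := by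
    refine (norm_add_le _ _).trans ?_
    rw [norm_neg, norm_mul 2, Complex.norm_two, Complex.norm_real, Real.norm_eq_abs]
    gcongr
  have h7 : ‖2 * Complex.I * k * v x - (iteratedDeriv 1 v x : ℝ)‖ ≤
      ‖2 * Complex.I * k‖ * B + B := by
    refine (norm_sub_le _ _).trans ?_
    rw [norm_mul (2 * Complex.I * k), Complex.norm_real, Complex.norm_real, Real.norm_eq_abs,
      Real.norm_eq_abs]
    gcongr
  unfold faddeevFlow
  refine (norm_add_le _ _).trans ?_
  rw [norm_mul, norm_mul (2 * Complex.I * k * v x - (iteratedDeriv 1 v x : ℝ))]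
  calc _ ≤ (‖(2 * Complex.I * k) ^ 2‖ + 2 * B) * D +
      (‖2 * Complex.I * k‖ * B + B) * (A * leftWeight x) := by gcongr
    _ ≤ (‖(2 * Complex.I * k) ^ 2‖ + 2 * B) * D * leftWeight x +
      (‖2 * Complex.I * k‖ * B + B) * (A * leftWeight x) := by
        exact add_le_add (le_mul_of_one_le_right (by positivity) h5) le_rfl
    _ = _ := by ring

theorem continuous_faddeevFlow (h : IsDominated v g) (hk : 0 ≤ k.im) :
    Continuous (faddeevFlow v k) := by
  have := h.contDiff.continuous
  have := h.continuous_iteratedDeriv (j := 1) (by norm_num)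
  have := h.isShortRange.continuous_faddeev hk
  have := h.isShortRange.continuous_faddeevDeriv hk
  unfold faddeevFlow
  fun_prop

/-- The linearized Volterra equation. -/
theorem faddeevFlow_eq (h : IsDominated v g) (hk : 0 ≤ k.im) (x : ℝ) :
    HasRightMoment (fun y => v y * faddeevFlow v k y + kdvField v y * faddeev v k y) ∧
    faddeevFlow v k x = ∫ y in Set.Ioi x, volterraKernel k (y - x) *
      (v y * faddeevFlow v k y + kdvField v y * faddeev v k y) := by
  have hs := h.isShortRange
  have hcv := h.contDiff.continuous
  have hcm := hs.continuous_faddeev hk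
  have hcn := h.continuous_faddeevFlow hk
  have hcw := h.continuous_kdvField
  obtain ⟨C, hC⟩ := h.exists_norm_faddeevFlow_le hk
  set A := 2 * Real.exp (2 * ∫ y, (1 + |y|) * g y)
  set B := ∫ y, g y
  have hB : 0 ≤ B := integral_nonneg h.nonneg
  have hmom : HasRightMoment fun y => v y * faddeevFlow v k y + kdvField v y * faddeev v k y := by
    refine hasRightMoment_of_norm_le (G := fun y => (C + (6 * B + 1) * A) * g y) (by fun_prop)
      ((h.integrable.const_mul (C + (6 * B + 1) * A)).congr
        (Eventually.of_forall fun y => by simp only; ring)) fun y => ?_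
    have h1 := h.bound y 0 (by norm_num)
    rw [iteratedDeriv_zero] at h1
    have h2 := h.abs_kdvField_le y
    have h3 := h.norm_faddeev_le hk y
    have h0 := h.nonneg y
    refine (norm_add_le _ _).trans ?_
    rw [norm_mul, norm_mul, Complex.norm_real, Complex.norm_real, Real.norm_eq_abs,
      Real.norm_eq_abs]
    calc _ ≤ g y * (C * leftWeight y) + (6 * B + 1) * g y * (A * leftWeight y) := by
          gcongr
          exact hC y
      _ = _ := by ring
  refine ⟨hmom, ?_⟩
  have d0 := fun x => (h.hasDerivAt x).ofReal_comp
  have d1 := fun x => (h.hasDerivAt_iteratedDeriv (j := 1) (by norm_num) x).ofReal_comp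
  have d2 := fun x => (h.hasDerivAt_iteratedDeriv (j := 2) (by norm_num) x).ofReal_comp
  have dm := hs.hasDerivAt_faddeev hk
  have dm' := hs.hasDerivAt_faddeevDeriv hk
  set K := 2 * Complex.I * k with hK
  -- p is the x-derivative of the flow, with second derivatives of the Faddeev function eliminated.
  -- The second goal is the Lax compatibility condition n'' + 2ikn' = vn + (6vv' − v''')m.
  set p : ℝ → ℂ := fun x => (iteratedDeriv 1 v x : ℝ) * faddeevDeriv v k x +
    (-K ^ 2 + 2 * v x) * (v x * faddeev v k x - K * faddeevDeriv v k x) +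
    K * (iteratedDeriv 1 v x : ℝ) * faddeev v k x + K * v x * faddeevDeriv v k x -
    (iteratedDeriv 2 v x : ℝ) * faddeev v k x with hp
  refine eq_integral_volterraKernel hmom (by fun_prop) hk (p := p) (fun x => ?_) (fun x => ?_)
    ?_ ?_ x
  · refine (((((d0 x).const_mul 2).const_add (-K ^ 2)).mul (dm' x)).add
      ((((d0 x).const_mul K).sub (d1 x)).mul (dm x))).congr_deriv ?_
    simp only [hp, Pi.sub_apply]
    ring
  · refine (((((d1 x).mul (dm' x)).add ((((d0 x).const_mul 2).const_add (-K ^ 2)).mul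
      (((d0 x).mul (dm x)).sub ((dm' x).const_mul K)))).add
      (((d1 x).const_mul K).mul (dm x))).add (((d0 x).const_mul K).mul (dm' x))).sub
      ((d2 x).mul (dm x)) |>.congr_deriv ?_
    simp only [hp, faddeevFlow, kdvField, ← hK, Pi.sub_apply, Pi.mul_apply]
    push_cast
    ring
  all_goals
    have l0 : Tendsto (fun x => (v x : ℂ)) atTop (𝓝 0) :=
      (Complex.continuous_ofReal.tendsto' 0 0 (by simp)).comp h.tendsto
    have l1 : Tendsto (fun x => ((iteratedDeriv 1 v x : ℝ) : ℂ)) atTop (𝓝 0) :=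
      (Complex.continuous_ofReal.tendsto' 0 0 (by simp)).comp
        (h.tendsto_iteratedDeriv (j := 1) (by norm_num))
    have l2 : Tendsto (fun x => ((iteratedDeriv 2 v x : ℝ) : ℂ)) atTop (𝓝 0) :=
      (Complex.continuous_ofReal.tendsto' 0 0 (by simp)).comp
        (h.tendsto_iteratedDeriv (j := 2) (by norm_num))
    have lm := hs.tendsto_faddeev hk
    have lm' := hs.tendsto_faddeevDeriv hk
  · have := (((l0.const_mul 2).const_add (-K ^ 2)).mul lm').add
      (((l0.const_mul K).sub l1).mul lm)
    simp only [mul_zero, add_zero, sub_zero, mul_one] at this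
    exact this
  · have := ((((l1.mul lm').add (((l0.const_mul 2).const_add (-K ^ 2)).mul
      ((l0.mul lm).sub (lm'.const_mul K)))).add ((l1.const_mul K).mul lm)).add
      ((l0.const_mul K).mul lm')).sub (l2.mul lm)
    simp only [mul_zero, add_zero, sub_zero, mul_one] at this
    exact this

end IsDominated


/-! ### The evolution of the Jost solutions along the KdV flow -/

theorem iteratedDeriv_congr_neg {f : ℝ → ℝ} (j : ℕ) (x : ℝ) :
    iteratedDeriv j (fun y => f (-y)) x = (-1) ^ j * iteratedDeriv j f (-x) := by
  simpa using iteratedDeriv_comp_neg j f x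

namespace IsRapidlyDecreasingKdVSolution

variable {u : ℝ → ℝ → ℝ} {k : ℂ}

theorem exists_isDominated (hu : IsRapidlyDecreasingKdVSolution u) (T : ℝ) :
    ∃ g, ∀ t, |t| ≤ T → IsDominated (fun y => u y t) g := by
  obtain ⟨g, hg, h⟩ := hu.decay T
  exact ⟨g, fun t ht => ⟨hu.contDiff t, hg, fun x j hj => h t ht x j hj⟩⟩

theorem isDominated (hu : IsRapidlyDecreasingKdVSolution u) (t : ℝ) :
    ∃ g, IsDominated (fun y => u y t) g := by
  obtain ⟨g, h⟩ := hu.exists_isDominated |t|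
  exact ⟨g, h t le_rfl⟩

theorem isShortRange (hu : IsRapidlyDecreasingKdVSolution u) (t : ℝ) :
    IsShortRange fun y => u y t := by
  obtain ⟨g, h⟩ := hu.isDominated t
  exact h.isShortRange

theorem hasDerivAt (hu : IsRapidlyDecreasingKdVSolution u) (x t : ℝ) :
    HasDerivAt (fun s => u x s) (kdvField (fun y => u y t) x) t := by
  unfold kdvField
  rw [iteratedDeriv_one]
  exact hu.kdv x t

/-- The KdV equation is invariant under `(x, t) ↦ (-x, -t)`. -/
theorem reflect (hu : IsRapidlyDecreasingKdVSolution u) :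
    IsRapidlyDecreasingKdVSolution fun x t => u (-x) (-t) where
  contDiff t := (hu.contDiff (-t)).comp contDiff_neg
  kdv x t := by
    have h1 := (hu.hasDerivAt (-x) (-t)).comp_of_eq t (hasDerivAt_neg t) rfl
    refine h1.congr_deriv ?_
    rw [← iteratedDeriv_one, iteratedDeriv_congr_neg (f := fun y => u y (-t)) 1,
      iteratedDeriv_congr_neg (f := fun y => u y (-t)) 3]
    unfold kdvField
    ring
  decay T := by
    obtain ⟨g, hg, h⟩ := hu.decay T
    refine ⟨fun x => g (-x), by simpa using hg.comp_neg, fun t ht x j hj => ?_⟩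
    rw [iteratedDeriv_congr_neg (f := fun y => u y (-t)) j, abs_mul, abs_pow, abs_neg, abs_one,
      one_pow, one_mul]
    exact h (-t) (by rwa [abs_neg]) (-x) j hj

theorem abs_sub_le {g : ℝ → ℝ} {T : ℝ} (hu : IsRapidlyDecreasingKdVSolution u)
    (h : ∀ t, |t| ≤ T → IsDominated (fun y => u y t) g) {s t : ℝ} (hs : |s| ≤ T) (ht : |t| ≤ T)
    (x : ℝ) : |u x s - u x t| ≤ (6 * (∫ y, g y) + 1) * g x * |s - t| := by
  have h1 : Convex ℝ (Set.Icc (-T) T) := convex_Icc _ _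
  exact h1.norm_image_sub_le_of_norm_hasDerivWithin_le (f := fun s => u x s)
    (f' := fun t => kdvField (fun y => u y t) x) (fun r _ => (hu.hasDerivAt x r).hasDerivWithinAt)
    (fun r hr => (h r (abs_le.2 hr)).abs_kdvField_le x) (abs_le.1 ht) (abs_le.1 hs)

/-- The difference quotient minus the expected derivative `faddeevFlow` solves the Volterra equation
with a source whose weighted L¹ norm tends to 0 by dominated convergence; stability of the equation
then gives convergence. Only u itself is differentiated in t, never its x-derivatives. -/
theorem hasDerivAt_faddeev (hu : IsRapidlyDecreasingKdVSolution u) (hk : 0 ≤ k.im) (x t : ℝ) :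
    HasDerivAt (fun s => faddeev (fun y => u y s) k x) (faddeevFlow (fun y => u y t) k x) t := by
  obtain ⟨g, hg⟩ := hu.exists_isDominated (|t| + 1)
  have ht : |t| ≤ |t| + 1 := by linarith
  have h0 := hg t ht
  have hv := h0.isShortRange
  have hcv : Continuous fun y => u y t := hv.continuous
  set A := 2 * Real.exp (2 * ∫ y, (1 + |y|) * g y)
  set M := 6 * (∫ y, g y) + 1
  have hA : 0 ≤ A := by positivity
  have hM : 0 ≤ M := by
    have : 0 ≤ ∫ y, g y := integral_nonneg h0.nonneg
    positivity
  set m : ℝ → ℝ → ℂ := fun s => faddeev (fun y => u y s) k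
  set n : ℝ → ℂ := faddeevFlow (fun y => u y t) k
  have hI : ∀ c : ℝ, Integrable fun y : ℝ => (1 + |y|) * (c * g y) := fun c =>
    (h0.integrable.const_mul c).congr (Eventually.of_forall fun y => by simp only; ring)
  have hnear : ∀ᶠ s in 𝓝 t, |s| ≤ |t| + 1 := by
    have : ∀ᶠ s in 𝓝 t, |s| < |t| + 1 :=
      (continuous_abs.tendsto t).eventually_lt_const (by linarith)
    exact this.mono fun s hs => hs.le
  have hm : ∀ s, |s| ≤ |t| + 1 → ∀ y, ‖m s y‖ ≤ A * leftWeight y := fun s hs =>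
    (hg s hs).norm_faddeev_le hk
  have hcm : ∀ s, |s| ≤ |t| + 1 → Continuous (m s) := fun s hs =>
    (hg s hs).isShortRange.continuous_faddeev hk
  have hlip := fun s hs y => hu.abs_sub_le hg (s := s) hs ht y
  have hmul : ∀ r s, |r| ≤ |t| + 1 → |s| ≤ |t| + 1 → HasRightMoment fun y => u y r * m s y :=
    fun r s hr hs => by
      have := (hg r hr).isShortRange.continuous
      have := hcm s hs
      refine hasRightMoment_of_norm_le (G := fun y => A * g y) (by fun_prop) (hI A) fun y => ?_
      have h1 := (hg r hr).bound y 0 (by norm_num)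
      rw [iteratedDeriv_zero] at h1
      have := hm s hs y
      have := h0.nonneg y
      rw [norm_mul, Complex.norm_real, Real.norm_eq_abs]
      calc _ ≤ g y * (A * leftWeight y) := by gcongr
        _ = _ := by ring
  -- the difference of two Faddeev functions
  have hdiff : ∀ s, |s| ≤ |t| + 1 → ∀ x, m s x - m t x =
      (∫ y in Set.Ioi x, volterraKernel k (y - x) * ((u y s - u y t) * m s y)) +
        volterraOp (fun y => u y t) k (fun y => m s y - m t y) x := fun s hs x => by
    have e1 := (hg s hs).isShortRange.faddeev_eq hk x
    have e2 := hv.faddeev_eq hk x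
    have i1 := (hmul s s hs hs).integrableOn_volterraKernel hk x
    have i2 := (hmul t t ht ht).integrableOn_volterraKernel hk x
    have i3 := (hmul t s ht hs).integrableOn_volterraKernel hk x
    change m s x = 1 + ∫ y in Set.Ioi x, volterraKernel k (y - x) * (u y s * m s y) at e1
    change m t x = 1 + ∫ y in Set.Ioi x, volterraKernel k (y - x) * (u y t * m t y) at e2
    have e3 : (∫ y in Set.Ioi x, volterraKernel k (y - x) * ((u y s - u y t) * m s y)) =
        (∫ y in Set.Ioi x, volterraKernel k (y - x) * (u y s * m s y)) -
          ∫ y in Set.Ioi x, volterraKernel k (y - x) * (u y t * m s y) := by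
      rw [← integral_sub i1 i3]
      exact integral_congr_ae (Eventually.of_forall fun y => by simp only; ring)
    have e4 : volterraOp (fun y => u y t) k (fun y => m s y - m t y) x =
        (∫ y in Set.Ioi x, volterraKernel k (y - x) * (u y t * m s y)) -
          ∫ y in Set.Ioi x, volterraKernel k (y - x) * (u y t * m t y) := by
      rw [← integral_sub i3 i2]
      exact integral_congr_ae (Eventually.of_forall fun y => by simp only; ring)
    rw [e3, e4, e1, e2]
    ring
  -- continuity in time
  have hcont : ∀ y, Tendsto (fun s => m s y) (𝓝 t) (𝓝 (m t y)) := fun y => by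
    rw [tendsto_iff_norm_sub_tendsto_zero]
    have hlim : Tendsto (fun s => 2 * (M * A * (∫ y, (1 + |y|) * g y) * |s - t|) *
        jostWeight (fun y => u y t) y) (𝓝 t) (𝓝 0) :=
      Continuous.tendsto' (by fun_prop) _ _ (by simp)
    refine squeeze_zero' (Eventually.of_forall fun s => norm_nonneg _) ?_ hlim
    filter_upwards [hnear] with s hs
    have := hv.norm_le_of_volterra (φ := fun y => (u y s - u y t) * m s y)
      (G := fun y => M * A * |s - t| * g y) (z := fun y => m s y - m t y) (C := 2 * A) hk
      (hI _) (fun y => ?_) (fun y => ?_) (hdiff s hs) y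
    · refine this.trans_eq ?_
      have : (∫ y, (1 + |y|) * (M * A * |s - t| * g y)) =
          M * A * |s - t| * ∫ y, (1 + |y|) * g y := by
        rw [← integral_const_mul]
        exact integral_congr_ae (Eventually.of_forall fun y => by simp only; ring)
      rw [this]
      ring
    · have h1 := hlip s hs y
      have := hm s hs y
      have := h0.nonneg y
      rw [norm_mul, ← Complex.ofReal_sub, Complex.norm_real, Real.norm_eq_abs]
      calc _ ≤ M * g y * |s - t| * (A * leftWeight y) := by gcongr
        _ = _ := by ring
    · refine (norm_sub_le _ _).trans ?_
      linarith [hm s hs y, hm t ht y]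
  -- the difference quotient
  set β : ℝ → ℝ → ℂ := fun s y => ((s - t : ℝ) : ℂ)⁻¹ * ((u y s - u y t) * m s y) -
    kdvField (fun y => u y t) y * m t y with hβ
  have hβ_le : ∀ s, |s| ≤ |t| + 1 → ∀ y, ‖β s y‖ ≤ 2 * M * A * g y * leftWeight y :=
    fun s hs y => by
      have h1 := hlip s hs y
      have h2 := hm s hs y
      have h3 := hm t ht y
      have h4 := h0.abs_kdvField_le y
      have h5 := h0.nonneg y
      have h6 := one_le_leftWeight y
      have h7 : ‖((s - t : ℝ) : ℂ)⁻¹ * ((u y s - u y t) * m s y)‖ ≤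
          M * g y * (A * leftWeight y) := by
        rw [norm_mul, norm_mul, norm_inv, ← Complex.ofReal_sub, Complex.norm_real,
          Complex.norm_real, Real.norm_eq_abs, Real.norm_eq_abs, ← mul_assoc]
        have h8 : |s - t|⁻¹ * |u y s - u y t| ≤ M * g y := by
          rcases eq_or_ne s t with rfl | hst
          · simp only [sub_self, abs_zero, mul_zero]; positivity
          · have : 0 < |s - t| := abs_pos.2 (sub_ne_zero.2 hst)
            rw [inv_mul_le_iff₀ this]
            linarith
        gcongr
      have h8 : ‖(kdvField (fun y => u y t) y : ℂ) * m t y‖ ≤ M * g y * (A * leftWeight y) := by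
        rw [norm_mul, Complex.norm_real, Real.norm_eq_abs]
        gcongr
      refine (norm_sub_le _ _).trans ((add_le_add h7 h8).trans_eq (by ring))
  have hβ_cont : ∀ s, |s| ≤ |t| + 1 → Continuous (β s) := fun s hs => by
    have := (hg s hs).isShortRange.continuous
    have := hcm s hs
    have := hcm t ht
    have := h0.continuous_kdvField
    rw [hβ]
    fun_prop
  -- The smallest G allowed in `norm_le_of_volterra`; its first moment has to go to 0.
  set G : ℝ → ℝ → ℝ := fun s y => ‖β s y‖ / leftWeight y with hG
  have hlw : ∀ y, 0 < leftWeight y := fun y => zero_lt_one.trans_le (one_le_leftWeight y)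
  have hG_meas : ∀ s, |s| ≤ |t| + 1 →
      AEStronglyMeasurable (fun y => (1 + |y|) * G s y) volume := fun s hs => by
    have h1 := (hβ_cont s hs).norm
    have h2 : Continuous leftWeight := by unfold leftWeight; fun_prop
    have h3 : Continuous (G s) := h1.div h2 fun y => (hlw y).ne'
    exact Continuous.aestronglyMeasurable (by fun_prop)
  have hG_le : ∀ s, |s| ≤ |t| + 1 → ∀ y, ‖(1 + |y|) * G s y‖ ≤ (1 + |y|) * (2 * M * A * g y) :=
    fun s hs y => by
      have : 0 ≤ G s y := div_nonneg (norm_nonneg _) (hlw y).le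
      rw [Real.norm_of_nonneg (by positivity)]
      gcongr
      exact (div_le_iff₀ (hlw y)).2 (hβ_le s hs y)
  have hε : Tendsto (fun s => ∫ y, (1 + |y|) * G s y) (𝓝[≠] t) (𝓝 0) := by
    have h1 := tendsto_integral_filter_of_dominated_convergence (μ := volume) (l := 𝓝[≠] t)
      (F := fun s y => (1 + |y|) * G s y) (f := fun _ => 0) _
      ((hnear.filter_mono nhdsWithin_le_nhds).mono hG_meas)
      ((hnear.filter_mono nhdsWithin_le_nhds).mono fun s hs => Eventually.of_forall (hG_le s hs))
      (hI _) (Eventually.of_forall fun y => ?_)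
    · simpa using h1
    · have h2 : Tendsto (fun s => ((s - t : ℝ) : ℂ)⁻¹ * (u y s - u y t)) (𝓝[≠] t)
          (𝓝 (kdvField (fun y => u y t) y)) := by
        have := (hasDerivAt_iff_tendsto_slope.1 (hu.hasDerivAt y t))
        refine ((Complex.continuous_ofReal.tendsto _).comp this).congr fun s => ?_
        simp [slope_def_field, div_eq_inv_mul]
      have h3 : Tendsto (fun s => β s y) (𝓝[≠] t) (𝓝 0) := by
        have := (h2.mul ((hcont y).mono_left nhdsWithin_le_nhds)).sub
          (tendsto_const_nhds (x := (kdvField (fun y => u y t) y : ℂ) * m t y))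
        rw [sub_self] at this
        exact this.congr fun s => by simp only [hβ]; ring
      have := (h3.norm.div_const (leftWeight y)).const_mul (1 + |y|)
      simpa using this
  obtain ⟨C, hC⟩ := h0.exists_norm_faddeevFlow_le hk
  obtain ⟨hn1, hn2⟩ : HasRightMoment (fun y => u y t * n y + kdvField (fun y => u y t) y * m t y) ∧
      ∀ x, n x = ∫ y in Set.Ioi x, volterraKernel k (y - x) *
        (u y t * n y + kdvField (fun y => u y t) y * m t y) :=
    ⟨(h0.faddeevFlow_eq hk 0).1, fun x => (h0.faddeevFlow_eq hk x).2⟩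
  have hcn : Continuous n := h0.continuous_faddeevFlow hk
  rw [hasDerivAt_iff_tendsto_slope, tendsto_iff_norm_sub_tendsto_zero]
  have hlim := (hε.const_mul 2).mul_const (jostWeight (fun y => u y t) x)
  rw [mul_zero, zero_mul] at hlim
  refine squeeze_zero' (Eventually.of_forall fun s => norm_nonneg _) ?_ hlim
  filter_upwards [hnear.filter_mono nhdsWithin_le_nhds, self_mem_nhdsWithin] with s hs hst
  set z : ℝ → ℂ := fun y => ((s - t : ℝ) : ℂ)⁻¹ * (m s y - m t y) - n y with hz
  have hslope : slope (fun s => m s x) t s = ((s - t : ℝ) : ℂ)⁻¹ * (m s x - m t x) := by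
    rw [slope_def_module, Complex.real_smul, Complex.ofReal_inv]
  have hz_le : ∀ y, ‖z y‖ ≤ (‖((s - t : ℝ) : ℂ)⁻¹‖ * (2 * A) + C) * leftWeight y := fun y => by
    refine (norm_sub_le _ _).trans ?_
    rw [norm_mul, add_mul]
    refine add_le_add ?_ (hC y)
    rw [mul_assoc]
    refine mul_le_mul_of_nonneg_left ((norm_sub_le _ _).trans ?_) (norm_nonneg _)
    linarith [hm s hs y, hm t ht y]
  have hun : HasRightMoment fun y => u y t * n y := by
    refine hasRightMoment_of_norm_le (G := fun y => C * g y) (by fun_prop) (hI C) fun y => ?_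
    have h1 := h0.bound y 0 (by norm_num)
    rw [iteratedDeriv_zero] at h1
    have := h0.nonneg y
    rw [norm_mul, Complex.norm_real, Real.norm_eq_abs]
    calc _ ≤ g y * (C * leftWeight y) := by gcongr; exact hC y
      _ = _ := by ring
  have hz_eq : ∀ x, z x = (∫ y in Set.Ioi x, volterraKernel k (y - x) * β s y) +
      volterraOp (fun y => u y t) k z x := fun x => by
    have i1 := (hmul s s hs hs).integrableOn_volterraKernel hk x
    have i2 := (hmul t t ht ht).integrableOn_volterraKernel hk x
    have i3 := (hmul t s ht hs).integrableOn_volterraKernel hk x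
    have i4 := hn1.integrableOn_volterraKernel hk x
    have i5 := hun.integrableOn_volterraKernel hk x
    set c : ℂ := ((s - t : ℝ) : ℂ)⁻¹
    have i6 : IntegrableOn (fun y => c * (volterraKernel k (y - x) * (u y s * m s y) -
      volterraKernel k (y - x) * (u y t * m s y))) (Set.Ioi x) := (i1.sub i3).const_mul c
    have i7 : IntegrableOn (fun y => c * (volterraKernel k (y - x) * (u y t * m s y) -
      volterraKernel k (y - x) * (u y t * m t y))) (Set.Ioi x) := (i3.sub i2).const_mul c
    have i8 : IntegrableOn (fun y => volterraKernel k (y - x) *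
        (u y t * n y + kdvField (fun y => u y t) y * m t y) -
      volterraKernel k (y - x) * (u y t * n y)) (Set.Ioi x) := i4.sub i5
    have e3 : (∫ y in Set.Ioi x, volterraKernel k (y - x) * ((u y s - u y t) * m s y)) =
        (∫ y in Set.Ioi x, volterraKernel k (y - x) * (u y s * m s y)) -
          ∫ y in Set.Ioi x, volterraKernel k (y - x) * (u y t * m s y) := by
      rw [← integral_sub i1 i3]
      exact integral_congr_ae (Eventually.of_forall fun y => by simp only; ring)
    have e4 : volterraOp (fun y => u y t) k (fun y => m s y - m t y) x =
        (∫ y in Set.Ioi x, volterraKernel k (y - x) * (u y t * m s y)) -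
          ∫ y in Set.Ioi x, volterraKernel k (y - x) * (u y t * m t y) := by
      rw [← integral_sub i3 i2]
      exact integral_congr_ae (Eventually.of_forall fun y => by simp only; ring)
    have e5 : (∫ y in Set.Ioi x, volterraKernel k (y - x) * β s y) =
        c * ((∫ y in Set.Ioi x, volterraKernel k (y - x) * (u y s * m s y)) -
          ∫ y in Set.Ioi x, volterraKernel k (y - x) * (u y t * m s y)) -
        ((∫ y in Set.Ioi x, volterraKernel k (y - x) *
          (u y t * n y + kdvField (fun y => u y t) y * m t y)) -
          ∫ y in Set.Ioi x, volterraKernel k (y - x) * (u y t * n y)) := by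
      rw [← integral_sub i1 i3, ← integral_sub i4 i5, ← integral_const_mul,
        ← integral_sub i6 i8]
      exact integral_congr_ae (Eventually.of_forall fun y => by
        simp only [hβ, c]; ring)
    have e6 : volterraOp (fun y => u y t) k z x =
        c * ((∫ y in Set.Ioi x, volterraKernel k (y - x) * (u y t * m s y)) -
          ∫ y in Set.Ioi x, volterraKernel k (y - x) * (u y t * m t y)) -
        ∫ y in Set.Ioi x, volterraKernel k (y - x) * (u y t * n y) := by
      rw [← integral_sub i3 i2, ← integral_const_mul, ← integral_sub i7 i5]
      exact integral_congr_ae (Eventually.of_forall fun y => by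
        simp only [hz, c]; ring)
    have e7 := hdiff s hs x
    rw [e3, e4] at e7
    have e8 := hn2 x
    rw [e5, e6, ← e8]
    simp only [hz]
    rw [e7]
    ring
  rw [hslope]
  refine hv.norm_le_of_volterra (φ := β s) (G := G s) hk ?_ (fun y => ?_) hz_le hz_eq x
  · exact (hI (2 * M * A)).mono' (hG_meas s hs) (Eventually.of_forall (hG_le s hs))
  · rw [hG]
    exact (div_mul_cancel₀ _ (hlw y).ne').ge

theorem hasDerivAt_jostPlus (hu : IsRapidlyDecreasingKdVSolution u) (hk : 0 ≤ k.im) (x t : ℝ) :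
    HasDerivAt (fun s => jostPlus (fun y => u y s) k x)
      ((4 * k ^ 2 + 2 * u x t) * deriv (jostPlus (fun y => u y t) k) x -
        ((deriv (fun y => u y t) x : ℝ) + 4 * Complex.I * k ^ 3) *
          jostPlus (fun y => u y t) k x) t := by
  have h1 : (fun s => jostPlus (fun y => u y s) k x) =
      fun s => Complex.exp (Complex.I * k * x) * faddeev (fun y => u y s) k x := by
    funext s
    rw [(hu.isShortRange s).jostPlus_eq hk]
    rfl
  rw [h1, (hu.isShortRange t).deriv_jostPlus hk, (hu.isShortRange t).jostPlus_eq hk]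
  refine ((hu.hasDerivAt_faddeev hk x t).const_mul _).congr_deriv ?_
  unfold faddeevFlow psiPlus
  rw [iteratedDeriv_one]
  linear_combination -4 * k ^ 2 * faddeevDeriv (fun y => u y t) k x *
    Complex.exp (Complex.I * k * x) * Complex.I_sq

/-- Reflection of the line preserves KdV only together with time reversal; this is why the term 4ik³
changes sign relative to ψ₊. -/
theorem hasDerivAt_jostMinus (hu : IsRapidlyDecreasingKdVSolution u) (hk : 0 ≤ k.im) (x t : ℝ) :
    HasDerivAt (fun s => jostMinus (fun y => u y s) k x)
      ((4 * k ^ 2 + 2 * u x t) * deriv (jostMinus (fun y => u y t) k) x -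
        ((deriv (fun y => u y t) x : ℝ) - 4 * Complex.I * k ^ 3) *
          jostMinus (fun y => u y t) k x) t := by
  have h1 : ∀ s, jostMinus (fun y => u y s) k =
      fun x => jostPlus (fun y => u (-y) s) k (-x) := fun s => by
    funext x
    exact (hu.isShortRange s).jostMinus_comp_neg hk x
  have h2 : (fun s => jostMinus (fun y => u y s) k x) =
      fun s => jostPlus (fun y => u (-y) (- -s)) k (-x) := by
    funext s
    rw [h1, neg_neg]
  have h3 : deriv (jostMinus (fun y => u y t) k) x =
      -deriv (jostPlus (fun y => u (-y) t) k) (-x) := by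
    rw [h1, deriv_comp_neg]
  have h4 : deriv (fun y => u (-y) t) (-x) = - deriv (fun y => u y t) x := by
    rw [deriv_comp_neg (fun y => u y t), neg_neg]
  have h := (hu.reflect.hasDerivAt_jostPlus hk (-x) (-t)).scomp_of_eq t (hasDerivAt_neg t) rfl
  rw [h2, h3, h1]
  refine h.congr_deriv ?_
  simp only [neg_neg, h4, neg_smul, one_smul]
  push_cast
  ring

end IsRapidlyDecreasingKdVSolution


/-! ### The evolution of the scattering data -/

section Evolution

variable {f₁ f₂ f₃ : ℝ → ℝ → ℂ} {a b : ℝ → ℝ → ℂ} {α β : ℝ → ℂ}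

/-- If three functions obey the same first order evolution equation, the coefficients which express
one of them through the two others are constant. -/
theorem coeff_eq_of_evolution
    (h₁ : ∀ t x, HasDerivAt (fun s => f₁ s x) (a t x * deriv (f₁ t) x + b t x * f₁ t x) t)
    (h₂ : ∀ t x, HasDerivAt (fun s => f₂ s x) (a t x * deriv (f₂ t) x + b t x * f₂ t x) t)
    (h₃ : ∀ t x, HasDerivAt (fun s => f₃ s x) (a t x * deriv (f₃ t) x + b t x * f₃ t x) t)
    (d₁ : ∀ t, Differentiable ℝ (f₁ t)) (d₂ : ∀ t, Differentiable ℝ (f₂ t))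
    (hw : ∀ t, ∃ x y, f₁ t x * f₂ t y - f₁ t y * f₂ t x ≠ 0)
    (h : ∀ t x, f₃ t x = α t * f₁ t x + β t * f₂ t x) (t s : ℝ) : α t = α s ∧ β t = β s := by
  have key : ∀ t, HasDerivAt α 0 t ∧ HasDerivAt β 0 t := fun t => by
    obtain ⟨x, y, hxy⟩ := hw t
    have hd := ((h₁ t x).mul (h₂ t y)).sub ((h₁ t y).mul (h₂ t x))
    have hne : ∀ᶠ s in 𝓝 t, f₁ s x * f₂ s y - f₁ s y * f₂ s x ≠ 0 :=
      hd.continuousAt.eventually_ne hxy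
    -- Cramer's rule at the two points x, y: differentiability of the coefficients is obtained, not
    -- assumed.
    have hα := (((h₃ t x).mul (h₂ t y)).sub ((h₃ t y).mul (h₂ t x))).div hd hxy
    have hβ := (((h₁ t x).mul (h₃ t y)).sub ((h₁ t y).mul (h₃ t x))).div hd hxy
    have hα' := hα.congr_of_eventuallyEq (f₁ := α) <| hne.mono fun s hs => by
      simp only [Pi.sub_apply, Pi.mul_apply, Pi.div_apply]
      rw [eq_div_iff hs, h s x, h s y]
      ring
    have hβ' := hβ.congr_of_eventuallyEq (f₁ := β) <| hne.mono fun s hs => by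
      simp only [Pi.sub_apply, Pi.mul_apply, Pi.div_apply]
      rw [eq_div_iff hs, h s x, h s y]
      ring
    generalize hα1 : (_ : ℂ) / (_ : ℂ) = α' at hα'
    generalize hβ1 : (_ : ℂ) / (_ : ℂ) = β' at hβ'
    -- The evolution is linear, so when the relation is differentiated in t all other terms cancel.
    have hlin : ∀ z, α' * f₁ t z + β' * f₂ t z = 0 := fun z => by
      have e1 := (hα'.mul (h₁ t z)).add (hβ'.mul (h₂ t z))
      have e2 : HasDerivAt (fun s => f₃ s z) _ t := e1.congr_of_eventuallyEq
        (Eventually.of_forall fun s => h s z)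
      have e3 := (h₃ t z).unique e2
      have e4 : deriv (f₃ t) z = α t * deriv (f₁ t) z + β t * deriv (f₂ t) z := by
        have : f₃ t = fun z => α t * f₁ t z + β t * f₂ t z := funext (h t)
        rw [this]
        exact (((d₁ t z).hasDerivAt.const_mul _).add ((d₂ t z).hasDerivAt.const_mul _)).deriv
      rw [e4, h t z] at e3
      linear_combination -e3
    have hα0 : α' = 0 := by
      refine (mul_eq_zero.1 ?_).resolve_right hxy
      linear_combination (f₂ t y) * hlin x - (f₂ t x) * hlin y
    have hβ0 : β' = 0 := by
      refine (mul_eq_zero.1 ?_).resolve_right hxy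
      linear_combination (f₁ t x) * hlin y - (f₁ t y) * hlin x
    rw [hα0] at hα'
    rw [hβ0] at hβ'
    exact ⟨hα', hβ'⟩
  exact ⟨is_const_of_deriv_eq_zero (fun t => (key t).1.differentiableAt) (fun t => (key t).1.deriv)
    t s, is_const_of_deriv_eq_zero (fun t => (key t).2.differentiableAt)
    (fun t => (key t).2.deriv) t s⟩

theorem ratio_eq_of_evolution
    (h₁ : ∀ t x, HasDerivAt (fun s => f₁ s x) (a t x * deriv (f₁ t) x + b t x * f₁ t x) t)
    (h₃ : ∀ t x, HasDerivAt (fun s => f₃ s x) (a t x * deriv (f₃ t) x + b t x * f₃ t x) t)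
    (d₁ : ∀ t, Differentiable ℝ (f₁ t)) (hw : ∀ t, f₁ t ≠ 0)
    (h : ∀ t x, f₃ t x = α t * f₁ t x) (t s : ℝ) : α t = α s := by
  have key : ∀ t, HasDerivAt α 0 t := fun t => by
    obtain ⟨x, hx⟩ := Function.ne_iff.1 (hw t)
    have hα := (h₃ t x).div (h₁ t x) hx
    refine (hα.congr_of_eventuallyEq (f₁ := α) ?_).congr_deriv ?_
    · refine ((h₁ t x).continuousAt.eventually_ne hx).mono fun s hs => ?_
      simp only [Pi.div_apply]
      rw [eq_div_iff hs, h s x]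
    · have e4 : deriv (f₃ t) x = α t * deriv (f₁ t) x := by
        have : f₃ t = fun z => α t * f₁ t z := funext (h t)
        rw [this]
        exact ((d₁ t x).hasDerivAt.const_mul _).deriv
      rw [e4, h t x]
      ring
  exact is_const_of_deriv_eq_zero (fun t => (key t).differentiableAt) (fun t => (key t).deriv) t s

end Evolution

theorem SolvesSchrodinger.differentiable {v : ℝ → ℝ} {E : ℂ} {f : ℝ → ℂ}
    (hf : SolvesSchrodinger v E f) : Differentiable ℝ f := hf.1.differentiable (by norm_num)

/-- The Wronskian at x is the derivative in y of the two-point determinant at y = x. -/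
theorem exists_det_ne_zero_of_wronskian_ne_zero {f g : ℝ → ℂ} (hf : Differentiable ℝ f)
    (hg : Differentiable ℝ g) {x : ℝ} (h : wronskian f g x ≠ 0) :
    ∃ x y, f x * g y - f y * g x ≠ 0 := by
  by_contra! hc
  apply h
  have h1 : HasDerivAt (fun y => f x * g y - f y * g x) (wronskian f g x) x :=
    ((hg x).hasDerivAt.const_mul _).sub ((hf x).hasDerivAt.mul_const _)
  have h2 : (fun y => f x * g y - f y * g x) = fun _ => 0 := funext fun y => hc x y
  rw [h2] at h1
  exact h1.unique (hasDerivAt_const x 0)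

theorem hasDerivAt_cexp_mul {f : ℝ → ℂ} {f' c : ℂ} {t : ℝ} (h : HasDerivAt f f' t) :
    HasDerivAt (fun s : ℝ => Complex.exp (c * s) * f s)
      (Complex.exp (c * t) * (f' + c * f t)) t := by
  have h1 : HasDerivAt (fun s : ℝ => Complex.exp (c * s)) (Complex.exp (c * t) * (c * 1)) t :=
    ((hasDerivAt_id t).ofReal_comp.const_mul c).cexp
  exact (h1.mul h).congr_deriv (by ring)

namespace IsRapidlyDecreasingKdVSolution

variable {u : ℝ → ℝ → ℝ} {k : ℂ}

/-- The exponential absorbs the term 4ik³. What is left depends on k only through k², so ψ₊(k),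
ψ₊(−k) and ψ₋(k) fall under one and the same evolution equation. -/
theorem hasDerivAt_gauge_jostPlus (hu : IsRapidlyDecreasingKdVSolution u) (hk : 0 ≤ k.im)
    (t x : ℝ) :
    HasDerivAt (fun s : ℝ => Complex.exp (4 * Complex.I * k ^ 3 * s) *
        jostPlus (fun y => u y s) k x)
      ((4 * k ^ 2 + 2 * u x t) * deriv (fun x => Complex.exp (4 * Complex.I * k ^ 3 * t) *
        jostPlus (fun y => u y t) k x) x +
        -(deriv (fun y => u y t) x : ℝ) * (Complex.exp (4 * Complex.I * k ^ 3 * t) *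
          jostPlus (fun y => u y t) k x)) t := by
  refine (hasDerivAt_cexp_mul (hu.hasDerivAt_jostPlus hk x t)).congr_deriv ?_
  have := ((((hu.isShortRange t).solves_jostPlus hk).differentiable x).hasDerivAt.const_mul
    (Complex.exp (4 * Complex.I * k ^ 3 * t))).deriv
  rw [this]
  ring

theorem hasDerivAt_gauge_jostMinus (hu : IsRapidlyDecreasingKdVSolution u) (hk : 0 ≤ k.im)
    (t x : ℝ) :
    HasDerivAt (fun s : ℝ => Complex.exp (-(4 * Complex.I * k ^ 3) * s) *
        jostMinus (fun y => u y s) k x)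
      ((4 * k ^ 2 + 2 * u x t) * deriv (fun x => Complex.exp (-(4 * Complex.I * k ^ 3) * t) *
        jostMinus (fun y => u y t) k x) x +
        -(deriv (fun y => u y t) x : ℝ) * (Complex.exp (-(4 * Complex.I * k ^ 3) * t) *
          jostMinus (fun y => u y t) k x)) t := by
  refine (hasDerivAt_cexp_mul (hu.hasDerivAt_jostMinus hk x t)).congr_deriv ?_
  have := ((((hu.isShortRange t).solves_jostMinus hk).differentiable x).hasDerivAt.const_mul
    (Complex.exp (-(4 * Complex.I * k ^ 3) * t))).deriv
  rw [this]
  ring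

/-- The scattering relation is solved for ψ₋ in terms of ψ₊(k) and ψ₊(−k) = ψ̄₊(k). After gauging,
its coefficients are (r/t)e^{−8ik³t} and 1/t, both constant in time. -/
theorem scattering_evolution (hu : IsRapidlyDecreasingKdVSolution u) {k : ℝ} (hk0 : k ≠ 0)
    (t : ℝ) : jostWronskian (fun y => u y t) k = jostWronskian (fun y => u y 0) k ∧
      reflection (fun y => u y t) k =
        reflection (fun y => u y 0) k * Complex.exp (8 * Complex.I * (k : ℂ) ^ 3 * t) := by
  have him : 0 ≤ (k : ℂ).im := by simp
  have him' : 0 ≤ (-(k : ℂ)).im := by simp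
  have hkc : (k : ℂ) ≠ 0 := Complex.ofReal_ne_zero.2 hk0
  have hs := hu.isShortRange
  have hT : ∀ s, transmissionBdry (fun y => u y s) k ≠ 0 := fun s => by
    rw [transmissionBdry_of_ne _ hkc]
    exact div_ne_zero (by simp [hkc]) ((hs s).jostWronskian_ne_zero_of_real hk0)
  set c : ℂ := 4 * Complex.I * (k : ℂ) ^ 3 with hc
  have key := coeff_eq_of_evolution
    (f₁ := fun s x => Complex.exp (c * s) * jostPlus (fun y => u y s) k x)
    (f₂ := fun s x => Complex.exp (-c * s) * jostPlus (fun y => u y s) (-(k : ℂ)) x)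
    (f₃ := fun s x => Complex.exp (-c * s) * jostMinus (fun y => u y s) k x)
    (a := fun s x => 4 * (k : ℂ) ^ 2 + 2 * u x s)
    (b := fun s x => -(deriv (fun y => u y s) x : ℝ))
    (α := fun s => reflection (fun y => u y s) k / transmissionBdry (fun y => u y s) k *
      Complex.exp (-c * s) ^ 2)
    (β := fun s => (transmissionBdry (fun y => u y s) k)⁻¹)
    (fun s x => hu.hasDerivAt_gauge_jostPlus him s x)
    (fun s x => by
      have := hu.hasDerivAt_gauge_jostPlus him' s x
      simp only [neg_sq, Odd.neg_pow (by decide : Odd 3), mul_neg] at this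
      exact this)
    (fun s x => hu.hasDerivAt_gauge_jostMinus him s x)
    (fun s => ((hs s).solves_jostPlus him).differentiable.const_mul _)
    (fun s => ((hs s).solves_jostPlus him').differentiable.const_mul _)
    (fun s => by
      refine exists_det_ne_zero_of_wronskian_ne_zero (x := 0)
        (((hs s).solves_jostPlus him).differentiable.const_mul _)
        (((hs s).solves_jostPlus him').differentiable.const_mul _) ?_
      rw [wronskian_mul_left, wronskian_neg_swap, wronskian_mul_left]
      have h1 : jostPlus (fun y => u y s) (-(k : ℂ)) =
          fun x => (starRingEnd ℂ) (jostPlus (fun y => u y s) k x) :=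
        funext fun x => (hs s).jostPlus_neg_ofReal k x
      rw [h1, (hs s).wronskian_conj_jostPlus]
      simp [hkc])
    (fun s x => by
      have h1 := (hs s).scattering_relation k x
      have h2 := hT s
      have h3 : Complex.exp (-(c * s)) * Complex.exp (c * s) = 1 := by
        rw [← Complex.exp_add]; simp
      rw [(hs s).jostPlus_neg_ofReal]
      field_simp
      linear_combination h1 - reflection (fun y => u y s) k * jostPlus (fun y => u y s) k x * h3)
    t 0
  obtain ⟨hα, hβ⟩ := key
  have hβ' : transmissionBdry (fun y => u y t) k = transmissionBdry (fun y => u y 0) k :=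
    inv_injective hβ
  constructor
  · rw [transmissionBdry_of_ne _ hkc, transmissionBdry_of_ne _ hkc] at hβ'
    rw [div_eq_mul_inv, div_eq_mul_inv] at hβ'
    exact inv_injective (mul_left_cancel₀ (by simp [hkc]) hβ')
  · simp only [hβ'] at hα
    have h0 := hT 0
    have h3 : Complex.exp (-(c * t)) ^ 2 * Complex.exp (8 * Complex.I * (k : ℂ) ^ 3 * t) = 1 := by
      rw [← Complex.exp_nat_mul, ← Complex.exp_add, ← Complex.exp_zero, hc]
      congr 1
      push_cast
      ring
    simp only [Complex.ofReal_zero, mul_zero, Complex.exp_zero, one_pow, mul_one] at hα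
    field_simp at hα
    rw [← hα, mul_assoc, h3, mul_one]

theorem reflection_eq (hu : IsRapidlyDecreasingKdVSolution u) (k t : ℝ) :
    reflection (fun y => u y t) k =
      reflection (fun y => u y 0) k * Complex.exp (8 * Complex.I * (k : ℂ) ^ 3 * t) := by
  have := (hu.isShortRange 0).continuous_reflection
  exact eq_of_continuous_of_eq_off_zero (hu.isShortRange t).continuous_reflection
    (by fun_prop) (fun k hk => (hu.scattering_evolution hk t).2) k

/-- The Wronskian of the Jost solutions is a constant of the motion. -/
theorem jostWronskian_eq (hu : IsRapidlyDecreasingKdVSolution u) (hk : 0 ≤ k.im) (t : ℝ) :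
    jostWronskian (fun y => u y t) k = jostWronskian (fun y => u y 0) k := by
  have hs := hu.isShortRange
  have hreal : ∀ k : ℝ, jostWronskian (fun y => u y t) k = jostWronskian (fun y => u y 0) k :=
    eq_of_continuous_of_eq_off_zero
      (IsShortRange.continuous_ofReal_comp fun k => (hs t).continuousOn_jostWronskian k (by simp))
      (IsShortRange.continuous_ofReal_comp fun k => (hs 0).continuousOn_jostWronskian k (by simp))
      fun k hk => (hu.scattering_evolution hk t).1
  -- The difference of the Wronskians, rotated to the right half-plane: bounded, because both differ
  -- from 2ik by a bounded function, and zero on the boundary, hence zero by Phragmén–Lindelöf.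
  set F : ℂ → ℂ := fun z => jostWronskian (fun y => u y t) (Complex.I * z) -
    jostWronskian (fun y => u y 0) (Complex.I * z) with hF
  have him : ∀ z : ℂ, (Complex.I * z).im = z.re := fun z => by simp
  have hopen : IsOpen {z : ℂ | 0 < z.re} := isOpen_lt continuous_const Complex.continuous_re
  have hcl : closure {z : ℂ | 0 < z.re} = {z : ℂ | 0 ≤ z.re} := Complex.closure_setOfPred_lt_re 0
  have hd : ∀ s, DifferentiableOn ℂ (fun z => jostWronskian (fun y => u y s) (Complex.I * z))
      {z : ℂ | 0 < z.re} := fun s =>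
    (hs s).differentiableOn_jostWronskian.comp (by fun_prop) fun z hz => by
      simpa [him] using hz
  have hc : ∀ s, ContinuousOn (fun z => jostWronskian (fun y => u y s) (Complex.I * z))
      (closure {z : ℂ | 0 < z.re}) := fun s => by
    rw [hcl]
    exact (hs s).continuousOn_jostWronskian.comp (by fun_prop) fun z hz => by
      simpa [him] using hz
  obtain ⟨C₁, hC₁⟩ := (hs t).norm_jostWronskian_sub_le
  obtain ⟨C₂, hC₂⟩ := (hs 0).norm_jostWronskian_sub_le
  have hbound : ∀ z : ℂ, 0 ≤ z.re → ‖F z‖ ≤ C₁ + C₂ := fun z hz => by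
    have h1 := hC₁ (Complex.I * z) (by rwa [him])
    have h2 := hC₂ (Complex.I * z) (by rwa [him])
    have : F z = (jostWronskian (fun y => u y t) (Complex.I * z) -
        2 * Complex.I * (Complex.I * z)) - (jostWronskian (fun y => u y 0) (Complex.I * z) -
        2 * Complex.I * (Complex.I * z)) := by simp only [hF]; ring
    rw [this]
    exact (norm_sub_le _ _).trans (add_le_add h1 h2)
  have := PhragmenLindelof.right_half_plane_of_bounded_on_real (f := F) (C := 0)
    (z := -Complex.I * k) ⟨(hd t).sub (hd 0), (hc t).sub (hc 0)⟩
    ⟨1, by norm_num, 0, by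
      refine Asymptotics.IsBigO.of_bound (C₁ + C₂) ?_
      refine (eventually_inf_principal.2 (Eventually.of_forall fun z hz => ?_))
      simpa using hbound z (le_of_lt hz)⟩
    ⟨C₁ + C₂, by
      refine eventually_map.2 ((eventually_ge_atTop 0).mono fun x hx => ?_)
      exact hbound x (by simpa using hx)⟩
    (fun x => by
      have : Complex.I * (x * Complex.I) = ((-x : ℝ) : ℂ) := by
        push_cast
        linear_combination (x : ℂ) * Complex.I_sq
      simp only [hF, this, hreal, sub_self, norm_zero, le_refl])
    (by simpa using hk)
  have h1 : Complex.I * (-Complex.I * k) = k := by linear_combination -k * Complex.I_sq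
  rw [norm_le_zero_iff] at this
  simp only [hF, h1] at this
  exact sub_eq_zero.1 this

end IsRapidlyDecreasingKdVSolution

/-! ### Norming constants and the poles of the transmission coefficient -/

namespace IsShortRange

variable {v : ℝ → ℝ} {κ : ℝ}

theorem jostPlus_I_mul_conj (hv : IsShortRange v) (hκ : 0 < κ) (x : ℝ) :
    (starRingEnd ℂ) (jostPlus v (Complex.I * κ) x) = jostPlus v (Complex.I * κ) x := by
  have := hv.jostPlus_conj (k := Complex.I * κ) (by simpa using hκ.le) x
  simpa using this.symm

theorem sq_jostPlus_I_mul (hv : IsShortRange v) (hκ : 0 < κ) (x : ℝ) :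
    jostPlus v (Complex.I * κ) x ^ 2 = ((‖jostPlus v (Complex.I * κ) x‖ ^ 2 : ℝ) : ℂ) := by
  rw [← Complex.normSq_eq_norm_sq, ← Complex.mul_conj, hv.jostPlus_I_mul_conj hκ, sq]

theorem integral_sq_jostPlus (hv : IsShortRange v) (hκ : 0 < κ) :
    ∫ x, jostPlus v (Complex.I * κ) x ^ 2 = ((normingConstant v κ)⁻¹ : ℝ) := by
  simp only [normingConstant, inv_inv]
  rw [← integral_complex_ofReal]
  exact integral_congr_ae (Eventually.of_forall fun x => hv.sq_jostPlus_I_mul hκ x)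

theorem normingConstant_pos (hv : IsShortRange v) (hκ : 0 < κ)
    (hW : jostWronskian v (Complex.I * κ) = 0) : 0 < normingConstant v κ := by
  have him : 0 < (Complex.I * (κ : ℂ)).im := by simpa using hκ
  refine inv_pos.2 ?_
  have hc := hv.continuous_jostPlus him.le
  obtain ⟨x, hx⟩ := Function.ne_iff.1 (hv.jostPlus_ne_zero him.le)
  exact integral_pos_of_integrable_nonneg_nonzero (by fun_prop)
    (hv.integrable_sq_norm_of_jostWronskian_eq_zero him hW) (fun x => by positivity)
    (x := x) (by simpa using hx)

/-- The simple zero of the Wronskian at a bound state. -/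
theorem tendsto_div_jostWronskian (hv : IsShortRange v) (hκ : 0 < κ) {μ : ℂ}
    (hμ : ∀ x, jostMinus v (Complex.I * κ) x = μ * jostPlus v (Complex.I * κ) x) (hμ0 : μ ≠ 0)
    (hW : jostWronskian v (Complex.I * κ) = 0) :
    Tendsto (fun k => (k - Complex.I * κ) / jostWronskian v k) (𝓝[≠] (Complex.I * κ))
      (𝓝 (normingConstant v κ / (2 * (Complex.I * κ) * μ))) := by
  have him : 0 < (Complex.I * (κ : ℂ)).im := by simpa using hκ
  have hint : Integrable fun x => jostPlus v (Complex.I * κ) x ^ 2 := by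
    refine ((hv.integrable_sq_norm_of_jostWronskian_eq_zero him hW).ofReal (𝕜 := ℂ)).congr
      (Eventually.of_forall fun x => (hv.sq_jostPlus_I_mul hκ x).symm)
  have h := hv.tendsto_jostWronskian_div him hμ0 hμ hint
  rw [hv.integral_sq_jostPlus hκ] at h
  have hn := hv.normingConstant_pos hκ hW
  have h2 := h.inv₀ (by
    have : (κ : ℂ) ≠ 0 := Complex.ofReal_ne_zero.2 hκ.ne'
    have : ((normingConstant v κ)⁻¹ : ℝ) ≠ (0 : ℂ) :=
      Complex.ofReal_ne_zero.2 (inv_ne_zero hn.ne')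
    simp_all)
  have h3 : (normingConstant v κ / (2 * (Complex.I * κ) * μ) : ℂ) =
      (2 * (Complex.I * κ) * μ * ((normingConstant v κ)⁻¹ : ℝ))⁻¹ := by
    push_cast
    rw [mul_inv, inv_inv, mul_comm, div_eq_mul_inv, mul_comm]
  rw [h3]
  exact h2.congr fun k => inv_div _ _

end IsShortRange

namespace IsRapidlyDecreasingKdVSolution

variable {u : ℝ → ℝ → ℝ} {κ : ℝ}

/-- The evolution of the proportionality factor of the Jost solutions at a bound state and of the
normalization of the bound state. -/
theorem boundState_evolution (hu : IsRapidlyDecreasingKdVSolution u) (hκ : 0 < κ)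
    (hW : jostWronskian (fun y => u y 0) (Complex.I * κ) = 0) (t : ℝ) :
    normingConstant (fun y => u y t) κ =
      normingConstant (fun y => u y 0) κ * Real.exp (8 * κ ^ 3 * t) := by
  have hs := hu.isShortRange
  have him : 0 < (Complex.I * (κ : ℂ)).im := by simpa using hκ
  have hκc : (κ : ℂ) ≠ 0 := Complex.ofReal_ne_zero.2 hκ.ne'
  have hWt : ∀ s, jostWronskian (fun y => u y s) (Complex.I * κ) = 0 := fun s =>
    (hu.jostWronskian_eq him.le s).trans hW
  choose μ hμ0 hμ using fun s => (hs s).jostMinus_eq_mul_of_jostWronskian_eq_zero him.le (hWt s)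
  set c : ℂ := 4 * Complex.I * (Complex.I * κ) ^ 3 with hc
  have hc' : c = ((4 * κ ^ 3 : ℝ) : ℂ) := by
    rw [hc]
    push_cast
    linear_combination 4 * (κ : ℂ) ^ 3 * (Complex.I ^ 2 - 1) * Complex.I_sq
  have hexp : ∀ s : ℝ, Complex.exp (-c * s) * Complex.exp (c * s) = 1 := fun s => by
    rw [← Complex.exp_add]; simp
  -- The relation ψ₋ = μψ₊ after gauging: μ(t)e^{−8κ³t} is constant.
  have key := ratio_eq_of_evolution
    (f₁ := fun s x => Complex.exp (c * s) * jostPlus (fun y => u y s) (Complex.I * κ) x)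
    (f₃ := fun s x => Complex.exp (-c * s) * jostMinus (fun y => u y s) (Complex.I * κ) x)
    (a := fun s x => 4 * (Complex.I * κ) ^ 2 + 2 * u x s)
    (b := fun s x => -(deriv (fun y => u y s) x : ℝ))
    (α := fun s => μ s * Complex.exp (-c * s) ^ 2)
    (fun s x => hu.hasDerivAt_gauge_jostPlus him.le s x)
    (fun s x => hu.hasDerivAt_gauge_jostMinus him.le s x)
    (fun s => ((hs s).solves_jostPlus him.le).differentiable.const_mul _)
    (fun s h => (hs s).jostPlus_ne_zero him.le (funext fun x =>
      (mul_eq_zero.1 (congrFun h x)).resolve_left (Complex.exp_ne_zero _)))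
    (fun s x => by
      rw [hμ s x]
      linear_combination -μ s * Complex.exp (-c * s) * jostPlus (fun y => u y s) (Complex.I * κ) x *
        hexp s)
    t 0
  simp only [Complex.ofReal_zero, mul_zero, Complex.exp_zero, one_pow, mul_one] at key
  -- W is independent of time, and so is its derivative at iκ. Hence the quotient of the norming
  -- constant by μ is conserved, and the evolution of μ determines that of the norming constant.
  have l1 := (hs t).tendsto_div_jostWronskian hκ (hμ t) (hμ0 t) (hWt t)
  have l2 := (hs 0).tendsto_div_jostWronskian hκ (hμ 0) (hμ0 0) hW
  have l3 := tendsto_nhds_unique l1 (l2.congr' (by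
    filter_upwards [mem_nhdsWithin_of_mem_nhds (IsShortRange.isOpen_upper.mem_nhds him)] with k hk
    rw [hu.jostWronskian_eq (le_of_lt hk) t]))
  have h1 := hμ0 t
  have h2 := hμ0 0
  have h4 : (normingConstant (fun y => u y t) κ : ℂ) * μ 0 =
      normingConstant (fun y => u y 0) κ * μ t := by
    have hI := Complex.I_ne_zero
    field_simp at l3
    rw [l3, mul_comm]
  have h5 : Complex.exp (-c * t) ^ 2 * (Real.exp (8 * κ ^ 3 * t) : ℂ) = 1 := by
    rw [hc', Complex.ofReal_exp, ← Complex.exp_nat_mul, ← Complex.exp_add, ← Complex.exp_zero]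
    congr 1
    push_cast
    ring
  have h6 : (normingConstant (fun y => u y t) κ : ℂ) =
      ((normingConstant (fun y => u y 0) κ * Real.exp (8 * κ ^ 3 * t) : ℝ) : ℂ) := by
    refine mul_right_cancel₀ h2 ?_
    rw [h4, ← key, Complex.ofReal_mul]
    linear_combination -(normingConstant (fun y => u y 0) κ : ℂ) * μ t * h5
  exact_mod_cast h6

end IsRapidlyDecreasingKdVSolution


/-! ### The function `χ` of the inverse scattering method -/

theorem HasExpansionAtInfinity.tendsto {χ : ℂ → ℂ} {Q : ℝ} (h : HasExpansionAtInfinity χ Q) :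
    Tendsto χ (Bornology.cobounded ℂ ⊓ 𝓟 {k : ℂ | k.im ≠ 0}) (𝓝 1) := by
  have h0 : Tendsto (fun k : ℂ => k⁻¹) (Bornology.cobounded ℂ ⊓ 𝓟 {k : ℂ | k.im ≠ 0}) (𝓝 0) :=
    tendsto_inv₀_cobounded.mono_left inf_le_left
  have h1 := h.trans_tendsto (g'' := fun k : ℂ => 1 / k ^ 2) (by
    have := h0.pow 2
    simpa using this)
  have h2 : Tendsto (fun k : ℂ => 1 + Complex.I / (2 * k) * (Q : ℂ))
      (Bornology.cobounded ℂ ⊓ 𝓟 {k : ℂ | k.im ≠ 0}) (𝓝 1) := by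
    have := ((h0.const_mul (Complex.I / 2)).mul_const (Q : ℂ)).const_add 1
    simp only [mul_zero, zero_mul, add_zero] at this
    refine this.congr fun k => ?_
    rw [div_mul_eq_div_mul_one_div, one_div]
  simpa using h1.add h2

theorem eventually_ne_cobounded (s : Set ℂ) :
    ∀ᶠ k : ℂ in Bornology.cobounded ℂ ⊓ 𝓟 s, k ≠ 0 ∧ k ∈ s := by
  refine eventually_inf_principal.2 ?_
  filter_upwards [Bornology.eventually_ne_cobounded (0 : ℂ)] with k hk hs
  exact ⟨hk, hs⟩

theorem isBigO_one_div_of_norm_le {s : Set ℂ} {F : ℂ → ℂ} {C : ℝ}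
    (h : ∀ k ∈ s, ‖k‖ * ‖F k‖ ≤ C) :
    F =O[Bornology.cobounded ℂ ⊓ 𝓟 s] fun k => 1 / k := by
  refine Asymptotics.IsBigO.of_bound C ?_
  filter_upwards [eventually_ne_cobounded s] with k hk
  rw [norm_div, norm_one, mul_one_div, le_div_iff₀ (norm_pos_iff.2 hk.1), mul_comm]
  exact h k hk.2

theorem hasExpansionAtInfinity_of_upper_lower {χ : ℂ → ℂ} {Q : ℝ}
    (hp : (fun k : ℂ => χ k - (1 + Complex.I / (2 * k) * (Q : ℂ)))
      =O[Bornology.cobounded ℂ ⊓ 𝓟 {k : ℂ | 0 < k.im}] fun k : ℂ => 1 / k ^ 2)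
    (hm : (fun k : ℂ => χ k - (1 + Complex.I / (2 * k) * (Q : ℂ)))
      =O[Bornology.cobounded ℂ ⊓ 𝓟 {k : ℂ | k.im < 0}] fun k : ℂ => 1 / k ^ 2) :
    HasExpansionAtInfinity χ Q := by
  have : {k : ℂ | k.im ≠ 0} = {k : ℂ | 0 < k.im} ∪ {k : ℂ | k.im < 0} := by
    ext k
    simp only [Set.mem_ofPred_eq, Set.mem_union]
    rw [ne_iff_lt_or_gt, or_comm]
  unfold HasExpansionAtInfinity
  rw [this, ← sup_principal, inf_sup_left]
  exact hp.sup hm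

/-- If `f` solves the Schrödinger equation, `g = f e^{ikx}` solves `g'' - 2ikg' - vg = 0`. -/
theorem SolvesSchrodinger.mul_planeWave {v : ℝ → ℝ} {k : ℂ} {f : ℝ → ℂ}
    (hf : SolvesSchrodinger v (k ^ 2) f) (c : ℂ) {g : ℝ → ℂ}
    (hg : ∀ x : ℝ, g x = c * f x * Complex.exp (Complex.I * k * x)) :
    ContDiff ℝ 2 g ∧ ∀ x : ℝ, deriv (deriv g) x - 2 * Complex.I * k * deriv g x - v x * g x = 0 := by
  obtain rfl : g = fun x : ℝ => c * f x * Complex.exp (Complex.I * k * x) := funext hg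
  have hexp : ContDiff ℝ 2 fun x : ℝ => Complex.exp (Complex.I * k * x) :=
    (contDiff_const.mul Complex.ofRealCLM.contDiff).cexp
  refine ⟨(contDiff_const.mul hf.1).mul hexp, fun x => ?_⟩
  have h1 : ∀ x, HasDerivAt (fun x : ℝ => c * f x * Complex.exp (Complex.I * k * x))
      (c * (deriv f x + Complex.I * k * f x) * Complex.exp (Complex.I * k * x)) x := fun x =>
    (((hf.hasDerivAt x).const_mul c).mul (hasDerivAt_planeWave k x)).congr_deriv (by ring)
  have h2 : deriv (fun x : ℝ => c * f x * Complex.exp (Complex.I * k * x)) =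
      fun x : ℝ => c * (deriv f x + Complex.I * k * f x) * Complex.exp (Complex.I * k * x) :=
    funext fun x => (h1 x).deriv
  have h3 := ((((hf.hasDerivAt_deriv x).add ((hf.hasDerivAt x).const_mul
    (Complex.I * k))).const_mul c).mul (hasDerivAt_planeWave k x)).deriv
  have h4 : deriv (fun x : ℝ => c * (deriv f x + Complex.I * k * f x) *
      Complex.exp (Complex.I * k * x)) x = _ := h3
  rw [h2, h4]
  simp only [Pi.add_apply]
  linear_combination -c * f x * Complex.exp (Complex.I * k * x) * k ^ 2 * Complex.I_sq

namespace IsShortRange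

variable {v : ℝ → ℝ} {k : ℂ}

theorem jostPlus_mul_planeWave (hv : IsShortRange v) (hk : 0 ≤ k.im) (x : ℝ) :
    jostPlus v k x * Complex.exp (-(Complex.I * k * x)) = faddeev v k x := by
  rw [hv.jostPlus_eq hk]
  unfold psiPlus
  rw [mul_right_comm, ← Complex.exp_add, add_neg_cancel, Complex.exp_zero, one_mul]

theorem jostMinus_mul_planeWave (hv : IsShortRange v) (hk : 0 ≤ k.im) (x : ℝ) :
    jostMinus v k x * Complex.exp (Complex.I * k * x) = faddeev (fun y => v (-y)) k (-x) := by
  rw [hv.jostMinus_comp_neg hk, ← hv.comp_neg.jostPlus_mul_planeWave hk]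
  simp

/-- W differs from 2ik by at most C, so |W| ≥ |k| as soon as |k| ≥ C. -/
theorem isBigO_inv_jostWronskian (hv : IsShortRange v) :
    (fun k => (jostWronskian v k)⁻¹) =O[Bornology.cobounded ℂ ⊓ 𝓟 {k : ℂ | 0 < k.im}]
      fun k : ℂ => 1 / k := by
  obtain ⟨C, hC⟩ := hv.norm_jostWronskian_sub_le
  refine Asymptotics.IsBigO.of_bound 1 ?_
  have h1 : ∀ᶠ k : ℂ in Bornology.cobounded ℂ ⊓ 𝓟 {k : ℂ | 0 < k.im}, C ≤ ‖k‖ :=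
    (tendsto_norm_cobounded_atTop.mono_left inf_le_left).eventually_ge_atTop C
  filter_upwards [eventually_ne_cobounded _, h1] with k hk hk1
  have h2 := hC k (le_of_lt hk.2)
  have h3 : ‖2 * Complex.I * k‖ = 2 * ‖k‖ := by simp
  have h4 := norm_sub_norm_le (2 * Complex.I * k) (jostWronskian v k)
  rw [norm_sub_rev] at h4
  have h5 : 0 < ‖k‖ := norm_pos_iff.2 hk.1
  rw [norm_inv, norm_div, norm_one, one_mul, one_div]
  exact inv_anti₀ h5 (by linarith)

theorem isBigO_faddeev_expansion {v' : ℝ → ℝ} (hv : IsShortRange v)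
    (hd : ∀ x, HasDerivAt v (v' x) x) (hi : Integrable v') (x : ℝ) :
    (fun k => faddeev v k x - (1 - (∫ y in Set.Ioi x, v y : ℝ) / (2 * Complex.I) * (1 / k)))
      =O[Bornology.cobounded ℂ ⊓ 𝓟 {k : ℂ | 0 < k.im}] fun k : ℂ => 1 / k ^ 2 := by
  obtain ⟨C, hC⟩ := hv.norm_faddeev_expansion hd hi x
  have h1 := isBigO_one_div_of_norm_le (s := {k : ℂ | 0 < k.im}) fun k hk => hC k (le_of_lt hk)
  have h2 : (fun k : ℂ => 1 / (2 * Complex.I) * (1 / k)) =O[Bornology.cobounded ℂ ⊓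
      𝓟 {k : ℂ | 0 < k.im}] fun k : ℂ => 1 / k := (Asymptotics.isBigO_refl _ _).const_mul_left _
  refine (h2.mul h1).congr' ?_ (Eventually.of_forall fun k => by simp only; ring)
  filter_upwards [eventually_ne_cobounded _] with k hk
  have := hk.1
  have := Complex.I_ne_zero
  field_simp
  ring

end IsShortRange

section

variable {u : ℝ → ℝ → ℝ} {k : ℂ}

theorem ismFunction_of_pos (hk : 0 < k.im) (x t : ℝ) :
    ismFunction u k x t = transmissionBdry (fun y => u y t) k * jostMinus (fun y => u y t) k x *
      Complex.exp (Complex.I * k * x) := by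
  rw [ismFunction, if_pos hk, transmission_eq_bdry _ hk]

theorem ismFunction_of_neg (hk : k.im < 0) (x t : ℝ) :
    ismFunction u k x t = jostPlus (fun y => u y t) (-k) x * Complex.exp (Complex.I * k * x) :=
  if_neg hk.not_gt

end

namespace IsRapidlyDecreasingKdVSolution

variable {u : ℝ → ℝ → ℝ} {k : ℂ} {N : ℕ} {κ : Fin N → ℝ}

/-- With m, n the Faddeev functions at +∞ and −∞, for Im k > 0 one has χ = 2ik n/W and W = 2ik nm +
nm' + n'm, where m', n' = O(1/k). So χ = 1/m + O(1/k²): the integral over the left half-line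
contained in n drops out, and both half-planes give the same Q₊. -/
theorem hasExpansionAtInfinity_ismFunction (hu : IsRapidlyDecreasingKdVSolution u) (x t : ℝ) :
    HasExpansionAtInfinity (fun k => ismFunction u k x t) (qPlus u x t) := by
  obtain ⟨g, hg⟩ := hu.isDominated t
  have hv := hg.isShortRange
  set v := fun y => u y t with hv_def
  have hd := fun x => hg.hasDerivAt x
  have hi := hg.integrable_iteratedDeriv (j := 1) (by norm_num)
  have hd' : ∀ x, HasDerivAt (fun y => v (-y)) (-iteratedDeriv 1 v (-x)) x := fun x =>
    ((hd (-x)).scomp_of_eq x (hasDerivAt_neg x) rfl).congr_deriv (by simp)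
  have hi' : Integrable fun y => -iteratedDeriv 1 v (-y) := hi.comp_neg.neg
  set a : ℝ := ∫ y in Set.Ioi x, v y with ha
  have hq : qPlus u x t = -a := rfl
  set A : ℂ := (a : ℂ) / (2 * Complex.I) with hA
  have hIA : ∀ k : ℂ, 1 + Complex.I / (2 * k) * ((qPlus u x t : ℝ) : ℂ) = 1 + A * (1 / k) :=
    fun k => by
      rw [hq, hA]
      rcases eq_or_ne k 0 with rfl | hk
      · simp
      have := Complex.I_ne_zero
      field_simp
      push_cast
      linear_combination -(a : ℂ) * Complex.I_sq
  have hexp := hv.isBigO_faddeev_expansion hd hi x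
  rw [← ha, ← hA] at hexp
  have hO1 : (fun k : ℂ => 1 / k) =O[Bornology.cobounded ℂ ⊓ 𝓟 {k : ℂ | 0 < k.im}]
      fun _ => (1 : ℂ) := by
    have : Tendsto (fun k : ℂ => 1 / k) (Bornology.cobounded ℂ ⊓ 𝓟 {k : ℂ | 0 < k.im}) (𝓝 0) := by
      simpa using (tendsto_inv₀_cobounded (α := ℂ)).mono_left inf_le_left
    exact this.isBigO_one ℂ
  have hc : ∀ c d : ℂ, (fun k : ℂ => c + d * (1 / k)) =O[Bornology.cobounded ℂ ⊓
      𝓟 {k : ℂ | 0 < k.im}] fun _ => (1 : ℂ) := fun c d =>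
    (Asymptotics.isBigO_const_const c one_ne_zero _).add (hO1.const_mul_left d)
  have hbdd : ∀ {w : ℝ → ℝ}, IsShortRange w → ∀ x, (fun k => faddeev w k x) =O[
      Bornology.cobounded ℂ ⊓ 𝓟 {k : ℂ | 0 < k.im}] fun _ => (1 : ℂ) := fun {w} hw x => by
    refine Asymptotics.IsBigO.of_bound (2 * jostWeight w x) ?_
    refine eventually_inf_principal.2 (Eventually.of_forall fun k hk => ?_)
    simpa using hw.norm_faddeev_le (le_of_lt hk) x
  refine hasExpansionAtInfinity_of_upper_lower ?_ ?_
  · obtain ⟨C₁, hC₁⟩ := hv.norm_mul_faddeevDeriv_le hd hi x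
    obtain ⟨C₂, hC₂⟩ := hv.comp_neg.norm_mul_faddeevDeriv_le hd' hi' (-x)
    have b1 := isBigO_one_div_of_norm_le (s := {k : ℂ | 0 < k.im}) fun k hk => hC₁ k (le_of_lt hk)
    have b2 := isBigO_one_div_of_norm_le (s := {k : ℂ | 0 < k.im}) fun k hk => hC₂ k (le_of_lt hk)
    have bm := hbdd hv x
    have bn := hbdd hv.comp_neg (-x)
    have bW := hv.isBigO_inv_jostWronskian
    have bq := (bn.mul b1).add ((b2.mul bm).congr_right fun k => mul_comm _ _)
    have b3 : (fun k => 1 - (1 + A * (1 / k)) * faddeev v k x) =O[Bornology.cobounded ℂ ⊓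
        𝓟 {k : ℂ | 0 < k.im}] fun k : ℂ => 1 / k ^ 2 := by
      have e1 : (fun k : ℂ => A ^ 2 * (1 / k ^ 2)) =O[Bornology.cobounded ℂ ⊓
        𝓟 {k : ℂ | 0 < k.im}] fun k : ℂ => 1 / k ^ 2 :=
          (Asymptotics.isBigO_refl _ _).const_mul_left _
      refine (e1.sub (((hc 1 A).mul hexp).congr_right fun k => one_mul _)).congr_left fun k => ?_
      ring
    have bk : (fun k : ℂ => 2 * Complex.I * k) =O[Bornology.cobounded ℂ ⊓
        𝓟 {k : ℂ | 0 < k.im}] fun k : ℂ => k := (Asymptotics.isBigO_refl _ _).const_mul_left _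
    have b4 := (((bk.mul bn).mul b3).congr_right (g₂ := fun k : ℂ => 1 / k) fun k => by
      rcases eq_or_ne k 0 with rfl | hk
      · simp
      · field_simp).sub
      (((hc 1 A).mul bq).congr_right (g₂ := fun k : ℂ => 1 / k) fun k => by ring)
    refine (bW.mul b4).congr' ?_ (Eventually.of_forall fun k => by simp only; ring)
    have bne : ∀ᶠ k : ℂ in Bornology.cobounded ℂ ⊓ 𝓟 {k : ℂ | 0 < k.im},
        jostWronskian v k ≠ 0 := by
      obtain ⟨C, hC⟩ := hv.norm_jostWronskian_sub_le
      have h1 : ∀ᶠ k : ℂ in Bornology.cobounded ℂ ⊓ 𝓟 {k : ℂ | 0 < k.im}, C ≤ ‖k‖ :=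
        (tendsto_norm_cobounded_atTop.mono_left inf_le_left).eventually_ge_atTop C
      filter_upwards [eventually_ne_cobounded _, h1] with k hk hk1 h0
      have h2 := hC k (le_of_lt hk.2)
      rw [h0, zero_sub, norm_neg] at h2
      have h5 : 0 < ‖k‖ := norm_pos_iff.2 hk.1
      have h3 : ‖2 * Complex.I * k‖ = 2 * ‖k‖ := by simp
      linarith
    filter_upwards [eventually_ne_cobounded _, bne] with k hk hW
    rw [hIA, ismFunction_of_pos hk.2, ← hv_def,
      mul_assoc (transmissionBdry v k), hv.jostMinus_mul_planeWave (le_of_lt hk.2),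
      transmissionBdry_of_ne _ hk.1]
    have hWe := hv.jostWronskian_eq_faddeev (le_of_lt hk.2) x
    generalize faddeev v k x = m at *
    generalize faddeev (fun y => v (-y)) k (-x) = n at *
    generalize faddeevDeriv v k x = m' at *
    generalize faddeevDeriv (fun y => v (-y)) k (-x) = n' at *
    rw [inv_mul_eq_iff_eq_mul₀ hW]
    have he : jostWronskian v k * (2 * Complex.I * k / jostWronskian v k * n) =
        2 * Complex.I * k * n := by field_simp
    linear_combination -he + (1 + A * (1 / k)) * hWe
  · have hneg : Tendsto (fun k : ℂ => -k) (Bornology.cobounded ℂ ⊓ 𝓟 {k : ℂ | k.im < 0})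
        (Bornology.cobounded ℂ ⊓ 𝓟 {k : ℂ | 0 < k.im}) := by
      refine tendsto_inf.2 ⟨tendsto_inf_left ?_, tendsto_inf_right ?_⟩
      · exact tendsto_neg_cobounded
      · exact tendsto_principal_principal.2 fun k hk => by simpa using hk
    refine (hexp.comp_tendsto hneg).congr' ?_ (Eventually.of_forall fun k => by simp)
    filter_upwards [eventually_ne_cobounded _] with k hk
    have h1 : 0 ≤ (-k).im := by simpa using (le_of_lt hk.2 : k.im ≤ 0)
    have h2 := hv.jostPlus_mul_planeWave h1 x
    rw [hIA, ismFunction_of_neg hk.2, Function.comp_apply, ← h2]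
    simp only [one_div, inv_neg, mul_neg, neg_mul, neg_neg, sub_neg_eq_add]
    rfl

theorem eq_pole_of_jostWronskian_eq_zero (hu : IsRapidlyDecreasingKdVSolution u)
    (hκ : BoundStates (fun x => u x 0) κ) (hk : 0 < k.im) {t : ℝ}
    (h : jostWronskian (fun y => u y t) k = 0) : ∃ n, k = Complex.I * κ n := by
  rw [hu.jostWronskian_eq hk.le] at h
  obtain ⟨h1, h2⟩ := (hu.isShortRange 0).isBoundStateEnergy_of_jostWronskian_eq_zero hk h
  obtain ⟨n, hn⟩ := (hκ.spectrum _).1 h2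
  refine ⟨n, ?_⟩
  rw [h1]
  congr 2
  exact (pow_left_inj₀ hk.le (hκ.pos n).le two_ne_zero).1 (neg_injective hn)

theorem jostWronskian_pole (hu : IsRapidlyDecreasingKdVSolution u)
    (hκ : BoundStates (fun x => u x 0) κ) (n : Fin N) (t : ℝ) :
    jostWronskian (fun y => u y t) (Complex.I * κ n) = 0 := by
  rw [hu.jostWronskian_eq (by simpa using (hκ.pos n).le)]
  exact (hu.isShortRange 0).jostWronskian_eq_zero_of_isBoundStateEnergy (hκ.pos n)
    ((hκ.spectrum _).2 ⟨n, rfl⟩)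

/-- The simple zero of W gives t a simple pole; its residue contains 1/μ, which cancels against ψ₋ =
μψ₊. -/
theorem tendsto_mul_ismFunction (hu : IsRapidlyDecreasingKdVSolution u)
    (hκ : BoundStates (fun x => u x 0) κ) (n : Fin N) (x t : ℝ) :
    Tendsto (fun k => (k - Complex.I * κ n) * ismFunction u k x t) (𝓝[≠] (Complex.I * κ n))
      (𝓝 (Complex.I * (normingConstant (fun y => u y 0) (κ n) * Real.exp (8 * κ n ^ 3 * t) : ℝ) *
        (jostPlus (fun y => u y t) (Complex.I * κ n) x *
          Complex.exp (Complex.I * (Complex.I * κ n) * x)))) := by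
  have hv := hu.isShortRange t
  have hκn := hκ.pos n
  have him : 0 < (Complex.I * (κ n : ℂ)).im := by simpa using hκn
  have hW := hu.jostWronskian_pole hκ n t
  obtain ⟨μ, hμ0, hμ⟩ := hv.jostMinus_eq_mul_of_jostWronskian_eq_zero him.le hW
  have h1 := hv.tendsto_div_jostWronskian hκn hμ hμ0 hW
  have hup := IsShortRange.isOpen_upper.mem_nhds him
  have h2 : ContinuousAt (fun k => 2 * Complex.I * k * (jostMinus (fun y => u y t) k x *
      Complex.exp (Complex.I * k * x))) (Complex.I * κ n) := by
    have := ((hv.differentiableOn_jostMinus x).differentiableAt hup).continuousAt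
    exact (by fun_prop : ContinuousAt (fun k : ℂ => 2 * Complex.I * k) _).mul
      (this.mul (by fun_prop))
  have h3 := h1.mul (h2.tendsto.mono_left nhdsWithin_le_nhds)
  rw [hu.boundState_evolution hκn (hu.jostWronskian_pole hκ n 0)] at h3
  have hκc : (κ n : ℂ) ≠ 0 := Complex.ofReal_ne_zero.2 hκn.ne'
  have he : (((normingConstant (fun y => u y 0) (κ n) * Real.exp (8 * κ n ^ 3 * t) : ℝ) : ℂ) /
      (2 * (Complex.I * κ n) * μ) * (2 * Complex.I * (Complex.I * κ n) *
        (jostMinus (fun y => u y t) (Complex.I * κ n) x *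
          Complex.exp (Complex.I * (Complex.I * κ n) * x)))) =
      Complex.I * (normingConstant (fun y => u y 0) (κ n) * Real.exp (8 * κ n ^ 3 * t) : ℝ) *
        (jostPlus (fun y => u y t) (Complex.I * κ n) x *
          Complex.exp (Complex.I * (Complex.I * κ n) * x)) := by
    rw [hμ x]
    have := Complex.I_ne_zero
    field_simp
  rw [he] at h3
  refine h3.congr' ?_
  filter_upwards [mem_nhdsWithin_of_mem_nhds hup] with k hk
  rw [ismFunction_of_pos hk, transmissionBdry_of_ne _ (by rintro rfl; simp at hk)]
  ring

/-- The untransplanted case. The jump is the scattering relation at time t with r evolved from time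
0, the residues come from the evolved norming constants, and the poles of t are confined to the
bound states. -/
theorem solvesContourProblem_ismFunction (hu : IsRapidlyDecreasingKdVSolution u)
    (hκ : BoundStates (fun x => u x 0) κ) (x t : ℝ) :
    (scatteringData (fun y => u y 0) κ).SolvesContourProblem x t
      (fun k => ismFunction u k x t) where
  holomorphic := by
    have hv := hu.isShortRange t
    rintro k ⟨hk0, hk⟩
    refine DifferentiableAt.differentiableWithinAt ?_
    rcases hk0.lt_or_gt with him | him
    · have hlow : {k : ℂ | k.im < 0} ∈ 𝓝 k :=
        (isOpen_lt Complex.continuous_im continuous_const).mem_nhds him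
      have h1 : DifferentiableAt ℂ (fun k => jostPlus (fun y => u y t) (-k) x) k :=
        ((hv.differentiableOn_jostPlus x).differentiableAt
          (IsShortRange.isOpen_upper.mem_nhds (by simpa using him))).comp k
          (f := fun k : ℂ => -k) (by fun_prop)
      refine (h1.mul (by fun_prop : DifferentiableAt ℂ (fun k : ℂ =>
        Complex.exp (Complex.I * k * x)) k)).congr_of_eventuallyEq ?_
      filter_upwards [hlow] with k hk
      exact ismFunction_of_neg hk x t
    · have hup := IsShortRange.isOpen_upper.mem_nhds him
      have hW : jostWronskian (fun y => u y t) k ≠ 0 := fun h => by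
        obtain ⟨n, hn⟩ := hu.eq_pole_of_jostWronskian_eq_zero hκ him h
        exact hk n hn
      have h1 := (hv.differentiableOn_jostMinus x).differentiableAt hup
      have h2 := hv.differentiableOn_jostWronskian.differentiableAt hup
      refine ((((by fun_prop : DifferentiableAt ℂ (fun k : ℂ => 2 * Complex.I * k) k).div h2
        hW).mul h1).mul (by fun_prop : DifferentiableAt ℂ (fun k : ℂ =>
        Complex.exp (Complex.I * k * x)) k)).congr_of_eventuallyEq ?_
      filter_upwards [hup] with k hk
      rw [ismFunction_of_pos hk, transmissionBdry_of_ne _ (by rintro rfl; simp at hk)]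
      rfl
  jump := by
    have hv := hu.isShortRange t
    refine ⟨fun k => transmissionBdry (fun y => u y t) k * jostMinus (fun y => u y t) k x *
        Complex.exp (Complex.I * k * x),
      fun k => jostPlus (fun y => u y t) (-(k : ℂ)) x * Complex.exp (Complex.I * k * x),
      fun k => ?_, fun k => ?_, fun k => ?_⟩
    · have h1 := hv.continuousWithinAt_transmissionBdry (k := k) (by simp) fun hk =>
        hv.jostWronskian_ne_zero_of_real (by exact_mod_cast hk)
      have h2 := hv.continuousOn_jostMinus x (k : ℂ) (by simp)
      have h3 := (h1.mul h2).mul (by fun_prop : ContinuousWithinAt (fun k : ℂ =>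
        Complex.exp (Complex.I * k * x)) {k | 0 ≤ k.im} k)
      refine (h3.mono fun k (hk : 0 < k.im) => hk.le).tendsto.congr' ?_
      filter_upwards [self_mem_nhdsWithin] with k hk
      exact (ismFunction_of_pos hk x t).symm
    · have h2 : ContinuousWithinAt (fun k => jostPlus (fun y => u y t) (-k) x)
          {k : ℂ | k.im ≤ 0} k :=
        ContinuousWithinAt.comp (f := fun k : ℂ => -k) (t := {k : ℂ | 0 ≤ k.im})
          (hv.continuousOn_jostPlus x (-(k : ℂ)) (by simp)) (by fun_prop) fun k hk => by
            simpa using hk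
      have h3 := h2.mul (by fun_prop : ContinuousWithinAt (fun k : ℂ =>
        Complex.exp (Complex.I * k * x)) {k | k.im ≤ 0} k)
      refine (h3.mono fun k (hk : k.im < 0) => hk.le).tendsto.congr' ?_
      filter_upwards [self_mem_nhdsWithin] with k hk
      exact (ismFunction_of_neg hk x t).symm
    · have h1 := hv.scattering_relation k x
      have h2 := hu.reflection_eq k t
      simp only [Complex.ofReal_neg, neg_neg]
      rw [hv.jostPlus_neg_ofReal, h1, h2]
      have h3 : Complex.exp (2 * Complex.I * k * x + 8 * Complex.I * (k : ℂ) ^ 3 * t) *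
          Complex.exp (Complex.I * -k * x) =
          Complex.exp (8 * Complex.I * (k : ℂ) ^ 3 * t) * Complex.exp (Complex.I * k * x) := by
        rw [← Complex.exp_add, ← Complex.exp_add]
        congr 1
        ring
      simp only [scatteringData]
      linear_combination -reflection (fun y => u y 0) k * jostPlus (fun y => u y t) k x * h3
  residue n := by
    have h := hu.tendsto_mul_ismFunction hκ n x t
    have hn := hκ.pos n
    have him : (-(Complex.I * (κ n : ℂ))).im < 0 := by simpa using hn
    change Tendsto (fun k => (k - Complex.I * (κ n : ℂ)) * ismFunction u k x t)
      (𝓝[≠] (Complex.I * (κ n : ℂ))) (𝓝 (Complex.I *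
      (normingConstant (fun y => u y 0) (κ n) : ℂ) *
      (Real.exp (-2 * κ n * x + 8 * κ n ^ 3 * t) : ℂ) *
      ismFunction u (-(Complex.I * (κ n : ℂ))) x t))
    convert h using 2
    rw [ismFunction_of_neg him, neg_neg, Real.exp_add]
    have h1 : Complex.exp (Complex.I * -(Complex.I * κ n) * x) *
        ((Real.exp (-2 * κ n * x) : ℝ) : ℂ) = Complex.exp (Complex.I * (Complex.I * κ n) * x) := by
      rw [Complex.ofReal_exp, ← Complex.exp_add]
      congr 1
      push_cast
      linear_combination -2 * (κ n : ℂ) * x * Complex.I_sq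
    rw [← h1]
    push_cast
    ring
  at_infinity := (hu.hasExpansionAtInfinity_ismFunction x t).tendsto

theorem hasDerivAt_qPlus (hu : IsRapidlyDecreasingKdVSolution u) (x t : ℝ) :
    HasDerivAt (fun y => qPlus u y t) (u x t) x := by
  have hv := hu.isShortRange t
  have := (hasDerivAt_integral_Ioi hv.continuous (fun a => hv.integrable_self.integrableOn) x).neg
  exact this.congr_deriv (neg_neg _)

theorem admissible_scatteringData (hu : IsRapidlyDecreasingKdVSolution u)
    (hκ : BoundStates (fun x => u x 0) κ) :
    (scatteringData (fun y => u y 0) κ).Admissible where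
  continuous := (hu.isShortRange 0).continuous_reflection
  conj_symm := (hu.isShortRange 0).reflection_neg
  norm_lt_one k hk := (hu.isShortRange 0).norm_reflection_lt_one hk
  at_zero := (hu.isShortRange 0).reflection_zero
  ne_zero n := ⟨(hκ.pos n).ne', ((hu.isShortRange 0).normingConstant_pos (hκ.pos n)
    (hu.jostWronskian_pole hκ n 0)).ne'⟩
  ne n m h := ⟨hκ.injective.ne h, by
    have h1 : 0 < κ n := hκ.pos n
    have h2 : 0 < κ m := hκ.pos m
    change κ n ≠ -κ m
    linarith⟩
  same_sign n := div_pos (hκ.pos n) ((hu.isShortRange 0).normingConstant_pos (hκ.pos n)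
    (hu.jostWronskian_pole hκ n 0))

end IsRapidlyDecreasingKdVSolution


/-! ### The `∂̄`-operator: Green's formula on a half-plane and the Cauchy kernel -/

section Dbar

variable {φ : ℂ → ℂ}

theorem ContDiff.continuous_dbar (hφ : ContDiff ℝ 1 φ) : Continuous (dbar φ) := by
  have h := hφ.continuous_fderiv one_ne_zero
  unfold dbar
  fun_prop

theorem dbar_eq_zero_of_tsupport_subset {R : ℝ}
    (hR : tsupport φ ⊆ Metric.ball 0 R) {k : ℂ} (hk : R ≤ ‖k‖) : φ k = 0 ∧ dbar φ k = 0 := by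
  have h : k ∉ tsupport φ := fun h => by
    have := hR h
    rw [mem_ball_zero_iff] at this
    linarith
  have h1 : fderiv ℝ φ k = 0 := by
    by_contra h1
    exact h (tsupport_fderiv_subset ℝ (subset_tsupport _ h1))
  refine ⟨image_eq_zero_of_notMem_tsupport h, ?_⟩
  simp [dbar, h1]

theorem HasCompactSupport.exists_tsupport_subset_ball (hc : HasCompactSupport φ) :
    ∃ R : ℝ, 0 < R ∧ tsupport φ ⊆ Metric.ball 0 R := by
  obtain ⟨R, hR, h⟩ := hc.isCompact.isBounded.exists_pos_norm_lt
  exact ⟨R, hR, fun k hk => mem_ball_zero_iff.2 (h k hk)⟩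

theorem HasCompactSupport.dbar (hc : HasCompactSupport φ) : HasCompactSupport (dbar φ) := by
  obtain ⟨R, -, hR⟩ := hc.exists_tsupport_subset_ball
  refine HasCompactSupport.intro (isCompact_closedBall (0 : ℂ) R) fun k hk => ?_
  rw [mem_closedBall_zero_iff, not_le] at hk
  exact (dbar_eq_zero_of_tsupport_subset hR hk.le).2

theorem dbar_comp_neg (φ : ℂ → ℂ) (k : ℂ) : dbar (fun z => φ (-z)) k = -dbar φ (-k) := by
  have h : fderiv ℝ (fun z => φ (-z)) k = (fderiv ℝ φ (-k)).comp
      (ContinuousLinearEquiv.neg ℝ : ℂ ≃L[ℝ] ℂ).toContinuousLinearMap :=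
    (ContinuousLinearEquiv.neg ℝ : ℂ ≃L[ℝ] ℂ).comp_right_fderiv (f := φ) (x := k)
  unfold dbar
  rw [h]
  simp only [ContinuousLinearMap.comp_apply, ContinuousLinearEquiv.coe_coe,
    ContinuousLinearEquiv.neg_apply, map_neg]
  ring

/-- Green's formula on the upper half-plane. -/
theorem integral_upper_mul_dbar {G : ℂ → ℂ} (hG : ContinuousOn G {k | 0 ≤ k.im})
    (hd : DifferentiableOn ℂ G {k | 0 < k.im}) (hφ : ContDiff ℝ 1 φ) (hc : HasCompactSupport φ) :
    ∫ k in {k : ℂ | 0 < k.im}, G k * dbar φ k = -(Complex.I / 2) * ∫ x : ℝ, G x * φ x := by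
  obtain ⟨R, hR0, hR⟩ := hc.exists_tsupport_subset_ball
  have hz := fun k hk => dbar_eq_zero_of_tsupport_subset hR (k := k) hk
  have hdφ := hφ.continuous_dbar
  set e := Complex.measurableEquivRealProd.symm
  have he : ∀ p : ℝ × ℝ, e p = p.1 + p.2 * Complex.I := fun p => Complex.mk_eq_add_mul_I _ _
  have hrect : Set.uIcc (-R) R ×ℂ Set.uIcc 0 R ⊆ {k : ℂ | 0 ≤ k.im} := fun k hk => by
    have := hk.2
    rw [Set.mem_preimage, Set.uIcc_of_le hR0.le] at this
    exact this.1
  have hcomp : IsCompact (Set.uIcc (-R) R ×ℂ Set.uIcc 0 R) := isCompact_uIcc.reProdIm isCompact_uIcc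
  have hcont : ContinuousOn (fun k => G k * dbar φ k) {k | 0 ≤ k.im} := hG.mul hdφ.continuousOn
  -- reduction to a rectangle
  have h1 : ∫ k in {k : ℂ | 0 < k.im}, G k * dbar φ k =
      ∫ x in (-R)..R, ∫ y in (0 : ℝ)..R, G (x + y * Complex.I) * dbar φ (x + y * Complex.I) := by
    rw [← (Complex.volume_preserving_equiv_real_prod.symm).setIntegral_preimage_emb
      Complex.measurableEquivRealProd.symm.measurableEmbedding]
    have hsub : Set.Ioc (-R) R ×ˢ Set.Ioc 0 R ⊆ e ⁻¹' {k : ℂ | 0 < k.im} := fun p hp => hp.2.1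
    rw [setIntegral_eq_of_subset_of_forall_sdiff_eq_zero _ hsub]
    · have hci : ContinuousOn (fun p => G (e p) * dbar φ (e p))
          (Set.Icc (-R) R ×ˢ Set.Icc 0 R) := by
        refine hcont.comp (f := e) ?_ fun p hp => hp.2.1
        simp only [funext he]
        fun_prop
      have hi := (hci.integrableOn_compact (isCompact_Icc.prod isCompact_Icc)
        (μ := volume)).mono_set (Set.prod_mono Set.Ioc_subset_Icc_self Set.Ioc_subset_Icc_self)
      rw [Measure.volume_eq_prod] at hi ⊢
      rw [setIntegral_prod _ hi, intervalIntegral.integral_of_le (by linarith)]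
      refine setIntegral_congr_fun measurableSet_Ioc fun x _ => ?_
      simp only [he]
      rw [intervalIntegral.integral_of_le hR0.le]
    · rintro p ⟨hp1, hp2⟩
      have hp1' : 0 < p.2 := hp1
      have : R ≤ ‖e p‖ := by
        by_contra! hlt
        refine hp2 ⟨?_, hp1', ?_⟩
        · have := abs_lt.1 ((Complex.abs_re_le_norm (e p)).trans_lt hlt)
          exact ⟨this.1, this.2.le⟩
        · exact (abs_le.1 ((Complex.abs_im_le_norm (e p)).trans hlt.le)).2
      change G (e p) * dbar φ (e p) = 0
      rw [(hz _ this).2, mul_zero]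
    · exact Complex.measurableEquivRealProd.symm.measurable
        (measurableSet_lt measurable_const Complex.measurable_im)
  -- Green's formula
  have hopen : IsOpen {k : ℂ | 0 < k.im} := IsShortRange.isOpen_upper
  have hGreen := Complex.integral_boundary_rect_of_hasFDerivAt_real_off_countable
    (fun k => G k * φ k)
    (fun k => G k • fderiv ℝ φ k + φ k • (deriv G k • (1 : ℂ →L[ℝ] ℂ)))
    (⟨-R, 0⟩ : ℂ) (⟨R, R⟩ : ℂ) ∅ Set.countable_empty
    ((hG.mul hφ.continuous.continuousOn).mono hrect)
    (fun k hk => by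
      have hk' : 0 < k.im := by
        have := hk.1.2.1
        simpa [hR0.le] using this
      have h1 : HasFDerivAt G (deriv G k • (1 : ℂ →L[ℝ] ℂ)) k :=
        (hd.differentiableAt (hopen.mem_nhds hk')).hasDerivAt.complexToReal_fderiv
      exact h1.mul (hφ.differentiable one_ne_zero k).hasFDerivAt)
    (by
      refine ((continuousOn_const (c := 2 * Complex.I)).mul hcont |>.mono hrect).integrableOn_compact hcomp |>.congr
        (Eventually.of_forall fun k => ?_)
      simp only [dbar, add_apply, smul_apply, one_apply_eq_self, smul_eq_mul, Pi.mul_apply]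
      linear_combination G k * fderiv ℝ φ k Complex.I * Complex.I_sq)
  have hside : ∀ k : ℂ, R ≤ ‖k‖ → G k * φ k = 0 := fun k hk => by rw [(hz k hk).1, mul_zero]
  have s1 : ∀ x : ℝ, G (x + R * Complex.I) * φ (x + R * Complex.I) = 0 := fun x =>
    hside _ (by
      have := Complex.abs_im_le_norm (x + R * Complex.I)
      simpa [abs_of_pos hR0] using this)
  have s2 : ∀ y : ℝ, G (R + y * Complex.I) * φ (R + y * Complex.I) = 0 := fun y =>
    hside _ (by
      have := Complex.abs_re_le_norm (R + y * Complex.I)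
      simpa [abs_of_pos hR0] using this)
  have s3 : ∀ y : ℝ, G ((-R : ℝ) + y * Complex.I) * φ ((-R : ℝ) + y * Complex.I) = 0 := fun y =>
    hside _ (by
      have := Complex.abs_re_le_norm ((-R : ℝ) + y * Complex.I)
      simpa [abs_of_pos hR0] using this)
  simp only [s1, s2, s3, intervalIntegral.integral_zero, smul_zero, sub_zero, add_zero,
    Complex.ofReal_zero, zero_mul] at hGreen
  have hline : ∫ x in (-R)..R, G (x : ℂ) * φ x = ∫ x : ℝ, G x * φ x := by
    rw [intervalIntegral.integral_of_le (by linarith)]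
    refine setIntegral_eq_integral_of_forall_compl_eq_zero fun x hx => hside _ ?_
    rw [Complex.norm_real, Real.norm_eq_abs]
    by_contra! hlt
    exact hx ⟨(abs_lt.1 hlt).1, (abs_lt.1 hlt).2.le⟩
  rw [hline] at hGreen
  rw [h1, hGreen, ← intervalIntegral.integral_const_mul]
  refine intervalIntegral.integral_congr fun x _ => ?_
  rw [← intervalIntegral.integral_const_mul]
  refine intervalIntegral.integral_congr fun y _ => ?_
  simp only [dbar, add_apply, smul_apply,
    one_apply_eq_self, smul_eq_mul]
  generalize fderiv ℝ φ (x + y * Complex.I) = L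
  linear_combination G (x + y * Complex.I) * (L 1 / 2) * Complex.I_sq

/-- Green's formula on the lower half-plane. -/
theorem integral_lower_mul_dbar {G : ℂ → ℂ} (hG : ContinuousOn G {k | k.im ≤ 0})
    (hd : DifferentiableOn ℂ G {k | k.im < 0}) (hφ : ContDiff ℝ 1 φ) (hc : HasCompactSupport φ) :
    ∫ k in {k : ℂ | k.im < 0}, G k * dbar φ k = Complex.I / 2 * ∫ x : ℝ, G x * φ x := by
  have h := integral_upper_mul_dbar (G := fun k => G (-k)) (φ := fun k => φ (-k))
    (hG.comp (by fun_prop) fun k hk => by simpa using hk)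
    (hd.comp (by fun_prop) fun k hk => by simpa using hk) (hφ.comp contDiff_neg)
    (hc.comp_homeomorph (Homeomorph.neg ℂ))
  have h1 : ∫ k in {k : ℂ | k.im < 0}, G k * dbar φ k =
      ∫ k in {k : ℂ | 0 < k.im}, G (-k) * dbar φ (-k) := by
    rw [← (Measure.measurePreserving_neg (volume : Measure ℂ)).setIntegral_preimage_emb
      (Homeomorph.neg ℂ).measurableEmbedding]
    congr 2
    ext k
    simp
  have h2 : ∫ x : ℝ, G (-x) * φ (-x) = ∫ x : ℝ, G x * φ x := by
    rw [← integral_neg_eq_self (fun x : ℝ => G x * φ x)]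
    simp only [Complex.ofReal_neg]
  rw [h2] at h
  rw [h1]
  simp only [dbar_comp_neg, mul_neg, integral_neg] at h
  linear_combination -h

theorem locallyIntegrable_inv_sub (p : ℂ) : LocallyIntegrable (fun k : ℂ => (k - p)⁻¹) volume := by
  have h0 : LocallyIntegrable (fun k : ℂ => k⁻¹) volume :=
    locallyIntegrable_of_norm_le_rpow (C := 1) (α := 1)
      (by rw [Complex.finrank_real_complex]; norm_num)
      (by rw [Complex.finrank_real_complex]; norm_num)
      (Eventually.of_forall fun k => by rw [norm_inv, Real.rpow_neg_one, one_mul])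
      measurable_inv.aestronglyMeasurable
  rw [locallyIntegrable_iff] at h0 ⊢
  intro K hK
  have h1 := h0 ((fun k => k - p) '' K) (hK.image (by fun_prop))
  exact ((measurePreserving_sub_right (volume : Measure ℂ) p).integrableOn_image
    (Homeomorph.subRight p).measurableEmbedding).1 h1

/-- In polar coordinates the Cauchy kernel cancels e^{iθ} and the Jacobian, leaving ∂_rφ/2 plus
(i/2r)∂_θφ. The radial part integrates along each ray to −φ(0); the angular part vanishes by
periodicity in the next lemma. -/
theorem integral_fderiv_polar_radial (hφ : ContDiff ℝ 1 φ) (hc : HasCompactSupport φ) (e : ℂ)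
    (he : ‖e‖ = 1) : ∫ r in Set.Ioi (0 : ℝ), fderiv ℝ φ (r * e) e = -φ 0 := by
  obtain ⟨R, hR0, hR⟩ := hc.exists_tsupport_subset_ball
  have hd : ∀ r : ℝ, HasDerivAt (fun r : ℝ => φ (r * e)) (fderiv ℝ φ (r * e) e) r := fun r => by
    have h1 : HasDerivAt (fun r : ℝ => (r : ℂ) * e) e r :=
      ((hasDerivAt_id r).ofReal_comp.mul_const e).congr_deriv (by simp)
    exact (hφ.differentiable one_ne_zero (r * e)).hasFDerivAt.comp_hasDerivAt r h1
  have hcont : Continuous fun r : ℝ => fderiv ℝ φ (r * e) e := by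
    have := hφ.continuous_fderiv one_ne_zero
    fun_prop
  have hzero : ∀ r : ℝ, R < |r| → φ (r * e) = 0 ∧ fderiv ℝ φ (r * e) = 0 := fun r hr => by
    have hn : (r * e : ℂ) ∉ tsupport φ := fun h => by
      have := hR h
      rw [mem_ball_zero_iff, norm_mul, he, Complex.norm_real, Real.norm_eq_abs] at this
      linarith
    refine ⟨image_eq_zero_of_notMem_tsupport hn, ?_⟩
    by_contra h1
    exact hn (tsupport_fderiv_subset ℝ (subset_tsupport _ h1))
  have hi : Integrable fun r : ℝ => fderiv ℝ φ (r * e) e :=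
    hcont.integrable_of_hasCompactSupport (HasCompactSupport.intro (isCompact_Icc (a := -R) (b := R))
      fun r hr => by
        rw [(hzero r (by by_contra! h; exact hr (abs_le.1 h))).2]; rfl)
  have := integral_Ioi_of_hasDerivAt_of_tendsto' (a := 0) (m := 0) (fun r _ => hd r)
    hi.integrableOn (tendsto_const_nhds.congr' (by
      filter_upwards [eventually_gt_atTop R] with r hr
      exact (hzero r (hr.trans_le (le_abs_self r))).1.symm))
  rw [this]
  simp

theorem integral_fderiv_polar_angular (hφ : ContDiff ℝ 1 φ) {r : ℝ} (hr : r ≠ 0) :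
    ∫ θ in Set.Ioo (-Real.pi) Real.pi,
      fderiv ℝ φ (r * Complex.exp (θ * Complex.I)) (Complex.exp (θ * Complex.I) * Complex.I) = 0 := by
  have hd : ∀ θ : ℝ, HasDerivAt (fun θ : ℝ => φ (r * Complex.exp (θ * Complex.I)))
      (r * fderiv ℝ φ (r * Complex.exp (θ * Complex.I))
        (Complex.exp (θ * Complex.I) * Complex.I)) θ := fun θ => by
    have h1 : HasDerivAt (fun θ : ℝ => (r : ℂ) * Complex.exp (θ * Complex.I))
        (r • (Complex.exp (θ * Complex.I) * Complex.I)) θ := by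
      refine ((((hasDerivAt_id θ).ofReal_comp.mul_const Complex.I).cexp).const_mul
        (r : ℂ)).congr_deriv ?_
      simp
    refine ((hφ.differentiable one_ne_zero _).hasFDerivAt.comp_hasDerivAt θ h1).congr_deriv ?_
    rw [ContinuousLinearMap.map_smul, Complex.real_smul]
  have hcont : Continuous fun θ : ℝ => (r : ℂ) * fderiv ℝ φ (r * Complex.exp (θ * Complex.I))
      (Complex.exp (θ * Complex.I) * Complex.I) := by
    have := hφ.continuous_fderiv one_ne_zero
    fun_prop
  have h := intervalIntegral.integral_eq_sub_of_hasDerivAt (a := -Real.pi) (b := Real.pi)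
    (fun θ _ => hd θ) (hcont.intervalIntegrable _ _)
  rw [intervalIntegral.integral_of_le (by linarith [Real.pi_pos]), integral_Ioc_eq_integral_Ioo,
    integral_const_mul] at h
  refine (mul_eq_zero.1 (h.trans ?_)).resolve_left (Complex.ofReal_ne_zero.2 hr)
  have : Complex.exp (((-Real.pi : ℝ) : ℂ) * Complex.I) = Complex.exp (Real.pi * Complex.I) := by
    push_cast
    rw [neg_mul, Complex.exp_neg, Complex.exp_pi_mul_I]
    norm_num
  rw [this, sub_self]

/-- The Cauchy kernel is a fundamental solution of the `∂̄`-operator. -/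
theorem integral_inv_mul_dbar (hφ : ContDiff ℝ 1 φ) (hc : HasCompactSupport φ) (p : ℂ) :
    ∫ k : ℂ, (k - p)⁻¹ * dbar φ k = -Real.pi * φ p := by
  -- reduction to the kernel at the origin
  wlog hp : p = 0 generalizing φ p
  · have h := this (φ := fun k => φ (k + p)) (hφ.comp (contDiff_id.add contDiff_const))
      (hc.comp_homeomorph (Homeomorph.addRight p)) 0 rfl
    have h1 : ∀ k, dbar (fun k => φ (k + p)) k = dbar φ (k + p) := fun k => by
      unfold dbar
      rw [fderiv_comp_add_right]
    simp only [h1, zero_add, sub_zero] at h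
    rw [← h, ← integral_add_right_eq_self _ p]
    simp
  subst hp
  obtain ⟨R, hR0, hR⟩ := hc.exists_tsupport_subset_ball
  have hf := hφ.continuous_fderiv one_ne_zero
  set E : ℝ → ℂ := fun θ => Complex.exp (θ * Complex.I) with hE
  have hEn : ∀ θ, ‖E θ‖ = 1 := fun θ => Complex.norm_exp_ofReal_mul_I θ
  have hzero : ∀ p : ℝ × ℝ, R < p.1 → fderiv ℝ φ (p.1 * E p.2) = 0 := fun p hp => by
    by_contra h1
    have := hR (tsupport_fderiv_subset ℝ (subset_tsupport _ h1))
    rw [mem_ball_zero_iff, norm_mul, hEn, mul_one, Complex.norm_real, Real.norm_eq_abs] at this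
    linarith [le_abs_self p.1]
  have hint : ∀ F : ℝ × ℝ → ℂ, Continuous F → (∀ p : ℝ × ℝ, R < p.1 → F p = 0) →
      IntegrableOn F (Set.Ioi 0 ×ˢ Set.Ioo (-Real.pi) Real.pi) := fun F hF h0 => by
    have h1 : IntegrableOn F (Set.Icc 0 R ×ˢ Set.Icc (-Real.pi) Real.pi) :=
      hF.continuousOn.integrableOn_compact (isCompact_Icc.prod isCompact_Icc)
    have h2 : IntegrableOn F (Set.Ioi R ×ˢ Set.Ioo (-Real.pi) Real.pi) :=
      integrableOn_zero.congr_fun (fun p hp => (h0 p hp.1).symm)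
        (measurableSet_Ioi.prod measurableSet_Ioo)
    refine (h1.union h2).mono_set fun p hp => ?_
    rcases le_or_gt p.1 R with h | h
    · exact Or.inl ⟨⟨le_of_lt hp.1, h⟩, Set.Ioo_subset_Icc_self hp.2⟩
    · exact Or.inr ⟨h, hp.2⟩
  set A : ℝ × ℝ → ℂ := fun p => fderiv ℝ φ (p.1 * E p.2) (E p.2) with hA
  set B : ℝ × ℝ → ℂ := fun p => fderiv ℝ φ (p.1 * E p.2) (E p.2 * Complex.I) with hB
  have hAi := hint A (by fun_prop) fun p hp => by simp [hA, hzero p hp]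
  have hBi := hint B (by fun_prop) fun p hp => by simp [hB, hzero p hp]
  have hIA : ∫ p in Set.Ioi (0 : ℝ) ×ˢ Set.Ioo (-Real.pi) Real.pi, A p =
      -(2 * Real.pi) * φ 0 := by
    rw [Measure.volume_eq_prod] at hAi ⊢
    rw [← setIntegral_prod_swap, setIntegral_prod (fun z => A z.swap) hAi.swap]
    simp only [hA, Prod.fst_swap, Prod.snd_swap]
    simp only [integral_fderiv_polar_radial hφ hc _ (hEn _)]
    rw [setIntegral_const]
    rw [Real.volume_real_Ioo_of_le (by linarith [Real.pi_pos]), Complex.real_smul]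
    push_cast
    ring
  have hIB : ∫ p in Set.Ioi (0 : ℝ) ×ˢ Set.Ioo (-Real.pi) Real.pi, B p = 0 := by
    rw [Measure.volume_eq_prod] at hBi ⊢
    rw [setIntegral_prod _ hBi]
    refine setIntegral_eq_zero_of_forall_eq_zero fun r hr => ?_
    exact integral_fderiv_polar_angular hφ (ne_of_gt hr)
  rw [← Complex.integral_comp_polarCoord_symm]
  -- A and B are the derivatives of φ in the radial and angular unit directions, so no 1/r remains
  -- and both are continuous up to r = 0.
  have hpt : ∀ p ∈ polarCoord.target, p.1 • ((Complex.polarCoord.symm p - 0)⁻¹ *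
      dbar φ (Complex.polarCoord.symm p)) = 1 / 2 * A p + Complex.I / 2 * B p := fun p hp => by
    have hp1 : (p.1 : ℂ) ≠ 0 := Complex.ofReal_ne_zero.2 (ne_of_gt hp.1)
    have he : Complex.polarCoord.symm p = p.1 * E p.2 := by
      rw [Complex.polarCoord_symm_apply, hE]
      simp only [Complex.exp_mul_I, Complex.ofReal_cos, Complex.ofReal_sin]
    rw [he, sub_zero, Complex.real_smul]
    simp only [hA, hB, dbar]
    generalize fderiv ℝ φ (p.1 * E p.2) = L
    have hE' : E p.2 = Real.cos p.2 + Real.sin p.2 * Complex.I := by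
      simp only [hE, Complex.exp_mul_I, Complex.ofReal_cos, Complex.ofReal_sin]
    have hL : ∀ a b : ℝ, L (a + b * Complex.I) = a * L 1 + b * L Complex.I := fun a b => by
      have : (a + b * Complex.I : ℂ) = a • (1 : ℂ) + b • Complex.I := by simp
      rw [this, map_add, map_smul, map_smul, Complex.real_smul, Complex.real_smul]
    have h1 : L (E p.2) = Real.cos p.2 * L 1 + Real.sin p.2 * L Complex.I := by rw [hE', hL]
    have h2 : L (E p.2 * Complex.I) = -Real.sin p.2 * L 1 + Real.cos p.2 * L Complex.I := by
      have : E p.2 * Complex.I = ((-Real.sin p.2 : ℝ) : ℂ) + (Real.cos p.2 : ℝ) * Complex.I := by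
        rw [hE']
        push_cast
        linear_combination (Complex.sin p.2) * Complex.I_sq
      rw [this, hL]
      push_cast
      ring
    have hne : E p.2 ≠ 0 := norm_ne_zero_iff.1 (by rw [hEn]; exact one_ne_zero)
    have hcs : (Real.cos p.2 : ℂ) ^ 2 + (Real.sin p.2 : ℂ) ^ 2 = 1 := by
      push_cast
      exact Complex.cos_sq_add_sin_sq _
    rw [h1, h2, mul_inv, mul_assoc, mul_inv_cancel_left₀ hp1, inv_mul_eq_iff_eq_mul₀ hne, hE']
    linear_combination (-(1 : ℂ) / 2) * (L 1 + Complex.I * L Complex.I) * hcs +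
      1 / 2 * (Real.sin p.2 * (Real.sin p.2 * L 1 - Real.cos p.2 * L Complex.I)) * Complex.I_sq
  rw [setIntegral_congr_fun polarCoord.open_target.measurableSet hpt]
  change ∫ p in Set.Ioi (0 : ℝ) ×ˢ Set.Ioo (-Real.pi) Real.pi, _ = _
  rw [integral_add (hAi.const_mul _) (hBi.const_mul _), integral_const_mul, integral_const_mul,
    hIA, hIB]
  ring

end Dbar


/-! ### From the contour problem to the `∂̄`-problem -/

/-- Riemann's theorem in a form suited to simple poles: it removes the singularities of χ minus its
principal parts and those cancelled by the zeros of a Blaschke product. -/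
theorem differentiableAt_update_limUnder {f : ℂ → ℂ} {c : ℂ}
    (hd : ∀ᶠ z in 𝓝[≠] c, DifferentiableAt ℂ f z)
    (h : Tendsto (fun z => (z - c) * f z) (𝓝[≠] c) (𝓝 0)) :
    DifferentiableAt ℂ (Function.update f c (limUnder (𝓝[≠] c) f)) c ∧
      Tendsto f (𝓝[≠] c) (𝓝 (limUnder (𝓝[≠] c) f)) := by
  obtain ⟨s, hs, hsd⟩ := eventually_nhdsWithin_iff.1 hd |>.exists_mem
  have h1 := Complex.differentiableOn_update_limUnder_of_isLittleO (f := f) hs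
    (fun z hz => (hsd z hz.1 hz.2).differentiableWithinAt) (by
      refine (Asymptotics.isLittleO_iff_tendsto' ?_).2 ?_
      · filter_upwards [self_mem_nhdsWithin] with z hz h0
        exact absurd (inv_eq_zero.1 h0) (sub_ne_zero.2 hz)
      · have h2 : Tendsto (fun z => (z - c) * f c) (𝓝[≠] c) (𝓝 0) :=
          (Continuous.tendsto' (by fun_prop) c 0 (by simp)).mono_left nhdsWithin_le_nhds
        have h3 := h.sub h2
        rw [sub_zero] at h3
        refine h3.congr fun z => ?_
        rw [div_inv_eq_mul]
        ring)
  have h2 := h1.differentiableAt hs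
  refine ⟨h2, ?_⟩
  have h3 := h2.continuousAt.tendsto.mono_left (nhdsWithin_le_nhds (s := {c}ᶜ))
  rw [Function.update_self] at h3
  refine h3.congr' ?_
  filter_upwards [self_mem_nhdsWithin] with z hz
  exact Function.update_of_ne hz _ _

theorem eventually_nhdsNE_notMem {s : Set ℂ} (hs : s.Finite) (c : ℂ) : ∀ᶠ z in 𝓝[≠] c, z ∉ s := by
  have h : (s \ {c})ᶜ ∈ 𝓝 c := (hs.subset Set.sdiff_subset).isClosed.compl_mem_nhds (by simp)
  filter_upwards [mem_nhdsWithin_of_mem_nhds h, self_mem_nhdsWithin] with z hz hzc hzs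
  exact hz ⟨hzs, hzc⟩

theorem volume_im_eq_zero : volume {k : ℂ | k.im = 0} = 0 := by
  have h := Complex.volume_preserving_equiv_real_prod.measure_preimage
    (s := Set.univ ×ˢ {(0 : ℝ)}) (MeasurableSet.univ.prod (measurableSet_singleton _)).nullMeasurableSet
  have h1 : Complex.measurableEquivRealProd ⁻¹' (Set.univ ×ˢ {(0 : ℝ)}) = {k : ℂ | k.im = 0} := by
    ext k
    simp
  rw [h1, Measure.volume_eq_prod, Measure.prod_prod] at h
  simpa using h

namespace DressingData

variable {N : ℕ} {D : DressingData N} {x t : ℝ} {χ : ℂ → ℂ}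

/-- The residue at `iκ_n` prescribed by the dressing data. -/
noncomputable def res (D : DressingData N) (x t : ℝ) (χ : ℂ → ℂ) (n : Fin N) : ℂ :=
  Complex.I * (D.c n : ℂ) * (Real.exp (-2 * D.κ n * x + 8 * (D.κ n) ^ 3 * t) : ℂ) * χ (-D.pole n)

/-- The singular part of `χ`. -/
noncomputable def singularPart (D : DressingData N) (x t : ℝ) (χ : ℂ → ℂ) (k : ℂ) : ℂ :=
  ∑ n, D.res x t χ n * (k - D.pole n)⁻¹

theorem pole_im (D : DressingData N) (n : Fin N) : (D.pole n).im = D.κ n := by simp [pole]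

theorem differentiableAt_singularPart {k : ℂ} (hk : ∀ n, k ≠ D.pole n) :
    DifferentiableAt ℂ (D.singularPart x t χ) k := by
  unfold singularPart
  refine DifferentiableAt.fun_sum fun n _ => ?_
  have := sub_ne_zero.2 (hk n)
  fun_prop (disch := assumption)

theorem isOpen_regular (D : DressingData N) : IsOpen {k : ℂ | k.im ≠ 0 ∧ ∀ n, k ≠ D.pole n} := by
  have h1 : IsOpen {k : ℂ | k.im ≠ 0} := isOpen_ne_fun Complex.continuous_im continuous_const
  have h2 : IsOpen (Set.range D.pole)ᶜ := (Set.finite_range D.pole).isClosed.isOpen_compl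
  convert h1.inter h2 using 1
  ext k
  simp [eq_comm]

theorem SolvesContourProblem.differentiableAt (h : D.SolvesContourProblem x t χ) {k : ℂ}
    (hk0 : k.im ≠ 0) (hk : ∀ n, k ≠ D.pole n) : DifferentiableAt ℂ χ k :=
  h.holomorphic.differentiableAt (D.isOpen_regular.mem_nhds ⟨hk0, hk⟩)

open Classical in
/-- `χ` minus its singular part, the singularities at the `iκ_n` being removed. -/
noncomputable def regularPart (D : DressingData N) (x t : ℝ) (χ : ℂ → ℂ) (k : ℂ) : ℂ :=
  if ∃ n, k = D.pole n then limUnder (𝓝[≠] k) (fun z => χ z - D.singularPart x t χ z)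
  else χ k - D.singularPart x t χ k

theorem regularPart_of_ne {k : ℂ} (hk : ∀ n, k ≠ D.pole n) :
    D.regularPart x t χ k = χ k - D.singularPart x t χ k := by
  rw [regularPart, if_neg (by push Not; exact hk)]

theorem tendsto_mul_singularPart (hinj : Function.Injective D.κ) (n : Fin N) :
    Tendsto (fun z => (z - D.pole n) * D.singularPart x t χ z) (𝓝[≠] D.pole n)
      (𝓝 (D.res x t χ n)) := by
  have h1 : ∀ m ∈ Finset.univ.erase n, Tendsto (fun z => (z - D.pole n) *
      (D.res x t χ m * (z - D.pole m)⁻¹)) (𝓝[≠] D.pole n) (𝓝 0) := fun m hm => by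
    have hne : D.pole n - D.pole m ≠ 0 := sub_ne_zero.2 fun h => by
      have := congrArg Complex.im h
      rw [pole_im, pole_im] at this
      exact (Finset.ne_of_mem_erase hm) (hinj this).symm
    have : ContinuousAt (fun z => (z - D.pole n) * (D.res x t χ m * (z - D.pole m)⁻¹))
        (D.pole n) := by fun_prop (disch := assumption)
    have h2 := this.tendsto.mono_left (nhdsWithin_le_nhds (s := {D.pole n}ᶜ))
    simpa using h2
  have h2 := (tendsto_finsetSum _ h1).const_add (D.res x t χ n)
  rw [Finset.sum_const_zero, add_zero] at h2
  refine h2.congr' ?_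
  filter_upwards [self_mem_nhdsWithin] with z hz
  have hz' : z - D.pole n ≠ 0 := sub_ne_zero.2 hz
  rw [singularPart, ← Finset.add_sum_erase _ _ (Finset.mem_univ n), mul_add, Finset.mul_sum]
  congr 1
  field_simp

/-- Multiplied by k − iκ_n, both χ and the singular part tend to the prescribed residue, so the
singularity of their difference is removable. Distinctness of the κ_n keeps the other terms of the
singular part finite there. -/
theorem SolvesContourProblem.differentiableAt_regularPart (h : D.SolvesContourProblem x t χ)
    (hinj : Function.Injective D.κ) {k : ℂ} (hk0 : k.im ≠ 0) :
    DifferentiableAt ℂ (D.regularPart x t χ) k := by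
  have hfin := Set.finite_range D.pole
  by_cases hk : ∃ n, k = D.pole n
  · obtain ⟨n, rfl⟩ := hk
    have him : ∀ᶠ z : ℂ in 𝓝[≠] D.pole n, z.im ≠ 0 :=
      (Complex.continuous_im.continuousAt.eventually_ne hk0).filter_mono nhdsWithin_le_nhds
    have h1 : ∀ᶠ z in 𝓝[≠] D.pole n,
        DifferentiableAt ℂ (fun z => χ z - D.singularPart x t χ z) z := by
      filter_upwards [him, eventually_nhdsNE_notMem hfin (D.pole n)] with z hz hz'
      have hz'' : ∀ m, z ≠ D.pole m := fun m hm => hz' ⟨m, hm.symm⟩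
      exact (h.differentiableAt hz hz'').sub (differentiableAt_singularPart hz'')
    have h2 : Tendsto (fun z => (z - D.pole n) * (χ z - D.singularPart x t χ z))
        (𝓝[≠] D.pole n) (𝓝 0) := by
      have := (h.residue n).sub (tendsto_mul_singularPart (x := x) (t := t) (χ := χ) hinj n)
      rw [res, sub_self] at this
      exact this.congr fun z => by ring
    refine (differentiableAt_update_limUnder h1 h2).1.congr_of_eventuallyEq ?_
    have h3 := eventually_nhdsNE_notMem hfin (D.pole n)
    rw [eventually_nhdsWithin_iff] at h3
    filter_upwards [h3] with z hz
    by_cases hzn : z = D.pole n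
    · rw [hzn, Function.update_self, regularPart, if_pos ⟨n, rfl⟩]
    · rw [Function.update_of_ne hzn, regularPart_of_ne fun m hm => hz hzn ⟨m, hm.symm⟩]
  · push Not at hk
    refine ((h.differentiableAt hk0 hk).sub
      (differentiableAt_singularPart (x := x) (t := t) (χ := χ) hk)).congr_of_eventuallyEq ?_
    filter_upwards [D.isOpen_regular.mem_nhds ⟨hk0, hk⟩] with z hz
    exact regularPart_of_ne hz.2

theorem continuousOn_extendFrom_halfPlane {A B : Set ℂ} {f : ℂ → ℂ} {g : ℝ → ℂ}
    (hB : B ⊆ closure A) (hAB : ∀ k ∈ B, k ∈ A ∨ k.im = 0) (hf : ContinuousOn f A)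
    (hg : ∀ k : ℝ, Tendsto f (𝓝[A] k) (𝓝 (g k))) : ContinuousOn (extendFrom A f) B := by
  refine continuousOn_extendFrom hB fun k hk => ?_
  rcases hAB k hk with h | h
  · exact ⟨_, hf k h⟩
  · have : k = (k.re : ℂ) := Complex.ext rfl (by simpa using h)
    rw [this]
    exact ⟨_, hg k.re⟩

/-- The decomposition of `χ` into a singular part and functions holomorphic in the half-planes
and continuous up to the boundary. -/
theorem SolvesContourProblem.exists_decomposition (h : D.SolvesContourProblem x t χ)
    (h0 : ∀ n, D.κ n ≠ 0) (hinj : Function.Injective D.κ) {χp χm : ℝ → ℂ}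
    (hp : ∀ k : ℝ, Tendsto χ (𝓝[{z : ℂ | 0 < z.im}] (k : ℂ)) (𝓝 (χp k)))
    (hm : ∀ k : ℝ, Tendsto χ (𝓝[{z : ℂ | z.im < 0}] (k : ℂ)) (𝓝 (χm k))) :
    ∃ Gp Gm : ℂ → ℂ, ContinuousOn Gp {k | 0 ≤ k.im} ∧ DifferentiableOn ℂ Gp {k | 0 < k.im} ∧
      ContinuousOn Gm {k | k.im ≤ 0} ∧ DifferentiableOn ℂ Gm {k | k.im < 0} ∧
      (∀ k : ℂ, 0 < k.im → (∀ n, k ≠ D.pole n) → χ k - D.singularPart x t χ k = Gp k) ∧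
      (∀ k : ℂ, k.im < 0 → (∀ n, k ≠ D.pole n) → χ k - D.singularPart x t χ k = Gm k) ∧
      ∀ k : ℝ, Gp k - Gm k = χp k - χm k := by
  set H := D.regularPart x t χ
  have hreal : ∀ k : ℝ, ∀ n, (k : ℂ) ≠ D.pole n := fun k n hkn => by
    have := congrArg Complex.im hkn
    rw [pole_im, Complex.ofReal_im] at this
    exact h0 n this.symm
  have hne : ∀ k : ℝ, ∀ᶠ z in 𝓝 (k : ℂ), ∀ n, z ≠ D.pole n := fun k => by
    have := (Set.finite_range D.pole).isClosed.compl_mem_nhds (x := (k : ℂ))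
      (by rintro ⟨n, hn⟩; exact hreal k n hn.symm)
    filter_upwards [this] with z hz n hn
    exact hz ⟨n, hn.symm⟩
  have hlim : ∀ (A : Set ℂ) (g : ℝ → ℂ) (k : ℝ), Tendsto χ (𝓝[A] (k : ℂ)) (𝓝 (g k)) →
      Tendsto H (𝓝[A] (k : ℂ)) (𝓝 (g k - D.singularPart x t χ k)) := fun A g k hA => by
    refine (hA.sub ((differentiableAt_singularPart
      (hreal k)).continuousAt.tendsto.mono_left nhdsWithin_le_nhds)).congr' ?_
    filter_upwards [(hne k).filter_mono nhdsWithin_le_nhds] with z hz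
    exact (regularPart_of_ne hz).symm
  have hlp := fun k => hlim _ χp k (hp k)
  have hlm := fun k => hlim _ χm k (hm k)
  have hcp : closure {k : ℂ | 0 < k.im} = {k : ℂ | 0 ≤ k.im} := Complex.closure_setOfPred_lt_im 0
  have hcm : closure {k : ℂ | k.im < 0} = {k : ℂ | k.im ≤ 0} := Complex.closure_setOfPred_im_lt 0
  have hdp : DifferentiableOn ℂ H {k : ℂ | 0 < k.im} := fun k hk =>
    (h.differentiableAt_regularPart hinj (ne_of_gt hk)).differentiableWithinAt
  have hdm : DifferentiableOn ℂ H {k : ℂ | k.im < 0} := fun k hk =>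
    (h.differentiableAt_regularPart hinj (ne_of_lt hk)).differentiableWithinAt
  have hep := extendFrom_extends hdp.continuousOn
  have hem := extendFrom_extends hdm.continuousOn
  refine ⟨extendFrom {k | 0 < k.im} H, extendFrom {k | k.im < 0} H,
    continuousOn_extendFrom_halfPlane hcp.ge (fun k hk => ?_) hdp.continuousOn hlp,
    hdp.congr hep,
    continuousOn_extendFrom_halfPlane hcm.ge (fun k hk => ?_) hdm.continuousOn hlm,
    hdm.congr hem, fun k hk hk' => ?_, fun k hk hk' => ?_, fun k => ?_⟩
  · rcases lt_or_eq_of_le (show 0 ≤ k.im from hk) with h | h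
    exacts [Or.inl h, Or.inr h.symm]
  · exact lt_or_eq_of_le (show k.im ≤ 0 from hk)
  · rw [hep k hk, ← regularPart_of_ne hk']
  · rw [hem k hk, ← regularPart_of_ne hk']
  · rw [extendFrom_eq (by rw [hcp]; simp) (hlp k), extendFrom_eq (by rw [hcm]; simp) (hlm k)]
    ring

theorem ae_ne_pole (D : DressingData N) : ∀ᵐ k : ℂ, ∀ n, k ≠ D.pole n := by
  have := (Set.finite_range D.pole).measure_zero (volume : Measure ℂ)
  filter_upwards [measure_eq_zero_iff_ae_notMem.1 this] with k hk n hn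
  exact hk ⟨n, hn.symm⟩

theorem locallyIntegrable_singularPart : LocallyIntegrable (D.singularPart x t χ) volume :=
  locallyIntegrable_finsetSum _ fun n _ => (locallyIntegrable_inv_sub (D.pole n)).smul (D.res x t χ n)

theorem locallyIntegrable_of_decomposition {f Gp Gm : ℂ → ℂ}
    (hp : ContinuousOn Gp {k | 0 ≤ k.im}) (hm : ContinuousOn Gm {k | k.im ≤ 0})
    (hfp : ∀ᵐ k : ℂ, 0 < k.im → f k = Gp k) (hfm : ∀ᵐ k : ℂ, k.im < 0 → f k = Gm k) :
    LocallyIntegrable f volume := by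
  rw [locallyIntegrable_iff]
  intro K hK
  have hup : IsClosed {k : ℂ | 0 ≤ k.im} := isClosed_le continuous_const Complex.continuous_im
  have hlow : IsClosed {k : ℂ | k.im ≤ 0} := isClosed_le Complex.continuous_im continuous_const
  have mup : MeasurableSet {k : ℂ | 0 < k.im} :=
    measurableSet_lt measurable_const Complex.measurable_im
  have mlow : MeasurableSet {k : ℂ | k.im < 0} :=
    measurableSet_lt Complex.measurable_im measurable_const
  have h1 : IntegrableOn f (K ∩ {k | 0 < k.im}) := by
    refine (((hp.mono Set.inter_subset_right).integrableOn_compact (hK.inter_right hup)).mono_set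
      (Set.inter_subset_inter_right _ fun k (hk : 0 < k.im) => hk.le)).congr ?_
    refine (ae_restrict_iff' (hK.measurableSet.inter mup)).2 ?_
    filter_upwards [hfp] with k hk hkK
    exact (hk hkK.2).symm
  have h2 : IntegrableOn f (K ∩ {k | k.im < 0}) := by
    refine (((hm.mono Set.inter_subset_right).integrableOn_compact (hK.inter_right hlow)).mono_set
      (Set.inter_subset_inter_right _ fun k (hk : k.im < 0) => hk.le)).congr ?_
    refine (ae_restrict_iff' (hK.measurableSet.inter mlow)).2 ?_
    filter_upwards [hfm] with k hk hkK
    exact (hk hkK.2).symm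
  have h3 : IntegrableOn f {k : ℂ | k.im = 0} :=
    IntegrableOn.of_measure_zero volume_im_eq_zero
  refine ((h1.union h2).union h3).mono_set fun k hk => ?_
  rcases lt_trichotomy k.im 0 with h | h | h
  · exact Or.inl (Or.inr ⟨hk, h⟩)
  · exact Or.inr h
  · exact Or.inl (Or.inl ⟨hk, h⟩)

/-- The two half-planes induce opposite orientations on the real axis, so Green's formulas combine
to the difference of the boundary values; the axis itself is a null set. -/
theorem integral_mul_dbar_of_decomposition {f Gp Gm φ : ℂ → ℂ}
    (hp : ContinuousOn Gp {k | 0 ≤ k.im}) (hdp : DifferentiableOn ℂ Gp {k | 0 < k.im})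
    (hm : ContinuousOn Gm {k | k.im ≤ 0}) (hdm : DifferentiableOn ℂ Gm {k | k.im < 0})
    (hfp : ∀ᵐ k : ℂ, 0 < k.im → f k = Gp k) (hfm : ∀ᵐ k : ℂ, k.im < 0 → f k = Gm k)
    (hφ : ContDiff ℝ 1 φ) (hc : HasCompactSupport φ) :
    ∫ k : ℂ, f k * dbar φ k = -(Complex.I / 2) * ∫ x : ℝ, (Gp x - Gm x) * φ x := by
  have mup : MeasurableSet {k : ℂ | 0 < k.im} :=
    measurableSet_lt measurable_const Complex.measurable_im
  have mlow : MeasurableSet {k : ℂ | k.im < 0} :=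
    measurableSet_lt Complex.measurable_im measurable_const
  have hint : Integrable fun k => f k * dbar φ k :=
    ((locallyIntegrable_of_decomposition hp hm hfp hfm).integrable_smul_left_of_hasCompactSupport
      hφ.continuous_dbar hc.dbar).congr (Eventually.of_forall fun k => by
        simp only [smul_eq_mul, mul_comm])
  have h1 := integral_upper_mul_dbar hp hdp hφ hc
  have h2 := integral_lower_mul_dbar hm hdm hφ hc
  have h3 : ∫ k in {k : ℂ | 0 < k.im}, f k * dbar φ k =
      ∫ k in {k : ℂ | 0 < k.im}, Gp k * dbar φ k := by
    refine setIntegral_congr_ae mup ?_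
    filter_upwards [hfp] with k hk hk'
    rw [hk hk']
  have h4 : ∫ k in {k : ℂ | 0 < k.im}ᶜ, f k * dbar φ k =
      ∫ k in {k : ℂ | k.im < 0}, Gm k * dbar φ k := by
    have : ({k : ℂ | 0 < k.im}ᶜ : Set ℂ) =ᵐ[volume] {k : ℂ | k.im < 0} := by
      filter_upwards [measure_eq_zero_iff_ae_notMem.1 volume_im_eq_zero] with k hk
      refine propext ⟨fun h => lt_of_le_of_ne (not_lt.1 h) hk, fun h => not_lt.2 (le_of_lt h)⟩
    rw [setIntegral_congr_set this]
    refine setIntegral_congr_ae mlow ?_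
    filter_upwards [hfm] with k hk hk'
    rw [hk hk']
  have hφr : HasCompactSupport fun x : ℝ => φ x :=
    hc.comp_isClosedEmbedding Complex.isometry_ofReal.isClosedEmbedding
  have hφc : Continuous fun x : ℝ => φ x := hφ.continuous.comp Complex.continuous_ofReal
  have ip : Integrable fun x : ℝ => Gp x * φ x := by
    have hc : Continuous fun x : ℝ => Gp x :=
      hp.comp_continuous Complex.continuous_ofReal fun x => by simp
    exact (hc.mul hφc).integrable_of_hasCompactSupport hφr.mul_left
  have im : Integrable fun x : ℝ => Gm x * φ x := by
    have hc : Continuous fun x : ℝ => Gm x :=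
      hm.comp_continuous Complex.continuous_ofReal fun x => by simp
    exact (hc.mul hφc).integrable_of_hasCompactSupport hφr.mul_left
  rw [← integral_add_compl mup hint, h3, h4, h1, h2]
  simp only [sub_mul]
  rw [integral_sub ip im]
  ring

/-- A solution of the contour problem solves the `∂̄`-problem. -/
theorem SolvesContourProblem.solvesDbarProblem (h : D.SolvesContourProblem x t χ)
    (h0 : ∀ n, D.κ n ≠ 0) (hinj : Function.Injective D.κ)
    (hneg : ∀ n m, D.κ n ≠ -D.κ m) : D.SolvesDbarProblem x t χ := by
  obtain ⟨χp, χm, hp, hm, hjump⟩ := h.jump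
  obtain ⟨Gp, Gm, cp, dp, cm, dm, ep, em, hG⟩ := h.exists_decomposition h0 hinj hp hm
  have hfp : ∀ᵐ k : ℂ, 0 < k.im → χ k - D.singularPart x t χ k = Gp k := by
    filter_upwards [D.ae_ne_pole] with k hk hk'
    exact ep k hk' hk
  have hfm : ∀ᵐ k : ℂ, k.im < 0 → χ k - D.singularPart x t χ k = Gm k := by
    filter_upwards [D.ae_ne_pole] with k hk hk'
    exact em k hk' hk
  have hreg := locallyIntegrable_of_decomposition cp cm hfp hfm
  have hsing := locallyIntegrable_singularPart (D := D) (x := x) (t := t) (χ := χ)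
  refine ⟨?_, fun n => ?_, ⟨χm, hm, fun φ hφ hc => ?_⟩, h.at_infinity⟩
  · exact (hreg.add hsing).congr (Eventually.of_forall fun k => by simp)
  · refine (h.differentiableAt ?_ fun m hm => hneg m n ?_).continuousAt
    · rw [Complex.neg_im, pole_im]
      exact neg_ne_zero.2 (h0 n)
    · have := congrArg Complex.im hm
      rw [Complex.neg_im, pole_im, pole_im] at this
      exact this.symm
  · have hφ1 : ContDiff ℝ 1 φ := hφ.of_le (by exact_mod_cast le_top)
    have e1 := integral_mul_dbar_of_decomposition cp dp cm dm hfp hfm hφ1 hc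
    have i1 : Integrable fun k => (χ k - D.singularPart x t χ k) * dbar φ k :=
      (hreg.integrable_smul_left_of_hasCompactSupport hφ1.continuous_dbar hc.dbar).congr
        (Eventually.of_forall fun k => by simp only [smul_eq_mul, mul_comm])
    have i2 : ∀ n, Integrable fun k => D.res x t χ n * ((k - D.pole n)⁻¹ * dbar φ k) := fun n =>
      (((locallyIntegrable_inv_sub (D.pole n)).integrable_smul_left_of_hasCompactSupport
        hφ1.continuous_dbar hc.dbar).const_mul (D.res x t χ n)).congr
        (Eventually.of_forall fun k => by simp only [smul_eq_mul, mul_comm])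
    -- Each principal part yields a point mass by the Cauchy kernel. It is continuous across the
    -- real axis, as κ_n ≠ 0, so the regular part retains the whole jump of χ.
    have e2 : ∫ k : ℂ, χ k * dbar φ k = (∫ k, (χ k - D.singularPart x t χ k) * dbar φ k) +
        ∑ n, D.res x t χ n * (-Real.pi * φ (D.pole n)) := by
      have e3 : (∑ n, D.res x t χ n * (-Real.pi * φ (D.pole n)) : ℂ) =
          ∫ k, ∑ n, D.res x t χ n * ((k - D.pole n)⁻¹ * dbar φ k) := by
        rw [integral_finsetSum _ fun n _ => i2 n]
        refine Finset.sum_congr rfl fun n _ => ?_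
        rw [integral_const_mul, integral_inv_mul_dbar hφ1 hc]
      rw [e3, ← integral_add i1 (integrable_finsetSum _ fun n _ => i2 n)]
      refine integral_congr_ae (Eventually.of_forall fun k => ?_)
      simp only [singularPart, ← mul_assoc, ← Finset.sum_mul]
      ring
    rw [e2, e1, neg_add, ← neg_mul, neg_neg, ← integral_const_mul, ← Finset.sum_neg_distrib]
    congr 1
    · refine integral_congr_ae (Eventually.of_forall fun k => ?_)
      simp only [hG, hjump]
      ring
    · refine Finset.sum_congr rfl fun n _ => ?_
      have : (Real.exp (-2 * D.κ n * x + 8 * D.κ n ^ 3 * t) : ℂ) =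
          Complex.exp (2 * Complex.I * D.pole n * x + 8 * Complex.I * (D.pole n) ^ 3 * t) := by
        rw [Complex.ofReal_exp, pole]
        congr 1
        push_cast
        linear_combination (-2 * (D.κ n : ℂ) * x - 8 * (D.κ n : ℂ) ^ 3 * t * (Complex.I ^ 2 - 1)) *
          Complex.I_sq
      rw [res, this]
      ring

end DressingData


/-! ### Expansions at infinity -/

theorem hasExpansionAtInfinity_one : HasExpansionAtInfinity (fun _ => 1) 0 := by
  unfold HasExpansionAtInfinity
  simp only [Complex.ofReal_zero, mul_zero, add_zero, sub_self]
  exact Asymptotics.isBigO_zero _ _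

theorem isBigO_expansion (Q : ℝ) : (fun k : ℂ => 1 + Complex.I / (2 * k) * (Q : ℂ))
    =O[Bornology.cobounded ℂ ⊓ 𝓟 {k : ℂ | k.im ≠ 0}] fun _ => (1 : ℂ) := by
  have h : HasExpansionAtInfinity (fun k => 1 + Complex.I / (2 * k) * (Q : ℂ)) Q := by
    unfold HasExpansionAtInfinity
    simp only [sub_self]
    exact Asymptotics.isBigO_zero _ _
  exact h.tendsto.isBigO_one ℂ

theorem HasExpansionAtInfinity.mul {χ₁ χ₂ : ℂ → ℂ} {Q₁ Q₂ : ℝ} (h₁ : HasExpansionAtInfinity χ₁ Q₁)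
    (h₂ : HasExpansionAtInfinity χ₂ Q₂) :
    HasExpansionAtInfinity (fun k => χ₁ k * χ₂ k) (Q₁ + Q₂) := by
  have h₂' := h₂
  unfold HasExpansionAtInfinity at h₁ h₂'
  have a := (Asymptotics.IsBigO.mul h₁ (h₂.tendsto.isBigO_one ℂ)).congr_right
    fun k => mul_one (1 / k ^ 2)
  have b := (Asymptotics.IsBigO.mul (isBigO_expansion Q₁) h₂').congr_right
    fun k => one_mul (1 / k ^ 2)
  have c : (fun k : ℂ => -(Q₁ * Q₂ / 4 : ℂ) * (1 / k ^ 2))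
      =O[Bornology.cobounded ℂ ⊓ 𝓟 {k : ℂ | k.im ≠ 0}] fun k => 1 / k ^ 2 :=
    (Asymptotics.isBigO_refl _ _).const_mul_left _
  refine ((a.add b).add c).congr' ?_ EventuallyEq.rfl
  filter_upwards [eventually_ne_cobounded _] with k hk
  have := hk.1
  push_cast
  field_simp
  linear_combination (-4) * (Q₁ : ℂ) * Q₂ * Complex.I_sq

theorem HasExpansionAtInfinity.congr' {χ₁ χ₂ : ℂ → ℂ} {Q : ℝ} (h : HasExpansionAtInfinity χ₁ Q)
    (he : χ₁ =ᶠ[Bornology.cobounded ℂ] χ₂) : HasExpansionAtInfinity χ₂ Q :=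
  Asymptotics.IsBigO.congr' h ((he.filter_mono inf_le_left).mono fun k hk => by
    simp only [hk]) EventuallyEq.rfl

/-! ### The Blaschke factors -/

section Blaschke

variable {N : ℕ} {κ : Fin N → ℝ} {I : Finset (Fin N)}

/-- The identity that drives the transplantation. With division by zero equal to zero it holds for
all k, including the zeros and poles. -/
theorem blaschke_neg (κ : Fin N → ℝ) (I : Finset (Fin N)) (k : ℂ) :
    blaschke κ I (-k) = (blaschke κ I k)⁻¹ := by
  unfold blaschke
  rw [← Finset.prod_inv_distrib]
  refine Finset.prod_congr rfl fun m _ => ?_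
  rw [inv_div, ← neg_div_neg_eq]
  congr 1 <;> ring

theorem blaschke_conj (κ : Fin N → ℝ) (I : Finset (Fin N)) (k : ℝ) :
    (starRingEnd ℂ) (blaschke κ I k) = (blaschke κ I k)⁻¹ := by
  unfold blaschke
  rw [← Finset.prod_inv_distrib, map_prod]
  refine Finset.prod_congr rfl fun m _ => ?_
  simp only [map_div₀, map_sub, map_add, map_mul, Complex.conj_ofReal, Complex.conj_I, inv_div]
  congr 1 <;> ring

theorem ofReal_sub_I_mul_ne_zero {c : ℝ} (hc : c ≠ 0) (k : ℝ) :
    (k : ℂ) - Complex.I * c ≠ 0 := fun h => hc (by simpa using congrArg Complex.im h)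

theorem ofReal_add_I_mul_ne_zero {c : ℝ} (hc : c ≠ 0) (k : ℝ) :
    (k : ℂ) + Complex.I * c ≠ 0 := fun h => hc (by simpa using congrArg Complex.im h)

theorem blaschke_ofReal_ne_zero (hκ : ∀ n, 0 < κ n) (k : ℝ) : blaschke κ I k ≠ 0 :=
  Finset.prod_ne_zero_iff.2 fun m _ => div_ne_zero (ofReal_sub_I_mul_ne_zero (hκ m).ne' k)
    (ofReal_add_I_mul_ne_zero (hκ m).ne' k)

theorem norm_blaschke_ofReal (hκ : ∀ n, 0 < κ n) (k : ℝ) : ‖blaschke κ I k‖ = 1 := by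
  have h := mul_inv_cancel₀ (blaschke_ofReal_ne_zero (I := I) hκ k)
  rw [← blaschke_conj, Complex.mul_conj, Complex.normSq_eq_norm_sq] at h
  have h1 : ‖blaschke κ I k‖ ^ 2 = 1 := by exact_mod_cast h
  exact (pow_eq_one_iff_of_nonneg (norm_nonneg _) two_ne_zero).1 h1

theorem differentiableAt_blaschke {k : ℂ} (hk : ∀ m ∈ I, k + Complex.I * κ m ≠ 0) :
    DifferentiableAt ℂ (blaschke κ I) k := by
  unfold blaschke
  refine DifferentiableAt.fun_finsetProd fun m hm => ?_
  have := hk m hm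
  fun_prop (disch := assumption)

theorem blaschke_eq_erase_mul {n : Fin N} (hn : n ∈ I) (k : ℂ) :
    blaschke κ I k = (k - Complex.I * κ n) / (k + Complex.I * κ n) * blaschke κ (I.erase n) k :=
  (Finset.mul_prod_erase _ _ hn).symm

/-- Each factor is 1 − 2iκ/k + O(1/k²) = 1 + (i/2k)(−4κ) + O(1/k²), and first-order coefficients add
under multiplication. -/
theorem hasExpansionAtInfinity_blaschke (κ : Fin N → ℝ) (I : Finset (Fin N)) :
    HasExpansionAtInfinity (blaschke κ I) (-(4 * ∑ m ∈ I, κ m)) := by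
  classical
  induction I using Finset.induction_on with
  | empty =>
    have : blaschke κ ∅ = fun _ => 1 := funext fun k => Finset.prod_empty
    simpa [this] using hasExpansionAtInfinity_one
  | insert n I hn ih =>
    have h1 : HasExpansionAtInfinity
        (fun k => (k - Complex.I * κ n) / (k + Complex.I * κ n)) (-(4 * κ n)) := by
      have hdiv : Tendsto (fun k : ℂ => k / (k + Complex.I * κ n)) (Bornology.cobounded ℂ)
          (𝓝 1) := by
        have h2 : Tendsto (fun k : ℂ => (1 + Complex.I * κ n * k⁻¹)⁻¹) (Bornology.cobounded ℂ)
            (𝓝 1) := by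
          have := ((tendsto_inv₀_cobounded (α := ℂ)).const_mul (Complex.I * κ n)).const_add 1
          rw [mul_zero, add_zero] at this
          simpa using this.inv₀ one_ne_zero
        refine h2.congr' ?_
        filter_upwards [Bornology.eventually_ne_cobounded (0 : ℂ)] with k hk
        have : 1 + Complex.I * κ n * k⁻¹ = (k + Complex.I * κ n) / k := by field_simp
        rw [this, inv_div]
      have h3 := ((hdiv.mono_left inf_le_left).isBigO_one ℂ (l := Bornology.cobounded ℂ ⊓
        𝓟 {k : ℂ | k.im ≠ 0})).mul (((Asymptotics.isBigO_refl (fun k : ℂ => 1 / k ^ 2)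
        (Bornology.cobounded ℂ ⊓ 𝓟 {k : ℂ | k.im ≠ 0})).const_mul_left
          (-2 * (κ n : ℂ) ^ 2)))
      refine h3.congr' ?_ (Eventually.of_forall fun k => one_mul _)
      have hne : ∀ᶠ k : ℂ in Bornology.cobounded ℂ ⊓ 𝓟 {k : ℂ | k.im ≠ 0},
          k ≠ -(Complex.I * κ n) :=
        (Bornology.eventually_ne_cobounded _).filter_mono inf_le_left
      filter_upwards [eventually_ne_cobounded _, hne] with k hk hk'
      have h4 := hk.1
      have h5 : k + Complex.I * κ n ≠ 0 := fun h => hk' (eq_neg_of_add_eq_zero_left h)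
      push_cast
      field_simp
      linear_combination (-4) * (κ n : ℂ) ^ 2 * Complex.I_sq
    have h2 := h1.mul ih
    have h3 : blaschke κ (insert n I) =
        fun k => (k - Complex.I * κ n) / (k + Complex.I * κ n) * blaschke κ I k :=
      funext fun k => Finset.prod_insert hn
    rw [h3, Finset.sum_insert hn]
    convert h2 using 1
    ring

/-- `∏_{m ∈ J} (κ_n - κ_m) / (κ_n + κ_m)`. -/
noncomputable def blaschkeValue (κ : Fin N → ℝ) (J : Finset (Fin N)) (n : Fin N) : ℝ :=
  ∏ m ∈ J, (κ n - κ m) / (κ n + κ m)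

theorem blaschke_I_mul (κ : Fin N → ℝ) (J : Finset (Fin N)) (n : Fin N) :
    blaschke κ J (Complex.I * κ n) = blaschkeValue κ J n := by
  unfold blaschke blaschkeValue
  push_cast
  refine Finset.prod_congr rfl fun m _ => ?_
  rw [← mul_sub, ← mul_add, mul_div_mul_left _ _ Complex.I_ne_zero]

theorem blaschkeValue_ne_zero (hκ : ∀ n, 0 < κ n) (hinj : Function.Injective κ)
    {J : Finset (Fin N)} {n : Fin N} (hn : n ∉ J) : blaschkeValue κ J n ≠ 0 :=
  Finset.prod_ne_zero_iff.2 fun m hm => div_ne_zero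
    (sub_ne_zero.2 (hinj.ne (by rintro rfl; exact hn hm))) (add_pos (hκ n) (hκ m)).ne'

end Blaschke

/-! ### Transplanted data -/

namespace DressingData

variable {N : ℕ} {D : DressingData N} {I : Finset (Fin N)} {n : Fin N}

theorem transplant_r (D : DressingData N) (I : Finset (Fin N)) (k : ℝ) :
    (D.transplant I).r k = D.r k * blaschke D.κ I k ^ 2 := by
  simp only [transplant, blaschke, Finset.prod_pow]

theorem transplant_κ_of_mem (h : n ∈ I) : (D.transplant I).κ n = -D.κ n := if_pos h

theorem transplant_κ_of_notMem (h : n ∉ I) : (D.transplant I).κ n = D.κ n := if_neg h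

theorem transplant_c_of_notMem (h : n ∉ I) :
    (D.transplant I).c n = D.c n * blaschkeValue D.κ I n ^ 2 := by
  simp only [transplant, if_neg h, blaschkeValue, Finset.prod_pow]

theorem transplant_c_of_mem (h : n ∈ I) : (D.transplant I).c n =
    -(4 * D.κ n ^ 2 / D.c n) * (blaschkeValue D.κ (I.erase n) n ^ 2)⁻¹ := by
  simp only [transplant, if_pos h, blaschkeValue, ← Finset.prod_pow, ← Finset.prod_inv_distrib]
  congr 1
  refine Finset.prod_congr rfl fun m _ => ?_
  rw [← inv_pow, inv_div]

theorem transplant_pole_of_mem (h : n ∈ I) :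
    (D.transplant I).pole n = -(Complex.I * D.κ n) := by
  rw [pole, transplant_κ_of_mem h]
  push_cast
  ring

theorem transplant_pole_of_notMem (h : n ∉ I) :
    (D.transplant I).pole n = Complex.I * D.κ n := by
  rw [pole, transplant_κ_of_notMem h]

theorem abs_transplant_κ (hpos : ∀ n, 0 < D.κ n) (n : Fin N) :
    |(D.transplant I).κ n| = D.κ n := by
  by_cases h : n ∈ I
  · rw [transplant_κ_of_mem h, abs_neg, abs_of_pos (hpos n)]
  · rw [transplant_κ_of_notMem h, abs_of_pos (hpos n)]

theorem transplant_κ_injective (hpos : ∀ n, 0 < D.κ n) (hinj : Function.Injective D.κ) :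
    Function.Injective (D.transplant I).κ := fun n m h => hinj <| by
  rw [← abs_transplant_κ (I := I) hpos, h, abs_transplant_κ hpos]

theorem transplant_κ_ne_neg (hpos : ∀ n, 0 < D.κ n) (hinj : Function.Injective D.κ) (n m : Fin N) :
    (D.transplant I).κ n ≠ -(D.transplant I).κ m := fun h => by
  have h1 : n = m := hinj <| by
    rw [← abs_transplant_κ (I := I) hpos, h, abs_neg, abs_transplant_κ hpos]
  subst h1
  have h2 : (D.transplant I).κ n = 0 := by linarith
  have h3 := abs_transplant_κ (I := I) hpos n
  rw [h2, abs_zero] at h3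
  exact (hpos n).ne h3

theorem transplant_κ_ne_zero (hpos : ∀ n, 0 < D.κ n) (n : Fin N) : (D.transplant I).κ n ≠ 0 :=
  abs_pos.1 (by rw [abs_transplant_κ hpos]; exact hpos n)

theorem Admissible.injective (hD : D.Admissible) : Function.Injective D.κ := fun n m h => by
  by_contra hne
  exact (hD.ne n m hne).1 h

theorem Admissible.c_pos (hD : D.Admissible) (hpos : ∀ n, 0 < D.κ n) (n : Fin N) : 0 < D.c n :=
  (div_pos_iff_of_pos_left (hpos n)).1 (hD.same_sign n)

theorem transplant_sign (hD : D.Admissible) (hpos : ∀ n, 0 < D.κ n) (n : Fin N) :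
    (0 < (D.transplant I).κ n ∧ 0 < (D.transplant I).c n) ∨
      ((D.transplant I).κ n < 0 ∧ (D.transplant I).c n < 0) := by
  have hc := hD.c_pos hpos n
  have hκ := hpos n
  by_cases h : n ∈ I
  · right
    rw [transplant_κ_of_mem h, transplant_c_of_mem h]
    have := blaschkeValue_ne_zero hpos hD.injective (Finset.notMem_erase n I)
    refine ⟨by linarith, mul_neg_of_neg_of_pos (neg_neg_of_pos (by positivity)) (by positivity)⟩
  · left
    rw [transplant_κ_of_notMem h, transplant_c_of_notMem h]
    have := blaschkeValue_ne_zero hpos hD.injective h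
    exact ⟨hκ, by positivity⟩

theorem sign_transplant_c (hD : D.Admissible) (hpos : ∀ n, 0 < D.κ n) (n : Fin N) :
    SignType.sign ((D.transplant I).c n) = SignType.sign ((D.transplant I).κ n) := by
  rcases transplant_sign (I := I) hD hpos n with ⟨h1, h2⟩ | ⟨h1, h2⟩
  · rw [sign_pos h1, sign_pos h2]
  · rw [sign_neg h1, sign_neg h2]

theorem transplant_r_neg (hD : D.Admissible) (k : ℝ) :
    (D.transplant I).r (-k) = (starRingEnd ℂ) ((D.transplant I).r k) := by
  rw [transplant_r, transplant_r, map_mul, map_pow, hD.conj_symm, blaschke_conj,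
    Complex.ofReal_neg, blaschke_neg]

theorem norm_transplant_r (hpos : ∀ n, 0 < D.κ n) (k : ℝ) :
    ‖(D.transplant I).r k‖ = ‖D.r k‖ := by
  rw [transplant_r, norm_mul, norm_pow, norm_blaschke_ofReal hpos, one_pow, mul_one]

theorem transplant_r_zero (hpos : ∀ n, 0 < D.κ n) : (D.transplant I).r 0 = D.r 0 := by
  -- At k = 0 the identity B(−k) = 1/B(k) says B(0)² = 1, so r(0) is unchanged.
  have h := blaschke_neg D.κ I 0
  have h1 := blaschke_ofReal_ne_zero (I := I) hpos 0
  rw [Complex.ofReal_zero] at h1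
  rw [neg_zero] at h
  rw [transplant_r, Complex.ofReal_zero, sq]
  nth_rewrite 1 [h]
  rw [inv_mul_cancel₀ h1, mul_one]

theorem Admissible.transplant (hD : D.Admissible) (hpos : ∀ n, 0 < D.κ n) (I : Finset (Fin N)) :
    (D.transplant I).Admissible where
  continuous := by
    have h1 : Continuous fun k : ℝ => blaschke D.κ I k := by
      refine continuous_iff_continuousAt.2 fun k => ?_
      exact (differentiableAt_blaschke fun m _ =>
        ofReal_add_I_mul_ne_zero (hpos m).ne' k).continuousAt.comp
        Complex.continuous_ofReal.continuousAt
    rw [show (D.transplant I).r = fun k : ℝ => D.r k * blaschke D.κ I k ^ 2 from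
      funext (transplant_r D I)]
    exact hD.continuous.mul (h1.pow 2)
  conj_symm := transplant_r_neg hD
  norm_lt_one k hk := by
    rw [norm_transplant_r hpos]
    exact hD.norm_lt_one k hk
  at_zero h := by
    rw [norm_transplant_r hpos] at h
    rw [transplant_r_zero hpos, hD.at_zero h]
  ne_zero n := ⟨transplant_κ_ne_zero hpos n, by
    rcases transplant_sign (I := I) hD hpos n with h | h
    exacts [h.2.ne', h.2.ne]⟩
  ne n m h := ⟨(transplant_κ_injective hpos hD.injective).ne h,
    transplant_κ_ne_neg hpos hD.injective n m⟩
  same_sign n := by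
    rcases transplant_sign (I := I) hD hpos n with h | h
    exacts [div_pos h.1 h.2, div_pos_of_neg_of_neg h.1 h.2]

/-- I is recovered as the set of n for which −κ_n occurs, since the original κ_n are positive and
distinct. -/
theorem range_transplant_injective (hpos : ∀ n, 0 < D.κ n) (hinj : Function.Injective D.κ)
    {I J : Finset (Fin N)}
    (h : Set.range (D.transplant I).κ = Set.range (D.transplant J).κ) : I = J := by
  have key : ∀ {I J : Finset (Fin N)},
      Set.range (D.transplant I).κ = Set.range (D.transplant J).κ → I ⊆ J := fun {I J} h n hn => by
    have h1 : -D.κ n ∈ Set.range (D.transplant J).κ :=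
      h ▸ ⟨n, transplant_κ_of_mem hn⟩
    obtain ⟨m, hm⟩ := h1
    have h2 := abs_transplant_κ (I := J) hpos m
    rw [hm, abs_neg, abs_of_pos (hpos n)] at h2
    obtain rfl := hinj h2
    by_contra hJ
    rw [transplant_κ_of_notMem hJ] at hm
    linarith [hpos n]
  exact (key h).antisymm (key h.symm)

end DressingData

/-! ### The transplanted function -/

section Transplant

variable {N : ℕ} {κ : Fin N → ℝ} {I : Finset (Fin N)} {χ : ℂ → ℝ → ℝ → ℂ} {x t : ℝ} {n : Fin N}

theorem transplantFunction_of_ne {k : ℂ} (hk : ∀ m ∈ I, k ≠ Complex.I * κ m) :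
    transplantFunction κ I χ k x t = χ k x t * blaschke κ I k := by
  rw [transplantFunction, if_neg (by push Not; exact hk)]

theorem finite_I_mul (κ : Fin N → ℝ) (I : Finset (Fin N)) :
    {k : ℂ | ∃ m ∈ I, k = Complex.I * κ m}.Finite :=
  (Set.finite_range fun m => Complex.I * (κ m : ℂ)).subset fun _ ⟨m, _, hk⟩ => ⟨m, hk.symm⟩

theorem transplantFunction_eventuallyEq {k : ℂ} (hk : ∀ m ∈ I, k ≠ Complex.I * κ m) :
    (fun k => transplantFunction κ I χ k x t) =ᶠ[𝓝 k] fun k => χ k x t * blaschke κ I k := by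
  filter_upwards [(finite_I_mul κ I).isClosed.compl_mem_nhds (x := k)
    (by rintro ⟨m, hm, h⟩; exact hk m hm h)] with z hz
  exact transplantFunction_of_ne fun m hm h => hz ⟨m, hm, h⟩

theorem add_I_mul_ne_zero (hκ : ∀ n, 0 < κ n) (n m : Fin N) :
    (Complex.I * κ n : ℂ) + Complex.I * κ m ≠ 0 := by
  rw [← mul_add]
  refine mul_ne_zero Complex.I_ne_zero ?_
  exact_mod_cast (add_pos (hκ n) (hκ m)).ne'

/-- The simple zero of the factor with index n cancels the simple pole of f. The limit is the value
assigned to the transplanted function at iκ_n. -/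
theorem tendsto_mul_blaschke (hκ : ∀ n, 0 < κ n) (hn : n ∈ I) {f : ℂ → ℂ} {R : ℂ}
    (hf : Tendsto (fun k => (k - Complex.I * κ n) * f k) (𝓝[≠] (Complex.I * κ n)) (𝓝 R)) :
    Tendsto (fun k => f k * blaschke κ I k) (𝓝[≠] (Complex.I * κ n))
      (𝓝 (R * (blaschkeValue κ (I.erase n) n / (2 * (Complex.I * κ n))))) := by
  have h1 : ContinuousAt (fun k => blaschke κ (I.erase n) k / (k + Complex.I * κ n))
      (Complex.I * κ n) :=
    (differentiableAt_blaschke fun m _ => add_I_mul_ne_zero hκ n m).continuousAt.div (by fun_prop)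
      (add_I_mul_ne_zero hκ n n)
  have h2 := hf.mul (h1.tendsto.mono_left nhdsWithin_le_nhds)
  rw [blaschke_I_mul, ← two_mul] at h2
  refine h2.congr fun k => ?_
  rw [blaschke_eq_erase_mul hn]
  ring

theorem transplantFunction_I_mul (hκ : ∀ n, 0 < κ n) (hn : n ∈ I) {R : ℂ}
    (hf : Tendsto (fun k => (k - Complex.I * κ n) * χ k x t) (𝓝[≠] (Complex.I * κ n)) (𝓝 R)) :
    transplantFunction κ I χ (Complex.I * κ n) x t =
      R * (blaschkeValue κ (I.erase n) n / (2 * (Complex.I * κ n))) := by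
  rw [transplantFunction, if_pos ⟨n, hn, rfl⟩]
  exact (tendsto_mul_blaschke hκ hn hf).limUnder_eq

theorem HasExpansionAtInfinity.transplant {Q : ℝ}
    (h : HasExpansionAtInfinity (fun k => χ k x t) Q) (κ : Fin N → ℝ) (I : Finset (Fin N)) :
    HasExpansionAtInfinity (fun k => transplantFunction κ I χ k x t)
      (Q - 4 * ∑ m ∈ I, κ m) := by
  refine HasExpansionAtInfinity.congr' (h.mul (hasExpansionAtInfinity_blaschke κ I)) ?_
  have : ∀ᶠ k in Bornology.cobounded ℂ, k ∉ {k : ℂ | ∃ m ∈ I, k = Complex.I * κ m} :=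
    Bornology.isBounded_def.1 (finite_I_mul κ I).isBounded
  filter_upwards [this] with k hk
  exact (transplantFunction_of_ne fun m hm h => hk ⟨m, hm, h⟩).symm

end Transplant

namespace DressingData

variable {N : ℕ} {D : DressingData N} {I : Finset (Fin N)} {χ : ℂ → ℝ → ℝ → ℂ} {x t : ℝ}

theorem blaschke_tendsto (D : DressingData N) (I : Finset (Fin N)) :
    Tendsto (blaschke D.κ I) (Bornology.cobounded ℂ ⊓ 𝓟 {k : ℂ | k.im ≠ 0}) (𝓝 1) :=
  (hasExpansionAtInfinity_blaschke D.κ I).tendsto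

/-- Transplanting poles turns a solution of the contour problem into a solution of the contour
problem with the transplanted data. -/
theorem SolvesContourProblem.transplant (h : D.SolvesContourProblem x t fun k => χ k x t)
    (hD : D.Admissible) (hpos : ∀ n, 0 < D.κ n) (I : Finset (Fin N)) :
    (D.transplant I).SolvesContourProblem x t fun k => transplantFunction D.κ I χ k x t where
  holomorphic := by
    rintro k ⟨hk0, hk⟩
    refine DifferentiableAt.differentiableWithinAt ?_
    by_cases hkI : ∃ n ∈ I, k = Complex.I * D.κ n
    · obtain ⟨n, hn, rfl⟩ := hkI
      have him : ∀ᶠ z : ℂ in 𝓝[≠] (Complex.I * (D.κ n : ℂ)), 0 < z.im :=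
        (IsShortRange.isOpen_upper.mem_nhds (by simpa using hpos n) :
          {k : ℂ | 0 < k.im} ∈ 𝓝 (Complex.I * (D.κ n : ℂ))) |> mem_nhdsWithin_of_mem_nhds
      have hp := eventually_nhdsNE_notMem (Set.finite_range D.pole) (Complex.I * (D.κ n : ℂ))
      have h1 : ∀ᶠ z in 𝓝[≠] (Complex.I * (D.κ n : ℂ)),
          DifferentiableAt ℂ (fun z => χ z x t * blaschke D.κ I z) z := by
        filter_upwards [him, hp] with z hz hz'
        refine (h.differentiableAt (ne_of_gt hz) fun m hm => hz' ⟨m, hm.symm⟩).mul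
          (differentiableAt_blaschke fun m _ hm => ?_)
        have := congrArg Complex.im hm
        simp only [Complex.add_im, Complex.mul_im, Complex.I_re, Complex.I_im, Complex.ofReal_re,
          Complex.ofReal_im, Complex.zero_im] at this
        linarith [hpos m]
      have hlim := tendsto_mul_blaschke hpos hn (h.residue n)
      have h2 : Tendsto (fun z => (z - Complex.I * (D.κ n : ℂ)) * (χ z x t * blaschke D.κ I z))
          (𝓝[≠] (Complex.I * (D.κ n : ℂ))) (𝓝 0) := by
        have h3 : Tendsto (fun z : ℂ => z - Complex.I * (D.κ n : ℂ))
            (𝓝[≠] (Complex.I * (D.κ n : ℂ))) (𝓝 0) :=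
          ((by fun_prop : Continuous fun z : ℂ => z - Complex.I * (D.κ n : ℂ)).tendsto' _ _
            (sub_self _)).mono_left nhdsWithin_le_nhds
        simpa using h3.mul hlim
      refine (differentiableAt_update_limUnder h1 h2).1.congr_of_eventuallyEq ?_
      have h3 := eventually_nhdsNE_notMem (finite_I_mul D.κ I) (Complex.I * (D.κ n : ℂ))
      rw [eventually_nhdsWithin_iff] at h3
      filter_upwards [h3] with z hz
      by_cases hzn : z = Complex.I * D.κ n
      · rw [hzn, Function.update_self, transplantFunction, if_pos ⟨n, hn, rfl⟩]
      · rw [Function.update_of_ne hzn,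
          transplantFunction_of_ne fun m hm hzm => hz hzn ⟨m, hm, hzm⟩]
    · push Not at hkI
      refine (DifferentiableAt.mul (h.differentiableAt hk0 fun n hn => ?_)
        (differentiableAt_blaschke fun m hm hkm => ?_)).congr_of_eventuallyEq
        (transplantFunction_eventuallyEq hkI)
      · by_cases hnI : n ∈ I
        · exact hkI n hnI hn
        · exact hk n (by rw [transplant_pole_of_notMem hnI]; exact hn)
      · exact hk m (by rw [transplant_pole_of_mem hm]; exact eq_neg_of_add_eq_zero_left hkm)
  jump := by
    obtain ⟨χp, χm, hp, hm, hj⟩ := h.jump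
    have hne : ∀ k : ℝ, ∀ m ∈ I, (k : ℂ) ≠ Complex.I * D.κ m := fun k m _ =>
      sub_ne_zero.1 (ofReal_sub_I_mul_ne_zero (hpos m).ne' k)
    have hlim : ∀ (A : Set ℂ) (g : ℝ → ℂ) (k : ℝ),
        Tendsto (fun k => χ k x t) (𝓝[A] (k : ℂ)) (𝓝 (g k)) →
        Tendsto (fun k => transplantFunction D.κ I χ k x t) (𝓝[A] (k : ℂ))
          (𝓝 (g k * blaschke D.κ I k)) := fun A g k hg => by
      refine (hg.mul ((differentiableAt_blaschke fun m _ =>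
        ofReal_add_I_mul_ne_zero (hpos m).ne' k).continuousAt.tendsto.mono_left
        nhdsWithin_le_nhds)).congr' ?_
      exact (transplantFunction_eventuallyEq (hne k)).symm.filter_mono nhdsWithin_le_nhds
    refine ⟨fun k => χp k * blaschke D.κ I k, fun k => χm k * blaschke D.κ I k,
      fun k => hlim _ χp k (hp k), fun k => hlim _ χm k (hm k), fun k => ?_⟩
    -- B(k) = B(k)² B(−k): the square goes into r, the other factor into χ₋(−k).
    have hb := blaschke_ofReal_ne_zero (I := I) hpos k
    change _ = _ * (χm (-k) * blaschke D.κ I ((-k : ℝ) : ℂ))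
    rw [← sub_mul, hj, transplant_r, Complex.ofReal_neg, blaschke_neg]
    field_simp
  residue n := by
    have hκn := hpos n
    have hcn := (hD.c_pos hpos n).ne'
    have hκc : (D.κ n : ℂ) ≠ 0 := Complex.ofReal_ne_zero.2 hκn.ne'
    have hcc : (D.c n : ℂ) ≠ 0 := Complex.ofReal_ne_zero.2 hcn
    have hIne := Complex.I_ne_zero
    have hneg : ∀ m ∈ I, -(Complex.I * (D.κ n : ℂ)) ≠ Complex.I * D.κ m := fun m _ hm =>
      add_I_mul_ne_zero hpos n m (by rw [← hm, add_neg_cancel])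
    have hres := h.residue n
    have hpole : D.pole n = Complex.I * D.κ n := rfl
    rw [hpole] at hres
    by_cases hn : n ∈ I
    · have hβ : (blaschkeValue D.κ (I.erase n) n : ℂ) ≠ 0 := Complex.ofReal_ne_zero.2
        (blaschkeValue_ne_zero hpos hD.injective (Finset.notMem_erase n I))
      rw [transplant_pole_of_mem hn, neg_neg, transplantFunction_I_mul hpos hn hres,
        transplant_κ_of_mem hn, transplant_c_of_mem hn]
      have hχ : ContinuousAt (fun k => χ k x t) (-(Complex.I * D.κ n)) := by
        refine (h.differentiableAt (by simpa using hκn.ne') fun m hm => ?_).continuousAt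
        exact add_I_mul_ne_zero hpos n m (by rw [pole] at hm; rw [← hm, add_neg_cancel])
      -- For n ∈ I the new pole sits at −iκ_n, where χ is regular. Multiplication by k + iκ_n leaves
      -- this function times χ, which tends to −2iκ_n χ(−iκ_n) divided by the remaining Blaschke
      -- value at iκ_n.
      have hb : ContinuousAt (fun k => (k - Complex.I * D.κ n) * blaschke D.κ (I.erase n) k)
          (-(Complex.I * D.κ n)) := by
        refine ContinuousAt.mul (by fun_prop) (differentiableAt_blaschke fun m hm => ?_).continuousAt
        intro h0
        have h1 : D.κ m = D.κ n := by
          have h2 : (D.κ m : ℂ) = D.κ n :=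
            mul_left_cancel₀ hIne (neg_add_eq_zero.1 h0).symm
          exact_mod_cast h2
        exact (Finset.mem_erase.1 hm).1 (hD.injective h1)
      have hlim := (hχ.mul hb).tendsto.mono_left
        (nhdsWithin_le_nhds (s := {-(Complex.I * (D.κ n : ℂ))}ᶜ))
      simp only [Pi.mul_apply, blaschke_neg, blaschke_I_mul] at hlim
      -- Reversing the sign of κ_n inverts the exponential. It therefore cancels the one inside the
      -- value of the new function at iκ_n, which is the old residue up to a factor.
      have hE : (Real.exp (-2 * -D.κ n * x + 8 * (-D.κ n) ^ 3 * t) : ℂ) *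
          (Real.exp (-2 * D.κ n * x + 8 * D.κ n ^ 3 * t) : ℂ) = 1 := by
        rw [← Complex.ofReal_mul, ← Real.exp_add]
        rw [show -2 * -D.κ n * x + 8 * (-D.κ n) ^ 3 * t +
          (-2 * D.κ n * x + 8 * D.κ n ^ 3 * t) = 0 by ring, Real.exp_zero, Complex.ofReal_one]
      generalize (Real.exp (-2 * -D.κ n * x + 8 * (-D.κ n) ^ 3 * t) : ℂ) = E₁ at hE ⊢
      generalize (Real.exp (-2 * D.κ n * x + 8 * D.κ n ^ 3 * t) : ℂ) = E₂ at hE ⊢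
      -- Both sides are multiples of χ(−iκ_n); matching the factors is what dictates the new c_n,
      -- with −4κ_n² from the two factors 2iκ_n and the residue constants.
      have hval : χ (-(Complex.I * D.κ n)) x t * ((-(Complex.I * D.κ n) - Complex.I * D.κ n) *
          (blaschkeValue D.κ (I.erase n) n : ℂ)⁻¹) =
          Complex.I * ((-(4 * D.κ n ^ 2 / D.c n) *
            (blaschkeValue D.κ (I.erase n) n ^ 2)⁻¹ : ℝ) : ℂ) * E₁ *
          (Complex.I * D.c n * E₂ * χ (-(Complex.I * D.κ n)) x t *
            (blaschkeValue D.κ (I.erase n) n / (2 * (Complex.I * D.κ n)))) := by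
        push_cast
        field_simp
        linear_combination (4 : ℂ) * χ (-(Complex.I * D.κ n)) x t * hE
      rw [hval] at hlim
      refine hlim.congr' ?_
      filter_upwards [(transplantFunction_eventuallyEq hneg).filter_mono nhdsWithin_le_nhds,
        self_mem_nhdsWithin] with k hk hkne
      have hk' : k + Complex.I * D.κ n ≠ 0 := fun h0 => hkne (eq_neg_of_add_eq_zero_left h0)
      rw [hk, blaschke_eq_erase_mul hn, sub_neg_eq_add, Pi.mul_apply]
      field_simp
    · have hβ : (blaschkeValue D.κ I n : ℂ) ≠ 0 := Complex.ofReal_ne_zero.2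
        (blaschkeValue_ne_zero hpos hD.injective hn)
      rw [transplant_pole_of_notMem hn, transplantFunction_of_ne hneg, transplant_κ_of_notMem hn,
        transplant_c_of_notMem hn, blaschke_neg, blaschke_I_mul]
      have hb : ContinuousAt (blaschke D.κ I) (Complex.I * D.κ n) :=
        (differentiableAt_blaschke fun m _ => add_I_mul_ne_zero hpos n m).continuousAt
      have hlim := hres.mul (hb.tendsto.mono_left
        (nhdsWithin_le_nhds (s := {Complex.I * (D.κ n : ℂ)}ᶜ)))
      rw [blaschke_I_mul] at hlim
      -- For n ∉ I the pole stays: one factor B(iκ_n) comes from the residue, the other from the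
      -- value of the new function at −iκ_n, which equals χ/B(iκ_n).
      have hval : Complex.I * (D.c n : ℂ) *
          (Real.exp (-2 * D.κ n * x + 8 * D.κ n ^ 3 * t) : ℂ) * χ (-(Complex.I * D.κ n)) x t *
          blaschkeValue D.κ I n =
          Complex.I * ((D.c n * blaschkeValue D.κ I n ^ 2 : ℝ) : ℂ) *
          (Real.exp (-2 * D.κ n * x + 8 * D.κ n ^ 3 * t) : ℂ) *
          (χ (-(Complex.I * D.κ n)) x t * (blaschkeValue D.κ I n : ℂ)⁻¹) := by
        push_cast
        field_simp
      rw [hval] at hlim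
      refine hlim.congr' ?_
      have hneI : ∀ m ∈ I, (Complex.I * (D.κ n : ℂ)) ≠ Complex.I * D.κ m := fun m hm h0 => by
        have h2 : (D.κ n : ℂ) = D.κ m := mul_left_cancel₀ hIne h0
        exact hn (hD.injective (by exact_mod_cast h2 : D.κ n = D.κ m) ▸ hm)
      filter_upwards [(transplantFunction_eventuallyEq hneI).filter_mono
        nhdsWithin_le_nhds] with k hk
      rw [hk, mul_assoc]
  at_infinity := by
    have h1 := h.at_infinity.mul (D.blaschke_tendsto I)
    rw [mul_one] at h1
    refine h1.congr' ?_
    have : ∀ᶠ k in Bornology.cobounded ℂ, k ∉ {k : ℂ | ∃ m ∈ I, k = Complex.I * D.κ m} :=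
      Bornology.isBounded_def.1 (finite_I_mul D.κ I).isBounded
    filter_upwards [this.filter_mono inf_le_left] with k hk
    exact (transplantFunction_of_ne fun m hm h => hk ⟨m, hm, h⟩).symm

end DressingData


/-! ### Dependence on x, and assembly of the theorem -/

namespace IsRapidlyDecreasingKdVSolution

variable {u : ℝ → ℝ → ℝ} {N : ℕ} {κ : Fin N → ℝ}

/-- The transplanted function is, in `x`, a solution of the Schrödinger equation times `e^{ikx}`. -/
theorem transplantFunction_eq_mul (hu : IsRapidlyDecreasingKdVSolution u)
    (hκ : BoundStates (fun x => u x 0) κ) (I : Finset (Fin N)) {k : ℂ} (hk : k.im ≠ 0) (t : ℝ) :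
    ∃ (f : ℝ → ℂ) (c : ℂ), SolvesSchrodinger (fun y => u y t) (k ^ 2) f ∧
      ∀ x, transplantFunction κ I (ismFunction u) k x t =
        c * f x * Complex.exp (Complex.I * k * x) := by
  have hv := hu.isShortRange t
  by_cases hkI : ∃ n ∈ I, k = Complex.I * κ n
  · obtain ⟨n, hn, rfl⟩ := hkI
    have him : 0 < (Complex.I * (κ n : ℂ)).im := by simpa using hκ.pos n
    -- At a removed singularity the value is proportional to the old residue, whose dependence on x
    -- is that of ψ₊(iκ_n)e^{ikx}; the differential equation thus holds at these points too.
    refine ⟨jostPlus (fun y => u y t) (Complex.I * κ n),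
      Complex.I * (normingConstant (fun y => u y 0) (κ n) * Real.exp (8 * κ n ^ 3 * t) : ℝ) *
        (blaschkeValue κ (I.erase n) n / (2 * (Complex.I * κ n))),
      hv.solves_jostPlus him.le, fun x => ?_⟩
    rw [transplantFunction_I_mul hκ.pos hn (hu.tendsto_mul_ismFunction hκ n x t)]
    ring
  · push Not at hkI
    rcases hk.lt_or_gt with h | h
    · refine ⟨jostPlus (fun y => u y t) (-k), blaschke κ I k, ?_, fun x => ?_⟩
      · have := hv.solves_jostPlus (k := -k) (by simpa using h.le)
        rwa [neg_sq] at this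
      · rw [transplantFunction_of_ne hkI, ismFunction_of_neg h]
        ring
    · refine ⟨jostMinus (fun y => u y t) k, transmission (fun y => u y t) k * blaschke κ I k,
        hv.solves_jostMinus h.le, fun x => ?_⟩
      rw [transplantFunction_of_ne hkI, ismFunction, if_pos h]
      ring

end IsRapidlyDecreasingKdVSolution

theorem mainTheorem1 (u : ℝ → ℝ → ℝ) (hu : IsRapidlyDecreasingKdVSolution u)
    (N : ℕ) (κ : Fin N → ℝ) (hκ : BoundStates (fun x => u x 0) κ) :
    (∀ I : Finset (Fin N),
      let D : DressingData N := scatteringData (fun x => u x 0) κ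
      let D' : DressingData N := D.transplant I
      let χ' : ℂ → ℝ → ℝ → ℂ := transplantFunction κ I (ismFunction u)
      let Q' : ℝ → ℝ → ℝ := fun x t => qPlus u x t - 4 * ∑ m ∈ I, κ m
      -- the transplanted function solves the dressing problem with the transplanted data
      (∀ x t : ℝ, D'.SolvesContourProblem x t (fun k => χ' k x t)) ∧
      (∀ x t : ℝ, D'.SolvesDbarProblem x t (fun k => χ' k x t)) ∧
      -- properties of the transplanted data
      (∀ k : ℝ, D'.r (-k) = (starRingEnd ℂ) (D'.r k)) ∧
      (∀ k : ℝ, ‖D'.r k‖ = ‖D.r k‖) ∧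
      D'.r 0 = D.r 0 ∧
      (∀ n, SignType.sign (D'.c n) = SignType.sign (D'.κ n)) ∧
      D'.Admissible ∧
      -- the Schroedinger equation for the transplanted function
      (∀ k : ℂ, k.im ≠ 0 → (∀ n, k ≠ D'.pole n) → ∀ t : ℝ,
        ContDiff ℝ 2 (fun y => χ' k y t) ∧
        ∀ x : ℝ, deriv (deriv (fun y => χ' k y t)) x -
          2 * Complex.I * k * deriv (fun y => χ' k y t) x - (u x t : ℂ) * χ' k x t = 0) ∧
      -- the same potential is recovered
      (∀ x t : ℝ, HasExpansionAtInfinity (fun k => χ' k x t) (Q' x t)) ∧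
      (∀ x t : ℝ, HasDerivAt (fun y => Q' y t) (u x t) x)) ∧
    -- the solution arises from the dressing method in `2 ^ N` different ways
    ∃ S : Finset (DressingData N), S.card = 2 ^ N ∧
      Set.InjOn (fun D : DressingData N => Set.range D.κ) (S : Set (DressingData N)) ∧
      ∀ D ∈ S, (∀ n, |D.κ n| = κ n) ∧ D.Admissible ∧ D.Generates u := by
  classical
  have hD := hu.admissible_scatteringData hκ
  have hC : ∀ (I : Finset (Fin N)) (x t : ℝ),
      ((scatteringData (fun x => u x 0) κ).transplant I).SolvesContourProblem x t
        fun k => transplantFunction κ I (ismFunction u) k x t := fun I x t =>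
    (hu.solvesContourProblem_ismFunction hκ x t).transplant hD hκ.pos I
  have hB : ∀ (I : Finset (Fin N)) (x t : ℝ),
      ((scatteringData (fun x => u x 0) κ).transplant I).SolvesDbarProblem x t
        fun k => transplantFunction κ I (ismFunction u) k x t := fun I x t =>
    (hC I x t).solvesDbarProblem (DressingData.transplant_κ_ne_zero hκ.pos)
      (DressingData.transplant_κ_injective hκ.pos hκ.injective)
      (DressingData.transplant_κ_ne_neg hκ.pos hκ.injective)
  have hE : ∀ (I : Finset (Fin N)) (x t : ℝ),
      HasExpansionAtInfinity (fun k => transplantFunction κ I (ismFunction u) k x t)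
        (qPlus u x t - 4 * ∑ m ∈ I, κ m) := fun I x t =>
    (hu.hasExpansionAtInfinity_ismFunction x t).transplant κ I
  have hQ : ∀ (I : Finset (Fin N)) (x t : ℝ),
      HasDerivAt (fun y => qPlus u y t - 4 * ∑ m ∈ I, κ m) (u x t) x := fun I x t =>
    (hu.hasDerivAt_qPlus x t).sub_const _
  have hrange : ∀ I J : Finset (Fin N),
      Set.range ((scatteringData (fun x => u x 0) κ).transplant I).κ =
        Set.range ((scatteringData (fun x => u x 0) κ).transplant J).κ → I = J := fun I J =>
    DressingData.range_transplant_injective hκ.pos hκ.injective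
  refine ⟨fun I => ⟨hC I, hB I, DressingData.transplant_r_neg hD,
    DressingData.norm_transplant_r hκ.pos, DressingData.transplant_r_zero hκ.pos,
    DressingData.sign_transplant_c hD hκ.pos, hD.transplant hκ.pos I, fun k hk _ t => ?_,
    hE I, hQ I⟩,
    -- One set of data per subset I; the set of the signed κ's determines I, which gives both the
    -- cardinality 2^N and the pairwise distinctness.
    Finset.univ.image fun I => (scatteringData (fun x => u x 0) κ).transplant I, ?_, ?_, ?_⟩
  · obtain ⟨f, c, hf, hfc⟩ := hu.transplantFunction_eq_mul hκ I hk t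
    exact hf.mul_planeWave c hfc
  · rw [Finset.card_image_of_injective _ fun I J h => hrange I J (by rw [h]), Finset.card_univ,
      Fintype.card_finset, Fintype.card_fin]
  · simp only [Set.InjOn, Finset.coe_image, Finset.coe_univ, Set.image_univ, Set.forall_mem_range]
    exact fun I J h => by rw [hrange I J h]
  · simp only [Finset.mem_image, Finset.mem_univ, true_and, forall_exists_index,
      forall_apply_eq_imp_iff]
    exact fun I => ⟨DressingData.abs_transplant_κ hκ.pos, hD.transplant hκ.pos I, _, _,
      fun x t => ⟨hC I x t, hB I x t, hE I x t, hQ I x t⟩⟩
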